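/- **Notation.** Fix $w_0,w\in C^\infty_c(\mathbf R)$ nonnegative, supported in $[-2,2]$ and $[\frac12,2]$ respectively, such that with $w_n(x)=w(|x|/2^n)$ for $n\ge 1$ one has $w_0+\sum_{n\ge1}w_n=1$ on $\mathbf R$, and let $W_n$ be the Schwartz function with $\widehat{W_n}=w_n$, where $\widehat f(\xi)=\int f(x)e^{-2i\pi x\xi}\,dx$. For $\delta>0$, a $\delta$-tube $R$ in $\mathbf R^d$ is the image of $[0,1]\times B_{\mathbf R^{d-1}}(0,\delta)$ (open ball) by an affine isometry $\mathbf R\times\mathbf R^{d-1}\to\mathbf R^d$, and $\overline R$ denotes the image of $[2,3]\times B_{\mathbf R^{d-1}}(0,\delta)$ by the same isometry. Let $f_d(\delta)$ be the infimum of the $\varepsilon>0$ for which there is a nonempty finite family of $\delta$-tubes $(R_j)$ with pairwise disjoint $\overline R_j$ and $|\bigcup_jR_j|\le\varepsilon\sum_j|R_j|$. For a bounded measurable $m:(-1,1)\to\mathbf C$ and $1\le p\le\infty$, let $\|m(\langle\cdot,\cdot\rangle)\|_{MS_p(L_2(\mathbf S^d))}$ be the norm on the Schatten class $S_p(L_2(\mathbf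 S^d))$ ($S_\infty$ being the compact operators) of the Schur multiplier with symbol $(x,y)\mapsto m(\langle x,y\rangle)$, that is of the map which sends a Hilbert-Schmidt operator in $S_p$ with kernel $a(x,y)$ to the operator with kernel $m(\langle x,y\rangle)a(x,y)$; it is $\infty$ if this map is not $S_p$-bounded. **Theorem.** For every $d\ge 1$ there is a constant $C_d$ (depending only on $d$ and the fixed functions $w_0,w$) such that for every $1\le p\le\infty$, every bounded measurable $m:(-1,1)\to\mathbf C$ with $\|m(\langle\cdot,\cdot\rangle)\|_{MS_p(L_2(\mathbf S^d))}<\infty$, every $n\ge0$ and every $\theta\in\mathbf R$ with $\sin\theta\ne0$, $$|W_n*(m\circ\cos)(\theta)|\le C_d\,\|m(\langle\cdot,\cdot\rangle)\|_{MS_p(L_2(\mathbf S^d))}\,\inf_{\delta>0}\left(f_d(\delta)^{|\frac1p-\frac12|}+\frac1{|\delta^22^n\sin\theta|^{1/3}}\right).$$ Moreover there is a constant $C_2'$ (depending only on $w_0,w$) such that for $d=2$, every such $p$, $m$ and $\theta$, and every $n\ge1$, $$|W_n*(m\circ\cos)(\theta)|\le C_2'\,\|m(\langle\cdot,\cdot\rangle)\|_{MS_p(L_2(\mathbf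 S^2))}\,\max\big(1,\,n+\log_2|\sin\theta|\big)^{-|\frac1p-\frac12|}.$$ -/

import Mathlib

open MeasureTheory
open scoped ENNReal ContDiff FourierTransform InnerProductSpace

noncomputable section

namespace SphericalSchur

/-! ### Tubes and the Besicovitch function -/

/-- The model set `[a, b] × B(0, δ)` in `ℝ × ℝ^{d-1}` (with the Euclidean structure). -/
def modelTube (d : ℕ) (a b δ : ℝ) : Set (WithLp 2 (ℝ × EuclideanSpace ℝ (Fin (d - 1)))) :=
  {z | z.fst ∈ Set.Icc a b ∧ ‖z.snd‖ < δ}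

/-- The type of affine isometries `ℝ × ℝ^{d-1} → ℝ^d`; each of them parametrises one `δ`-tube
together with its orientation. -/
abbrev TubeFrame (d : ℕ) : Type :=
  WithLp 2 (ℝ × EuclideanSpace ℝ (Fin (d - 1))) →ᵃⁱ[ℝ] EuclideanSpace ℝ (Fin d)

/-- The `δ`-tube `R`, image of `[0, 1] × B(0, δ)`. -/
def tube {d : ℕ} (U : TubeFrame d) (δ : ℝ) : Set (EuclideanSpace ℝ (Fin d)) :=
  U '' modelTube d 0 1 δ

/-- The shifted tube `R̄`, image of `[2, 3] × B(0, δ)`. -/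
def shiftedTube {d : ℕ} (U : TubeFrame d) (δ : ℝ) : Set (EuclideanSpace ℝ (Fin d)) :=
  U '' modelTube d 2 3 δ

/-- `f_d(δ)`: the infimum of the `ε > 0` for which there is a nonempty finite family of `δ`-tubes
`R_j` in `ℝ^d` such that the `R̄_j` are pairwise disjoint and `|⋃ R_j| / ∑ |R_j| ≤ ε`. -/
def besicovitchFun (d : ℕ) (δ : ℝ) : ℝ :=
  sInf {ε : ℝ | 0 < ε ∧ ∃ (N : ℕ) (U : Fin N → TubeFrame d), 0 < N ∧
    Pairwise (fun i j => Disjoint (shiftedTube (U i) δ) (shiftedTube (U j) δ)) ∧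
    volume.real (⋃ j, tube (U j) δ) / ∑ j, volume.real (tube (U j) δ) ≤ ε}

/-! ### Schatten norms -/

section Schatten

variable {H : Type*} [NormedAddCommGroup H] [InnerProductSpace ℂ H] [CompleteSpace H]

/-- The trace `∑ ⟨e_i, A e_i⟩ ∈ [0, ∞]` of a positive bounded operator `A`, computed in a Hilbert
basis (for positive `A` it does not depend on the basis). -/
def posTrace (A : H →L[ℂ] H) : ℝ≥0∞ :=
  ∑' i, ENNReal.ofReal
    (⟪(exists_hilbertBasis ℂ H).choose_spec.choose i,
      A ((exists_hilbertBasis ℂ H).choose_spec.choose i)⟫_ℂ).re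

/-- The Schatten norm `Tr((T^*T)^{p/2})^{1/p} ∈ [0, ∞]` for `p < ∞`, and the operator norm for
`p = ∞`. (It is only applied to Hilbert-Schmidt operators, which are compact.) -/
def schattenNorm (p : ℝ≥0∞) (T : H →L[ℂ] H) : ℝ≥0∞ :=
  if p = ⊤ then ‖T‖ₑ else (posTrace ((star T * T) ^ (p.toReal / 2))) ^ (1 / p.toReal)

end Schatten

/-! ### Operators with square integrable kernel, and Schur multipliers -/

section Kernel

variable {X : Type*} [MeasurableSpace X] {μ : Measure X} [SFinite μ]

theorem kernel_ae_memLp (a : Lp ℂ 2 (μ.prod μ)) :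
    ∀ᵐ x ∂μ, MemLp (fun y => a (x, y)) 2 μ := by
  have hm : AEStronglyMeasurable a (μ.prod μ) := Lp.aestronglyMeasurable a
  have h1 : ∫⁻ z, ‖a z‖ₑ ^ (2 : ℝ) ∂(μ.prod μ) < ⊤ := by
    have := lintegral_rpow_enorm_lt_top_of_eLpNorm_lt_top (p := 2) (by simp) (by simp)
      (Lp.memLp a).2
    simpa using this
  rw [lintegral_prod _ (hm.enorm.pow_const _)] at h1
  have h2 := ae_lt_top' (hm.enorm.pow_const (2 : ℝ)).lintegral_prod_right' h1.ne
  filter_upwards [h2, hm.prodMk_left] with x hx hx'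
  refine ⟨hx', ?_⟩
  rw [eLpNorm_lt_top_iff_lintegral_rpow_enorm_lt_top (by simp) (by simp)]
  simpa using hx

theorem kernel_eLpNorm_le (a : Lp ℂ 2 (μ.prod μ)) (f : Lp ℂ 2 μ) :
    eLpNorm (fun x => ∫ y, a (x, y) * f y ∂μ) 2 μ ≤ ‖a‖ₑ * ‖f‖ₑ := by
  have hm : AEStronglyMeasurable a (μ.prod μ) := Lp.aestronglyMeasurable a
  have key : ∀ᵐ x ∂μ, ‖∫ y, a (x, y) * f y ∂μ‖ₑ ^ (2 : ℝ)
      ≤ (∫⁻ y, ‖a (x, y)‖ₑ ^ (2 : ℝ) ∂μ) * ‖f‖ₑ ^ (2 : ℝ) := by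
    filter_upwards [hm.prodMk_left] with x hx
    have h1 : ‖∫ y, a (x, y) * f y ∂μ‖ₑ ≤
        (∫⁻ y, ‖a (x, y)‖ₑ ^ (2 : ℝ) ∂μ) ^ (1 / 2 : ℝ) * ‖f‖ₑ := by
      refine (enorm_integral_le_lintegral_enorm _).trans ?_
      have := ENNReal.lintegral_mul_le_Lp_mul_Lq μ Real.HolderConjugate.two_two
        hx.enorm (Lp.aestronglyMeasurable f).enorm
      rw [Lp.enorm_def, eLpNorm_eq_lintegral_rpow_enorm_toReal (by simp) (by simp)]
      simpa [enorm_mul] using this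
    calc _ ≤ ((∫⁻ y, ‖a (x, y)‖ₑ ^ (2 : ℝ) ∂μ) ^ (1 / 2 : ℝ) * ‖f‖ₑ) ^ (2 : ℝ) := by gcongr
      _ = _ := by
        rw [ENNReal.mul_rpow_of_nonneg _ _ (by norm_num), ← ENNReal.rpow_mul]; norm_num
  have h3 : ∫⁻ x, ‖∫ y, a (x, y) * f y ∂μ‖ₑ ^ (2 : ℝ) ∂μ ≤ (‖a‖ₑ * ‖f‖ₑ) ^ (2 : ℝ) := by
    refine (lintegral_mono_ae key).trans ?_
    have hfin : ‖f‖ₑ ^ (2 : ℝ) ≠ ⊤ := ENNReal.rpow_ne_top_of_nonneg (by norm_num) (by simp)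
    rw [lintegral_mul_const' _ _ hfin, ENNReal.mul_rpow_of_nonneg _ _ (by norm_num),
      Lp.enorm_def a, eLpNorm_eq_lintegral_rpow_enorm_toReal (by simp) (by simp),
      lintegral_prod _ (hm.enorm.pow_const _), ← ENNReal.rpow_mul]
    simp
  rw [eLpNorm_eq_lintegral_rpow_enorm_toReal (by simp) (by simp)]
  calc _ ≤ ((‖a‖ₑ * ‖f‖ₑ) ^ (2 : ℝ)) ^ (1 / 2 : ℝ) := by
        simp only [ENNReal.toReal_ofNat]; gcongr
    _ = _ := by rw [← ENNReal.rpow_mul]; norm_num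

theorem kernel_memLp (a : Lp ℂ 2 (μ.prod μ)) (f : Lp ℂ 2 μ) :
    MemLp (fun x => ∫ y, a (x, y) * f y ∂μ) 2 μ := by
  refine ⟨?_, (kernel_eLpNorm_le a f).trans_lt (ENNReal.mul_lt_top (by simp) (by simp))⟩
  exact AEStronglyMeasurable.integral_prod_right' (f := fun z : X × X => a z * f z.2)
    ((Lp.aestronglyMeasurable a).mul (Lp.aestronglyMeasurable f).comp_snd)

/-- The operator `A f (x) = ∫ a(x, y) f(y) dμ(y)` on `L²(X, μ)` with kernel
`a ∈ L²(X × X, μ ⊗ μ)`. -/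
def kernelOp (a : Lp ℂ 2 (μ.prod μ)) : Lp ℂ 2 μ →L[ℂ] Lp ℂ 2 μ :=
  LinearMap.mkContinuous
    { toFun := fun f => (kernel_memLp a f).toLp _
      map_add' := by
        intro f g
        rw [← MemLp.toLp_add, MemLp.toLp_eq_toLp_iff]
        filter_upwards [kernel_ae_memLp a] with x hx
        have h1 : Integrable (fun y => a (x, y) * f y) μ := hx.integrable_mul (Lp.memLp f)
        have h2 : Integrable (fun y => a (x, y) * g y) μ := hx.integrable_mul (Lp.memLp g)
        simp only [Pi.add_apply]
        rw [← integral_add h1 h2]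
        refine integral_congr_ae ?_
        filter_upwards [Lp.coeFn_add f g] with y hy
        rw [hy, Pi.add_apply, mul_add]
      map_smul' := by
        intro c f
        rw [RingHom.id_apply, ← MemLp.toLp_const_smul, MemLp.toLp_eq_toLp_iff]
        refine Filter.Eventually.of_forall fun x => ?_
        simp only [Pi.smul_apply]
        rw [← integral_smul]
        refine integral_congr_ae ?_
        filter_upwards [Lp.coeFn_smul c f] with y hy
        rw [hy, Pi.smul_apply, smul_eq_mul, smul_eq_mul]
        ring }
    ‖a‖
    (by
      intro f
      have h := kernel_eLpNorm_le a f
      rw [LinearMap.coe_mk, AddHom.coe_mk, Lp.norm_toLp]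
      have h' := ENNReal.toReal_mono (by finiteness) h
      simpa [ENNReal.toReal_mul] using h')

/-- The norm `‖m‖_{MS_p(L²(X, μ))} ∈ [0, ∞]` of the Schur multiplier with (bounded measurable)
symbol `m`, that sends the operator with kernel `a` to the operator with kernel `b = m a`: the best
constant `K` with `‖S_m A‖_p ≤ K ‖A‖_p` for all `A ∈ S_2 ∩ S_p`. As `S_2 ∩ S_p` is dense in `S_p`,
it is the norm of the extension of `S_m` to `S_p` if `S_m` is `S_p`-bounded, and `∞` otherwise. -/
def schurNorm (p : ℝ≥0∞) (μ : Measure X) [SFinite μ] (m : X × X → ℂ) : ℝ≥0∞ :=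
  sInf {K : ℝ≥0∞ | ∀ a b : Lp ℂ 2 (μ.prod μ), (∀ᵐ z ∂(μ.prod μ), b z = m z * a z) →
    schattenNorm p (kernelOp a) ≠ ⊤ →
    schattenNorm p (kernelOp b) ≤ K * schattenNorm p (kernelOp a)}

end Kernel

/-- The unit sphere `S^d` of `ℝ^{d+1}`. -/
abbrev Sph (d : ℕ) : Type := Metric.sphere (0 : EuclideanSpace ℝ (Fin (d + 1))) 1

/-- The rotation invariant surface measure on `S^d`. (Multiplying the measure by a positive constant
does not change the norms of Schur multipliers.) -/
def sphMeasure (d : ℕ) : Measure (Sph d) :=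
  (volume : Measure (EuclideanSpace ℝ (Fin (d + 1)))).toSphere

instance (d : ℕ) : IsFiniteMeasure (sphMeasure d) := by
  unfold sphMeasure; infer_instance

/-- `‖m(⟨·,·⟩)‖_{MS_p(L²(S^d))}`. The value only depends on the restriction of `m` to `(-1, 1)`, as
`⟨x, y⟩ ∈ (-1, 1)` for almost all `x, y ∈ S^d` when `d ≥ 1`. -/
def sphSchurNorm (d : ℕ) (p : ℝ≥0∞) (m : ℝ → ℂ) : ℝ≥0∞ :=
  schurNorm p (sphMeasure d) fun z =>
    m ⟪(z.1 : EuclideanSpace ℝ (Fin (d + 1))), (z.2 : EuclideanSpace ℝ (Fin (d + 1)))⟫_ℝ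

/-! ### Littlewood-Paley decomposition -/

/-- The functions `w_n`, where `w_n(x) = w(|x| / 2^n)` for `n ≥ 1`. -/
def dyadic (w₀ w : ℝ → ℝ) (n : ℕ) (x : ℝ) : ℝ :=
  if n = 0 then w₀ x else w (|x| / 2 ^ n)

/-- `w₀, w` are nonnegative smooth functions with supports in `[-2, 2]` and `[1/2, 2]`
such that `w₀ + ∑_{n ≥ 1} w_n = 1`. -/
structure IsLittlewoodPaley (w₀ w : ℝ → ℝ) : Prop where
  smooth_zero : ContDiff ℝ ∞ w₀
  smooth : ContDiff ℝ ∞ w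
  nonneg_zero : ∀ x, 0 ≤ w₀ x
  nonneg : ∀ x, 0 ≤ w x
  support_zero : tsupport w₀ ⊆ Set.Icc (-2) 2
  support : tsupport w ⊆ Set.Icc (1 / 2) 2
  hasSum_one : ∀ x, HasSum (fun n => dyadic w₀ w n x) 1

/-- `W_n`, the function with Fourier transform `w_n`, for the convention
`f̂(ξ) = ∫ f(x) e^{-2iπxξ} dx`. -/
def kernelW (w₀ w : ℝ → ℝ) (n : ℕ) : ℝ → ℂ :=
  𝓕⁻ (fun ξ : ℝ => (dyadic w₀ w n ξ : ℂ))

/-- `(W_n ∗ (m ∘ cos))(θ)`. -/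
def lpPiece (w₀ w : ℝ → ℝ) (n : ℕ) (m : ℝ → ℂ) (θ : ℝ) : ℂ :=
  convolution (kernelW w₀ w n) (fun t => m (Real.cos t)) (ContinuousLinearMap.mul ℂ ℂ) volume θ

/-- The exponent `|1/p - 1/2|`, for `p ∈ [1, ∞]` with `1/∞ = 0`. -/
def pExp (p : ℝ≥0∞) : ℝ := |(p⁻¹).toReal - 1 / 2|

end SphericalSchur

end

open MeasureTheory
open scoped ENNReal ContDiff FourierTransform InnerProductSpace

noncomputable section

set_option linter.unusedSectionVars false

namespace SphericalSchur

/-! ### Traces and quadratic forms -/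

section Trace

variable {H : Type*} [NormedAddCommGroup H] [InnerProductSpace ℂ H] [CompleteSpace H]

/-! The multiplier is tested on a finite rank operator A = ∑_c φ_c ⊗ α_c^*, and the image S_m(A) is
paired with a second family γ_c. Each φ_c is the normalised indicator of a tiny set near a point x_c
of the sphere, so ∑_c ⟨φ_c, S_m(A) γ_c⟩ is close to ∑_c ∫ m(⟨x_c, y⟩) conj(α_c(y)) γ_c(y) dy.

The vectors are wave packets in a chart around the pole, where the sphere magnified by l looks like
ℝ^d. The index c = (j, n) consists of a tube and a lattice point in a ball of radius ρ. Both packets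
are centred at that lattice point; the frequencies of α_c lie in R_j and those of γ_c in the shifted
tube. Their product has width about 1 along the axis of the tube, width about 1/δ across it, and
frequency between 1 and 3 along it. The point x_c lies in the axial direction, at angle about θ from
the lattice point, so that ⟨x_c, y⟩ is cos(θ - s/l) up to curvature, s being the axial coordinate
relative to the lattice point. All terms are then nearly equal to one number, an average of m ∘ cos
at frequencies between l and 3l (`norm_column_sub_le`), with relative errors ρ²/(l sin θ), 1/ρ and
1/(ρδ).

The Schatten bound (`norm_sum_average_le`, `norm_sum_column_le`) carries the geometry. The
frequencies of the α_c fill only ⋃ R_j, so these vectors live in a space of effective dimension D =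
|ball| |⋃ R_j|, and for p < 2 the p-norm of A is at most its Hilbert-Schmidt norm times D^{1/p-1/2}.
The γ_c are almost orthogonal, because the shifted tubes are disjoint and lattice translates within
a tube are orthogonal. The quotient of the two effective dimensions is about |⋃ R_j| / ∑ |R_j|, and
its power |1/p - 1/2| is gained. For p ≥ 2 the two families exchange roles. Taking ρδ = (δ² l sin
θ)^{1/3} balances the errors (`exists_norm_integral_cos_mul_axisKernelOf_le`).

To pass from these averages to W_n, the function w is written as a Schwartz function times the sum
of two dilates of the Fourier transform of the test kernel (`IsLittlewoodPaley.exists_factor`). In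
the plane, 2^N tubes around lines with prescribed binary digits give f_2(2^{-N}/20) ≤ C/N
(`exists_besicovitchFun_two_le`), and N is taken close to (n + log₂|sin θ|)/4. -/

variable (H) in
/-- The Hilbert basis in which `posTrace` is computed. -/
def traceBasis : HilbertBasis (exists_hilbertBasis ℂ H).choose ℂ H :=
  (exists_hilbertBasis ℂ H).choose_spec.choose

theorem tsum_enorm_inner_sq {ι : Type*} (b : HilbertBasis ι ℂ H) (u : H) :
    ∑' i, ‖⟪b i, u⟫_ℂ‖ₑ ^ 2 = ‖u‖ₑ ^ 2 := by
  have h := b.hasSum_inner_mul_inner u u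
  have h1 : HasSum (fun i => ‖⟪b i, u⟫_ℂ‖ ^ 2) (‖u‖ ^ 2) := by
    have h2 := Complex.hasSum_re h
    have h3 : (⟪u, u⟫_ℂ).re = ‖u‖ ^ 2 := by
      rw [← inner_self_eq_norm_sq (𝕜 := ℂ)]; rfl
    rw [h3] at h2
    convert h2 using 2 with i
    rw [← inner_conj_symm u, RCLike.conj_mul]
    norm_cast
  have h4 := h1.tsum_eq
  simp_rw [← ofReal_norm, ← ENNReal.ofReal_pow (norm_nonneg _)]
  rw [← ENNReal.ofReal_tsum_of_nonneg (fun _ => by positivity) h1.summable, h4]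

/-- Quadratic form of `A`, with values in `[0, ∞]`. -/
def quadForm (A : H →L[ℂ] H) (v : H) : ℝ≥0∞ := ENNReal.ofReal (⟪v, A v⟫_ℂ).re

theorem quadForm_star_mul_self (B : H →L[ℂ] H) (v : H) :
    quadForm (star B * B) v = ‖B v‖ₑ ^ 2 := by
  have : (⟪v, (star B * B) v⟫_ℂ).re = ‖B v‖ ^ 2 := by
    rw [ContinuousLinearMap.star_eq_adjoint, mul_apply_eq_comp,
      ContinuousLinearMap.adjoint_inner_right, ← inner_self_eq_norm_sq (𝕜 := ℂ)]
    rfl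
  rw [quadForm, this, ENNReal.ofReal_pow (norm_nonneg _), ofReal_norm]

theorem quadForm_mono {A B : H →L[ℂ] H} (h : A ≤ B) (v : H) : quadForm A v ≤ quadForm B v := by
  refine ENNReal.ofReal_le_ofReal ?_
  have := ((ContinuousLinearMap.le_def _ _).1 h).re_inner_nonneg_right v
  rw [sub_apply, inner_sub_right] at this
  simpa using this

theorem spectrum_nonneg' {Q : H →L[ℂ] H} (hQ : 0 ≤ Q) {x : ℝ} (hx : x ∈ spectrum ℝ Q) : 0 ≤ x :=
  spectrum_nonneg_of_nonneg hQ hx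

/-- The functional calculus preserves order, so an affine bound of f by g on the spectrum passes to
quadratic forms. Tangent lines of concave powers are the bounds fed into it. -/
theorem quadForm_cfc_le {Q : H →L[ℂ] H} (hQ : 0 ≤ Q) {f g : ℝ → ℝ} (hf : Continuous f)
    (hg : Continuous g) {a b : ℝ} (ha : 0 ≤ a) (hb : 0 ≤ b)
    (h : ∀ x ∈ spectrum ℝ Q, f x ≤ a * g x + b) (v : H) :
    quadForm (cfc f Q) v ≤
      ENNReal.ofReal a * quadForm (cfc g Q) v + ENNReal.ofReal b * ‖v‖ₑ ^ 2 := by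
  have hsa : IsSelfAdjoint Q := .of_nonneg hQ
  have h1 : cfc f Q ≤ cfc (fun x => a * g x + b) Q :=
    cfc_mono h hf.continuousOn (by fun_prop)
  refine (quadForm_mono h1 v).trans ?_
  rw [cfc_add_const b (fun x => a * g x) Q (by fun_prop), cfc_const_mul a g Q (by fun_prop)]
  rw [quadForm]
  have : (⟪v, (a • cfc g Q + algebraMap ℝ (H →L[ℂ] H) b) v⟫_ℂ).re
      = a * (⟪v, cfc g Q v⟫_ℂ).re + b * ‖v‖ ^ 2 := by
    have h2 : (algebraMap ℝ (H →L[ℂ] H) b) v = (b : ℂ) • v := by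
      rw [Algebra.algebraMap_eq_smul_one]; simp
    have h3 : (a • cfc g Q) v = (a : ℂ) • cfc g Q v := by simp
    rw [add_apply, h2, h3, inner_add_right, inner_smul_right, inner_smul_right,
      inner_self_eq_norm_sq_to_K]
    norm_cast
    simp
    exact Or.inl (by norm_cast)
  rw [this]
  refine ENNReal.ofReal_add_le.trans ?_
  rw [ENNReal.ofReal_mul ha, ENNReal.ofReal_mul hb, ENNReal.ofReal_pow (norm_nonneg _),
    ofReal_norm, quadForm]

theorem quadForm_cfc_mono {Q : H →L[ℂ] H} {f g : ℝ → ℝ} (hf : Continuous f)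
    (hg : Continuous g) (h : ∀ x ∈ spectrum ℝ Q, f x ≤ g x) (v : H) :
    quadForm (cfc f Q) v ≤ quadForm (cfc g Q) v :=
  quadForm_mono (cfc_mono h hf.continuousOn hg.continuousOn) v

theorem quadForm_cfc_id {Q : H →L[ℂ] H} (hQ : 0 ≤ Q) (v : H) :
    quadForm (cfc (fun x : ℝ => x) Q) v = quadForm Q v := by
  have hsa : IsSelfAdjoint Q := .of_nonneg hQ
  rw [cfc_id' ℝ Q]

/-- `‖B s(Q) v‖² = ⟨v, (x s(x)²)(Q) v⟩` for `Q = B^* B`. -/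
theorem enorm_apply_cfc_sq (B : H →L[ℂ] H) {s : ℝ → ℝ} (hs : Continuous s) (v : H) :
    ‖B (cfc s (star B * B) v)‖ₑ ^ 2 =
      quadForm (cfc (fun x => x * s x ^ 2) (star B * B)) v := by
  have hQ : 0 ≤ star B * B := star_mul_self_nonneg B
  have hsa : IsSelfAdjoint (star B * B) := .of_nonneg hQ
  rw [← mul_apply_eq_comp, ← quadForm_star_mul_self]
  congr 1
  have hs1 : star (cfc s (star B * B)) = cfc s (star B * B) :=
    (cfc_predicate s (star B * B) : IsSelfAdjoint _).star_eq
  rw [star_mul, hs1, mul_assoc, ← mul_assoc (star B)]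
  conv_lhs => enter [2, 1]; rw [← cfc_id' ℝ (star B * B)]
  rw [← cfc_mul (fun x => x) s _ (by fun_prop) (by fun_prop), ← cfc_mul s _ _ (by fun_prop) (by fun_prop)]
  congr 1
  ext x; ring

/-- `‖√f(Q) v‖² = ⟨v, f(Q) v⟩`. -/
theorem enorm_cfc_sq {Q : H →L[ℂ] H} (hQ : 0 ≤ Q) {s : ℝ → ℝ} (hs : Continuous s) (v : H) :
    ‖cfc s Q v‖ₑ ^ 2 = quadForm (cfc (fun x => s x ^ 2) Q) v := by
  have hsa : IsSelfAdjoint Q := .of_nonneg hQ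
  rw [← quadForm_star_mul_self]
  congr 1
  have hs1 : star (cfc s Q) = cfc s Q := (cfc_predicate s Q : IsSelfAdjoint _).star_eq
  rw [hs1, ← cfc_mul s s _ (by fun_prop) (by fun_prop)]
  congr 1
  ext x; ring

theorem inner_cfc_left {Q : H →L[ℂ] H} (s : ℝ → ℝ) (u v : H) :
    ⟪cfc s Q u, v⟫_ℂ = ⟪u, cfc s Q v⟫_ℂ := by
  have hs1 : star (cfc s Q) = cfc s Q := (cfc_predicate s Q : IsSelfAdjoint _).star_eq
  conv_lhs => rw [← hs1]
  rw [ContinuousLinearMap.star_eq_adjoint, ContinuousLinearMap.adjoint_inner_left]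

theorem posTrace_rpow {Q : H →L[ℂ] H} (hQ : 0 ≤ Q) (y : ℝ) :
    posTrace (Q ^ y) = ∑' i, quadForm (cfc (fun x : ℝ => x ^ y) Q) (traceBasis H i) := by
  -- `traceBasis` is the very basis chosen in the definition of `posTrace`, so no independence of
  -- the basis is needed.
  rw [CFC.rpow_eq_cfc_real hQ]; rfl

/-- Orthonormal vectors are at distance √2, so balls of radius 1/2 around them are disjoint.
Countability makes sums over the basis measurable in a parameter. -/
theorem countable_of_hilbertBasis [TopologicalSpace.SeparableSpace H] {ι : Type*}
    (b : HilbertBasis ι ℂ H) : Countable ι := by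
  have hd : Pairwise (Function.onFun Disjoint fun i => Metric.ball (b i) (1 / 2)) := by
    intro i j hij
    refine Metric.ball_disjoint_ball ?_
    have h1 : ‖b i - b j‖ ^ 2 = 2 := by
      rw [@norm_sub_sq ℂ, b.orthonormal.2 hij, b.orthonormal.1, b.orthonormal.1]
      norm_num
    rw [dist_eq_norm]
    nlinarith [norm_nonneg (b i - b j)]
  have := Set.PairwiseDisjoint.countable_of_isOpen (s := fun i => Metric.ball (b i) (1 / 2))
    (a := Set.univ) (fun i _ j _ hij => hd hij) (fun _ _ => Metric.isOpen_ball)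
    (fun i _ => ⟨b i, by simp⟩)
  exact Set.countable_univ_iff.1 this

instance [TopologicalSpace.SeparableSpace H] : Countable (exists_hilbertBasis ℂ H).choose :=
  countable_of_hilbertBasis (traceBasis H)

/-! ### Bessel families -/

/-- A weakly measurable family `v` of vectors with `∫ |⟨u, v_ξ⟩|² ≤ β ‖u‖²`. -/
structure IsBessel {Ξ : Type*} [MeasurableSpace Ξ] (τ : Measure Ξ) (v : Ξ → H) (β : ℝ≥0∞) :
    Prop where
  meas : ∀ u, AEMeasurable (fun ξ => ⟪u, v ξ⟫_ℂ) τ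
  bound : ∀ u, ∫⁻ ξ, ‖⟪u, v ξ⟫_ℂ‖ₑ ^ 2 ∂τ ≤ β * ‖u‖ₑ ^ 2

variable [TopologicalSpace.SeparableSpace H]
  {Ξ : Type*} [MeasurableSpace Ξ] {τ : Measure Ξ} {v : Ξ → H} {β : ℝ≥0∞}

/-- The family is only weakly measurable; Parseval turns the norm into a countable sum of measurable
coefficients. -/
theorem IsBessel.aemeasurable_enorm (hv : IsBessel τ v β) (T : H →L[ℂ] H) :
    AEMeasurable (fun ξ => ‖T (v ξ)‖ₑ ^ 2) τ := by
  simp_rw [← tsum_enorm_inner_sq (traceBasis H), ← ContinuousLinearMap.adjoint_inner_left]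
  exact AEMeasurable.tsum fun i => ((hv.meas _).enorm).pow_const _

/-- With s = √f, Parseval and an exchange of sum and integral give ∑_i ∫ |⟨s(Q) e_i, v_ξ⟩|². The
Bessel bound applied to each s(Q) e_i then produces the trace of f(Q). -/
theorem IsBessel.lintegral_cfc_le (hv : IsBessel τ v β) {Q : H →L[ℂ] H} (hQ : 0 ≤ Q) {f : ℝ → ℝ}
    (hf : Continuous f) (hf0 : ∀ x, 0 ≤ x → 0 ≤ f x) :
    ∫⁻ ξ, quadForm (cfc f Q) (v ξ) ∂τ ≤ β * ∑' i, quadForm (cfc f Q) (traceBasis H i) := by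
  have hsa : IsSelfAdjoint Q := .of_nonneg hQ
  have key : ∀ u, quadForm (cfc f Q) u = ‖cfc (fun x => √(f x)) Q u‖ₑ ^ 2 := by
    intro u
    rw [enorm_cfc_sq hQ (by fun_prop)]
    congr 1
    refine cfc_congr fun x hx => ?_
    exact (Real.sq_sqrt (hf0 x (spectrum_nonneg' hQ hx))).symm
  simp_rw [key]
  have h1 : ∀ ξ, ‖cfc (fun x => √(f x)) Q (v ξ)‖ₑ ^ 2 =
      ∑' i, ‖⟪cfc (fun x => √(f x)) Q (traceBasis H i), v ξ⟫_ℂ‖ₑ ^ 2 := by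
    intro ξ
    rw [← tsum_enorm_inner_sq (traceBasis H)]
    simp_rw [inner_cfc_left]
  simp_rw [h1]
  rw [lintegral_tsum fun i => ((hv.meas _).enorm).pow_const _, ← ENNReal.tsum_mul_left]
  exact ENNReal.tsum_le_tsum fun i => hv.bound _

/-- The tangent line inequality `x^r ≤ r a^{r-1} x + (1-r) a^r`. -/
theorem rpow_le_tangent {r a x : ℝ} (hr0 : 0 ≤ r) (hr1 : r ≤ 1) (ha : 0 < a) (hx : 0 ≤ x) :
    x ^ r ≤ r * a ^ (r - 1) * x + (1 - r) * a ^ r := by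
  have h := Real.geom_mean_le_arith_mean2_weighted hr0 (by linarith : (0 : ℝ) ≤ 1 - r) hx ha.le
    (by ring)
  have h3 : a ^ (1 - r) * a ^ (r - 1) = 1 := by
    rw [← Real.rpow_add ha]; simp
  have h4 : a * a ^ (r - 1) = a ^ r := by
    rw [Real.rpow_sub ha, Real.rpow_one]
    field_simp
  calc x ^ r = x ^ r * a ^ (1 - r) * a ^ (r - 1) := by rw [mul_assoc, h3, mul_one]
    _ ≤ (r * x + (1 - r) * a) * a ^ (r - 1) := by gcongr
    _ = _ := by rw [← h4]; ring

/-- The right side of the hypothesis is minimal at a = x / y, where it equals x^r y^(1-r). -/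
theorem le_rpow_mul_rpow_of_tangent {r x y z : ℝ} (hr0 : 0 ≤ r) (hr1 : r ≤ 1) (hx : 0 ≤ x)
    (hy : 0 ≤ y) (h : ∀ a, 0 < a → z ≤ r * a ^ (r - 1) * x + (1 - r) * a ^ r * y) :
    z ≤ x ^ r * y ^ (1 - r) := by
  rcases eq_or_lt_of_le hr0 with rfl | hr0'
  · have := h 1 one_pos; simpa using this
  rcases eq_or_lt_of_le hr1 with rfl | hr1'
  · have := h 1 one_pos; simpa using this
  -- Either number may vanish, so both are enlarged by ε before the optimal a is inserted, and ε
  -- then tends to 0.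
  have h1 : ∀ ε : ℝ, 0 < ε → z ≤ (x + ε) ^ r * (y + ε) ^ (1 - r) := by
    intro ε hε
    have hX : 0 < x + ε := by linarith
    have hY : 0 < y + ε := by linarith
    refine (h ((x + ε) / (y + ε)) (by positivity)).trans ?_
    have e1 : ((x + ε) / (y + ε)) ^ (r - 1) * (x + ε) = (x + ε) ^ r * (y + ε) ^ (1 - r) := by
      rw [Real.div_rpow hX.le hY.le, Real.rpow_sub hX, Real.rpow_sub hY, Real.rpow_sub hY]
      simp only [Real.rpow_one]
      have := Real.rpow_pos_of_pos hY r
      field_simp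
    have e2 : ((x + ε) / (y + ε)) ^ r * (y + ε) = (x + ε) ^ r * (y + ε) ^ (1 - r) := by
      rw [Real.div_rpow hX.le hY.le, Real.rpow_sub hY]
      simp only [Real.rpow_one]
      have := Real.rpow_pos_of_pos hY r
      field_simp
    calc _ ≤ r * (((x + ε) / (y + ε)) ^ (r - 1) * (x + ε))
        + (1 - r) * (((x + ε) / (y + ε)) ^ r * (y + ε)) := by
          have hr1'' : 0 ≤ 1 - r := by linarith
          rw [← mul_assoc, ← mul_assoc]
          gcongr <;> linarith
      _ = _ := by rw [e1, e2]; ring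
  have h2 : Filter.Tendsto (fun ε : ℝ => (x + ε) ^ r * (y + ε) ^ (1 - r))
      (nhdsWithin 0 (Set.Ioi 0)) (nhds ((x + 0) ^ r * (y + 0) ^ (1 - r))) := by
    refine Filter.Tendsto.mono_left (Continuous.tendsto ?_ 0) nhdsWithin_le_nhds
    exact ((Real.continuous_rpow_const hr0).comp (by fun_prop)).mul
      ((Real.continuous_rpow_const (by linarith)).comp (by fun_prop))
  rw [add_zero, add_zero] at h2
  exact ge_of_tendsto h2 (by filter_upwards [self_mem_nhdsWithin] with ε hε using h1 ε hε)

/-- Operator concavity inequality, integrated along a Bessel family. -/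
theorem IsBessel.lintegral_cfc_le_rpow (hv : IsBessel τ v β) {Q : H →L[ℂ] H} (hQ : 0 ≤ Q)
    {f g : ℝ → ℝ} (hf : Continuous f) (hg : Continuous g) (hg0 : ∀ x, 0 ≤ x → 0 ≤ g x)
    {r : ℝ} (hr0 : 0 ≤ r) (hr1 : r ≤ 1) (hfg : ∀ x, 0 ≤ x → f x ≤ g x ^ r)
    {X D : ℝ} (hX0 : 0 ≤ X) (hD0 : 0 ≤ D)
    (hX : β * ∑' i, quadForm (cfc g Q) (traceBasis H i) ≤ ENNReal.ofReal X)
    (hD : ∫⁻ ξ, ‖v ξ‖ₑ ^ 2 ∂τ ≤ ENNReal.ofReal D) :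
    ∫⁻ ξ, quadForm (cfc f Q) (v ξ) ∂τ ≤ ENNReal.ofReal (X ^ r * D ^ (1 - r)) := by
  -- The tangent at a bounds the integral by a combination of the trace term X and the total mass D;
  -- optimising in a interpolates between them.
  have h1 : ∀ a : ℝ, 0 < a → ∫⁻ ξ, quadForm (cfc f Q) (v ξ) ∂τ ≤
      ENNReal.ofReal (r * a ^ (r - 1) * X + (1 - r) * a ^ r * D) := by
    intro a ha
    have hc1 : 0 ≤ r * a ^ (r - 1) := by positivity
    have hc2 : 0 ≤ (1 - r) * a ^ r := mul_nonneg (by linarith) (by positivity)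
    calc _ ≤ ∫⁻ ξ, (ENNReal.ofReal (r * a ^ (r - 1)) * quadForm (cfc g Q) (v ξ)
          + ENNReal.ofReal ((1 - r) * a ^ r) * ‖v ξ‖ₑ ^ 2) ∂τ := by
          refine lintegral_mono fun ξ => quadForm_cfc_le hQ hf hg hc1 hc2 (fun x hx => ?_) _
          have hx0 := spectrum_nonneg' hQ hx
          exact (hfg x hx0).trans (rpow_le_tangent hr0 hr1 ha (hg0 x hx0))
      _ = ENNReal.ofReal (r * a ^ (r - 1)) * ∫⁻ ξ, quadForm (cfc g Q) (v ξ) ∂τ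
          + ENNReal.ofReal ((1 - r) * a ^ r) * ∫⁻ ξ, ‖v ξ‖ₑ ^ 2 ∂τ := by
          have hm : AEMeasurable (fun ξ => ‖v ξ‖ₑ ^ 2) τ := by
            simpa using hv.aemeasurable_enorm (ContinuousLinearMap.id ℂ H)
          rw [lintegral_add_right' _ (hm.const_mul _),
            lintegral_const_mul' _ _ ENNReal.ofReal_ne_top,
            lintegral_const_mul' _ _ ENNReal.ofReal_ne_top]
      _ ≤ ENNReal.ofReal (r * a ^ (r - 1)) * ENNReal.ofReal X
          + ENNReal.ofReal ((1 - r) * a ^ r) * ENNReal.ofReal D := by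
          gcongr
          exact (hv.lintegral_cfc_le hQ hg hg0).trans hX
      _ = _ := by
          rw [← ENNReal.ofReal_mul hc1, ← ENNReal.ofReal_mul hc2, ← ENNReal.ofReal_add
            (by positivity) (by positivity)]
  have hfin : ∫⁻ ξ, quadForm (cfc f Q) (v ξ) ∂τ ≠ ⊤ :=
    ((h1 1 one_pos).trans_lt ENNReal.ofReal_lt_top).ne
  rw [← ENNReal.ofReal_toReal hfin]
  refine ENNReal.ofReal_le_ofReal (le_rpow_mul_rpow_of_tangent hr0 hr1 hX0 hD0 fun a ha => ?_)
  refine ENNReal.toReal_le_of_le_ofReal ?_ (h1 a ha)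
  have hc2 : 0 ≤ (1 - r) * a ^ r := mul_nonneg (by linarith) (by positivity)
  positivity

/-- Cauchy-Schwarz for a finite sum of integrals. -/
theorem enorm_sum_integral_mul_le {C : Type*} [Fintype C] {f g : C → Ξ → ℂ}
    (hf : ∀ c, AEMeasurable (f c) τ) (hg : ∀ c, AEMeasurable (g c) τ) :
    ‖∑ c, ∫ ξ, f c ξ * g c ξ ∂τ‖ₑ ^ 2 ≤
      (∑ c, ∫⁻ ξ, ‖f c ξ‖ₑ ^ 2 ∂τ) * ∑ c, ∫⁻ ξ, ‖g c ξ‖ₑ ^ 2 ∂τ := by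
  have h2 : (2 : ℝ).HolderConjugate 2 := Real.HolderConjugate.two_two
  have h1 : ‖∑ c, ∫ ξ, f c ξ * g c ξ ∂τ‖ₑ ≤
      (∑ c, ∫⁻ ξ, ‖f c ξ‖ₑ ^ 2 ∂τ) ^ (1 / 2 : ℝ) * (∑ c, ∫⁻ ξ, ‖g c ξ‖ₑ ^ 2 ∂τ) ^ (1 / 2 : ℝ) := by
    calc _ ≤ ∑ c, ‖∫ ξ, f c ξ * g c ξ ∂τ‖ₑ := enorm_sum_le _ _
      _ ≤ ∑ c, (∫⁻ ξ, ‖f c ξ‖ₑ ^ 2 ∂τ) ^ (1 / 2 : ℝ) * (∫⁻ ξ, ‖g c ξ‖ₑ ^ 2 ∂τ) ^ (1 / 2 : ℝ) := by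
          refine Finset.sum_le_sum fun c _ => (enorm_integral_le_lintegral_enorm _).trans ?_
          have := ENNReal.lintegral_mul_le_Lp_mul_Lq τ h2 (hf c).enorm (hg c).enorm
          simpa [enorm_mul] using this
      _ ≤ _ := by
          refine (ENNReal.inner_le_Lp_mul_Lq Finset.univ _ _ h2).trans (le_of_eq ?_)
          congr 2 <;>
          · refine Finset.sum_congr rfl fun c _ => ?_
            rw [← ENNReal.rpow_mul]; norm_num
  calc _ ≤ _ := pow_le_pow_left' h1 2
    _ = _ := by
      rw [mul_pow, ← ENNReal.rpow_natCast, ← ENNReal.rpow_natCast, ← ENNReal.rpow_mul,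
        ← ENNReal.rpow_mul]
      norm_num

end Trace

/-! ### Schatten norm estimates for finite rank operators -/

section FiniteRank

variable {H : Type*} [NormedAddCommGroup H] [InnerProductSpace ℂ H] [CompleteSpace H]
  {C : Type*} [Fintype C] {φ α γ : C → H} {A B : H →L[ℂ] H}

theorem enorm_finiteRank_sq (hφ : Orthonormal ℂ φ) (hA : ∀ u, A u = ∑ c, ⟪α c, u⟫_ℂ • φ c)
    (u : H) : ‖A u‖ₑ ^ 2 = ∑ c, ‖⟪α c, u⟫_ℂ‖ₑ ^ 2 := by
  have h : ‖A u‖ ^ 2 = ∑ c, ‖⟪α c, u⟫_ℂ‖ ^ 2 := by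
    rw [hA, ← inner_self_eq_norm_sq (𝕜 := ℂ), hφ.inner_sum]
    simp only [map_sum]
    refine Finset.sum_congr rfl fun c _ => ?_
    rw [RCLike.conj_mul]
    norm_cast
  simp_rw [← ofReal_norm, ← ENNReal.ofReal_pow (norm_nonneg _)]
  rw [h, ENNReal.ofReal_sum_of_nonneg fun _ _ => by positivity]

/-- A Hilbert-Schmidt norm can be summed over the φ_c instead of over the basis: s(Q) is
self-adjoint and moves onto α_c. -/
theorem tsum_enorm_finiteRank_cfc (hφ : Orthonormal ℂ φ)
    (hA : ∀ u, A u = ∑ c, ⟪α c, u⟫_ℂ • φ c) {ι : Type*} (b : HilbertBasis ι ℂ H) (Q : H →L[ℂ] H)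
    (s : ℝ → ℝ) :
    ∑' i, ‖A (cfc s Q (b i))‖ₑ ^ 2 = ∑ c, ‖cfc s Q (α c)‖ₑ ^ 2 := by
  simp_rw [enorm_finiteRank_sq hφ hA, ← tsum_enorm_inner_sq b]
  rw [Summable.tsum_finsetSum fun _ _ => ENNReal.summable]
  refine Finset.sum_congr rfl fun c _ => tsum_congr fun i => ?_
  rw [← inner_cfc_left, ← inner_conj_symm, ← ofReal_norm, ← ofReal_norm, RCLike.norm_conj]

theorem enorm_sum_inner_sq_le (a b : C → H) :
    ‖∑ c, ⟪a c, b c⟫_ℂ‖ₑ ^ 2 ≤ (∑ c, ‖a c‖ₑ ^ 2) * ∑ c, ‖b c‖ₑ ^ 2 := by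
  have h : ‖∑ c, ⟪a c, b c⟫_ℂ‖ ^ 2 ≤ (∑ c, ‖a c‖ ^ 2) * ∑ c, ‖b c‖ ^ 2 := by
    have h1 : ‖∑ c, ⟪a c, b c⟫_ℂ‖ ≤ ∑ c, ‖a c‖ * ‖b c‖ :=
      (norm_sum_le _ _).trans (Finset.sum_le_sum fun c _ => norm_inner_le_norm _ _)
    calc _ ≤ (∑ c, ‖a c‖ * ‖b c‖) ^ 2 := by gcongr
      _ ≤ _ := Finset.sum_mul_sq_le_sq_mul_sq _ _ _
  simp_rw [← ofReal_norm, ← ENNReal.ofReal_pow (norm_nonneg _)]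
  rw [← ENNReal.ofReal_sum_of_nonneg fun _ _ => by positivity,
    ← ENNReal.ofReal_sum_of_nonneg fun _ _ => by positivity,
    ← ENNReal.ofReal_mul (Finset.sum_nonneg fun _ _ => by positivity)]
  exact ENNReal.ofReal_le_ofReal h

theorem sum_enorm_inner_sq_le_of_orthonormal (hφ : Orthonormal ℂ φ) (u : H) :
    ∑ c, ‖⟪u, φ c⟫_ℂ‖ₑ ^ 2 ≤ ‖u‖ₑ ^ 2 := by
  have h := hφ.sum_inner_products_le u (s := Finset.univ)
  simp_rw [← ofReal_norm, ← ENNReal.ofReal_pow (norm_nonneg _)]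
  rw [← ENNReal.ofReal_sum_of_nonneg fun _ _ => by positivity]
  refine ENNReal.ofReal_le_ofReal (le_of_eq_of_le ?_ h)
  refine Finset.sum_congr rfl fun c _ => ?_
  rw [← inner_conj_symm, RCLike.norm_conj]

theorem norm_finiteRank_le (hφ : Orthonormal ℂ φ) (hA : ∀ u, A u = ∑ c, ⟪α c, u⟫_ℂ • φ c)
    {β : ℝ} (hβ : 0 ≤ β) (hα : ∀ u, ∑ c, ‖⟪u, α c⟫_ℂ‖ₑ ^ 2 ≤ ENNReal.ofReal β * ‖u‖ₑ ^ 2) :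
    ‖A‖ ≤ √β := by
  refine A.opNorm_le_bound (by positivity) fun u => ?_
  have h1 : ‖A u‖ₑ ^ 2 ≤ ENNReal.ofReal β * ‖u‖ₑ ^ 2 := by
    rw [enorm_finiteRank_sq hφ hA]
    refine le_of_eq_of_le (Finset.sum_congr rfl fun c _ => ?_) (hα u)
    rw [← inner_conj_symm, ← ofReal_norm, ← ofReal_norm, RCLike.norm_conj]
  rw [← ofReal_norm, ← ofReal_norm, ← ENNReal.ofReal_pow (norm_nonneg _),
    ← ENNReal.ofReal_pow (norm_nonneg _), ← ENNReal.ofReal_mul hβ,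
    ENNReal.ofReal_le_ofReal_iff (by positivity)] at h1
  refine abs_le_of_sq_le_sq' ?_ (by positivity) |>.2
  rw [mul_pow, Real.sq_sqrt hβ]
  exact h1

theorem schattenNorm_of_ne_top {p : ℝ≥0∞} (hp : p ≠ ⊤) (T : H →L[ℂ] H) :
    schattenNorm p T = (posTrace ((star T * T) ^ (p.toReal / 2))) ^ (1 / p.toReal) := by
  rw [schattenNorm, if_neg hp]

theorem schattenNorm_le_iff {p : ℝ≥0∞} (hp : p ≠ ⊤) (hp1 : 1 ≤ p) (T : H →L[ℂ] H) {N : ℝ}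
    (hN : 0 ≤ N) : schattenNorm p T ≤ ENNReal.ofReal N ↔
      posTrace ((star T * T) ^ (p.toReal / 2)) ≤ ENNReal.ofReal (N ^ p.toReal) := by
  have hp0 : 0 < p.toReal := ENNReal.toReal_pos (by positivity) hp
  rw [schattenNorm_of_ne_top hp, one_div, ENNReal.rpow_inv_le_iff hp0,
    ENNReal.ofReal_rpow_of_nonneg hN hp0.le]

/-- Interpolation between the operator norm, at most √β, and the Hilbert-Schmidt norm, at most √S:
the spectrum of A^*A lies in [0, β], where x^{q/2} ≤ β^{q/2-1} x. -/
theorem schattenNorm_finiteRank_le_of_two_le {p : ℝ≥0∞} (hp : 2 ≤ p) (hφ : Orthonormal ℂ φ)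
    (hA : ∀ u, A u = ∑ c, ⟪γ c, u⟫_ℂ • φ c) {β S : ℝ} (hβ : 0 ≤ β)
    (hγ : ∀ u, ∑ c, ‖⟪u, γ c⟫_ℂ‖ₑ ^ 2 ≤ ENNReal.ofReal β * ‖u‖ₑ ^ 2)
    (hS0 : 0 ≤ S) (hS : ∑ c, ‖γ c‖ₑ ^ 2 ≤ ENNReal.ofReal S) :
    schattenNorm p A ≤
      ENNReal.ofReal (S ^ (p⁻¹).toReal * β ^ (1 / 2 - (p⁻¹).toReal)) := by
  have hn := norm_finiteRank_le hφ hA hβ hγ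
  by_cases hp' : p = ⊤
  · subst hp'
    rw [schattenNorm, if_pos rfl, ← ofReal_norm]
    refine ENNReal.ofReal_le_ofReal (hn.trans (le_of_eq ?_))
    simp [Real.sqrt_eq_rpow]
  have hp1 : 1 ≤ p := le_trans (by norm_num) hp
  have hq2 : 2 ≤ p.toReal := by
    have := ENNReal.toReal_mono hp' hp
    simpa using this
  set q := p.toReal with hq
  have hq0 : 0 < q := by linarith
  have hQ : 0 ≤ star A * A := star_mul_self_nonneg A
  rw [schattenNorm_le_iff hp' hp1 A (by positivity), posTrace_rpow hQ, ENNReal.toReal_inv, ← hq]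
  have h1 : ∀ x ∈ spectrum ℝ (star A * A), x ^ (q / 2) ≤ β ^ (q / 2 - 1) * x + 0 := by
    intro x hx
    have hx0 := spectrum_nonneg' hQ hx
    have hx1 : x ≤ β := by
      have := (spectrum.norm_le_norm_mul_of_mem hx).trans
        (mul_le_of_le_one_right (norm_nonneg _) ContinuousLinearMap.norm_id_le)
      rw [CStarRing.norm_star_mul_self, Real.norm_of_nonneg hx0] at this
      have h2 : ‖A‖ * ‖A‖ ≤ √β * √β := by gcongr
      rw [Real.mul_self_sqrt hβ] at h2
      linarith
    rcases eq_or_lt_of_le hx0 with rfl | hx0'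
    · rw [Real.zero_rpow (by positivity)]; simp
    calc x ^ (q / 2) = x ^ (q / 2 - 1) * x := by
          rw [Real.rpow_sub_one hx0'.ne']; field_simp
      _ ≤ β ^ (q / 2 - 1) * x := by
          gcongr
          linarith
      _ = _ := by ring
  have hA0 : ∑' i, ‖A (traceBasis H i)‖ₑ ^ 2 = ∑ c, ‖γ c‖ₑ ^ 2 := by
    have := tsum_enorm_finiteRank_cfc hφ hA (traceBasis H) (star A * A) (fun _ => 1)
    simpa [cfc_const_one ℝ (star A * A)] using this
  calc _ ≤ ∑' i, ENNReal.ofReal (β ^ (q / 2 - 1)) * ‖A (traceBasis H i)‖ₑ ^ 2 := by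
        refine ENNReal.tsum_le_tsum fun i => ?_
        refine (quadForm_cfc_le hQ (Real.continuous_rpow_const (by positivity)) continuous_id
          (by positivity) le_rfl h1 _).trans (le_of_eq ?_)
        rw [ENNReal.ofReal_zero, zero_mul, add_zero]
        congr 1
        rw [← quadForm_star_mul_self]
        exact quadForm_cfc_id hQ _
    _ ≤ ENNReal.ofReal (β ^ (q / 2 - 1)) * ENNReal.ofReal S := by
        rw [ENNReal.tsum_mul_left, hA0]; gcongr
    _ = _ := by
        rw [← ENNReal.ofReal_mul (by positivity)]
        congr 1
        rw [Real.mul_rpow (by positivity) (by positivity), ← Real.rpow_mul hS0, ← Real.rpow_mul hβ,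
          inv_mul_cancel₀ hq0.ne', Real.rpow_one, mul_comm]
        congr 2
        field_simp

variable [TopologicalSpace.SeparableSpace H]
  {Ξ : Type*} [MeasurableSpace Ξ] {τ : Measure Ξ} {v : Ξ → H} {f : C → Ξ → ℂ}

/-- Expanding α_c along v_ξ and applying Cauchy-Schwarz leaves F ∫ ‖B v_ξ‖². As B^*B =
((B^*B)^{q/2})^{2/q} with 2/q ≤ 1, concavity bounds this integral by N² D^{1-2/q}: only a space of
dimension D is seen. -/
theorem enorm_sum_inner_le_of_two_le {p : ℝ≥0∞} (hp : 2 ≤ p) (hφ : Orthonormal ℂ φ)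
    (hv : IsBessel τ v 1) (hf : ∀ c, AEMeasurable (f c) τ)
    (hα : ∀ u c, ⟪u, α c⟫_ℂ = ∫ ξ, f c ξ * ⟪u, v ξ⟫_ℂ ∂τ) {F D N : ℝ} (hF0 : 0 ≤ F) (hD0 : 0 ≤ D)
    (hN0 : 0 ≤ N) (hF : ∑ c, ∫⁻ ξ, ‖f c ξ‖ₑ ^ 2 ∂τ ≤ ENNReal.ofReal F)
    (hD : ∫⁻ ξ, ‖v ξ‖ₑ ^ 2 ∂τ ≤ ENNReal.ofReal D) (hB : schattenNorm p B ≤ ENNReal.ofReal N) :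
    ‖∑ c, ⟪φ c, B (α c)⟫_ℂ‖ ^ 2 ≤ N ^ 2 * (F * D ^ (1 - 2 * (p⁻¹).toReal)) := by
  have hQ : 0 ≤ star B * B := star_mul_self_nonneg B
  have key : ∫⁻ ξ, ‖B (v ξ)‖ₑ ^ 2 ∂τ ≤ ENNReal.ofReal (N ^ 2 * D ^ (1 - 2 * (p⁻¹).toReal)) := by
    by_cases hp' : p = ⊤
    · subst hp'
      rw [schattenNorm, if_pos rfl] at hB
      calc _ ≤ ∫⁻ ξ, ENNReal.ofReal N ^ 2 * ‖v ξ‖ₑ ^ 2 ∂τ := by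
            refine lintegral_mono fun ξ => ?_
            rw [← mul_pow]
            gcongr
            exact (B.le_opENorm _).trans (by gcongr)
        _ ≤ _ := by
            rw [lintegral_const_mul' _ _ (by simp), ENNReal.ofReal_mul (by positivity),
              ENNReal.ofReal_pow hN0]
            gcongr
            simpa using hD
    have hp1 : 1 ≤ p := le_trans (by norm_num) hp
    have hq2 : 2 ≤ p.toReal := by
      have := ENNReal.toReal_mono hp' hp
      simpa using this
    rw [schattenNorm_le_iff hp' hp1 B hN0, posTrace_rpow hQ] at hB
    rw [ENNReal.toReal_inv]
    set q := p.toReal with hq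
    have hq0 : 0 < q := by linarith
    have h1 := hv.lintegral_cfc_le_rpow hQ (f := fun x => x) (g := fun x => x ^ (q / 2))
      continuous_id (Real.continuous_rpow_const (by positivity)) (fun x hx => by positivity)
      (r := 2 / q) (by positivity) (by rw [div_le_one hq0]; exact hq2)
      (fun x hx => by
        rw [← Real.rpow_mul hx]; field_simp; simp)
      (X := N ^ q) (D := D) (by positivity) hD0 (by rw [one_mul]; exact hB) hD
    simp_rw [quadForm_cfc_id hQ, quadForm_star_mul_self] at h1
    refine h1.trans (le_of_eq ?_)
    congr 1
    rw [← Real.rpow_mul hN0]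
    congr 1
    · rw [mul_div_cancel₀ _ hq0.ne']; norm_cast
  have hsum : ∑ c, ⟪φ c, B (α c)⟫_ℂ = ∑ c, ∫ ξ, f c ξ * ⟪φ c, B (v ξ)⟫_ℂ ∂τ := by
    refine Finset.sum_congr rfl fun c _ => ?_
    simp_rw [← ContinuousLinearMap.adjoint_inner_left]
    rw [hα]
  have hm : ∀ c, AEMeasurable (fun ξ => ⟪φ c, B (v ξ)⟫_ℂ) τ := by
    intro c
    simp_rw [← ContinuousLinearMap.adjoint_inner_left]
    exact hv.meas _
  have h2 := enorm_sum_integral_mul_le (τ := τ) hf hm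
  rw [← hsum] at h2
  have h3 : ∑ c, ∫⁻ ξ, ‖⟪φ c, B (v ξ)⟫_ℂ‖ₑ ^ 2 ∂τ ≤ ∫⁻ ξ, ‖B (v ξ)‖ₑ ^ 2 ∂τ := by
    rw [← lintegral_finsetSum' _ fun c _ => (hm c).enorm.pow_const _]
    refine lintegral_mono fun ξ => ?_
    refine le_of_eq_of_le (Finset.sum_congr rfl fun c _ => ?_)
      (sum_enorm_inner_sq_le_of_orthonormal hφ (B (v ξ)))
    rw [← inner_conj_symm, ← ofReal_norm, ← ofReal_norm, RCLike.norm_conj]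
  have h4 := h2.trans (mul_le_mul' hF (h3.trans key))
  rw [← ofReal_norm, ← ENNReal.ofReal_pow (norm_nonneg _), ← ENNReal.ofReal_mul hF0,
    ENNReal.ofReal_le_ofReal_iff (by positivity)] at h4
  linarith

/-- A self-improving estimate. Let T = ∑ ‖σ(Q) α_c‖² with Q = A^*A and σ² = Q^{q/2-1}, so that T is
the trace of Q^{q/2}. Expanding one copy of α_c along v_ξ, Cauchy-Schwarz gives T² ≤ F ∫ ⟨v_ξ,
Q^{q-1} v_ξ⟩. By concavity that integral is at most T^r D^{1-r}, and T^r can be divided out. -/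
theorem schattenNorm_finiteRank_le_of_lt_two {p : ℝ≥0∞} (hp1 : 1 ≤ p) (hp2 : p < 2)
    (hφ : Orthonormal ℂ φ) (hv : IsBessel τ v 1) (hA : ∀ u, A u = ∑ c, ⟪α c, u⟫_ℂ • φ c)
    (hf : ∀ c, AEMeasurable (f c) τ)
    (hα : ∀ u c, ⟪u, α c⟫_ℂ = ∫ ξ, f c ξ * ⟪u, v ξ⟫_ℂ ∂τ) {F D : ℝ} (hF0 : 0 ≤ F) (hD0 : 0 ≤ D)
    (hF : ∑ c, ∫⁻ ξ, ‖f c ξ‖ₑ ^ 2 ∂τ ≤ ENNReal.ofReal F)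
    (hD : ∫⁻ ξ, ‖v ξ‖ₑ ^ 2 ∂τ ≤ ENNReal.ofReal D) :
    schattenNorm p A ≤ ENNReal.ofReal (√F * D ^ ((p⁻¹).toReal - 1 / 2)) := by
  have hQ : 0 ≤ star A * A := star_mul_self_nonneg A
  have hp' : p ≠ ⊤ := (hp2.trans (by norm_num)).ne
  have hq1 : 1 ≤ p.toReal := by
    have := ENNReal.toReal_mono hp' hp1
    simpa using this
  have hq2 : p.toReal < 2 := by
    have := (ENNReal.toReal_lt_toReal hp' (by norm_num)).2 hp2
    simpa using this
  rw [schattenNorm_le_iff hp' hp1 A (by positivity), posTrace_rpow hQ, ENNReal.toReal_inv]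
  set q := p.toReal with hq
  have hq0 : 0 < q := by linarith
  -- This exponent satisfies x^{q-1} = (x^{q/2})^r and 2 - r = 2/q.
  set r := (2 * q - 2) / q with hr
  have hr0 : 0 ≤ r := div_nonneg (by linarith) hq0.le
  have hr1 : r ≤ 1 := by rw [hr, div_le_one hq0]; linarith
  set Y := (√F * D ^ (q⁻¹ - 1 / 2)) ^ q with hY
  have step : ∀ η : ℝ, 0 < η →
      ∑' i, quadForm (cfc (fun x : ℝ => x * ((max x 0 + η) ^ ((q / 2 - 1) / 2)) ^ 2) (star A * A))
        (traceBasis H i) ≤ ENNReal.ofReal Y := by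
    intro η hη
    have hpos : ∀ x : ℝ, 0 < max x 0 + η := fun x => by
      have := le_max_right x 0; linarith
    -- The exponent is negative, so the weight is regularised by η; the maximum makes it continuous
    -- on the whole line.
    set σ : ℝ → ℝ := fun x => (max x 0 + η) ^ ((q / 2 - 1) / 2) with hσ
    have hσ0 : ∀ x, 0 < σ x := fun x => Real.rpow_pos_of_pos (hpos x) _
    have hσc : Continuous σ := by
      refine Continuous.rpow_const (by fun_prop) fun x => Or.inl (hpos x).ne'
    have e1 : ∑' i, quadForm (cfc (fun x : ℝ => x * σ x ^ 2) (star A * A)) (traceBasis H i)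
        = ∑ c, ‖cfc σ (star A * A) (α c)‖ₑ ^ 2 := by
      rw [← tsum_enorm_finiteRank_cfc hφ hA (traceBasis H)]
      simp_rw [enorm_apply_cfc_sq A hσc]
    rw [e1]
    set T := ∑ c, ‖cfc σ (star A * A) (α c)‖ ^ 2 with hT
    have e2 : ∑ c, ‖cfc σ (star A * A) (α c)‖ₑ ^ 2 = ENNReal.ofReal T := by
      rw [hT, ENNReal.ofReal_sum_of_nonneg fun _ _ => by positivity]
      simp_rw [← ofReal_norm, ← ENNReal.ofReal_pow (norm_nonneg _)]
    have hT0 : 0 ≤ T := Finset.sum_nonneg fun _ _ => by positivity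
    rw [e2] at e1 ⊢
    have e3 : (T : ℂ) = ∑ c, ∫ ξ, f c ξ * ⟪cfc (fun x : ℝ => σ x ^ 2) (star A * A) (α c), v ξ⟫_ℂ ∂τ := by
      rw [hT]
      push_cast
      refine Finset.sum_congr rfl fun c _ => ?_
      rw [← hα]
      have hsa : IsSelfAdjoint (star A * A) := .of_nonneg hQ
      have : (cfc (fun x : ℝ => σ x ^ 2) (star A * A)) (α c) =
          cfc σ (star A * A) (cfc σ (star A * A) (α c)) := by
        rw [← mul_apply_eq_comp, ← cfc_mul σ σ _ (by fun_prop) (by fun_prop)]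
        simp_rw [sq]
      rw [this, inner_cfc_left, inner_self_eq_norm_sq_to_K]
      rfl
    have hm : ∀ c, AEMeasurable
        (fun ξ => ⟪cfc (fun x : ℝ => σ x ^ 2) (star A * A) (α c), v ξ⟫_ℂ) τ := fun c => hv.meas _
    have e4 := enorm_sum_integral_mul_le (τ := τ) hf hm
    rw [← e3, ← lintegral_finsetSum' _ fun c _ => (hm c).enorm.pow_const _] at e4
    have e5 : ∀ ξ, ∑ c, ‖⟪cfc (fun x : ℝ => σ x ^ 2) (star A * A) (α c), v ξ⟫_ℂ‖ₑ ^ 2 =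
        quadForm (cfc (fun x : ℝ => x * (σ x ^ 2) ^ 2) (star A * A)) (v ξ) := by
      intro ξ
      rw [← enorm_apply_cfc_sq A (s := fun x => σ x ^ 2) (by fun_prop), enorm_finiteRank_sq hφ hA]
      simp_rw [inner_cfc_left]
    simp_rw [e5] at e4
    have e6 := hv.lintegral_cfc_le_rpow hQ (f := fun x => x * (σ x ^ 2) ^ 2)
      (g := fun x => x * σ x ^ 2) (by fun_prop) (by fun_prop)
      (fun x hx => mul_nonneg hx (by positivity)) hr0 hr1
      (fun x hx => by
        have hy := hpos x
        have hxm : max x 0 = x := max_eq_left hx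
        simp only [hσ]
        rw [hxm] at hy ⊢
        rcases eq_or_lt_of_le hx with rfl | hx'
        · rw [zero_mul]; positivity
        have p1 : ((x + η) ^ ((q / 2 - 1) / 2)) ^ 2 = (x + η) ^ (q / 2 - 1) := by
          rw [← Real.rpow_natCast, ← Real.rpow_mul hy.le]; congr 1; push_cast; ring
        have p2 : ((x + η) ^ (q / 2 - 1)) ^ 2 = (x + η) ^ (q - 2) := by
          rw [← Real.rpow_natCast, ← Real.rpow_mul hy.le]; congr 1; push_cast; ring
        rw [p1, p2, Real.mul_rpow hx (by positivity), ← Real.rpow_mul hy.le]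
        have p3 : (q / 2 - 1) * r = (q - 2) + (1 - r) := by
          rw [hr]; field_simp; ring
        rw [p3, Real.rpow_add hy]
        have p4 : x = x ^ r * x ^ (1 - r) := by
          rw [← Real.rpow_add hx']; simp
        have p5 : x ^ (1 - r) ≤ (x + η) ^ (1 - r) := by
          gcongr <;> linarith
        calc x * (x + η) ^ (q - 2) = x ^ r * x ^ (1 - r) * (x + η) ^ (q - 2) := by rw [← p4]
          _ ≤ x ^ r * (x + η) ^ (1 - r) * (x + η) ^ (q - 2) := by gcongr
          _ = _ := by ring)
      (X := T) (D := D) hT0 hD0 (by rw [one_mul]; exact e1.le) hD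
    have e7 := e4.trans (mul_le_mul' hF e6)
    rw [← ENNReal.ofReal_mul hF0, ← ofReal_norm, ← ENNReal.ofReal_pow (norm_nonneg _),
      ENNReal.ofReal_le_ofReal_iff (by positivity), Complex.norm_real, Real.norm_of_nonneg hT0]
      at e7
    refine ENNReal.ofReal_le_ofReal ?_
    rcases eq_or_lt_of_le hT0 with h0 | hTpos
    · rw [← h0]; positivity
    -- The bound is T² ≤ F T^r D^{1-r} with T finite and positive.
    have e8 : T ^ (2 - r) ≤ F * D ^ (1 - r) := by
      have : T ^ 2 = T ^ (2 - r) * T ^ r := by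
        rw [← Real.rpow_add hTpos, ← Real.rpow_natCast]; congr 1; push_cast; ring
      rw [this] at e7
      have hTr : 0 < T ^ r := Real.rpow_pos_of_pos hTpos r
      nlinarith
    have e9 : 2 - r = 2 * q⁻¹ := by rw [hr]; field_simp; ring
    have e10 : 1 - r = 2 * (q⁻¹ - 1 / 2) := by rw [hr]; field_simp; ring
    have e11 := Real.rpow_le_rpow (by positivity) e8 (by positivity : 0 ≤ q / 2)
    rw [e9, e10, ← Real.rpow_mul hT0, show 2 * q⁻¹ * (q / 2) = 1 by field_simp, Real.rpow_one] at e11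
    refine e11.trans (le_of_eq ?_)
    rw [hY, Real.mul_rpow hF0 (by positivity), Real.mul_rpow (by positivity) (by positivity),
      Real.sqrt_eq_rpow, ← Real.rpow_mul hF0, ← Real.rpow_mul hD0, ← Real.rpow_mul hD0]
    congr 2 <;> ring
  -- Removing η costs η^{q/2} per basis vector, which tends to 0 only on finite partial sums.
  rw [ENNReal.tsum_eq_iSup_sum]
  refine iSup_le fun s => ?_
  have h1 : ∀ η : ℝ, 0 < η → ∑ i ∈ s, quadForm (cfc (fun x : ℝ => x ^ (q / 2)) (star A * A))
      (traceBasis H i) ≤ ENNReal.ofReal (Y + s.card * η ^ (q / 2)) := by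
    intro η hη
    have hpos : ∀ x : ℝ, 0 < max x 0 + η := fun x => by
      have := le_max_right x 0; linarith
    calc _ ≤ ∑ i ∈ s, (ENNReal.ofReal 1 * quadForm
            (cfc (fun x : ℝ => x * ((max x 0 + η) ^ ((q / 2 - 1) / 2)) ^ 2) (star A * A))
              (traceBasis H i) + ENNReal.ofReal (η ^ (q / 2)) * ‖traceBasis H i‖ₑ ^ 2) := by
          refine Finset.sum_le_sum fun i _ => ?_
          refine quadForm_cfc_le hQ (Real.continuous_rpow_const (by positivity)) ?_ zero_le_one
            (by positivity) (fun x hx => ?_) _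
          · exact continuous_id.mul ((Continuous.rpow_const (by fun_prop)
              fun x => Or.inl (hpos x).ne').pow 2)
          · have hx0 := spectrum_nonneg' hQ hx
            have hy := hpos x
            rw [max_eq_left hx0] at hy ⊢
            have p1 : ((x + η) ^ ((q / 2 - 1) / 2)) ^ 2 = (x + η) ^ (q / 2 - 1) := by
              rw [← Real.rpow_natCast, ← Real.rpow_mul hy.le]; congr 1; push_cast; ring
            rw [p1, one_mul]
            have p2 : (x + η) ^ (q / 2 - 1) ≤ η ^ (q / 2 - 1) :=
              Real.rpow_le_rpow_of_nonpos hη (by linarith) (by linarith)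
            calc x ^ (q / 2) ≤ (x + η) ^ (q / 2) := by gcongr; linarith
              _ = (x + η) * (x + η) ^ (q / 2 - 1) := by
                  rw [Real.rpow_sub_one hy.ne']; field_simp
              _ = x * (x + η) ^ (q / 2 - 1) + η * (x + η) ^ (q / 2 - 1) := by ring
              _ ≤ x * (x + η) ^ (q / 2 - 1) + η * η ^ (q / 2 - 1) := by gcongr
              _ = _ := by rw [Real.rpow_sub_one hη.ne']; field_simp
      _ = ∑ i ∈ s, quadForm
            (cfc (fun x : ℝ => x * ((max x 0 + η) ^ ((q / 2 - 1) / 2)) ^ 2) (star A * A))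
              (traceBasis H i) + s.card * ENNReal.ofReal (η ^ (q / 2)) := by
          rw [Finset.sum_add_distrib]
          have : ∀ i, ‖traceBasis H i‖ₑ = 1 := fun i => by
            rw [← ofReal_norm, (traceBasis H).orthonormal.1]; simp
          simp [this]
      _ ≤ ENNReal.ofReal Y + s.card * ENNReal.ofReal (η ^ (q / 2)) := by
          gcongr
          exact (ENNReal.sum_le_tsum s).trans (step η hη)
      _ = _ := by
          rw [ENNReal.ofReal_add (by positivity) (by positivity),
            ENNReal.ofReal_mul (by positivity), ENNReal.ofReal_natCast]
  have h2 : Filter.Tendsto (fun η : ℝ => ENNReal.ofReal (Y + s.card * η ^ (q / 2)))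
      (nhdsWithin 0 (Set.Ioi 0)) (nhds (ENNReal.ofReal (Y + s.card * 0 ^ (q / 2)))) := by
    refine Filter.Tendsto.mono_left (Continuous.tendsto ?_ 0) nhdsWithin_le_nhds
    exact ENNReal.continuous_ofReal.comp (continuous_const.add
      (continuous_const.mul (Real.continuous_rpow_const (by positivity))))
  rw [Real.zero_rpow (by positivity), mul_zero, add_zero] at h2
  exact ge_of_tendsto h2 (by filter_upwards [self_mem_nhdsWithin] with η hη using h1 η hη)

/-- With Q = B^*B and σ² = Q^{1-q/2}, the pairing is split as ⟨σ^{-1}(Q) B^* φ_c, σ(Q) γ_c⟩. The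
left vectors have total square at most Tr Q^{q/2} ≤ N^q. For the right ones, Q^{1-q/2} = (Q^{q/2})^r
with r = (2-q)/q, and concavity along the Bessel family γ applies. -/
theorem enorm_sum_inner_le_of_lt_two {p : ℝ≥0∞} (hp1 : 1 ≤ p) (hp2 : p < 2)
    (hφ : Orthonormal ℂ φ) {β S N : ℝ} (hβ : 0 ≤ β)
    (hγ : ∀ u, ∑ c, ‖⟪u, γ c⟫_ℂ‖ₑ ^ 2 ≤ ENNReal.ofReal β * ‖u‖ₑ ^ 2)
    (hS0 : 0 ≤ S) (hS : ∑ c, ‖γ c‖ₑ ^ 2 ≤ ENNReal.ofReal S) (hN0 : 0 ≤ N)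
    (hB : schattenNorm p B ≤ ENNReal.ofReal N) :
    ‖∑ c, ⟪φ c, B (γ c)⟫_ℂ‖ ^ 2 ≤
      N ^ 2 * (S ^ (2 - 2 * (p⁻¹).toReal) * β ^ (2 * (p⁻¹).toReal - 1)) := by
  have hQ : 0 ≤ star B * B := star_mul_self_nonneg B
  have hsa : IsSelfAdjoint (star B * B) := .of_nonneg hQ
  have hp' : p ≠ ⊤ := (hp2.trans (by norm_num)).ne
  have hq1 : 1 ≤ p.toReal := by
    have := ENNReal.toReal_mono hp' hp1
    simpa using this
  have hq2 : p.toReal < 2 := by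
    have := (ENNReal.toReal_lt_toReal hp' (by norm_num)).2 hp2
    simpa using this
  rw [schattenNorm_le_iff hp' hp1 B hN0, posTrace_rpow hQ] at hB
  rw [ENNReal.toReal_inv]
  set q := p.toReal with hq
  have hq0 : 0 < q := by linarith
  set r := (2 - q) / q with hr
  have hr0 : 0 ≤ r := div_nonneg (by linarith) hq0.le
  have hr1 : r ≤ 1 := by rw [hr, div_le_one hq0]; linarith
  let _ : MeasurableSpace C := ⊤
  -- Counting measure on C turns the finite family γ into a Bessel family.
  have hγB : IsBessel (Measure.count : Measure C) γ (ENNReal.ofReal β) :=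
    ⟨fun u => (measurable_from_top).aemeasurable, fun u => by
      rw [lintegral_count, tsum_fintype]; exact hγ u⟩
  have e0 := hγB.lintegral_cfc_le_rpow hQ (f := fun x => x ^ (1 - q / 2))
    (g := fun x => x ^ (q / 2)) (Real.continuous_rpow_const (by linarith))
    (Real.continuous_rpow_const (by linarith)) (fun x hx => by positivity) hr0 hr1
    (fun x hx => by
      rw [← Real.rpow_mul hx]
      refine le_of_eq ?_
      congr 1
      rw [hr]; field_simp) (X := β * N ^ q) (D := S) (by positivity) hS0
    (by rw [ENNReal.ofReal_mul hβ]; gcongr) (by rw [lintegral_count, tsum_fintype]; exact hS)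
  rw [lintegral_count, tsum_fintype] at e0
  have key : ∀ η : ℝ, 0 < η → ‖∑ c, ⟪φ c, B (γ c)⟫_ℂ‖ ^ 2 ≤
      N ^ q * ((β * N ^ q) ^ r * S ^ (1 - r) + η ^ (1 - q / 2) * S) := by
    intro η hη
    have hpos : ∀ x : ℝ, 0 < max x 0 + η := fun x => by
      have := le_max_right x 0; linarith
    set σ : ℝ → ℝ := fun x => (max x 0 + η) ^ ((1 - q / 2) / 2) with hσ
    have hσ0 : ∀ x, 0 < σ x := fun x => Real.rpow_pos_of_pos (hpos x) _
    have hσc : Continuous σ := by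
      refine Continuous.rpow_const (by fun_prop) fun x => Or.inl (hpos x).ne'
    have hσi : Continuous fun x => (σ x)⁻¹ := hσc.inv₀ fun x => (hσ0 x).ne'
    have hσ2 : ∀ x, 0 ≤ x → σ x ^ 2 = (x + η) ^ (1 - q / 2) := by
      intro x hx
      simp only [hσ]
      rw [max_eq_left hx, ← Real.rpow_natCast, ← Real.rpow_mul (by linarith)]
      congr 1; push_cast; ring
    have s1 : ∀ c, ⟪φ c, B (γ c)⟫_ℂ =
        ⟪cfc (fun x : ℝ => (σ x)⁻¹) (star B * B) (star B (φ c)), cfc σ (star B * B) (γ c)⟫_ℂ := by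
      intro c
      rw [inner_cfc_left, ← mul_apply_eq_comp, ← cfc_mul _ σ _ hσi.continuousOn hσc.continuousOn]
      have : (fun x => (σ x)⁻¹ * σ x) = fun _ => (1 : ℝ) := by
        ext x; exact inv_mul_cancel₀ (hσ0 x).ne'
      rw [this, cfc_const_one ℝ (star B * B), ContinuousLinearMap.star_eq_adjoint,
        ContinuousLinearMap.adjoint_inner_left]
      rfl
    have s2 : ∑ c, ‖cfc (fun x : ℝ => (σ x)⁻¹) (star B * B) (star B (φ c))‖ₑ ^ 2
        ≤ ENNReal.ofReal (N ^ q) := by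
      simp_rw [← tsum_enorm_inner_sq (traceBasis H)]
      rw [← Summable.tsum_finsetSum fun _ _ => ENNReal.summable]
      refine le_trans (ENNReal.tsum_le_tsum fun i => ?_) hB
      calc _ = ∑ c, ‖⟪B (cfc (fun x : ℝ => (σ x)⁻¹) (star B * B) (traceBasis H i)), φ c⟫_ℂ‖ₑ ^ 2 := by
            refine Finset.sum_congr rfl fun c _ => ?_
            rw [← inner_cfc_left, ContinuousLinearMap.star_eq_adjoint,
              ContinuousLinearMap.adjoint_inner_right]
        _ ≤ _ := sum_enorm_inner_sq_le_of_orthonormal hφ _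
        _ = _ := enorm_apply_cfc_sq B hσi _
        _ ≤ _ := by
            refine quadForm_cfc_mono (by fun_prop) (Real.continuous_rpow_const (by positivity))
              (fun x hx => ?_) _
            have hx0 := spectrum_nonneg' hQ hx
            rw [inv_pow, hσ2 x hx0]
            rcases eq_or_lt_of_le hx0 with rfl | hx'
            · rw [zero_mul]; positivity
            rw [mul_inv_le_iff₀ (by positivity)]
            calc x = x ^ (q / 2) * x ^ (1 - q / 2) := by
                  rw [← Real.rpow_add hx']; simp
              _ ≤ _ := by
                  have : 0 ≤ 1 - q / 2 := by linarith
                  gcongr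
                  linarith
    have s3 : ∑ c, ‖cfc σ (star B * B) (γ c)‖ₑ ^ 2 ≤
        ENNReal.ofReal ((β * N ^ q) ^ r * S ^ (1 - r) + η ^ (1 - q / 2) * S) := by
      calc _ ≤ ∑ c, (ENNReal.ofReal 1 * quadForm (cfc (fun x : ℝ => x ^ (1 - q / 2)) (star B * B)) (γ c)
            + ENNReal.ofReal (η ^ (1 - q / 2)) * ‖γ c‖ₑ ^ 2) := by
            refine Finset.sum_le_sum fun c _ => ?_
            rw [enorm_cfc_sq hQ hσc]
            refine quadForm_cfc_le hQ (by fun_prop) (Real.continuous_rpow_const (by linarith))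
              zero_le_one (by positivity) (fun x hx => ?_) _
            have hx0 := spectrum_nonneg' hQ hx
            rw [hσ2 x hx0, one_mul]
            exact Real.rpow_add_le_add_rpow hx0 hη.le (by linarith) (by linarith)
        _ = ∑ c, quadForm (cfc (fun x : ℝ => x ^ (1 - q / 2)) (star B * B)) (γ c)
            + ENNReal.ofReal (η ^ (1 - q / 2)) * ∑ c, ‖γ c‖ₑ ^ 2 := by
            rw [Finset.sum_add_distrib, Finset.mul_sum]; simp
        _ ≤ _ := by
            rw [ENNReal.ofReal_add (by positivity) (by positivity),
              ENNReal.ofReal_mul (p := η ^ (1 - q / 2)) (by positivity)]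
            gcongr
    have s4 := (enorm_sum_inner_sq_le _ _).trans (mul_le_mul' s2 s3)
    simp_rw [← s1] at s4
    rwa [← ofReal_norm, ← ENNReal.ofReal_pow (norm_nonneg _), ← ENNReal.ofReal_mul (by positivity),
      ENNReal.ofReal_le_ofReal_iff (by positivity)] at s4
  have h2 : Filter.Tendsto
      (fun η : ℝ => N ^ q * ((β * N ^ q) ^ r * S ^ (1 - r) + η ^ (1 - q / 2) * S))
      (nhdsWithin 0 (Set.Ioi 0))
      (nhds (N ^ q * ((β * N ^ q) ^ r * S ^ (1 - r) + 0 ^ (1 - q / 2) * S))) := by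
    refine Filter.Tendsto.mono_left (Continuous.tendsto ?_ 0) nhdsWithin_le_nhds
    exact continuous_const.mul (continuous_const.add
      ((Real.continuous_rpow_const (by linarith)).mul continuous_const))
  have h3 := ge_of_tendsto h2 (by filter_upwards [self_mem_nhdsWithin] with η hη using key η hη)
  refine h3.trans (le_of_eq ?_)
  rw [Real.zero_rpow (by linarith), zero_mul, add_zero, Real.mul_rpow hβ (by positivity),
    ← Real.rpow_mul hN0]
  have e1 : N ^ q * N ^ (q * r) = N ^ 2 := by
    have : q * r = 2 - q := by rw [hr]; field_simp
    rw [this, ← Real.rpow_add_of_nonneg hN0 hq0.le (by linarith)]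
    rw [← Real.rpow_natCast]; congr 1; push_cast; ring
  have e2 : 1 - r = 2 - 2 * q⁻¹ := by rw [hr]; field_simp; ring
  have e3 : r = 2 * q⁻¹ - 1 := by rw [hr]; field_simp
  rw [← e1, e2, ← e3]
  ring

end FiniteRank

/-! ### Testing a Schur multiplier on finite rank operators -/

section Testing

variable {X : Type*} [MeasurableSpace X] {μ : Measure X}

instance : Fact ((2 : ℝ≥0∞) ≠ ⊤) := ⟨by norm_num⟩

/-- The infimum is itself admissible: divide by the norm of A when it is positive, and use any one
finite admissible constant when it vanishes. -/
theorem le_schurNorm_mul [SFinite μ] {p : ℝ≥0∞} {M : X × X → ℂ} (hK : schurNorm p μ M ≠ ⊤)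
    {a b : Lp ℂ 2 (μ.prod μ)} (hab : ∀ᵐ z ∂(μ.prod μ), b z = M z * a z)
    (ha : schattenNorm p (kernelOp a) ≠ ⊤) :
    schattenNorm p (kernelOp b) ≤ schurNorm p μ M * schattenNorm p (kernelOp a) := by
  by_cases h0 : schattenNorm p (kernelOp a) = 0
  · obtain ⟨K, hK1, -⟩ := exists_lt_of_csInf_lt
      (s := {K : ℝ≥0∞ | ∀ a b : Lp ℂ 2 (μ.prod μ), (∀ᵐ z ∂(μ.prod μ), b z = M z * a z) →
        schattenNorm p (kernelOp a) ≠ ⊤ →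
        schattenNorm p (kernelOp b) ≤ K * schattenNorm p (kernelOp a)}) (b := ⊤)
      ⟨⊤, by
        by_contra h
        have : schurNorm p μ M = ⊤ := by
          rw [schurNorm, Set.eq_empty_of_forall_notMem (s := {K : ℝ≥0∞ | _}), sInf_empty]
          intro K hK'
          refine h fun a b hab ha => (hK' a b hab ha).trans (by gcongr; exact le_top)
        exact hK this⟩ (lt_top_iff_ne_top.2 hK)
    have := hK1 a b hab ha
    rw [h0, mul_zero] at this ⊢
    exact this
  · rw [← ENNReal.div_le_iff h0 ha]
    refine le_sInf fun K hK' => ?_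
    rw [ENNReal.div_le_iff h0 ha]
    exact hK' a b hab ha

variable [IsFiniteMeasure μ]

/-- The normalised indicator function of a set of positive measure. -/
def unitIndicator (μ : Measure X) [IsFiniteMeasure μ] {s : Set X} (hs : MeasurableSet s) :
    Lp ℂ 2 μ :=
  indicatorConstLp 2 hs (measure_ne_top μ s) (((√(μ.real s))⁻¹ : ℝ) : ℂ)

theorem unitIndicator_coe {s : Set X} (hs : MeasurableSet s) :
    unitIndicator μ hs =ᵐ[μ] s.indicator fun _ => (((√(μ.real s))⁻¹ : ℝ) : ℂ) :=
  indicatorConstLp_coeFn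

theorem orthonormal_unitIndicator {C : Type*} {s : C → Set X} (hs : ∀ c, MeasurableSet (s c))
    (hd : Pairwise fun c c' => Disjoint (s c) (s c')) (h0 : ∀ c, μ (s c) ≠ 0) :
    Orthonormal ℂ fun c => unitIndicator μ (hs c) := by
  refine ⟨fun c => ?_, fun c c' hcc' => ?_⟩
  · have hpos : 0 < μ.real (s c) := ENNReal.toReal_pos (h0 c) (measure_ne_top _ _)
    change ‖indicatorConstLp 2 (hs c) (measure_ne_top μ (s c)) _‖ = 1
    rw [norm_indicatorConstLp (by norm_num) (by norm_num), Complex.norm_real,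
      Real.norm_of_nonneg (by positivity), ENNReal.toReal_ofNat, ← Real.sqrt_eq_rpow,
      inv_mul_cancel₀ (by positivity)]
  · change ⟪unitIndicator μ (hs c), unitIndicator μ (hs c')⟫_ℂ = 0
    rw [L2.inner_def]
    refine integral_eq_zero_of_ae ?_
    filter_upwards [unitIndicator_coe (μ := μ) (hs c), unitIndicator_coe (μ := μ) (hs c')]
      with x hx hx'
    rw [hx, hx']
    by_cases h : x ∈ s c
    · have h' : x ∉ s c' := fun h' => Set.disjoint_left.1 (hd hcc') h h'
      simp [h']
    · simp [h]

theorem kernelOp_coe (a : Lp ℂ 2 (μ.prod μ)) (f : Lp ℂ 2 μ) :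
    kernelOp a f =ᵐ[μ] fun x => ∫ y, a (x, y) * f y ∂μ :=
  MemLp.coeFn_toLp (kernel_memLp a f)

variable {C : Type*} [Fintype C] {s : C → Set X}

/-- The kernel `∑ 1_{s_c}(x) conj(α_c(y)) / μ(s_c)^{1/2}`. -/
def testKernel (μ : Measure X) [IsFiniteMeasure μ] (s : C → Set X) (α : C → Lp ℂ 2 μ)
    (z : X × X) : ℂ :=
  ∑ c, (s c).indicator (fun _ => (((√(μ.real (s c)))⁻¹ : ℝ) : ℂ)) z.1 *
    starRingEnd ℂ (α c z.2)

theorem memLp_testKernel (hs : ∀ c, MeasurableSet (s c)) (α : C → Lp ℂ 2 μ) :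
    MemLp (testKernel μ s α) 2 (μ.prod μ) := by
  refine memLp_finsetSum _ fun c _ => ?_
  have h1 : Measurable ((s c).indicator fun _ => (((√(μ.real (s c)))⁻¹ : ℝ) : ℂ)) :=
    measurable_const.indicator (hs c)
  have h2 : StronglyMeasurable fun y => starRingEnd ℂ (α c y) :=
    RCLike.continuous_conj.comp_stronglyMeasurable (Lp.stronglyMeasurable (α c))
  refine (memLp_two_iff_integrable_sq_norm ((h1.comp measurable_fst).stronglyMeasurable.mul
    (h2.comp_measurable measurable_snd)).aestronglyMeasurable).2 ?_
  have h3 : MemLp ((s c).indicator fun _ => (((√(μ.real (s c)))⁻¹ : ℝ) : ℂ)) 2 μ :=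
    memLp_indicator_const 2 (hs c) _ (Or.inr (measure_ne_top _ _))
  have h4 := ((memLp_two_iff_integrable_sq_norm h3.1).1 h3)
  have h5 := ((memLp_two_iff_integrable_sq_norm (Lp.memLp (α c)).1).1 (Lp.memLp (α c)))
  refine (h4.mul_prod h5).congr (Filter.Eventually.of_forall fun z => ?_)
  simp only [Pi.mul_apply, Function.comp_apply, norm_mul, RCLike.norm_conj, mul_pow]

/-- The element of `L²` given by `testKernel`. -/
def testKernelLp (hs : ∀ c, MeasurableSet (s c)) (α : C → Lp ℂ 2 μ) : Lp ℂ 2 (μ.prod μ) :=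
  (memLp_testKernel hs α).toLp _

theorem testKernelLp_coe (hs : ∀ c, MeasurableSet (s c)) (α : C → Lp ℂ 2 μ) :
    ∀ᵐ x ∂μ, ∀ᵐ y ∂μ, testKernelLp hs α (x, y) = testKernel μ s α (x, y) :=
  Measure.ae_ae_of_ae_prod (MemLp.coeFn_toLp (memLp_testKernel hs α))

theorem kernelOp_testKernel (hs : ∀ c, MeasurableSet (s c)) (α : C → Lp ℂ 2 μ) (u : Lp ℂ 2 μ) :
    kernelOp (testKernelLp hs α) u =
      ∑ c, ⟪α c, u⟫_ℂ • unitIndicator μ (hs c) := by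
  refine Lp.ext ?_
  have h1 := testKernelLp_coe hs α
  have h2 : ∀ᵐ x ∂μ, ∀ c, unitIndicator μ (hs c) x =
      (s c).indicator (fun _ => (((√(μ.real (s c)))⁻¹ : ℝ) : ℂ)) x :=
    (ae_all_iff).2 fun c => unitIndicator_coe (hs c)
  have h3 : (((∑ c, ⟪α c, u⟫_ℂ • unitIndicator μ (hs c) : Lp ℂ 2 μ)) : X → ℂ) =ᵐ[μ]
      fun x => ∑ c, ⟪α c, u⟫_ℂ * unitIndicator μ (hs c) x := by
    refine (Lp.coeFn_fun_finsetSum Finset.univ _).trans ?_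
    have : ∀ᵐ x ∂μ, ∀ c, (⟪α c, u⟫_ℂ • unitIndicator μ (hs c) : Lp ℂ 2 μ) x =
        ⟪α c, u⟫_ℂ * unitIndicator μ (hs c) x :=
      ae_all_iff.2 fun c => by
        filter_upwards [Lp.coeFn_smul ⟪α c, u⟫_ℂ (unitIndicator μ (hs c))] with x hx
        rw [hx]; rfl
    filter_upwards [this] with x hx
    exact Finset.sum_congr rfl fun c _ => hx c
  filter_upwards [kernelOp_coe (testKernelLp hs α) u, h1, h2, h3] with x hx1 hx2 hx3 hx4
  rw [hx1, hx4]
  have h5 : ∫ y, testKernelLp hs α (x, y) * u y ∂μ =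
      ∫ y, ∑ c, (s c).indicator (fun _ => (((√(μ.real (s c)))⁻¹ : ℝ) : ℂ)) x *
        (starRingEnd ℂ (α c y) * u y) ∂μ := by
    refine integral_congr_ae ?_
    filter_upwards [hx2] with y hy
    rw [hy, testKernel, Finset.sum_mul]
    exact Finset.sum_congr rfl fun c _ => by ring
  have h6 : ∀ c, Integrable (fun y => starRingEnd ℂ (α c y) * u y) μ := fun c => by
    have := L2.integrable_inner (𝕜 := ℂ) (α c) u
    refine this.congr (Filter.Eventually.of_forall fun y => ?_)
    simp [mul_comm]
  rw [h5, integral_finsetSum _ fun c _ => (h6 c).const_mul _]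
  refine Finset.sum_congr rfl fun c _ => ?_
  rw [integral_const_mul, hx3 c, L2.inner_def, mul_comm]
  congr 1
  refine integral_congr_ae (Filter.Eventually.of_forall fun y => ?_)
  simp [mul_comm]

/-- On s_c only the c-th term of the kernel survives, as the sets are disjoint. The coefficient is
therefore an average over s_c of an integral in y alone. -/
theorem inner_kernelOp_mul_testKernel (hs : ∀ c, MeasurableSet (s c))
    (hd : Pairwise fun c c' => Disjoint (s c) (s c')) (α : C → Lp ℂ 2 μ) {M : X × X → ℂ}
    {b : Lp ℂ 2 (μ.prod μ)}
    (hab : ∀ᵐ z ∂(μ.prod μ), b z = M z * testKernelLp hs α z) (c : C)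
    (g : Lp ℂ 2 μ) :
    ⟪unitIndicator μ (hs c), kernelOp b g⟫_ℂ =
      ∫ x in s c, (((μ.real (s c))⁻¹ : ℝ) : ℂ) *
        ∫ y, M (x, y) * (starRingEnd ℂ (α c y) * g y) ∂μ ∂μ := by
  rw [L2.inner_def, ← integral_indicator (hs c)]
  refine integral_congr_ae ?_
  have h1 := testKernelLp_coe hs α
  filter_upwards [unitIndicator_coe (hs c), kernelOp_coe b g, h1,
    Measure.ae_ae_of_ae_prod hab] with x hx1 hx2 hx3 hx4
  rw [hx1, hx2]
  by_cases hx : x ∈ s c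
  · rw [Set.indicator_of_mem hx, Set.indicator_of_mem hx]
    have h5 : ∫ y, b (x, y) * g y ∂μ = (((√(μ.real (s c)))⁻¹ : ℝ) : ℂ) *
        ∫ y, M (x, y) * (starRingEnd ℂ (α c y) * g y) ∂μ := by
      rw [← integral_const_mul]
      refine integral_congr_ae ?_
      filter_upwards [hx3, hx4] with y hy hy'
      rw [hy', hy, testKernel, Finset.sum_eq_single c]
      · rw [Set.indicator_of_mem hx]; ring
      · intro c' _ hc'
        rw [Set.indicator_of_notMem (fun h => Set.disjoint_left.1 (hd hc') h hx), zero_mul]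
      · simp
    rw [h5, RCLike.inner_apply, Complex.conj_ofReal, mul_right_comm]
    congr 1
    rw [← Complex.ofReal_mul, ← mul_inv, Real.mul_self_sqrt measureReal_nonneg]
  · rw [Set.indicator_of_notMem hx, Set.indicator_of_notMem hx, inner_zero_left]

theorem exists_mul_toLp {a : Lp ℂ 2 (μ.prod μ)} {M : X × X → ℂ}
    (hM : AEStronglyMeasurable M (μ.prod μ)) {Mb : ℝ} (hMb : ∀ z, ‖M z‖ ≤ Mb) :
    ∃ b : Lp ℂ 2 (μ.prod μ), ∀ᵐ z ∂(μ.prod μ), b z = M z * a z := by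
  have h : MemLp (fun z => M z * a z) 2 (μ.prod μ) :=
    (Lp.memLp a).of_le_mul (c := Mb) (hM.mul (Lp.aestronglyMeasurable a))
      (Filter.Eventually.of_forall fun z => by rw [norm_mul]; gcongr; exact hMb z)
  exact ⟨h.toLp _, h.coeFn_toLp⟩

/-- The left and right factors in the pairing exchange their roles at `p = 2`. -/
def pairTerm (p : ℝ≥0∞) (a g : ℂ) : ℂ :=
  if p < 2 then starRingEnd ℂ a * g else starRingEnd ℂ g * a

variable [TopologicalSpace.SeparableSpace (Lp ℂ 2 μ)]
  {Ξ : Type*} [MeasurableSpace Ξ] {τ : Measure Ξ}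

/-- For p < 2 the multiplier acts on the operator built from α, whose p-norm is small because α is
spread over a family of small mass D; for p ≥ 2 it acts on the one built from the almost orthogonal
γ. The same bound results in both cases. -/
theorem norm_sum_average_le {p : ℝ≥0∞} (hp : 1 ≤ p) {M : X × X → ℂ}
    (hM : AEStronglyMeasurable M (μ.prod μ)) {Mb : ℝ} (hMb : ∀ z, ‖M z‖ ≤ Mb)
    (hK : schurNorm p μ M ≠ ⊤)
    (hs : ∀ c, MeasurableSet (s c)) (hd : Pairwise fun c c' => Disjoint (s c) (s c'))
    (h0 : ∀ c, μ (s c) ≠ 0) {v : Ξ → Lp ℂ 2 μ} {f : C → Ξ → ℂ} {α γ : C → Lp ℂ 2 μ}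
    (hv : IsBessel τ v 1) (hf : ∀ c, AEMeasurable (f c) τ)
    (hα : ∀ u c, ⟪u, α c⟫_ℂ = ∫ ξ, f c ξ * ⟪u, v ξ⟫_ℂ ∂τ) {F D β S : ℝ} (hF0 : 0 ≤ F) (hD0 : 0 ≤ D)
    (hβ : 0 ≤ β) (hS0 : 0 ≤ S)
    (hF : ∑ c, ∫⁻ ξ, ‖f c ξ‖ₑ ^ 2 ∂τ ≤ ENNReal.ofReal F)
    (hD : ∫⁻ ξ, ‖v ξ‖ₑ ^ 2 ∂τ ≤ ENNReal.ofReal D)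
    (hγ : ∀ u, ∑ c, ‖⟪u, γ c⟫_ℂ‖ₑ ^ 2 ≤ ENNReal.ofReal β * ‖u‖ₑ ^ 2)
    (hS : ∑ c, ‖γ c‖ₑ ^ 2 ≤ ENNReal.ofReal S) :
    ‖∑ c, ∫ x in s c, (((μ.real (s c))⁻¹ : ℝ) : ℂ) *
      ∫ y, M (x, y) * pairTerm p (α c y) (γ c y) ∂μ ∂μ‖ ≤
      (schurNorm p μ M).toReal *
        (√F * D ^ pExp p * S ^ (1 / 2 - pExp p) * β ^ pExp p) := by
  set K := (schurNorm p μ M).toReal with hKdef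
  have hK0 : 0 ≤ K := ENNReal.toReal_nonneg
  have hφ := orthonormal_unitIndicator hs hd h0
  have hKe : schurNorm p μ M = ENNReal.ofReal K := (ENNReal.ofReal_toReal hK).symm
  have hpinv : p⁻¹ ≠ ⊤ := by
    intro h; rw [ENNReal.inv_eq_top] at h; subst h; simp at hp
  refine abs_le_of_sq_le_sq' (b := K * (√F * D ^ pExp p * S ^ (1 / 2 - pExp p) * β ^ pExp p))
    ?_ (by positivity) |>.2
  by_cases hp2 : p < 2
  · have ht : (1 / 2 : ℝ) ≤ (p⁻¹).toReal := by
      have h1 : (2 : ℝ≥0∞)⁻¹ ≤ p⁻¹ := ENNReal.inv_le_inv.2 hp2.le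
      have := ENNReal.toReal_mono hpinv h1
      simpa using this
    have hpe : pExp p = (p⁻¹).toReal - 1 / 2 := by rw [pExp, abs_of_nonneg (by linarith)]
    obtain ⟨b, hb⟩ := exists_mul_toLp (a := testKernelLp hs α) hM hMb
    have e1 := schattenNorm_finiteRank_le_of_lt_two hp hp2 hφ hv (kernelOp_testKernel hs α)
      hf hα hF0 hD0 hF hD
    have e2 := le_schurNorm_mul hK hb (e1.trans_lt ENNReal.ofReal_lt_top).ne
    have e3 := e2.trans (mul_le_mul_right e1 _)
    rw [hKe, ← ENNReal.ofReal_mul hK0] at e3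
    have e4 := enorm_sum_inner_le_of_lt_two hp hp2 hφ hβ hγ hS0 hS (by positivity) e3
    simp_rw [inner_kernelOp_mul_testKernel hs hd α hb] at e4
    simp_rw [pairTerm, if_pos hp2]
    refine e4.trans (le_of_eq ?_)
    rw [hpe]
    have i1 : S ^ (2 - 2 * (p⁻¹).toReal) = (S ^ (1 / 2 - ((p⁻¹).toReal - 1 / 2))) ^ 2 := by
      rw [← Real.rpow_natCast, ← Real.rpow_mul hS0]; congr 1; push_cast; ring
    have i2 : β ^ (2 * (p⁻¹).toReal - 1) = (β ^ ((p⁻¹).toReal - 1 / 2)) ^ 2 := by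
      rw [← Real.rpow_natCast, ← Real.rpow_mul hβ]; congr 1; push_cast; ring
    rw [i1, i2]; ring
  · push Not at hp2
    have ht : (p⁻¹).toReal ≤ (1 / 2 : ℝ) := by
      have h1 : p⁻¹ ≤ (2 : ℝ≥0∞)⁻¹ := ENNReal.inv_le_inv.2 hp2
      have := ENNReal.toReal_mono (by simp) h1
      simpa using this
    have hpe : pExp p = 1 / 2 - (p⁻¹).toReal := by
      rw [pExp, abs_of_nonpos (by linarith)]; ring
    obtain ⟨b, hb⟩ := exists_mul_toLp (a := testKernelLp hs γ) hM hMb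
    have e1 := schattenNorm_finiteRank_le_of_two_le hp2 hφ (kernelOp_testKernel hs γ) hβ hγ hS0 hS
    have e2 := le_schurNorm_mul hK hb (e1.trans_lt ENNReal.ofReal_lt_top).ne
    have e3 := e2.trans (mul_le_mul_right e1 _)
    rw [hKe, ← ENNReal.ofReal_mul hK0] at e3
    have e4 := enorm_sum_inner_le_of_two_le hp2 hφ hv hf hα hF0 hD0 (by positivity) hF hD e3
    simp_rw [inner_kernelOp_mul_testKernel hs hd γ hb] at e4
    simp_rw [pairTerm, if_neg (not_lt.2 hp2)]
    refine e4.trans (le_of_eq ?_)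
    rw [hpe]
    have i1 : D ^ (1 - 2 * (p⁻¹).toReal) = (D ^ (1 / 2 - (p⁻¹).toReal)) ^ 2 := by
      rw [← Real.rpow_natCast, ← Real.rpow_mul hD0]; congr 1; push_cast; ring
    have i2 : S ^ (1 / 2 - (1 / 2 - (p⁻¹).toReal)) = S ^ (p⁻¹).toReal := by congr 1; ring
    rw [i1, i2]
    have i3 : √F ^ 2 = F := Real.sq_sqrt hF0
    calc _ = (K * (S ^ (p⁻¹).toReal * β ^ (1 / 2 - (p⁻¹).toReal))) ^ 2 *
          (√F ^ 2 * (D ^ (1 / 2 - (p⁻¹).toReal)) ^ 2) := by rw [i3]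
      _ = _ := by ring

end Testing

/-! ### Measure theory on the sphere -/

section Sphere

open scoped Pointwise Topology

variable {d : ℕ}

/-- The inner product of two points of the sphere. -/
def sphInner (x y : Sph d) : ℝ :=
  ⟪(x : EuclideanSpace ℝ (Fin (d + 1))), (y : EuclideanSpace ℝ (Fin (d + 1)))⟫_ℝ

theorem continuous_sphInner : Continuous fun z : Sph d × Sph d => sphInner z.1 z.2 := by
  unfold sphInner; fun_prop

theorem continuous_sphInner_left (x : Sph d) : Continuous (sphInner x) :=
  continuous_sphInner.comp (by fun_prop : Continuous fun y : Sph d => (x, y))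

theorem continuous_sphInner_right (y : Sph d) : Continuous fun x => sphInner x y :=
  continuous_sphInner.comp (by fun_prop : Continuous fun x : Sph d => (x, y))

theorem sphMeasure_apply {s : Set (Sph d)} (hs : MeasurableSet s) :
    sphMeasure d s = (d + 1 : ℕ) * volume {z : EuclideanSpace ℝ (Fin (d + 1)) |
      ∃ r ∈ Set.Ioo (0 : ℝ) 1, ∃ y ∈ s, r • (y : EuclideanSpace ℝ (Fin (d + 1))) = z} := by
  rw [sphMeasure, Measure.toSphere_apply' _ hs, finrank_euclideanSpace_fin]
  congr 2
  ext z
  simp [Set.mem_smul]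

theorem sphMeasure_isometry (L : EuclideanSpace ℝ (Fin (d + 1)) ≃ₗᵢ[ℝ] EuclideanSpace ℝ (Fin (d + 1)))
    {s t : Set (Sph d)} (hs : MeasurableSet s) (ht : MeasurableSet t)
    (h : ∀ x y : Sph d, L x = y → (x ∈ s ↔ y ∈ t)) : sphMeasure d s = sphMeasure d t := by
  rw [sphMeasure_apply hs, sphMeasure_apply ht]
  congr 1
  rw [← (LinearIsometryEquiv.measurePreserving L.symm).measure_preimage_emb
    L.symm.toHomeomorph.measurableEmbedding]
  congr 1
  ext z
  constructor
  · rintro ⟨r, hr, y, hy, hyz⟩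
    refine ⟨r, hr, ⟨L y, by simp⟩, (h y ⟨L y, by simp⟩ rfl).1 hy, ?_⟩
    apply L.symm.injective
    rw [← hyz]
    simp
  · rintro ⟨r, hr, y, hy, rfl⟩
    exact ⟨r, hr, ⟨L.symm y, by simp⟩, (h ⟨L.symm y, by simp⟩ y (by simp)).2 hy, by simp⟩

/-- The distribution of `⟨x, y⟩` for random `y` does not depend on `x`. -/
theorem map_sphInner (x x' : Sph d) :
    (sphMeasure d).map (sphInner x) = (sphMeasure d).map (sphInner x') := by
  ext s hs
  have hm := fun x : Sph d => (continuous_sphInner_left x).measurable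
  rw [Measure.map_apply (hm x) hs, Measure.map_apply (hm x') hs]
  set L := Submodule.reflection (ℝ ∙ ((x : EuclideanSpace ℝ (Fin (d + 1))) - x'))ᗮ
  have hL : L x = x' := Submodule.reflection_sub (by simp)
  refine sphMeasure_isometry L (hm x hs) (hm x' hs) fun y z hyz => ?_
  simp only [Set.mem_preimage, sphInner]
  rw [← hyz, ← hL, L.inner_map_map]

/-- By equality in Cauchy-Schwarz the exceptional points are ± x, so the cone over them lies in a
line, which is a proper subspace of ℝ^{d+1}. -/
theorem measure_sphInner_notMem (hd : 1 ≤ d) (x : Sph d) :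
    sphMeasure d {y | sphInner x y ∉ Set.Ioo (-1 : ℝ) 1} = 0 := by
  have hm : MeasurableSet {y | sphInner x y ∉ Set.Ioo (-1 : ℝ) 1} :=
    ((continuous_sphInner_left x).measurable measurableSet_Ioo).compl
  rw [sphMeasure_apply hm]
  have hx : ‖(x : EuclideanSpace ℝ (Fin (d + 1)))‖ = 1 := by simp
  have hsub : {z : EuclideanSpace ℝ (Fin (d + 1)) | ∃ r ∈ Set.Ioo (0 : ℝ) 1,
      ∃ y ∈ {y | sphInner x y ∉ Set.Ioo (-1 : ℝ) 1}, r • (y : EuclideanSpace ℝ (Fin (d + 1))) = z}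
      ⊆ (ℝ ∙ (x : EuclideanSpace ℝ (Fin (d + 1))) : Submodule ℝ _) := by
    rintro z ⟨r, -, y, hy, rfl⟩
    have hy1 : ‖(y : EuclideanSpace ℝ (Fin (d + 1)))‖ = 1 := by simp
    refine Submodule.smul_mem _ _ ?_
    have habs : |sphInner x y| ≤ 1 := by
      have := abs_real_inner_le_norm (x : EuclideanSpace ℝ (Fin (d + 1))) y
      rwa [hx, hy1, mul_one] at this
    rw [Set.mem_ofPred_eq, Set.mem_Ioo, not_and_or, not_lt, not_lt] at hy
    rw [abs_le] at habs
    rcases hy with hy | hy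
    · have h : sphInner x y = -1 := le_antisymm hy habs.1
      have := (inner_eq_neg_one_iff_of_norm_eq_one (𝕜 := ℝ) hx hy1).1 h
      exact Submodule.mem_span_singleton.2 ⟨-1, by simp [this]⟩
    · have h : sphInner x y = 1 := le_antisymm habs.2 hy
      have := (inner_eq_one_iff_of_norm_eq_one (𝕜 := ℝ) hx hy1).1 h
      exact Submodule.mem_span_singleton.2 ⟨1, by rw [one_smul, this]⟩
  rw [measure_mono_null hsub, mul_zero]
  refine Measure.addHaar_submodule _ _ fun h => ?_
  have h1 := finrank_span_singleton (K := ℝ) (v := (x : EuclideanSpace ℝ (Fin (d + 1))))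
    (norm_ne_zero_iff.1 (by rw [hx]; norm_num))
  rw [h, finrank_top, finrank_euclideanSpace_fin] at h1
  omega

theorem sphMeasure_singleton (hd : 1 ≤ d) (x : Sph d) : sphMeasure d {x} = 0 := by
  refine measure_mono_null ?_ (measure_sphInner_notMem hd x)
  rintro y rfl
  simp [sphInner]

instance : (sphMeasure d).IsOpenPosMeasure := by unfold sphMeasure; infer_instance

theorem infinite_of_isOpen (hd : 1 ≤ d) {U : Set (Sph d)} (hU : IsOpen U) (hne : U.Nonempty) :
    U.Infinite := by
  intro hfin
  refine hU.measure_ne_zero (sphMeasure d) hne ?_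
  rw [← Set.biUnion_of_singleton U, measure_biUnion_null_iff hfin.countable]
  exact fun x _ => sphMeasure_singleton hd x

/-- Hall's marriage theorem, applied to subsets of cardinality |C|: even a single one of them is
large enough for any set of indices. -/
theorem exists_injective_mem_of_infinite {C X : Type*} [Fintype C] {U : C → Set X}
    (h : ∀ c, (U c).Infinite) : ∃ x : C → X, Function.Injective x ∧ ∀ c, x c ∈ U c := by
  classical
  choose t ht1 ht2 using fun c => (h c).exists_subset_card_eq (Fintype.card C)
  obtain ⟨x, hx1, hx2⟩ := (Finset.all_card_le_biUnion_card_iff_exists_injective t).1 (by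
    intro s
    rcases s.eq_empty_or_nonempty with rfl | ⟨c, hc⟩
    · simp
    · calc s.card ≤ Fintype.card C := Finset.card_le_univ s
        _ = (t c).card := (ht2 c).symm
        _ ≤ _ := Finset.card_le_card (Finset.subset_biUnion_of_mem t hc))
  exact ⟨x, hx1, fun c => ht1 c (hx2 c)⟩

/-- Finitely many points of the sphere have pairwise disjoint small open perturbations. -/
theorem exists_disjoint_isOpen (hd : 1 ≤ d) {C : Type*} [Fintype C] {U : C → Set (Sph d)}
    (hU : ∀ c, IsOpen (U c)) (hne : ∀ c, (U c).Nonempty) :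
    ∃ s : C → Set (Sph d), (∀ c, IsOpen (s c)) ∧ (∀ c, (s c).Nonempty) ∧ (∀ c, s c ⊆ U c) ∧
      Pairwise fun c c' => Disjoint (s c) (s c') := by
  obtain ⟨x, hx, hxU⟩ := exists_injective_mem_of_infinite
    fun c => infinite_of_isOpen hd (hU c) (hne c)
  obtain ⟨V, hV, hVd⟩ := (Set.finite_range x).t2_separation
  refine ⟨fun c => V (x c) ∩ U c, fun c => (hV _).2.inter (hU c), fun c => ⟨x c, (hV _).1, hxU c⟩,
    fun c => Set.inter_subset_right, fun c c' h => ?_⟩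
  exact (hVd ⟨c, rfl⟩ ⟨c', rfl⟩ (hx.ne h)).mono Set.inter_subset_left Set.inter_subset_left

/-- `x ↦ ∫ m(⟨x, y⟩) k(y) dy` is continuous, even though `m` is only measurable. -/
theorem continuous_integral_sphInner {m : ℝ → ℂ} (hm : Measurable m) {Mb : ℝ}
    (hMb : ∀ t, ‖m t‖ ≤ Mb) {k : Sph d → ℂ} (hk : Integrable k (sphMeasure d)) :
    Continuous fun x => ∫ y, m (sphInner x y) * k y ∂(sphMeasure d) := by
  set μ := sphMeasure d
  have hMb0 : 0 ≤ Mb := (norm_nonneg _).trans (hMb 0)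
  have hmeas : ∀ x, Measurable (sphInner (d := d) x) := fun x => (continuous_sphInner_left x).measurable
  have step : ∀ ε > 0, ∃ F : Sph d → ℂ, Continuous F ∧
      ∀ x, dist (∫ y, m (sphInner x y) * k y ∂μ) (F x) < ε := by
    intro ε hε
    obtain ⟨g, hg1, hg2⟩ := hk.exists_boundedContinuous_integral_sub_le
      (ε := ε / (4 * (Mb + 1))) (by positivity)
    have hgb : ∀ y, ‖g y‖ ≤ ‖g‖ := g.norm_coe_le_norm
    set x₀ : Sph d := ⟨EuclideanSpace.single 0 1, by simp⟩
    -- The symbol is approximated in L¹ of the law of ⟨x₀, y⟩. This law does not depend on the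
    -- point, so the approximation is uniform in x.
    have hmi : Integrable m (μ.map (sphInner x₀)) :=
      Integrable.of_bound hm.aestronglyMeasurable Mb (Filter.Eventually.of_forall hMb)
    obtain ⟨q, hq1, hq2⟩ := hmi.exists_boundedContinuous_integral_sub_le
      (ε := ε / (4 * (‖g‖ + 1))) (by positivity)
    have hqb : ∀ y, ‖q y‖ ≤ ‖q‖ := q.norm_coe_le_norm
    refine ⟨fun x => ∫ y, q (sphInner x y) * g y ∂μ, ?_, fun x => ?_⟩
    · refine continuous_of_dominated (bound := fun _ => ‖q‖ * ‖g‖) ?_ ?_ (integrable_const _) ?_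
      · exact fun x => ((q.continuous.comp (continuous_sphInner_left x)).mul
          g.continuous).aestronglyMeasurable
      · refine fun x => Filter.Eventually.of_forall fun y => ?_
        rw [norm_mul]; gcongr <;> simp [hqb, hgb]
      · refine Filter.Eventually.of_forall fun y => ?_
        exact (q.continuous.comp (continuous_sphInner_right y)).mul continuous_const
    · have mm : ∀ x, AEStronglyMeasurable (fun y => m (sphInner x y)) μ := fun x =>
        (hm.comp (hmeas x)).aestronglyMeasurable
      have mq : ∀ x, AEStronglyMeasurable (fun y => q (sphInner x y)) μ := fun x =>
        (q.continuous.comp (continuous_sphInner_left x)).aestronglyMeasurable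
      have i1 : Integrable (fun y => m (sphInner x y) * k y) μ :=
        hk.bdd_mul (mm x) (Filter.Eventually.of_forall fun y => hMb _)
      have i3 : Integrable (fun y => q (sphInner x y) * g y) μ :=
        hg2.bdd_mul (mq x) (Filter.Eventually.of_forall fun y => hqb _)
      have i4 : Integrable (fun y => m (sphInner x y) - q (sphInner x y)) μ :=
        Integrable.of_bound ((mm x).sub (mq x)) (Mb + ‖q‖) (Filter.Eventually.of_forall fun y =>
          (norm_sub_le _ _).trans (add_le_add (hMb _) (hqb _)))
      have i5 : Integrable (fun y => k y - g y) μ := hk.sub hg2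
      rw [dist_eq_norm, ← integral_sub i1 i3]
      have hkey : ∫ y, ‖m (sphInner x y) - q (sphInner x y)‖ ∂μ ≤ ε / (4 * (‖g‖ + 1)) := by
        have := integral_map (μ := μ) (φ := sphInner x) (f := fun t => ‖m t - q t‖)
          (hmeas x).aemeasurable
          ((hm.aestronglyMeasurable.sub q.continuous.measurable.aestronglyMeasurable).norm)
        rw [← this, map_sphInner x x₀]
        exact hq1
      calc _ ≤ ∫ y, (Mb * ‖k y - g y‖ + ‖g‖ * ‖m (sphInner x y) - q (sphInner x y)‖) ∂μ := by
            refine norm_integral_le_of_norm_le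
              (((hk.sub hg2).norm.const_mul _).add (i4.norm.const_mul _))
              (Filter.Eventually.of_forall fun y => ?_)
            have : m (sphInner x y) * k y - q (sphInner x y) * g y =
              m (sphInner x y) * (k y - g y) + (m (sphInner x y) - q (sphInner x y)) * g y := by
              ring
            simp only [this]
            refine (norm_add_le _ _).trans (add_le_add ?_ ?_)
            · rw [norm_mul]; gcongr; exact hMb _
            · rw [norm_mul, mul_comm]; gcongr; exact hgb _
        _ = Mb * ∫ y, ‖k y - g y‖ ∂μ + ‖g‖ * ∫ y, ‖m (sphInner x y) - q (sphInner x y)‖ ∂μ := by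
            rw [integral_add (i5.norm.const_mul _) (i4.norm.const_mul _),
              integral_const_mul, integral_const_mul]
        _ ≤ Mb * (ε / (4 * (Mb + 1))) + ‖g‖ * (ε / (4 * (‖g‖ + 1))) := by gcongr
        _ ≤ ε / 4 + ε / 4 := by
            gcongr
            · rw [mul_div_assoc', div_le_div_iff₀ (by positivity) (by norm_num)]
              nlinarith
            · rw [mul_div_assoc', div_le_div_iff₀ (by positivity) (by norm_num)]
              nlinarith [norm_nonneg g]
        _ < ε := by linarith
  refine continuous_of_uniform_approx_of_continuous fun u hu => ?_
  obtain ⟨ε, hε, hεu⟩ := Metric.mem_uniformity_dist.1 hu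
  obtain ⟨F, hF, hF'⟩ := step ε hε
  exact ⟨F, hF, fun x => hεu (hF' x)⟩

end Sphere

/-! ### Schur multipliers on the sphere, tested at points -/

section Points

open scoped Topology

variable {d : ℕ} {Ξ : Type*} [MeasurableSpace Ξ] {τ : Measure Ξ}

theorem integrable_conj_mul {X : Type*} [MeasurableSpace X] {μ : Measure X} (a g : Lp ℂ 2 μ) :
    Integrable (fun y => starRingEnd ℂ (a y) * g y) μ := by
  refine (L2.integrable_inner (𝕜 := ℂ) a g).congr (Filter.Eventually.of_forall fun y => ?_)
  simp [mul_comm]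

theorem integrable_pairTerm {X : Type*} [MeasurableSpace X] {μ : Measure X} (p : ℝ≥0∞)
    (a g : Lp ℂ 2 μ) : Integrable (fun y => pairTerm p (a y) (g y)) μ := by
  unfold pairTerm
  split_ifs
  · exact integrable_conj_mul a g
  · exact integrable_conj_mul g a

instance : TopologicalSpace.SeparableSpace (Lp ℂ 2 (sphMeasure d)) :=
  have : SecondCountableTopology (Lp ℂ 2 (sphMeasure d)) := Lp.SecondCountableTopology
  inferInstance

/-- Averages over small sets become values at points, because each inner integral is continuous in
x. The sets are disjoint open subsets of prescribed neighbourhoods, so the points x_c may even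
coincide. -/
theorem norm_sum_integral_sphInner_le (hd : 1 ≤ d) {p : ℝ≥0∞} (hp : 1 ≤ p) {m : ℝ → ℂ}
    (hm : Measurable m) {Mb : ℝ} (hMb : ∀ z, ‖m z‖ ≤ Mb) (hK : sphSchurNorm d p m ≠ ⊤)
    {C : Type*} [Fintype C] (x : C → Sph d)
    {v : Ξ → Lp ℂ 2 (sphMeasure d)} {f : C → Ξ → ℂ} {α γ : C → Lp ℂ 2 (sphMeasure d)}
    (hv : IsBessel τ v 1) (hf : ∀ c, AEMeasurable (f c) τ)
    (hα : ∀ u c, ⟪u, α c⟫_ℂ = ∫ ξ, f c ξ * ⟪u, v ξ⟫_ℂ ∂τ) {F D β S : ℝ} (hF0 : 0 ≤ F) (hD0 : 0 ≤ D)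
    (hβ : 0 ≤ β) (hS0 : 0 ≤ S)
    (hF : ∑ c, ∫⁻ ξ, ‖f c ξ‖ₑ ^ 2 ∂τ ≤ ENNReal.ofReal F)
    (hD : ∫⁻ ξ, ‖v ξ‖ₑ ^ 2 ∂τ ≤ ENNReal.ofReal D)
    (hγ : ∀ u, ∑ c, ‖⟪u, γ c⟫_ℂ‖ₑ ^ 2 ≤ ENNReal.ofReal β * ‖u‖ₑ ^ 2)
    (hS : ∑ c, ‖γ c‖ₑ ^ 2 ≤ ENNReal.ofReal S) :
    ‖∑ c, ∫ y, m (sphInner (x c) y) * pairTerm p (α c y) (γ c y) ∂(sphMeasure d)‖ ≤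
      (sphSchurNorm d p m).toReal *
        (√F * D ^ pExp p * S ^ (1 / 2 - pExp p) * β ^ pExp p) := by
  let μ := sphMeasure d
  set R := (sphSchurNorm d p m).toReal * (√F * D ^ pExp p * S ^ (1 / 2 - pExp p) * β ^ pExp p)
  set Φ : C → Sph d → ℂ := fun c x => ∫ y, m (sphInner x y) * pairTerm p (α c y) (γ c y) ∂μ
  have hΦ : ∀ c, Continuous (Φ c) := fun c =>
    continuous_integral_sphInner hm hMb (integrable_pairTerm p (α c) (γ c))
  refine le_of_forall_pos_le_add fun ε hε => ?_
  set η := ε / (Fintype.card C + 1) with hη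
  have hη0 : 0 < η := by positivity
  obtain ⟨s, hs1, hs2, hs3, hs4⟩ := exists_disjoint_isOpen hd
    (U := fun c => {x' | dist (Φ c x') (Φ c (x c)) < η})
    (fun c => isOpen_lt ((hΦ c).dist continuous_const) continuous_const)
    (fun c => ⟨x c, by simpa using hη0⟩)
  have hpos : ∀ c, μ (s c) ≠ 0 := fun c => (hs1 c).measure_ne_zero μ (hs2 c)
  have main := norm_sum_average_le hp (μ := μ)
    (M := fun z : Sph d × Sph d => m (sphInner z.1 z.2))
    (hm.comp continuous_sphInner.measurable).aestronglyMeasurable (fun z => hMb _) hK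
    (fun c => (hs1 c).measurableSet) hs4 hpos hv hf hα hF0 hD0 hβ hS0 hF hD hγ hS
  have hclose : ∀ c, ‖Φ c (x c) - ∫ x' in s c, (((μ.real (s c))⁻¹ : ℝ) : ℂ) * Φ c x' ∂μ‖ ≤ η := by
    intro c
    have hr : 0 < μ.real (s c) := ENNReal.toReal_pos (hpos c) (measure_ne_top _ _)
    have hbd : ∃ B, ∀ x', ‖Φ c x'‖ ≤ B :=
      (isCompact_univ.exists_bound_of_continuousOn (hΦ c).continuousOn).imp
        fun B hB x' => hB x' trivial
    obtain ⟨B, hB⟩ := hbd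
    have hi : Integrable (Φ c) (μ.restrict (s c)) :=
      Integrable.of_bound (hΦ c).aestronglyMeasurable B (Filter.Eventually.of_forall hB)
    have e1 : Φ c (x c) = ∫ x' in s c, (((μ.real (s c))⁻¹ : ℝ) : ℂ) * Φ c (x c) ∂μ := by
      rw [setIntegral_const, Complex.real_smul, ← mul_assoc, ← Complex.ofReal_mul,
        mul_inv_cancel₀ hr.ne', Complex.ofReal_one, one_mul]
    rw [e1, ← integral_sub (integrable_const _) (hi.const_mul _)]
    have e2 := norm_setIntegral_le_of_norm_le_const (μ := μ) (s := s c)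
      (f := fun x' => (((μ.real (s c))⁻¹ : ℝ) : ℂ) * Φ c (x c) -
        (((μ.real (s c))⁻¹ : ℝ) : ℂ) * Φ c x') (C := (μ.real (s c))⁻¹ * η)
      (measure_lt_top _ _) (fun x' hx' => by
        rw [← mul_sub, norm_mul, Complex.norm_real, Real.norm_of_nonneg (by positivity)]
        gcongr
        rw [← dist_eq_norm, dist_comm]
        exact (hs3 c hx').le)
    refine e2.trans (le_of_eq ?_)
    field_simp
  have hsum : ‖∑ c, Φ c (x c) - ∑ c, ∫ x' in s c, (((μ.real (s c))⁻¹ : ℝ) : ℂ) * Φ c x' ∂μ‖ ≤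
      ε := by
    rw [← Finset.sum_sub_distrib]
    calc _ ≤ ∑ c : C, η := norm_sum_le_of_le _ fun c _ => hclose c
      _ = Fintype.card C * η := by simp
      _ ≤ ε := by
          rw [hη, mul_div_assoc', div_le_iff₀ (by positivity)]
          nlinarith
  calc _ ≤ _ + _ := norm_le_norm_add_norm_sub' _ _
    _ ≤ R + ε := add_le_add main hsum

end Points

/-! ### Transport of `L²` spaces under a chart -/

section Transport

variable {X Y : Type*} [MeasurableSpace X] [MeasurableSpace Y] {μ : Measure X} {ν : Measure Y}
  [IsFiniteMeasure μ] [IsFiniteMeasure ν] {κ : Y → X} {π : X → Y}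

/-- Composition with π need not respect null sets of ν; it does where the density of the image
measure is nonzero, and elsewhere the transported functions vanish. -/
theorem ae_of_ae_comp (hκ : Measurable κ) (hπ : Measurable π) (hπκ : ∀ᵐ h ∂ν, π (κ h) = h)
    (hac : ν.map κ ≪ μ) {P : Y → Prop} (hP : ∀ᵐ h ∂ν, P h) :
    ∀ᵐ x ∂μ, ((ν.map κ).rnDeriv μ x).toReal ≠ 0 → P (π x) := by
  obtain ⟨N, hN1, hN2, hN3⟩ := exists_measurable_superset_of_null (ae_iff.1 hP)
  have h1 : ∀ᵐ x ∂(ν.map κ), π x ∉ N := by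
    refine (ae_map_iff hκ.aemeasurable (p := fun x => π x ∉ N) (hπ hN2).compl).2 ?_
    have h2 : ∀ᵐ h ∂ν, h ∉ N := measure_eq_zero_iff_ae_notMem.1 hN3
    filter_upwards [hπκ, h2] with h hh hh'
    rwa [hh]
  rw [← Measure.withDensity_rnDeriv_eq _ _ hac,
    ae_withDensity_iff (Measure.measurable_rnDeriv _ _)] at h1
  filter_upwards [h1] with x hx hx0
  by_contra hc
  exact hx (fun h => hx0 (by simp [h])) (hN1 hc)

theorem lintegral_transport (hκ : Measurable κ)
    (hac : ν.map κ ≪ μ) {F : X → ℝ≥0∞} (hF : Measurable F) :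
    ∫⁻ x, (ν.map κ).rnDeriv μ x * F x ∂μ = ∫⁻ h, F (κ h) ∂ν := by
  rw [lintegral_rnDeriv_mul hac hF.aemeasurable, lintegral_map hF hκ]

theorem eLpNorm_transport (hκ : Measurable κ) (hπ : Measurable π) (hπκ : ∀ᵐ h ∂ν, π (κ h) = h)
    (hac : ν.map κ ≪ μ) (f : Lp ℂ 2 ν) :
    eLpNorm (fun x => ((√((ν.map κ).rnDeriv μ x).toReal : ℝ) : ℂ) * f (π x)) 2 μ =
      eLpNorm f 2 ν := by
  rw [eLpNorm_eq_lintegral_rpow_enorm_toReal (by simp) (by simp),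
    eLpNorm_eq_lintegral_rpow_enorm_toReal (by simp) (by simp)]
  congr 1
  have h1 : Measurable fun x => ‖f (π x)‖ₑ ^ (2 : ℝ≥0∞).toReal :=
    (((Lp.stronglyMeasurable f).measurable.comp hπ).enorm).pow_const _
  have h2 : ∫⁻ x, (ν.map κ).rnDeriv μ x * ‖f (π x)‖ₑ ^ (2 : ℝ≥0∞).toReal ∂μ =
      ∫⁻ h, ‖f h‖ₑ ^ (2 : ℝ≥0∞).toReal ∂ν := by
    rw [lintegral_transport hκ hac h1]
    refine lintegral_congr_ae ?_
    filter_upwards [hπκ] with h hh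
    rw [hh]
  rw [← h2]
  refine lintegral_congr_ae ?_
  filter_upwards [Measure.rnDeriv_lt_top (ν.map κ) μ] with x hx
  rw [enorm_mul, ENNReal.mul_rpow_of_nonneg _ _ (by simp)]
  congr 1
  rw [← ofReal_norm, Complex.norm_real, Real.norm_of_nonneg (Real.sqrt_nonneg _),
    ENNReal.toReal_ofNat, ENNReal.rpow_ofNat, ← ENNReal.ofReal_pow (Real.sqrt_nonneg _),
    Real.sq_sqrt ENNReal.toReal_nonneg, ENNReal.ofReal_toReal hx.ne]

theorem memLp_transport (hκ : Measurable κ) (hπ : Measurable π) (hπκ : ∀ᵐ h ∂ν, π (κ h) = h)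
    (hac : ν.map κ ≪ μ) (f : Lp ℂ 2 ν) :
    MemLp (fun x => ((√((ν.map κ).rnDeriv μ x).toReal : ℝ) : ℂ) * f (π x)) 2 μ := by
  refine ⟨?_, ?_⟩
  · refine Measurable.aestronglyMeasurable ?_
    have := (Lp.stronglyMeasurable f).measurable
    have := Measure.measurable_rnDeriv (ν.map κ) μ
    fun_prop
  · rw [eLpNorm_transport hκ hπ hπκ hac f]
    exact (Lp.memLp f).2

/-- The isometry `L²(ν) → L²(μ)` induced by a chart `κ` with `ν.map κ ≪ μ`. -/
def transport (hκ : Measurable κ) (hπ : Measurable π) (hπκ : ∀ᵐ h ∂ν, π (κ h) = h)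
    (hac : ν.map κ ≪ μ) : Lp ℂ 2 ν →ₗᵢ[ℂ] Lp ℂ 2 μ where
  toFun f := (memLp_transport hκ hπ hπκ hac f).toLp _
  map_add' f g := by
    rw [← MemLp.toLp_add, MemLp.toLp_eq_toLp_iff]
    filter_upwards [ae_of_ae_comp hκ hπ hπκ hac (Lp.coeFn_add f g)] with x hx
    rw [Pi.add_apply]
    by_cases h0 : ((ν.map κ).rnDeriv μ x).toReal = 0
    · simp [h0]
    · rw [hx h0, Pi.add_apply, mul_add]
  map_smul' c f := by
    rw [RingHom.id_apply, ← MemLp.toLp_const_smul, MemLp.toLp_eq_toLp_iff]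
    filter_upwards [ae_of_ae_comp hκ hπ hπκ hac (Lp.coeFn_smul c f)] with x hx
    rw [Pi.smul_apply]
    by_cases h0 : ((ν.map κ).rnDeriv μ x).toReal = 0
    · simp [h0]
    · rw [hx h0, Pi.smul_apply, smul_eq_mul, smul_eq_mul]; ring
  norm_map' f := by
    simp only [LinearMap.coe_mk, AddHom.coe_mk]
    rw [Lp.norm_toLp, eLpNorm_transport hκ hπ hπκ hac f]
    rfl

theorem transport_coe (hκ : Measurable κ) (hπ : Measurable π) (hπκ : ∀ᵐ h ∂ν, π (κ h) = h)
    (hac : ν.map κ ≪ μ) (f : Lp ℂ 2 ν) : transport hκ hπ hπκ hac f =ᵐ[μ]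
      fun x => ((√((ν.map κ).rnDeriv μ x).toReal : ℝ) : ℂ) * f (π x) :=
  MemLp.coeFn_toLp (memLp_transport hκ hπ hπκ hac f)

theorem integral_transport (hκ : Measurable κ) (hπ : Measurable π) (hπκ : ∀ᵐ h ∂ν, π (κ h) = h)
    (hac : ν.map κ ≪ μ) (f g : Lp ℂ 2 ν) {F : X → ℂ} (hF : Measurable F) :
    ∫ x, F x * (starRingEnd ℂ (transport hκ hπ hπκ hac f x) * transport hκ hπ hπκ hac g x) ∂μ =
      ∫ h, F (κ h) * (starRingEnd ℂ (f h) * g h) ∂ν := by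
  have h1 : ∫ x, F x * (starRingEnd ℂ (transport hκ hπ hπκ hac f x) *
      transport hκ hπ hπκ hac g x) ∂μ = ∫ x, ((ν.map κ).rnDeriv μ x).toReal •
        (F x * (starRingEnd ℂ (f (π x)) * g (π x))) ∂μ := by
    refine integral_congr_ae ?_
    filter_upwards [transport_coe hκ hπ hπκ hac f, transport_coe hκ hπ hπκ hac g] with x hx hx'
    rw [hx, hx', map_mul, Complex.conj_ofReal, Complex.real_smul]
    have : (((ν.map κ).rnDeriv μ x).toReal : ℂ) =
        ((√((ν.map κ).rnDeriv μ x).toReal : ℝ) : ℂ) * ((√((ν.map κ).rnDeriv μ x).toReal : ℝ) : ℂ) := by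
      rw [← Complex.ofReal_mul, Real.mul_self_sqrt ENNReal.toReal_nonneg]
    rw [this]; ring
  have hf := (Lp.stronglyMeasurable f).measurable
  have hg := (Lp.stronglyMeasurable g).measurable
  have hc : Measurable (starRingEnd ℂ : ℂ → ℂ) := RCLike.continuous_conj.measurable
  rw [h1, integral_rnDeriv_smul hac, integral_map hκ.aemeasurable]
  · refine integral_congr_ae ?_
    filter_upwards [hπκ] with h hh
    rw [hh]
  · exact (hF.mul ((hc.comp (hf.comp hπ)).mul (hg.comp hπ))).aestronglyMeasurable

end Transport

/-! ### Testing a multiplier in a chart of the sphere. -/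

section PointsChart

variable {d : ℕ} {Ξ : Type*} [MeasurableSpace Ξ] {τ : Measure Ξ}
  {Y : Type*} [MeasurableSpace Y] {ν : Measure Y} [IsFiniteMeasure ν] {κ : Y → Sph d}
  {π : Sph d → Y}

/-- The transport map is isometric and its adjoint is a contraction, so norms and Bessel bounds
survive. The two square roots of the density multiply to the density, which turns the integral on
the sphere into one in the chart. -/
theorem norm_sum_integral_chart_le (hd : 1 ≤ d) {p : ℝ≥0∞} (hp : 1 ≤ p) {m : ℝ → ℂ}
    (hm : Measurable m) {Mb : ℝ} (hMb : ∀ z, ‖m z‖ ≤ Mb) (hK : sphSchurNorm d p m ≠ ⊤)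
    (hκ : Measurable κ) (hπ : Measurable π) (hπκ : ∀ᵐ h ∂ν, π (κ h) = h)
    (hac : ν.map κ ≪ sphMeasure d) {C : Type*} [Fintype C] (x : C → Sph d)
    {v : Ξ → Lp ℂ 2 ν} {f : C → Ξ → ℂ} {α γ : C → Lp ℂ 2 ν}
    (hv : IsBessel τ v 1) (hf : ∀ c, AEMeasurable (f c) τ)
    (hα : ∀ u c, ⟪u, α c⟫_ℂ = ∫ ξ, f c ξ * ⟪u, v ξ⟫_ℂ ∂τ) {F D β S : ℝ} (hF0 : 0 ≤ F) (hD0 : 0 ≤ D)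
    (hβ : 0 ≤ β) (hS0 : 0 ≤ S)
    (hF : ∑ c, ∫⁻ ξ, ‖f c ξ‖ₑ ^ 2 ∂τ ≤ ENNReal.ofReal F)
    (hD : ∫⁻ ξ, ‖v ξ‖ₑ ^ 2 ∂τ ≤ ENNReal.ofReal D)
    (hγ : ∀ u, ∑ c, ‖⟪u, γ c⟫_ℂ‖ₑ ^ 2 ≤ ENNReal.ofReal β * ‖u‖ₑ ^ 2)
    (hS : ∑ c, ‖γ c‖ₑ ^ 2 ≤ ENNReal.ofReal S) :
    ‖∑ c, ∫ h, m (sphInner (x c) (κ h)) * pairTerm p (α c h) (γ c h) ∂ν‖ ≤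
      (sphSchurNorm d p m).toReal *
        (√F * D ^ pExp p * S ^ (1 / 2 - pExp p) * β ^ pExp p) := by
  set V := transport hκ hπ hπκ hac
  set W := ContinuousLinearMap.adjoint V.toContinuousLinearMap
  have hW : ∀ u v, ⟪u, V v⟫_ℂ = ⟪W u, v⟫_ℂ := fun u v =>
    (ContinuousLinearMap.adjoint_inner_left V.toContinuousLinearMap v u).symm
  have hWn : ∀ u, ‖W u‖ₑ ≤ ‖u‖ₑ := fun u => by
    rw [enorm_le_iff_norm_le]
    calc ‖W u‖ ≤ ‖W‖ * ‖u‖ := W.le_opNorm u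
      _ ≤ 1 * ‖u‖ := by
          gcongr
          rw [LinearIsometryEquiv.norm_map]
          exact V.norm_toContinuousLinearMap_le
      _ = ‖u‖ := one_mul _
  have hVn : ∀ f, ‖V f‖ₑ = ‖f‖ₑ := fun f => by
    rw [← ofReal_norm, ← ofReal_norm, V.norm_map]
  have main := norm_sum_integral_sphInner_le hd hp hm hMb hK x
    (v := fun ξ => V (v ξ)) (f := f) (α := fun c => V (α c)) (γ := fun c => V (γ c)) (τ := τ)
    ⟨fun u => by simpa only [hW] using hv.meas (W u), fun u => by
      simp only [hW]
      refine (hv.bound (W u)).trans ?_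
      gcongr
      exact hWn u⟩ hf (fun u c => by simp only [hW]; exact hα _ _) hF0 hD0 hβ hS0 hF
    (by simpa only [hVn] using hD) (fun u => by
      simp only [hW]
      refine (hγ (W u)).trans ?_
      gcongr
      exact hWn u) (by simpa only [hVn] using hS)
  refine le_trans (le_of_eq ?_) main
  congr 1
  refine Finset.sum_congr rfl fun c _ => ?_
  have hF : Measurable fun y => m (sphInner (x c) y) :=
    hm.comp (continuous_sphInner_left (x c)).measurable
  unfold pairTerm
  split_ifs
  · exact (integral_transport hκ hπ hπκ hac (α c) (γ c) hF).symm
  · exact (integral_transport hκ hπ hπκ hac (γ c) (α c) hF).symm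

end PointsChart

/-! ### The orthographic chart of the sphere -/

section Chart

open scoped Topology

variable {d : ℕ}

/-- The isomorphism `ℝ × ℝ^d → ℝ^{d+1}`. -/
def consVec (t : ℝ) (h : EuclideanSpace ℝ (Fin d)) : EuclideanSpace ℝ (Fin (d + 1)) :=
  WithLp.toLp 2 (Fin.cons t h.ofLp : Fin (d + 1) → ℝ)

/-- The last `d` coordinates. -/
def tailVec (x : EuclideanSpace ℝ (Fin (d + 1))) : EuclideanSpace ℝ (Fin d) :=
  WithLp.toLp 2 (fun i => x i.succ)

theorem tailVec_consVec (t : ℝ) (h : EuclideanSpace ℝ (Fin d)) : tailVec (consVec t h) = h := by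
  ext i; simp [tailVec, consVec]

theorem continuous_tailVec : Continuous (tailVec (d := d)) := by
  unfold tailVec; fun_prop

theorem smul_consVec (r t : ℝ) (h : EuclideanSpace ℝ (Fin d)) :
    r • consVec t h = consVec (r * t) (r • h) := by
  ext i
  refine Fin.cases ?_ (fun j => ?_) i <;> simp [consVec]

theorem inner_consVec (s t : ℝ) (g h : EuclideanSpace ℝ (Fin d)) :
    ⟪consVec s g, consVec t h⟫_ℝ = s * t + ⟪g, h⟫_ℝ := by
  simp [consVec, PiLp.inner_apply, Fin.sum_univ_succ, mul_comm]

theorem norm_consVec_sq (t : ℝ) (h : EuclideanSpace ℝ (Fin d)) :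
    ‖consVec t h‖ ^ 2 = t ^ 2 + ‖h‖ ^ 2 := by
  rw [← real_inner_self_eq_norm_sq, inner_consVec, real_inner_self_eq_norm_sq, ← sq]

theorem continuous_consVec :
    Continuous fun z : ℝ × EuclideanSpace ℝ (Fin d) => consVec z.1 z.2 := by
  unfold consVec
  refine (PiLp.continuous_toLp 2 _).comp (continuous_pi fun i => ?_)
  refine Fin.cases ?_ (fun j => ?_) i
  · simpa using continuous_fst
  · simp only [Fin.cons_succ]
    fun_prop

theorem measurePreserving_consVec :
    MeasurePreserving (fun z : ℝ × EuclideanSpace ℝ (Fin d) => consVec z.1 z.2) := by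
  have h1 := (volume_preserving_piFinSuccAbove (fun _ : Fin (d + 1) => ℝ) 0).symm
  have h2 := EuclideanSpace.volume_preserving_symm_measurableEquiv_toLp (Fin (d + 1))
  have h3 := EuclideanSpace.volume_preserving_symm_measurableEquiv_toLp (Fin d)
  have h4 := (MeasurePreserving.id (volume : Measure ℝ)).prod h3
  have h5 := (h2.symm.comp h1).comp h4
  change MeasurePreserving _ (volume.prod volume) _
  convert h5 using 1
  ext z i
  refine Fin.cases ?_ (fun j => ?_) i <;> simp [consVec]

/-- Restriction to the closed unit ball. -/
def ballProj (g : EuclideanSpace ℝ (Fin d)) : EuclideanSpace ℝ (Fin d) := (max 1 ‖g‖)⁻¹ • g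

theorem norm_ballProj_le (g : EuclideanSpace ℝ (Fin d)) : ‖ballProj g‖ ≤ 1 := by
  have : (0 : ℝ) < max 1 ‖g‖ := lt_max_of_lt_left one_pos
  rw [ballProj, norm_smul, norm_inv, Real.norm_of_nonneg this.le, inv_mul_le_iff₀ this, mul_one]
  exact le_max_right _ _

theorem ballProj_of_le {g : EuclideanSpace ℝ (Fin d)} (hg : ‖g‖ ≤ 1) : ballProj g = g := by
  rw [ballProj, max_eq_left hg, inv_one, one_smul]

theorem continuous_ballProj : Continuous (ballProj (d := d)) := by
  unfold ballProj
  refine Continuous.smul (Continuous.inv₀ (continuous_const.max continuous_norm) fun g => ?_)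
    continuous_id
  exact (lt_max_of_lt_left one_pos).ne'

/-- The orthographic chart, at scale `l`. -/
def chart (l : ℝ) (h : EuclideanSpace ℝ (Fin d)) : Sph d :=
  ⟨consVec (√(1 - ‖ballProj (l⁻¹ • h)‖ ^ 2)) (ballProj (l⁻¹ • h)), by
    rw [mem_sphere_zero_iff_norm, ← sq_eq_sq₀ (norm_nonneg _) zero_le_one, norm_consVec_sq,
      Real.sq_sqrt (sub_nonneg.2 (pow_le_one₀ (norm_nonneg _) (norm_ballProj_le _)))]
    ring⟩

/-- The inverse of `chart`. -/
def chartInv (l : ℝ) (x : Sph d) : EuclideanSpace ℝ (Fin d) := l • tailVec x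

theorem continuous_chart (l : ℝ) : Continuous (chart (d := d) l) := by
  unfold chart
  refine Continuous.subtype_mk ?_ _
  have h1 : Continuous fun h : EuclideanSpace ℝ (Fin d) => ballProj (l⁻¹ • h) :=
    continuous_ballProj.comp (by fun_prop)
  exact continuous_consVec.comp (Continuous.prodMk (by fun_prop) h1)

theorem continuous_chartInv (l : ℝ) : Continuous (chartInv (d := d) l) := by
  unfold chartInv
  exact (continuous_tailVec.comp continuous_subtype_val).const_smul l

theorem norm_inv_smul_lt {l : ℝ} (hl : 0 < l) {h : EuclideanSpace ℝ (Fin d)} (hh : ‖h‖ < l) :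
    ‖l⁻¹ • h‖ < 1 := by
  rw [norm_smul, norm_inv, Real.norm_of_nonneg hl.le, inv_mul_lt_iff₀ hl, mul_one]
  exact hh

theorem chart_coe {l : ℝ} (hl : 0 < l) {h : EuclideanSpace ℝ (Fin d)} (hh : ‖h‖ < l) :
    (chart l h : EuclideanSpace ℝ (Fin (d + 1))) =
      consVec (√(1 - ‖l⁻¹ • h‖ ^ 2)) (l⁻¹ • h) := by
  simp only [chart, ballProj_of_le (norm_inv_smul_lt hl hh).le]

theorem chartInv_chart {l : ℝ} (hl : 0 < l) {h : EuclideanSpace ℝ (Fin d)} (hh : ‖h‖ < l) :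
    chartInv l (chart l h) = h := by
  rw [chartInv, chart_coe hl hh, tailVec_consVec, smul_inv_smul₀ hl.ne']

/-- The cone Z over a null set A of the sphere is null, so by Fubini almost every horizontal slice
of Z is null. The chart image of A is recovered from slices at countably many heights tending to 0
by radial projection, a differentiable map, which preserves null sets. A point of the sphere at
height s > 0 is recovered from any slice at height less than s. -/
theorem map_chart_absolutelyContinuous {l : ℝ} (hl : 0 < l) {r : ℝ} (hr : r ≤ l) :
    ((volume.restrict (Metric.ball (0 : EuclideanSpace ℝ (Fin d)) r)).map (chart l)) ≪
      sphMeasure d := by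
  refine Measure.AbsolutelyContinuous.mk fun A hA hA0 => ?_
  have hκ : Measurable (chart (d := d) l) := (continuous_chart l).measurable
  rw [Measure.map_apply hκ hA, Measure.restrict_apply (hκ hA)]
  rw [sphMeasure_apply hA, mul_eq_zero, or_iff_right (by simp)] at hA0
  set Z := {z : EuclideanSpace ℝ (Fin (d + 1)) |
      ∃ r ∈ Set.Ioo (0 : ℝ) 1, ∃ y ∈ A, r • (y : EuclideanSpace ℝ (Fin (d + 1))) = z}
  have h1 : (volume : Measure (ℝ × EuclideanSpace ℝ (Fin d)))
      {z | consVec z.1 z.2 ∈ Z} = 0 :=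
    measurePreserving_consVec.quasiMeasurePreserving.preimage_null hA0
  have h2 : ∀ᵐ t : ℝ, (volume : Measure (EuclideanSpace ℝ (Fin d))) {g | consVec t g ∈ Z} = 0 :=
    Measure.ae_ae_of_ae_prod (measure_eq_zero_iff_ae_notMem.1 h1) |>.mono fun t ht =>
      measure_eq_zero_iff_ae_notMem.2 ht
  have h3 : ∀ k : ℕ, ∃ t ∈ Set.Ioo (0 : ℝ) (1 / (k + 1)),
      (volume : Measure (EuclideanSpace ℝ (Fin d))) {g | consVec t g ∈ Z} = 0 := by
    intro k
    have hne : (volume.restrict (Set.Ioo (0 : ℝ) (1 / (k + 1)))) ≠ 0 := by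
      rw [Ne, Measure.restrict_eq_zero, Real.volume_Ioo, sub_zero, ENNReal.ofReal_eq_zero, not_le]
      positivity
    have : NeZero (volume.restrict (Set.Ioo (0 : ℝ) (1 / (k + 1)))) := ⟨hne⟩
    obtain ⟨t, ht1, ht2⟩ := ((ae_restrict_mem (μ := volume) measurableSet_Ioo).and
      (ae_restrict_of_ae h2)).exists (f := ae (volume.restrict (Set.Ioo (0 : ℝ) (1 / (k + 1)))))
    exact ⟨t, ht1, ht2⟩
  choose t ht1 ht2 using h3
  -- This map projects (t k, w) radially to the sphere and then reads its chart coordinate.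
  set G : ℕ → EuclideanSpace ℝ (Fin d) → EuclideanSpace ℝ (Fin d) := fun k w =>
    (l * (√(t k ^ 2 + ‖w‖ ^ 2))⁻¹) • w
  have hG : ∀ k, Differentiable ℝ (G k) := by
    intro k w
    have ht := (ht1 k).1
    have hne : t k ^ 2 + ‖w‖ ^ 2 ≠ 0 := by positivity
    have hd : DifferentiableAt ℝ (fun w : EuclideanSpace ℝ (Fin d) => t k ^ 2 + ‖w‖ ^ 2) w :=
      (differentiableAt_const _).add (differentiableAt_id.norm_sq ℝ)
    exact (((hd.sqrt hne).inv (Real.sqrt_ne_zero'.2 (by positivity))).const_mul l).smul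
      differentiableAt_id
  refine measure_mono_null (t := ⋃ k, G k '' {g | consVec (t k) g ∈ Z}) ?_
    (measure_iUnion_null fun k => addHaar_image_eq_zero_of_differentiableOn_of_addHaar_eq_zero
      volume (hG k).differentiableOn (ht2 k))
  rintro h ⟨hhA, hhr⟩
  have hh : ‖h‖ < l := (mem_ball_zero_iff.1 hhr).trans_le hr
  have hg := norm_inv_smul_lt hl hh
  set g := l⁻¹ • h with hgdef
  have hs2 : 0 < 1 - ‖g‖ ^ 2 := by nlinarith [norm_nonneg g]
  have hs := Real.sqrt_pos.2 hs2
  set s := √(1 - ‖g‖ ^ 2) with hsdef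
  obtain ⟨k, hk⟩ := exists_nat_one_div_lt hs
  have ht0 := (ht1 k).1
  have hts : t k < s := (ht1 k).2.trans hk
  refine Set.mem_iUnion.2 ⟨k, (t k / s) • g, ?_, ?_⟩
  · refine ⟨t k / s, ⟨by positivity, (div_lt_one hs).2 hts⟩, chart l h, hhA, ?_⟩
    rw [chart_coe hl hh, smul_consVec, ← hsdef, div_mul_cancel₀ _ hs.ne']
  · have hq : √(t k ^ 2 + ‖(t k / s) • g‖ ^ 2) = t k / s := by
      have : t k ^ 2 + ‖(t k / s) • g‖ ^ 2 = (t k / s) ^ 2 := by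
        rw [norm_smul, mul_pow, Real.norm_of_nonneg (by positivity)]
        have h5 : s ^ 2 = 1 - ‖g‖ ^ 2 := Real.sq_sqrt hs2.le
        have h6 : t k ^ 2 = (t k / s) ^ 2 * s ^ 2 := by
          rw [← mul_pow, div_mul_cancel₀ _ hs.ne']
        rw [h6, h5]; ring
      rw [this, Real.sqrt_sq (by positivity)]
    simp only [G]
    rw [hq, smul_smul, mul_assoc, inv_mul_cancel₀ (by positivity), mul_one, hgdef,
      smul_inv_smul₀ hl.ne']

/-- A rank one test, with α = γ the normalised indicator of a set E on which m(⟨x, y⟩) is close to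
z. The average over E is at most K in modulus and close to z, which is impossible for |z| > K if E
has positive measure. -/
theorem norm_comp_sphInner_le (hd : 1 ≤ d) {p : ℝ≥0∞} (hp : 1 ≤ p) {m : ℝ → ℂ}
    (hm : Measurable m) {Mb : ℝ} (hMb : ∀ z, ‖m z‖ ≤ Mb) (hK : sphSchurNorm d p m ≠ ⊤)
    (x : Sph d) :
    ∀ᵐ y ∂(sphMeasure d), ‖m (sphInner x y)‖ ≤ (sphSchurNorm d p m).toReal := by
  let μ := sphMeasure d
  set K := (sphSchurNorm d p m).toReal
  set G : Sph d → ℂ := fun y => m (sphInner x y)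
  have hG : Measurable G := hm.comp (continuous_sphInner_left x).measurable
  have key : ∀ z : ℂ, K < ‖z‖ → μ (G ⁻¹' Metric.ball z ((‖z‖ - K) / 2)) = 0 := by
    intro z hz
    set r := (‖z‖ - K) / 2 with hr
    have hr0 : 0 < r := by rw [hr]; linarith
    by_contra h0
    set E := G ⁻¹' Metric.ball z r
    have hE : MeasurableSet E := hG measurableSet_ball
    have hpos : 0 < μ.real E := ENNReal.toReal_pos h0 (measure_ne_top _ _)
    set α : Lp ℂ 2 (sphMeasure d) := unitIndicator μ hE
    have hα1 : ‖α‖ = 1 :=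
      (orthonormal_unitIndicator (μ := μ) (C := Unit) (s := fun _ => E) (fun _ => hE)
        (fun c c' h => (h (Subsingleton.elim _ _)).elim) (fun _ => h0)).1 ()
    have hα1' : ‖α‖ₑ = 1 := by rw [← ofReal_norm, hα1, ENNReal.ofReal_one]
    have hb : ∀ u : Lp ℂ 2 (sphMeasure d), ‖⟪u, α⟫_ℂ‖ₑ ^ 2 ≤ ‖u‖ₑ ^ 2 := fun u => by
      gcongr
      rw [enorm_le_iff_norm_le]
      simpa [hα1] using norm_inner_le_norm (𝕜 := ℂ) u α
    have main := norm_sum_integral_sphInner_le hd hp hm hMb hK (C := Unit) (fun _ => x)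
      (τ := Measure.dirac ()) (v := fun _ => α) (f := fun _ _ => 1) (α := fun _ => α)
      (γ := fun _ => α) (F := 1) (D := 1) (β := 1) (S := 1)
      ⟨fun u => aemeasurable_const, fun u => by simpa using hb u⟩ (fun _ => aemeasurable_const)
      (by simp) zero_le_one zero_le_one zero_le_one zero_le_one (by simp) (by simp [hα1'])
      (by simpa using hb) (by simp [hα1'])
    simp only [Finset.univ_unique, Finset.sum_singleton, Real.sqrt_one, Real.one_rpow,
      mul_one] at main
    have e1 : ∫ y, m (sphInner x y) * pairTerm p (α y) (α y) ∂μ =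
        ∫ y in E, (((μ.real E)⁻¹ : ℝ) : ℂ) * G y ∂μ := by
      rw [← integral_indicator hE]
      refine integral_congr_ae ?_
      filter_upwards [unitIndicator_coe (μ := μ) hE] with y hy
      have hpt : pairTerm p (α y) (α y) = starRingEnd ℂ (α y) * α y := by simp [pairTerm]
      rw [hpt, hy]
      by_cases hyE : y ∈ E
      · rw [Set.indicator_of_mem hyE, Set.indicator_of_mem hyE, Complex.conj_ofReal,
          ← Complex.ofReal_mul, ← mul_inv, Real.mul_self_sqrt hpos.le, mul_comm]
      · simp [hyE]
    have hi : Integrable G (μ.restrict E) :=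
      Integrable.of_bound hG.aestronglyMeasurable Mb (Filter.Eventually.of_forall fun y => hMb _)
    have e2 : z = ∫ y in E, (((μ.real E)⁻¹ : ℝ) : ℂ) * z ∂μ := by
      rw [setIntegral_const, Complex.real_smul, ← mul_assoc, ← Complex.ofReal_mul,
        mul_inv_cancel₀ hpos.ne', Complex.ofReal_one, one_mul]
    have e3 : ‖z - ∫ y in E, (((μ.real E)⁻¹ : ℝ) : ℂ) * G y ∂μ‖ ≤ r := by
      nth_rw 1 [e2]
      rw [← integral_sub (integrable_const _) (hi.const_mul _)]
      refine (norm_setIntegral_le_of_norm_le_const (C := (μ.real E)⁻¹ * r) (measure_lt_top _ _)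
        fun y hy => ?_).trans (le_of_eq ?_)
      · rw [← mul_sub, norm_mul, Complex.norm_real, Real.norm_of_nonneg (by positivity)]
        gcongr
        rw [← dist_eq_norm, dist_comm]
        exact (Metric.mem_ball.1 hy).le
      · field_simp
    rw [e1] at main
    have e4 := norm_le_norm_add_norm_sub' z (∫ y in E, (((μ.real E)⁻¹ : ℝ) : ℂ) * G y ∂μ)
    have : ‖z‖ ≤ K + r := e4.trans (add_le_add main e3)
    rw [hr] at this
    linarith
  have h2 : (μ.map G) {z | K < ‖z‖} = 0 := by
    refine measure_null_of_locally_null _ fun z hz => ⟨Metric.ball z ((‖z‖ - K) / 2), ?_, ?_⟩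
    · refine mem_nhdsWithin_of_mem_nhds (Metric.ball_mem_nhds _ ?_)
      have : K < ‖z‖ := hz
      linarith
    · rw [Measure.map_apply hG measurableSet_ball]
      exact key z hz
  rw [Measure.map_apply hG (measurableSet_lt measurable_const measurable_norm)] at h2
  filter_upwards [measure_eq_zero_iff_ae_notMem.1 h2] with y hy
  exact not_lt.1 hy

/-- The symbol of a bounded Schur multiplier is bounded. -/
theorem norm_le_sphSchurNorm (hd : 1 ≤ d) {p : ℝ≥0∞} (hp : 1 ≤ p) {m : ℝ → ℂ}
    (hm : Measurable m) {Mb : ℝ} (hMb : ∀ z, ‖m z‖ ≤ Mb) (hK : sphSchurNorm d p m ≠ ⊤) :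
    ∀ᵐ t : ℝ, t ∈ Set.Ioo (-1 : ℝ) 1 → ‖m t‖ ≤ (sphSchurNorm d p m).toReal := by
  set K := (sphSchurNorm d p m).toReal
  obtain ⟨e, rfl⟩ : ∃ e, d = e + 1 := ⟨d - 1, by omega⟩
  set x : Sph (e + 1) := ⟨EuclideanSpace.single 1 1, by simp⟩
  have h1 := map_chart_absolutelyContinuous (d := e + 1) one_pos le_rfl
    (ae_iff.1 (norm_comp_sphInner_le hd hp hm hMb hK x))
  have hms : MeasurableSet {t | ¬ ‖m t‖ ≤ K} := (measurableSet_le hm.norm measurable_const).compl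
  have hms' : MeasurableSet {y : Sph (e + 1) | ¬ ‖m (sphInner x y)‖ ≤ K} :=
    (continuous_sphInner_left x).measurable hms
  rw [Measure.map_apply (continuous_chart 1).measurable hms', Measure.restrict_apply
    ((continuous_chart 1).measurable hms')] at h1
  -- In the chart ⟨x, y⟩ is the first coordinate. A thin box A × (-η, η)^e inside the unit ball is
  -- contained in a null set, and the factor (2η)^e is positive, so A is null; η = (1 - a)/(e + 1)
  -- keeps the box inside the ball.
  have key : ∀ k : ℕ, volume ({t | ¬ ‖m t‖ ≤ K} ∩
      Set.Ioo (-(1 - 1 / ((k : ℝ) + 1))) (1 - 1 / ((k : ℝ) + 1))) = 0 := by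
    intro k
    set a : ℝ := 1 - 1 / ((k : ℝ) + 1) with ha
    have ha1 : a < 1 := by rw [ha]; linarith [show 0 < 1 / ((k : ℝ) + 1) by positivity]
    have ha0 : 0 ≤ a := by
      rw [ha, sub_nonneg, div_le_one (by positivity)]
      linarith [k.cast_nonneg (α := ℝ)]
    set η : ℝ := (1 - a) / (e + 1)
    have hη : 0 < η := div_pos (by linarith) (by positivity)
    set A := {t | ¬ ‖m t‖ ≤ K} ∩ Set.Ioo (-a) a
    set B : Set (Fin (e + 1) → ℝ) :=
      Set.univ.pi (Fin.cons A fun _ => Set.Ioo (-η) η : Fin (e + 1) → Set ℝ)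
    have hB : volume ((WithLp.ofLp : EuclideanSpace ℝ (Fin (e + 1)) → _) ⁻¹' B) = 0 := by
      refine measure_mono_null ?_ h1
      intro h hh
      have hh0 : h 0 ∈ A := by simpa using hh 0 trivial
      have hhs : ∀ j : Fin e, h j.succ ∈ Set.Ioo (-η) η := fun j => by
        simpa using hh j.succ trivial
      have hn : ‖h‖ < 1 := by
        rw [← sq_lt_one_iff₀ (norm_nonneg _), EuclideanSpace.norm_sq_eq, Fin.sum_univ_succ]
        have i1 : ‖h 0‖ ^ 2 ≤ a ^ 2 := by
          rw [Real.norm_eq_abs]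
          gcongr
          exact abs_le.2 ⟨hh0.2.1.le, hh0.2.2.le⟩
        have i2 : ∑ j : Fin e, ‖h j.succ‖ ^ 2 ≤ e * η ^ 2 := by
          calc _ ≤ ∑ j : Fin e, η ^ 2 := by
                refine Finset.sum_le_sum fun j _ => ?_
                rw [Real.norm_eq_abs]
                gcongr
                exact abs_le.2 ⟨(hhs j).1.le, (hhs j).2.le⟩
            _ = _ := by simp
        have i3 : (e + 1) * η = 1 - a := by
          simp only [η]; field_simp
        have i4 : η ≤ 1 := by
          simp only [η]
          rw [div_le_one (by positivity)]
          linarith [e.cast_nonneg (α := ℝ)]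
        nlinarith [mul_pos hη hη, e.cast_nonneg (α := ℝ)]
      refine ⟨?_, mem_ball_zero_iff.2 hn⟩
      have : sphInner x (chart 1 h) = h 0 := by
        rw [sphInner, chart_coe one_pos hn]
        have hx : (x : EuclideanSpace ℝ (Fin (e + 1 + 1))) =
            consVec 0 (EuclideanSpace.single 0 1) := by
          ext i
          refine Fin.cases ?_ (fun j => ?_) i
          · simp [x, consVec]
          · have h1 : (1 : Fin (e + 1 + 1)) = Fin.succ 0 := rfl
            simp only [x, consVec, h1, PiLp.single_apply, Fin.succ_inj, Fin.cons_succ]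
        rw [hx, inner_consVec, EuclideanSpace.inner_single_left]
        simp
      simp only [Set.mem_preimage, Set.mem_ofPred_eq, this]
      exact hh0.1
    have h3 := EuclideanSpace.volume_preserving_symm_measurableEquiv_toLp (Fin (e + 1))
    have h4 := h3.measure_preimage_equiv B
    have h5 : volume B = 0 := by
      rw [← h4]; exact hB
    rw [volume_pi, Measure.pi_pi, Fin.prod_univ_succ, mul_eq_zero] at h5
    rcases h5 with h5 | h5
    · simpa using h5
    · simp at h5
      linarith
  have h6 : volume ({t | ¬ ‖m t‖ ≤ K} ∩ Set.Ioo (-1 : ℝ) 1) = 0 := by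
    refine measure_mono_null ?_ (measure_iUnion_null key)
    rintro t ⟨ht1, ht2⟩
    obtain ⟨k, hk⟩ := exists_nat_one_div_lt (sub_pos.2 (abs_lt.2 ht2))
    refine Set.mem_iUnion.2 ⟨k, ht1, ?_⟩
    rw [Set.mem_Ioo, ← abs_lt]
    linarith
  filter_upwards [measure_eq_zero_iff_ae_notMem.1 h6] with t ht ht'
  by_contra hc
  exact ht ⟨hc, ht'⟩

end Chart

/-! ### Plancherel's theorem and plane waves -/

section Plancherel

open scoped SchwartzMap

variable {V : Type*} [NormedAddCommGroup V] [InnerProductSpace ℝ V] [FiniteDimensional ℝ V]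
  [MeasurableSpace V] [BorelSpace V]

theorem continuous_fourier {f : V → ℂ} (hf : Integrable f) : Continuous (𝓕 f) :=
  VectorFourier.fourierIntegral_continuous Real.continuous_fourierChar
    (by exact continuous_inner) hf

/-- The integral transform and its L² extension agree as distributions: against a test function,
both move the transform onto the test function. -/
theorem fourier_ae_eq {f : V → ℂ} (hf : Integrable f) (hf2 : MemLp f 2) :
    𝓕 f =ᵐ[volume] (𝓕 (hf2.toLp f) : Lp ℂ 2 (volume : Measure V)) := by
  refine ae_eq_of_integral_contDiff_smul_eq (continuous_fourier hf).locallyIntegrable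
    ((Lp.memLp _).locallyIntegrable (by norm_num)) fun g hg hgc => ?_
  set φ : 𝓢(V, ℂ) := (hgc.comp_left (g := Complex.ofReal) Complex.ofReal_zero).toSchwartzMap
    (Complex.ofRealCLM.contDiff.comp hg)
  have hφ : ∀ x, φ x = (g x : ℂ) := fun x => rfl
  have h1 := congrArg (fun T => T φ) (Lp.fourier_toTemperedDistribution_eq (hf2.toLp f))
  simp only [TemperedDistribution.fourier_apply, Lp.toTemperedDistribution_apply] at h1
  have h2 : ∫ x, (𝓕 φ : 𝓢(V, ℂ)) x • (hf2.toLp f) x = ∫ x, f x • 𝓕 (φ : V → ℂ) x := by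
    refine integral_congr_ae ?_
    filter_upwards [hf2.coeFn_toLp] with x hx
    rw [hx, smul_eq_mul, smul_eq_mul, mul_comm, SchwartzMap.fourier_coe]
  have h3 := VectorFourier.integral_fourierIntegral_smul_eq_flip (e := Real.fourierChar)
    (μ := (volume : Measure V)) (ν := (volume : Measure V)) (L := innerₗ V) (f := f) (g := φ)
    Real.continuous_fourierChar (by exact continuous_inner) hf φ.integrable
  rw [flip_innerₗ] at h3
  have h4 : ∫ x, g x • 𝓕 f x = ∫ x, 𝓕 f x • φ x := by
    refine integral_congr_ae (Filter.Eventually.of_forall fun x => ?_)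
    simp only [hφ, Complex.real_smul, smul_eq_mul, mul_comm]
  have h5 : ∫ x, g x • (𝓕 (hf2.toLp f) : Lp ℂ 2 (volume : Measure V)) x =
      ∫ x, φ x • (𝓕 (hf2.toLp f) : Lp ℂ 2 (volume : Measure V)) x := by
    refine integral_congr_ae (Filter.Eventually.of_forall fun x => ?_)
    simp only [hφ, Complex.real_smul, smul_eq_mul]
  rw [h4, h5, ← h1, h2]
  exact h3

theorem lintegral_sq_Lp {X : Type*} [MeasurableSpace X] {μ : Measure X} (f : Lp ℂ 2 μ) :
    ∫⁻ x, ‖f x‖ₑ ^ 2 ∂μ = ‖f‖ₑ ^ 2 := by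
  have := eLpNorm_nnreal_pow_eq_lintegral (μ := μ) (f := f) (p := 2) (by norm_num)
  rw [Lp.enorm_def]
  simpa using this.symm

theorem lintegral_fourier_sq {f : V → ℂ} (hf : Integrable f) (hf2 : MemLp f 2) :
    ∫⁻ ξ, ‖𝓕 f ξ‖ₑ ^ 2 = ∫⁻ x, ‖f x‖ₑ ^ 2 := by
  have h1 : ∫⁻ ξ, ‖𝓕 f ξ‖ₑ ^ 2 =
      ∫⁻ ξ, ‖(𝓕 (hf2.toLp f) : Lp ℂ 2 (volume : Measure V)) ξ‖ₑ ^ 2 := by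
    refine lintegral_congr_ae ?_
    filter_upwards [fourier_ae_eq hf hf2] with x hx
    rw [hx]
  have h2 : ∫⁻ x, ‖f x‖ₑ ^ 2 = ∫⁻ x, ‖hf2.toLp f x‖ₑ ^ 2 := by
    refine lintegral_congr_ae ?_
    filter_upwards [hf2.coeFn_toLp] with x hx
    rw [hx]
  rw [h1, h2, lintegral_sq_Lp, lintegral_sq_Lp, ← ofReal_norm, ← ofReal_norm,
    Lp.norm_fourier_eq]

end Plancherel

/-! ### Plane waves on a ball as a Parseval family. -/

section PlaneWave

variable {d : ℕ} {r : ℝ}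

/-- Lebesgue measure on a ball. -/
abbrev ballMeasure (d : ℕ) (r : ℝ) : Measure (EuclideanSpace ℝ (Fin d)) :=
  volume.restrict (Metric.ball 0 r)

instance : IsFiniteMeasure (ballMeasure d r) := ⟨by simpa using measure_ball_lt_top⟩

/-- The function `e^{2πi⟨ξ, h⟩}`. -/
def wave (ξ h : EuclideanSpace ℝ (Fin d)) : ℂ := (𝐞 ⟪ξ, h⟫_ℝ : ℂ)

theorem norm_wave (ξ h : EuclideanSpace ℝ (Fin d)) : ‖wave ξ h‖ = 1 := Circle.norm_coe _

theorem continuous_wave :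
    Continuous fun z : EuclideanSpace ℝ (Fin d) × EuclideanSpace ℝ (Fin d) => wave z.1 z.2 := by
  unfold wave
  exact continuous_subtype_val.comp (Real.continuous_fourierChar.comp continuous_inner)

theorem wave_add (ξ h k : EuclideanSpace ℝ (Fin d)) : wave ξ (h + k) = wave ξ h * wave ξ k := by
  simp only [wave, inner_add_right, AddChar.map_add_eq_mul, Circle.coe_mul]

theorem wave_neg (ξ h : EuclideanSpace ℝ (Fin d)) :
    wave ξ (-h) = starRingEnd ℂ (wave ξ h) := by
  simp only [wave, inner_neg_right, AddChar.map_neg_eq_inv, Circle.coe_inv_eq_conj]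

theorem wave_sub (ξ h k : EuclideanSpace ℝ (Fin d)) :
    wave ξ (h - k) = wave ξ h * starRingEnd ℂ (wave ξ k) := by
  rw [sub_eq_add_neg, wave_add, wave_neg]

theorem fourier_eq_wave (f : EuclideanSpace ℝ (Fin d) → ℂ) (ξ : EuclideanSpace ℝ (Fin d)) :
    𝓕 f ξ = ∫ h, starRingEnd ℂ (wave ξ h) * f h := by
  rw [Real.fourier_eq]
  refine integral_congr_ae (Filter.Eventually.of_forall fun h => ?_)
  simp only [wave, Circle.smul_def, smul_eq_mul, AddChar.map_neg_eq_inv, Circle.coe_inv_eq_conj,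
    real_inner_comm]

theorem fourierInv_eq_wave (f : EuclideanSpace ℝ (Fin d) → ℂ) (h : EuclideanSpace ℝ (Fin d)) :
    𝓕⁻ f h = ∫ ξ, f ξ * wave ξ h := by
  rw [Real.fourierInv_eq]
  refine integral_congr_ae (Filter.Eventually.of_forall fun h => ?_)
  simp only [wave, Circle.smul_def, smul_eq_mul, mul_comm]

theorem memLp_wave (ξ : EuclideanSpace ℝ (Fin d)) : MemLp (wave ξ) 2 (ballMeasure d r) :=
  MemLp.of_bound (continuous_wave.comp (by fun_prop : Continuous fun h => (ξ, h))).aestronglyMeasurable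
    1 (Filter.Eventually.of_forall fun h => (norm_wave ξ h).le)

/-- The plane wave `e^{2πi⟨ξ, ·⟩}` on a ball. -/
def planeWave (r : ℝ) (ξ : EuclideanSpace ℝ (Fin d)) : Lp ℂ 2 (ballMeasure d r) :=
  (memLp_wave ξ).toLp _

theorem planeWave_coe (ξ : EuclideanSpace ℝ (Fin d)) :
    planeWave r ξ =ᵐ[ballMeasure d r] wave ξ :=
  MemLp.coeFn_toLp (memLp_wave ξ)

theorem enorm_planeWave_sq (ξ : EuclideanSpace ℝ (Fin d)) :
    ‖planeWave r ξ‖ₑ ^ 2 = volume (Metric.ball (0 : EuclideanSpace ℝ (Fin d)) r) := by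
  rw [← lintegral_sq_Lp]
  have : ∫⁻ x, ‖planeWave r ξ x‖ₑ ^ 2 ∂(ballMeasure d r) = ∫⁻ _, 1 ∂(ballMeasure d r) := by
    refine lintegral_congr_ae ?_
    filter_upwards [planeWave_coe ξ] with x hx
    rw [hx, ← ofReal_norm, norm_wave]; simp
  rw [this, lintegral_one, Measure.restrict_apply_univ]

/-- Extension by zero. -/
def extendBall (u : Lp ℂ 2 (ballMeasure d r)) : EuclideanSpace ℝ (Fin d) → ℂ :=
  (Metric.ball 0 r).indicator u

theorem integrable_extendBall (u : Lp ℂ 2 (ballMeasure d r)) : Integrable (extendBall u) :=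
  (integrable_indicator_iff measurableSet_ball).2 ((Lp.memLp u).integrable (by norm_num))

theorem memLp_extendBall (u : Lp ℂ 2 (ballMeasure d r)) : MemLp (extendBall u) 2 :=
  (memLp_indicator_iff_restrict measurableSet_ball).2 (Lp.memLp u)

theorem lintegral_extendBall_sq (u : Lp ℂ 2 (ballMeasure d r)) :
    ∫⁻ x, ‖extendBall u x‖ₑ ^ 2 = ‖u‖ₑ ^ 2 := by
  rw [← lintegral_sq_Lp, ← lintegral_indicator measurableSet_ball]
  refine lintegral_congr fun x => ?_
  rw [extendBall]
  by_cases hx : x ∈ Metric.ball (0 : EuclideanSpace ℝ (Fin d)) r <;> simp [hx]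

theorem inner_planeWave (u : Lp ℂ 2 (ballMeasure d r)) (ξ : EuclideanSpace ℝ (Fin d)) :
    ⟪u, planeWave r ξ⟫_ℂ = starRingEnd ℂ (𝓕 (extendBall u) ξ) := by
  rw [fourier_eq_wave, ← integral_conj, L2.inner_def, ← integral_indicator measurableSet_ball]
  have h1 := (ae_restrict_iff' measurableSet_ball).1 (planeWave_coe (r := r) ξ)
  refine integral_congr_ae ?_
  filter_upwards [h1] with h hh
  rw [extendBall]
  by_cases hx : h ∈ Metric.ball (0 : EuclideanSpace ℝ (Fin d)) r
  · rw [Set.indicator_of_mem hx, Set.indicator_of_mem hx, hh hx, RCLike.inner_apply, map_mul,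
      Complex.conj_conj]
  · simp [hx]

theorem lintegral_inner_planeWave_sq (u : Lp ℂ 2 (ballMeasure d r)) :
    ∫⁻ ξ, ‖⟪u, planeWave r ξ⟫_ℂ‖ₑ ^ 2 = ‖u‖ₑ ^ 2 := by
  rw [← lintegral_extendBall_sq, ← lintegral_fourier_sq (integrable_extendBall u)
    (memLp_extendBall u)]
  refine lintegral_congr fun ξ => ?_
  rw [inner_planeWave, ← ofReal_norm, RCLike.norm_conj, ofReal_norm]

theorem continuous_inner_planeWave (u : Lp ℂ 2 (ballMeasure d r)) :
    Continuous fun ξ => ⟪u, planeWave r ξ⟫_ℂ := by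
  simp only [inner_planeWave]
  exact RCLike.continuous_conj.comp (continuous_fourier (integrable_extendBall u))

/-- Plancherel's theorem. The total mass of this family over Ξ is |ball| |Ξ|, the effective
dimension of functions on the ball with frequencies in Ξ. -/
theorem isBessel_planeWave (Ξ : Set (EuclideanSpace ℝ (Fin d))) :
    IsBessel (volume.restrict Ξ) (planeWave (d := d) r) 1 :=
  ⟨fun u => (continuous_inner_planeWave u).aemeasurable, fun u => by
    rw [one_mul, ← lintegral_inner_planeWave_sq u]
    exact setLIntegral_le_lintegral _ _⟩

theorem memLp_fourierInv {f : EuclideanSpace ℝ (Fin d) → ℂ} (hf : Integrable f) :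
    MemLp (𝓕⁻ f) 2 (ballMeasure d r) := by
  have hc : Continuous (𝓕⁻ f) := by
    have : 𝓕⁻ f = fun x => 𝓕 f (-x) := funext fun x => Real.fourierInv_eq_fourier_neg f x
    rw [this]
    exact (continuous_fourier hf).comp continuous_neg
  refine MemLp.of_bound hc.aestronglyMeasurable (∫ ξ, ‖f ξ‖) (Filter.Eventually.of_forall fun h => ?_)
  rw [fourierInv_eq_wave]
  refine (norm_integral_le_integral_norm _).trans (le_of_eq ?_)
  simp [norm_wave]

/-- The superposition of plane waves with amplitude `f`. -/
def wavePacket (r : ℝ) {f : EuclideanSpace ℝ (Fin d) → ℂ} (hf : Integrable f) :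
    Lp ℂ 2 (ballMeasure d r) := (memLp_fourierInv hf).toLp _

theorem wavePacket_coe {f : EuclideanSpace ℝ (Fin d) → ℂ} (hf : Integrable f) :
    wavePacket r hf =ᵐ[ballMeasure d r] 𝓕⁻ f := MemLp.coeFn_toLp (memLp_fourierInv hf)

/-- Fubini. This is the expansion of a packet along a Bessel family that the Schatten estimates
require. -/
theorem inner_wavePacket {f : EuclideanSpace ℝ (Fin d) → ℂ} (hf : Integrable f)
    (u : Lp ℂ 2 (ballMeasure d r)) :
    ⟪u, wavePacket r hf⟫_ℂ = ∫ ξ, f ξ * ⟪u, planeWave r ξ⟫_ℂ := by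
  have h1 : ∀ ξ, f ξ * ⟪u, planeWave r ξ⟫_ℂ =
      ∫ h, starRingEnd ℂ (u h) * (f ξ * wave ξ h) ∂(ballMeasure d r) := fun ξ => by
    rw [L2.inner_def, ← integral_const_mul]
    refine integral_congr_ae ?_
    filter_upwards [planeWave_coe ξ] with h hh
    rw [hh, RCLike.inner_apply]; ring
  have h2 : ⟪u, wavePacket r hf⟫_ℂ =
      ∫ h, (∫ ξ, starRingEnd ℂ (u h) * (f ξ * wave ξ h)) ∂(ballMeasure d r) := by
    rw [L2.inner_def]
    refine integral_congr_ae ?_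
    filter_upwards [wavePacket_coe hf] with h hh
    rw [hh, RCLike.inner_apply, fourierInv_eq_wave, integral_const_mul, mul_comm]
  simp_rw [h1]
  rw [h2]
  refine integral_integral_swap ?_
  have hu : Integrable (fun h => starRingEnd ℂ (u h)) (ballMeasure d r) :=
    (Complex.conjCLE : ℂ →L[ℝ] ℂ).integrable_comp ((Lp.memLp u).integrable (by norm_num))
  have h3 := (hu.mul_prod hf).mul_bdd (c := 1)
    (g := fun z : EuclideanSpace ℝ (Fin d) × EuclideanSpace ℝ (Fin d) => wave z.2 z.1)
    (continuous_wave.comp continuous_swap).aestronglyMeasurable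
    (Filter.Eventually.of_forall fun z => (norm_wave _ _).le)
  refine h3.congr (Filter.Eventually.of_forall fun z => ?_)
  simp only [Function.uncurry]
  ring

end PlaneWave

/-! ### Exponentials on cubes -/

section Lattice

variable {d : ℕ}

/-- The points of the lattice `(ℤ / 6)^d`. -/
def latticePt (n : Fin d → ℕ) : EuclideanSpace ℝ (Fin d) :=
  WithLp.toLp 2 fun i => (n i : ℝ) / 6

/-- A cube of side `6`. -/
def cube (a : EuclideanSpace ℝ (Fin d)) : Set (EuclideanSpace ℝ (Fin d)) :=
  {ξ | ∀ i, ξ i ∈ Set.Ioc (a i) (a i + 6)}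

theorem cube_eq (a : EuclideanSpace ℝ (Fin d)) :
    cube a = (MeasurableEquiv.toLp 2 (Fin d → ℝ)).symm ⁻¹'
      (Set.univ.pi fun i => Set.Ioc (a i) (a i + 6)) := by
  ext ξ; simp [cube]

theorem setIntegral_cube_prod (a : EuclideanSpace ℝ (Fin d)) (f : Fin d → ℝ → ℂ) :
    ∫ ξ in cube a, ∏ i, f i (ξ i) = ∏ i, ∫ t in Set.Ioc (a i) (a i + 6), f i t := by
  have h := EuclideanSpace.volume_preserving_symm_measurableEquiv_toLp (Fin d)
  rw [cube_eq]
  have h1 := h.setIntegral_preimage_emb (MeasurableEquiv.measurableEmbedding _)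
    (fun x : Fin d → ℝ => ∏ i, f i (x i)) (Set.univ.pi fun i => Set.Ioc (a i) (a i + 6))
  refine Eq.trans h1 ?_
  rw [volume_pi, Measure.restrict_pi_pi]
  exact integral_fintype_prod_eq_prod (𝕜 := ℂ) (fun i t => f i t)

/-- The frequency is a nonzero multiple of 1/6, so the interval of length 6 contains a whole number
of periods. -/
theorem integral_fourierChar_period {n n' : ℕ} (h : n ≠ n') (a : ℝ) :
    ∫ t in Set.Ioc a (a + 6), (𝐞 (t * (((n' : ℝ) - n) / 6)) : ℂ) = 0 := by
  rw [← intervalIntegral.integral_of_le (by linarith)]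
  set k : ℝ := ((n' : ℝ) - n) / 6
  have hk : k ≠ 0 := by
    simp only [k]
    refine div_ne_zero (sub_ne_zero.2 ?_) (by norm_num)
    exact_mod_cast h.symm
  have h1 : ∀ t : ℝ, (𝐞 (t * k) : ℂ) = Complex.exp ((2 * Real.pi * k * Complex.I) * t) := by
    intro t
    rw [Real.fourierChar_apply]
    congr 1
    push_cast; ring
  simp_rw [h1]
  have hc : (2 * Real.pi * k * Complex.I : ℂ) ≠ 0 := by
    simp [hk, Real.pi_ne_zero]
  rw [integral_exp_mul_complex hc, div_eq_zero_iff]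
  left
  rw [sub_eq_zero]
  have h2 : (2 * Real.pi * k * Complex.I : ℂ) * ((a + 6 : ℝ) : ℂ) =
      (2 * Real.pi * k * Complex.I : ℂ) * a + ((n' : ℤ) - n : ℤ) * (2 * Real.pi * Complex.I) := by
    simp only [k]; push_cast; ring
  rw [h2, Complex.exp_add, Complex.exp_int_mul_two_pi_mul_I, mul_one]

theorem wave_latticePt (ξ : EuclideanSpace ℝ (Fin d)) (n n' : Fin d → ℕ) :
    starRingEnd ℂ (wave ξ (latticePt n)) * wave ξ (latticePt n') =
      ∏ i, (𝐞 (ξ i * (((n' i : ℝ) - n i) / 6)) : ℂ) := by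
  rw [mul_comm, ← wave_sub, wave, PiLp.inner_apply]
  simp only [Real.fourierChar_apply]
  rw [← Complex.exp_sum, Complex.ofReal_mul, Complex.ofReal_sum, Finset.mul_sum, Finset.sum_mul]
  congr 1
  refine Finset.sum_congr rfl fun i _ => ?_
  simp only [latticePt, PiLp.sub_apply, RCLike.inner_apply, conj_trivial]
  push_cast
  ring

theorem setIntegral_cube_wave (a : EuclideanSpace ℝ (Fin d)) (n n' : Fin d → ℕ) :
    ∫ ξ in cube a, starRingEnd ℂ (wave ξ (latticePt n)) * wave ξ (latticePt n') =
      if n = n' then 6 ^ d else 0 := by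
  simp_rw [wave_latticePt]
  rw [setIntegral_cube_prod a fun i t => (𝐞 (t * (((n' i : ℝ) - n i) / 6)) : ℂ)]
  split_ifs with h
  · subst h
    simp
  · obtain ⟨i, hi⟩ := Function.ne_iff.1 h
    exact Finset.prod_eq_zero (Finset.mem_univ i) (integral_fourierChar_period hi _)

instance (a : EuclideanSpace ℝ (Fin d)) : IsFiniteMeasure (volume.restrict (cube a)) := by
  refine ⟨?_⟩
  have h := EuclideanSpace.volume_preserving_symm_measurableEquiv_toLp (Fin d)
  rw [Measure.restrict_apply_univ, cube_eq, h.measure_preimage_equiv, Real.volume_pi_Ioc]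
  exact ENNReal.prod_lt_top fun i _ => ENNReal.ofReal_lt_top

/-- Bessel's inequality for the exponentials with frequencies in `(ℤ/6)^d`, on cubes of side
`6`. -/
theorem sum_enorm_integral_wave_le {ι : Type*} [Fintype ι] {n : ι → Fin d → ℕ}
    (hn : Function.Injective n) (a : EuclideanSpace ℝ (Fin d)) {W : EuclideanSpace ℝ (Fin d) → ℂ}
    (hW : MemLp W 2) (hWa : ∀ ξ, ξ ∉ cube a → W ξ = 0) :
    ∑ c, ‖∫ ξ, starRingEnd ℂ (wave ξ (latticePt (n c))) * W ξ‖ₑ ^ 2 ≤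
      ENNReal.ofReal (6 ^ d) * ∫⁻ ξ, ‖W ξ‖ₑ ^ 2 := by
  set ν := volume.restrict (cube a)
  have hw : ∀ k, MemLp (fun ξ => wave ξ k) 2 ν := fun k =>
    MemLp.of_bound (continuous_wave.comp
      (by fun_prop : Continuous fun ξ => (ξ, k))).aestronglyMeasurable 1
      (Filter.Eventually.of_forall fun h => (norm_wave _ _).le)
  set χ : ι → Lp ℂ 2 ν := fun c =>
    (((√(6 ^ d))⁻¹ : ℝ) : ℂ) • (hw (latticePt (n c))).toLp _
  set w : Lp ℂ 2 ν := (hW.restrict (cube a)).toLp W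
  have hin : ∀ c (g : Lp ℂ 2 ν), ⟪χ c, g⟫_ℂ = (((√(6 ^ d))⁻¹ : ℝ) : ℂ) *
      ∫ ξ in cube a, starRingEnd ℂ (wave ξ (latticePt (n c))) * g ξ := fun c g => by
    rw [inner_smul_left, Complex.conj_ofReal, L2.inner_def]
    congr 1
    refine integral_congr_ae ?_
    filter_upwards [(hw (latticePt (n c))).coeFn_toLp] with ξ hξ
    rw [hξ, RCLike.inner_apply, mul_comm]
  have hχ : Orthonormal ℂ χ := by
    classical
    rw [orthonormal_iff_ite]
    intro c c'
    rw [inner_smul_right, hin]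
    have : ∫ ξ in cube a, starRingEnd ℂ (wave ξ (latticePt (n c))) *
        (hw (latticePt (n c'))).toLp _ ξ = if n c = n c' then 6 ^ d else 0 := by
      rw [← setIntegral_cube_wave a]
      refine integral_congr_ae ?_
      filter_upwards [(hw (latticePt (n c'))).coeFn_toLp] with ξ hξ
      rw [hξ]
    rw [this]
    by_cases hc : c = c'
    · rw [if_pos hc, if_pos (by rw [hc])]
      rw [← mul_assoc, ← Complex.ofReal_mul, ← mul_inv, Real.mul_self_sqrt (by positivity)]
      push_cast
      exact inv_mul_cancel₀ (pow_ne_zero _ (by norm_num))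
    · rw [if_neg hc, if_neg (fun h => hc (hn h))]; simp
  have hb := hχ.sum_inner_products_le (s := Finset.univ) w
  have hint : ∀ c, ∫ ξ, starRingEnd ℂ (wave ξ (latticePt (n c))) * W ξ =
      (√(6 ^ d) : ℝ) * ⟪χ c, w⟫_ℂ := fun c => by
    rw [hin, ← mul_assoc, ← Complex.ofReal_mul, mul_inv_cancel₀ (by positivity),
      Complex.ofReal_one, one_mul]
    have h1 : ∫ ξ in cube a, starRingEnd ℂ (wave ξ (latticePt (n c))) * w ξ =
        ∫ ξ in cube a, starRingEnd ℂ (wave ξ (latticePt (n c))) * W ξ := by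
      refine integral_congr_ae ?_
      filter_upwards [(hW.restrict (cube a)).coeFn_toLp] with ξ hξ
      rw [hξ]
    rw [h1, setIntegral_eq_integral_of_forall_compl_eq_zero]
    intro ξ hξ
    rw [hWa ξ hξ, mul_zero]
  have hw2 : ‖w‖ₑ ^ 2 ≤ ∫⁻ ξ, ‖W ξ‖ₑ ^ 2 := by
    rw [← lintegral_sq_Lp]
    refine le_trans (le_of_eq (lintegral_congr_ae ?_))
      (setLIntegral_le_lintegral (cube a) fun ξ => ‖W ξ‖ₑ ^ 2)
    filter_upwards [(hW.restrict (cube a)).coeFn_toLp] with ξ hξ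
    rw [hξ]
  calc _ = ENNReal.ofReal (∑ c, 6 ^ d * ‖⟪χ c, w⟫_ℂ‖ ^ 2) := by
        rw [ENNReal.ofReal_sum_of_nonneg fun c _ => by positivity]
        refine Finset.sum_congr rfl fun c _ => ?_
        rw [hint, ← ofReal_norm, ← ENNReal.ofReal_pow (norm_nonneg _), norm_mul, mul_pow,
          Complex.norm_real, Real.norm_of_nonneg (by positivity), Real.sq_sqrt (by positivity)]
    _ ≤ ENNReal.ofReal (6 ^ d * ‖w‖ ^ 2) := by
        rw [← Finset.mul_sum]; gcongr
    _ = ENNReal.ofReal (6 ^ d) * ‖w‖ₑ ^ 2 := by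
        rw [ENNReal.ofReal_mul (by positivity), ENNReal.ofReal_pow (norm_nonneg _), ofReal_norm]
    _ ≤ _ := by gcongr

end Lattice

/-! ### Frames and wave packets adapted to tubes -/

section Frames

open scoped SchwartzMap

variable {d : ℕ}

/-- The space of directions orthogonal to the axis of a tube. -/
abbrev Cross (d : ℕ) : Type := EuclideanSpace ℝ (Fin (d - 1))

/-- Linear isometries `ℝ × ℝ^{d-1} ≃ ℝ^d`. -/
abbrev LinFrame (d : ℕ) : Type :=
  WithLp 2 (ℝ × Cross d) ≃ₗᵢ[ℝ] EuclideanSpace ℝ (Fin d)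

theorem finrank_model (hd : 1 ≤ d) : Module.finrank ℝ (WithLp 2 (ℝ × Cross d)) =
    Module.finrank ℝ (EuclideanSpace ℝ (Fin d)) := by
  rw [LinearEquiv.finrank_eq (WithLp.linearEquiv 2 ℝ (ℝ × Cross d)), Module.finrank_prod]
  simp
  omega

/-- The linear part of an affine isometry `ℝ × ℝ^{d-1} → ℝ^d`. -/
def linFrame (hd : 1 ≤ d) (U : TubeFrame d) : LinFrame d :=
  U.linearIsometry.toLinearIsometryEquiv (finrank_model hd)

theorem frame_apply (hd : 1 ≤ d) (U : TubeFrame d) (z : WithLp 2 (ℝ × Cross d)) :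
    U z = U 0 + linFrame hd U z := by
  have := U.map_vadd 0 z
  rw [vadd_eq_add, add_zero, vadd_eq_add] at this
  rw [this, add_comm]
  rfl

/-- The measurable isomorphism `(s, w) ↦ x₀ + L (s, w)`. -/
def frameEquiv (L : LinFrame d) (x₀ : EuclideanSpace ℝ (Fin d)) :
    ℝ × Cross d ≃ᵐ EuclideanSpace ℝ (Fin d) :=
  ((MeasurableEquiv.toLp 2 (ℝ × Cross d)).trans L.toHomeomorph.toMeasurableEquiv).trans
    (Homeomorph.addLeft x₀).toMeasurableEquiv

theorem frameEquiv_apply (L : LinFrame d) (x₀ : EuclideanSpace ℝ (Fin d)) (z : ℝ × Cross d) :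
    frameEquiv L x₀ z = x₀ + L (WithLp.toLp 2 z) := rfl

theorem measurePreserving_frameEquiv (L : LinFrame d) (x₀ : EuclideanSpace ℝ (Fin d)) :
    MeasurePreserving (frameEquiv L x₀) :=
  ((measurePreserving_add_left volume x₀).comp L.measurePreserving).comp
    (WithLp.volume_preserving_toLp (U := ℝ) (V := Cross d))

theorem inner_frame (L : LinFrame d) (z z' : ℝ × Cross d) :
    ⟪L (WithLp.toLp 2 z), L (WithLp.toLp 2 z')⟫_ℝ = z.1 * z'.1 + ⟪z.2, z'.2⟫_ℝ := by
  rw [L.inner_map_map, WithLp.prod_inner_apply]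
  simp [mul_comm]

theorem norm_frame_sq (L : LinFrame d) (z : ℝ × Cross d) :
    ‖L (WithLp.toLp 2 z)‖ ^ 2 = z.1 ^ 2 + ‖z.2‖ ^ 2 := by
  rw [← real_inner_self_eq_norm_sq, inner_frame, real_inner_self_eq_norm_sq, ← sq]

/-- A smooth bump function positive exactly on `(0, 1)`. -/
def axisBump : ContDiffBump (1 / 2 : ℝ) := ⟨1 / 4, 1 / 2, by norm_num, by norm_num⟩

/-- A smooth bump function supported on the unit ball. -/
def crossBump (d : ℕ) : ContDiffBump (0 : Cross d) := ⟨1 / 2, 1, by norm_num, by norm_num⟩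

/-- The inverse Fourier transform of `axisBump`. -/
def axisHat : 𝓢(ℝ, ℂ) :=
  𝓕⁻ ((axisBump.hasCompactSupport.comp_left (g := Complex.ofReal) Complex.ofReal_zero).toSchwartzMap
    (Complex.ofRealCLM.contDiff.comp axisBump.contDiff))

/-- The inverse Fourier transform of `crossBump`. -/
def crossHat (d : ℕ) : 𝓢(Cross d, ℂ) :=
  𝓕⁻ (((crossBump d).hasCompactSupport.comp_left (g := Complex.ofReal)
    Complex.ofReal_zero).toSchwartzMap (Complex.ofRealCLM.contDiff.comp (crossBump d).contDiff))

theorem axisHat_apply (s : ℝ) : axisHat s = ∫ t : ℝ, (axisBump t : ℂ) * (𝐞 (t * s) : ℂ) := by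
  rw [axisHat, SchwartzMap.fourierInv_coe, Real.fourierInv_eq]
  refine integral_congr_ae (Filter.Eventually.of_forall fun t => ?_)
  simp only [Circle.smul_def, smul_eq_mul, RCLike.inner_apply, conj_trivial]
  rw [mul_comm, mul_comm s t]
  rfl

theorem crossHat_apply (w : Cross d) :
    crossHat d w = ∫ v : Cross d, (crossBump d v : ℂ) * (𝐞 ⟪v, w⟫_ℝ : ℂ) := by
  rw [crossHat, SchwartzMap.fourierInv_coe, Real.fourierInv_eq]
  refine integral_congr_ae (Filter.Eventually.of_forall fun t => ?_)
  simp only [Circle.smul_def, smul_eq_mul]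
  rw [mul_comm]
  rfl

/-- The amplitude of a wave packet in the model tube `[b, b + 1] × B(0, δ)`. -/
def modelAmp (d : ℕ) (δ b : ℝ) (z : ℝ × Cross d) : ℝ :=
  axisBump (z.1 - b) * crossBump d (δ⁻¹ • z.2)

/-- The amplitude of a wave packet in the tube with frame `U`. -/
def tubeAmp (hd : 1 ≤ d) (U : TubeFrame d) (δ b : ℝ) (ξ : EuclideanSpace ℝ (Fin d)) : ℂ :=
  (modelAmp d δ b ((frameEquiv (linFrame hd U) (U 0)).symm ξ) : ℂ)

theorem tubeAmp_frame (hd : 1 ≤ d) (U : TubeFrame d) (δ b : ℝ) (z : ℝ × Cross d) :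
    tubeAmp hd U δ b (frameEquiv (linFrame hd U) (U 0) z) = (modelAmp d δ b z : ℂ) := by
  rw [tubeAmp, MeasurableEquiv.symm_apply_apply]

theorem continuous_modelAmp (δ b : ℝ) : Continuous (modelAmp d δ b) := by
  unfold modelAmp
  exact (axisBump.continuous.comp (by fun_prop)).mul ((crossBump d).continuous.comp (by fun_prop))

theorem measurable_tubeAmp (hd : 1 ≤ d) (U : TubeFrame d) (δ b : ℝ) :
    Measurable (tubeAmp hd U δ b) :=
  Complex.measurable_ofReal.comp ((continuous_modelAmp δ b).measurable.comp
    (MeasurableEquiv.measurable _))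

theorem norm_tubeAmp_le (hd : 1 ≤ d) (U : TubeFrame d) (δ b : ℝ) (ξ : EuclideanSpace ℝ (Fin d)) :
    ‖tubeAmp hd U δ b ξ‖ ≤ 1 := by
  rw [tubeAmp, Complex.norm_real, modelAmp,
    Real.norm_of_nonneg (mul_nonneg axisBump.nonneg (crossBump d).nonneg)]
  exact mul_le_one₀ axisBump.le_one (crossBump d).nonneg (crossBump d).le_one

theorem modelAmp_ne_zero {δ b : ℝ} (hδ : 0 < δ) {z : ℝ × Cross d} (h : modelAmp d δ b z ≠ 0) :
    z.1 ∈ Set.Icc b (b + 1) ∧ ‖z.2‖ < δ := by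
  rw [modelAmp, mul_ne_zero_iff] at h
  have h1 : z.1 - b ∈ Metric.ball (1 / 2 : ℝ) (1 / 2) := by
    have := axisBump.support_eq
    rw [show axisBump.rOut = 1 / 2 from rfl] at this
    rw [← this]; exact h.1
  have h2 : δ⁻¹ • z.2 ∈ Metric.ball (0 : Cross d) 1 := by
    have := (crossBump d).support_eq
    rw [show (crossBump d).rOut = 1 from rfl] at this
    rw [← this]; exact h.2
  rw [Real.ball_eq_Ioo] at h1
  rw [mem_ball_zero_iff, norm_smul, norm_inv, Real.norm_of_nonneg hδ.le, inv_mul_lt_iff₀ hδ,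
    mul_one] at h2
  refine ⟨⟨?_, ?_⟩, h2⟩ <;> linarith [h1.1, h1.2]

theorem frame_mem_image (hd : 1 ≤ d) (U : TubeFrame d) {δ a b : ℝ} {z : ℝ × Cross d}
    (h : z.1 ∈ Set.Icc a b ∧ ‖z.2‖ < δ) :
    frameEquiv (linFrame hd U) (U 0) z ∈ U '' modelTube d a b δ :=
  ⟨WithLp.toLp 2 z, h, by rw [frame_apply hd, frameEquiv_apply]⟩

theorem tubeAmp_ne_zero (hd : 1 ≤ d) (U : TubeFrame d) {δ b : ℝ} (hδ : 0 < δ)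
    {ξ : EuclideanSpace ℝ (Fin d)} (h : tubeAmp hd U δ b ξ ≠ 0) :
    ξ ∈ U '' modelTube d b (b + 1) δ := by
  have h1 := modelAmp_ne_zero hδ (Complex.ofReal_ne_zero.1 h)
  have := frame_mem_image hd U h1
  rwa [MeasurableEquiv.apply_symm_apply] at this

theorem tubeAmp_zero_support (hd : 1 ≤ d) (U : TubeFrame d) {δ : ℝ} (hδ : 0 < δ)
    {ξ : EuclideanSpace ℝ (Fin d)} (h : ξ ∉ tube U δ) : tubeAmp hd U δ 0 ξ = 0 := by
  by_contra h'
  have := tubeAmp_ne_zero hd U hδ h'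
  rw [zero_add] at this
  exact h this

theorem tubeAmp_two_support (hd : 1 ≤ d) (U : TubeFrame d) {δ : ℝ} (hδ : 0 < δ)
    {ξ : EuclideanSpace ℝ (Fin d)} (h : ξ ∉ shiftedTube U δ) : tubeAmp hd U δ 2 ξ = 0 := by
  by_contra h'
  have := tubeAmp_ne_zero hd U hδ h'
  rw [show (2 : ℝ) + 1 = 3 by norm_num] at this
  exact h this

/-- The tube has half-length 1/2 and radius at most 1, hence stays within distance 3 of its centre,
at axial coordinate 5/2. This fixes the side 6 of the cubes and the spacing 1/6 of the lattice. -/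
theorem shiftedTube_subset_cube (U : TubeFrame d) {δ : ℝ} (hδ : δ ≤ 1) :
    ∃ a, shiftedTube U δ ⊆ cube a := by
  set c := U (WithLp.toLp 2 ((5 / 2 : ℝ), (0 : Cross d)))
  refine ⟨WithLp.toLp 2 fun i => c i - 3, ?_⟩
  rintro ξ ⟨z, ⟨hz1, hz2⟩, rfl⟩ i
  have h1 : ‖U z - c‖ < 3 := by
    rw [← dist_eq_norm, U.dist_map, dist_eq_norm, ← sq_lt_sq₀ (norm_nonneg _) (by norm_num),
      WithLp.prod_norm_sq_eq_of_L2]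
    have h3 : ‖(z - WithLp.toLp 2 ((5 / 2 : ℝ), (0 : Cross d))).fst‖ ≤ 1 / 2 := by
      have h5 : (z - WithLp.toLp 2 ((5 / 2 : ℝ), (0 : Cross d))).fst = z.fst - 5 / 2 := rfl
      rw [Real.norm_eq_abs, abs_le, h5]
      constructor <;> linarith [hz1.1, hz1.2]
    have h4 : ‖(z - WithLp.toLp 2 ((5 / 2 : ℝ), (0 : Cross d))).snd‖ ≤ 1 := by
      have h5 : (z - WithLp.toLp 2 ((5 / 2 : ℝ), (0 : Cross d))).snd = z.snd - 0 := rfl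
      rw [h5, sub_zero]
      exact hz2.le.trans hδ
    nlinarith [norm_nonneg (z - WithLp.toLp 2 ((5 / 2 : ℝ), (0 : Cross d))).fst,
      norm_nonneg (z - WithLp.toLp 2 ((5 / 2 : ℝ), (0 : Cross d))).snd]
  have h2 : |U z i - c i| < 3 := (PiLp.norm_apply_le (U z - c) i).trans_lt h1
  rw [abs_lt] at h2
  simp only
  constructor <;> linarith [h2.1, h2.2]

theorem volume_image_modelTube (hd : 1 ≤ d) (U : TubeFrame d) (δ : ℝ) {a b : ℝ} :
    volume (U '' modelTube d a b δ) =
      ENNReal.ofReal (b - a) * volume (Metric.ball (0 : Cross d) δ) := by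
  have h := (measurePreserving_frameEquiv (linFrame hd U) (U 0)).measure_preimage_equiv
    (U '' modelTube d a b δ)
  rw [← h]
  have : frameEquiv (linFrame hd U) (U 0) ⁻¹' (U '' modelTube d a b δ) =
      Set.Icc a b ×ˢ Metric.ball (0 : Cross d) δ := by
    ext z
    constructor
    · rintro ⟨y, hy, hyz⟩
      rw [frameEquiv_apply, ← frame_apply hd] at hyz
      have := U.injective hyz
      subst this
      exact ⟨hy.1, mem_ball_zero_iff.2 hy.2⟩
    · rintro ⟨h1, h2⟩
      exact frame_mem_image hd U ⟨h1, mem_ball_zero_iff.1 h2⟩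
  rw [this, Measure.volume_eq_prod, Measure.prod_prod, Real.volume_Icc]

theorem volume_image_modelTube_lt_top (hd : 1 ≤ d) (U : TubeFrame d) (δ : ℝ) {a b : ℝ} :
    volume (U '' modelTube d a b δ) < ⊤ := by
  rw [volume_image_modelTube hd]
  exact ENNReal.mul_lt_top ENNReal.ofReal_lt_top measure_ball_lt_top

theorem memLp_of_bounded_of_support {X : Type*} [MeasurableSpace X] {μ : Measure X} {f : X → ℂ}
    (hf : Measurable f) (h1 : ∀ x, ‖f x‖ ≤ 1) {s : Set X} (hs : μ s < ⊤)
    (h2 : ∀ x, x ∉ s → f x = 0) (p : ℝ≥0∞) : MemLp f p μ := by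
  have hs' : MeasurableSet {x | f x ≠ 0} := hf (measurableSet_singleton 0).compl
  have hsub : {x | f x ≠ 0} ⊆ s := fun x hx => by
    by_contra h; exact hx (h2 x h)
  have h3 : f = {x | f x ≠ 0}.indicator f := by
    ext x
    by_cases hx : f x = 0 <;> simp [hx]
  rw [h3, memLp_indicator_iff_restrict hs']
  have : IsFiniteMeasure (μ.restrict {x | f x ≠ 0}) :=
    ⟨by rw [Measure.restrict_apply_univ]; exact (measure_mono hsub).trans_lt hs⟩
  exact MemLp.of_bound hf.aestronglyMeasurable 1 (Filter.Eventually.of_forall h1)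

theorem memLp_tubeAmp (hd : 1 ≤ d) (U : TubeFrame d) {δ : ℝ} (hδ : 0 < δ) (b : ℝ) (p : ℝ≥0∞) :
    MemLp (tubeAmp hd U δ b) p :=
  memLp_of_bounded_of_support (measurable_tubeAmp hd U δ b) (norm_tubeAmp_le hd U δ b)
    (volume_image_modelTube_lt_top hd U δ) (fun ξ hξ => by
      by_contra h
      exact hξ (tubeAmp_ne_zero hd U hδ h)) p

theorem lintegral_tubeAmp_sq_le (hd : 1 ≤ d) (U : TubeFrame d) {δ : ℝ} (hδ : 0 < δ) (b : ℝ) :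
    ∫⁻ ξ, ‖tubeAmp hd U δ b ξ‖ₑ ^ 2 ≤ volume (Metric.ball (0 : Cross d) δ) := by
  rw [← (measurePreserving_frameEquiv (linFrame hd U) (U 0)).lintegral_comp_emb
    (MeasurableEquiv.measurableEmbedding _)]
  calc ∫⁻ z, ‖tubeAmp hd U δ b (frameEquiv (linFrame hd U) (U 0) z)‖ₑ ^ 2
      ≤ ∫⁻ z, (Set.Icc b (b + 1) ×ˢ Metric.ball (0 : Cross d) δ).indicator 1 z := by
        refine lintegral_mono fun z => ?_
        by_cases hz : modelAmp d δ b z = 0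
        · simp [tubeAmp_frame, hz]
        · have := modelAmp_ne_zero hδ hz
          have hmem : z ∈ Set.Icc b (b + 1) ×ˢ Metric.ball (0 : Cross d) δ :=
            ⟨this.1, mem_ball_zero_iff.2 this.2⟩
          rw [Set.indicator_of_mem hmem]
          refine pow_le_one₀ (by simp) ?_
          rw [← ofReal_norm, ENNReal.ofReal_le_one]
          exact norm_tubeAmp_le hd U δ b _
    _ = _ := by
        rw [lintegral_indicator_one (measurableSet_Icc.prod measurableSet_ball),
          Measure.volume_eq_prod, Measure.prod_prod, Real.volume_Icc]
        simp

/-- In the coordinates of the frame the amplitude is a tensor product. The base point contributes a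
phase, the shift b along the axis a modulation, and the dilation by δ a spreading over width 1/δ. -/
theorem fourierInv_tubeAmp (hd : 1 ≤ d) (U : TubeFrame d) {δ : ℝ} (hδ : 0 < δ) (b : ℝ)
    (z : ℝ × Cross d) :
    𝓕⁻ (tubeAmp hd U δ b) (linFrame hd U (WithLp.toLp 2 z)) =
      wave (U 0) (linFrame hd U (WithLp.toLp 2 z)) * ((𝐞 (b * z.1) : ℂ) * axisHat z.1) *
        (((δ ^ (d - 1) : ℝ) : ℂ) * crossHat d (δ • z.2)) := by
  set L := linFrame hd U
  rw [fourierInv_eq_wave]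
  rw [← (measurePreserving_frameEquiv L (U 0)).integral_comp' (g := fun ξ =>
    tubeAmp hd U δ b ξ * wave ξ (L (WithLp.toLp 2 z)))]
  have h1 : ∀ y : ℝ × Cross d, tubeAmp hd U δ b (frameEquiv L (U 0) y) *
      wave (frameEquiv L (U 0) y) (L (WithLp.toLp 2 z)) =
      wave (U 0) (L (WithLp.toLp 2 z)) * (((axisBump (y.1 - b) : ℂ) * (𝐞 (y.1 * z.1) : ℂ)) *
        ((crossBump d (δ⁻¹ • y.2) : ℂ) * (𝐞 ⟪y.2, z.2⟫_ℝ : ℂ))) := by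
    intro y
    have hw : wave (U 0 + L (WithLp.toLp 2 y)) (L (WithLp.toLp 2 z)) =
        wave (U 0) (L (WithLp.toLp 2 z)) * ((𝐞 (y.1 * z.1) : ℂ) * (𝐞 ⟪y.2, z.2⟫_ℝ : ℂ)) := by
      simp only [wave]
      rw [inner_add_left, inner_frame, AddChar.map_add_eq_mul, AddChar.map_add_eq_mul,
        Circle.coe_mul, Circle.coe_mul]
    rw [tubeAmp_frame, frameEquiv_apply, hw, modelAmp]
    push_cast; ring
  simp_rw [h1]
  rw [integral_const_mul, Measure.volume_eq_prod,
    integral_prod_mul (fun t : ℝ => (axisBump (t - b) : ℂ) * (𝐞 (t * z.1) : ℂ))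
      (fun v : Cross d => (crossBump d (δ⁻¹ • v) : ℂ) * (𝐞 ⟪v, z.2⟫_ℝ : ℂ)), mul_assoc]
  congr 2
  · rw [axisHat_apply, ← integral_const_mul, ← integral_add_right_eq_self _ b]
    refine integral_congr_ae (Filter.Eventually.of_forall fun t => ?_)
    simp only [add_sub_cancel_right, add_mul, AddChar.map_add_eq_mul, Circle.coe_mul]
    ring
  · rw [crossHat_apply]
    have h2 := Measure.integral_comp_inv_smul_of_nonneg (volume : Measure (Cross d))
      (fun v : Cross d => (crossBump d v : ℂ) * (𝐞 ⟪v, δ • z.2⟫_ℝ : ℂ)) hδ.le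
    rw [finrank_euclideanSpace_fin, Complex.real_smul] at h2
    rw [← h2]
    refine integral_congr_ae (Filter.Eventually.of_forall fun v => ?_)
    have h3 : ⟪δ⁻¹ • v, δ • z.2⟫_ℝ = ⟪v, z.2⟫_ℝ := by
      rw [real_inner_smul_left, real_inner_smul_right, ← mul_assoc, inv_mul_cancel₀ hδ.ne', one_mul]
    simp only [h3]

end Frames

/-! ### The estimate for a family of tubes -/

section TubeFamily

variable {d : ℕ}

/-- The function `e^{4πis} |φ̌(s)|²`, where `φ` is `axisBump`. -/
def axisKernel (s : ℝ) : ℂ := (𝐞 (2 * s) : ℂ) * ((‖axisHat s‖ ^ 2 : ℝ) : ℂ)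

/-- The dilated kernel in the directions orthogonal to a tube. -/
def crossKernel (d : ℕ) (δ : ℝ) (w : Cross d) : ℝ := (δ ^ (d - 1)) ^ 2 * ‖crossHat d (δ • w)‖ ^ 2

/-- `axisKernel`, conjugated if `p ≥ 2`. -/
def axisKernelOf (p : ℝ≥0∞) (s : ℝ) : ℂ :=
  if p < 2 then axisKernel s else starRingEnd ℂ (axisKernel s)

/-- The product of the wave packets of a tube and of the shifted tube. -/
def tubeKernel (p : ℝ≥0∞) (L : LinFrame d) (δ : ℝ) (z : EuclideanSpace ℝ (Fin d)) : ℂ :=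
  axisKernelOf p ((frameEquiv L 0).symm z).1 *
    (crossKernel d δ ((frameEquiv L 0).symm z).2 : ℂ)

/-- The amplitude of a wave packet translated to `latticePt n`. -/
def shiftAmp (hd : 1 ≤ d) (U : TubeFrame d) (δ b : ℝ) (n : Fin d → ℕ)
    (ξ : EuclideanSpace ℝ (Fin d)) : ℂ :=
  tubeAmp hd U δ b ξ * starRingEnd ℂ (wave ξ (latticePt n))

theorem measurable_conj_wave (k : EuclideanSpace ℝ (Fin d)) :
    Measurable fun ξ => starRingEnd ℂ (wave ξ k) :=
  (RCLike.continuous_conj.comp (continuous_wave.comp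
    (by fun_prop : Continuous fun ξ => (ξ, k)))).measurable

theorem measurable_shiftAmp (hd : 1 ≤ d) (U : TubeFrame d) (δ b : ℝ) (n : Fin d → ℕ) :
    Measurable (shiftAmp hd U δ b n) :=
  (measurable_tubeAmp hd U δ b).mul (measurable_conj_wave _)

theorem norm_shiftAmp (hd : 1 ≤ d) (U : TubeFrame d) (δ b : ℝ) (n : Fin d → ℕ)
    (ξ : EuclideanSpace ℝ (Fin d)) : ‖shiftAmp hd U δ b n ξ‖ = ‖tubeAmp hd U δ b ξ‖ := by
  rw [shiftAmp, norm_mul, RCLike.norm_conj, norm_wave, mul_one]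

theorem memLp_shiftAmp (hd : 1 ≤ d) (U : TubeFrame d) {δ : ℝ} (hδ : 0 < δ) (b : ℝ)
    (n : Fin d → ℕ) (p : ℝ≥0∞) : MemLp (shiftAmp hd U δ b n) p :=
  (memLp_tubeAmp hd U hδ b p).of_le (measurable_shiftAmp hd U δ b n).aestronglyMeasurable
    (Filter.Eventually.of_forall fun ξ => (norm_shiftAmp hd U δ b n ξ).le)

theorem integrable_shiftAmp (hd : 1 ≤ d) (U : TubeFrame d) {δ : ℝ} (hδ : 0 < δ) (b : ℝ)
    (n : Fin d → ℕ) : Integrable (shiftAmp hd U δ b n) :=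
  memLp_one_iff_integrable.1 (memLp_shiftAmp hd U hδ b n 1)

theorem fourierInv_shiftAmp (hd : 1 ≤ d) (U : TubeFrame d) (δ b : ℝ) (n : Fin d → ℕ)
    (h : EuclideanSpace ℝ (Fin d)) :
    𝓕⁻ (shiftAmp hd U δ b n) h = 𝓕⁻ (tubeAmp hd U δ b) (h - latticePt n) := by
  rw [fourierInv_eq_wave, fourierInv_eq_wave]
  refine integral_congr_ae (Filter.Eventually.of_forall fun ξ => ?_)
  simp only [shiftAmp, wave_sub]
  ring

theorem lintegral_shiftAmp_sq_le (hd : 1 ≤ d) (U : TubeFrame d) {δ : ℝ} (hδ : 0 < δ) (b : ℝ)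
    (n : Fin d → ℕ) :
    ∫⁻ ξ, ‖shiftAmp hd U δ b n ξ‖ₑ ^ 2 ≤ volume (Metric.ball (0 : Cross d) δ) := by
  refine le_trans (le_of_eq (lintegral_congr fun ξ => ?_)) (lintegral_tubeAmp_sq_le hd U hδ b)
  rw [← ofReal_norm, norm_shiftAmp, ofReal_norm]

/-- Both packets share a frame, so the phase of the base point cancels. What remains of the shift
from b = 0 to b = 2 is the modulation of `axisKernel`; the product depends on U only through its
linear part. -/
theorem pairTerm_fourierInv (hd : 1 ≤ d) (U : TubeFrame d) {δ : ℝ} (hδ : 0 < δ) (p : ℝ≥0∞)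
    (z : EuclideanSpace ℝ (Fin d)) :
    pairTerm p (𝓕⁻ (tubeAmp hd U δ 0) z) (𝓕⁻ (tubeAmp hd U δ 2) z) =
      tubeKernel p (linFrame hd U) δ z := by
  set L := linFrame hd U
  obtain ⟨y, rfl⟩ := (frameEquiv L 0).surjective z
  have key : starRingEnd ℂ (𝓕⁻ (tubeAmp hd U δ 0) (frameEquiv L 0 y)) *
      𝓕⁻ (tubeAmp hd U δ 2) (frameEquiv L 0 y) =
      axisKernel y.1 * (crossKernel d δ y.2 : ℂ) := by
    rw [frameEquiv_apply, zero_add, fourierInv_tubeAmp hd U hδ, fourierInv_tubeAmp hd U hδ]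
    have h1 : ∀ a : ℂ, starRingEnd ℂ a * a = ((‖a‖ ^ 2 : ℝ) : ℂ) := fun a => by
      rw [mul_comm, Complex.mul_conj, Complex.normSq_eq_norm_sq]
    have h2 := h1 (wave (U 0) (L (WithLp.toLp 2 y)))
    rw [norm_wave] at h2
    have h3 := h1 (axisHat y.1)
    have h4 := h1 (crossHat d (δ • y.2))
    simp only [zero_mul, AddChar.map_zero_eq_one, Circle.coe_one, one_mul, map_mul,
      Complex.conj_ofReal, axisKernel, crossKernel]
    push_cast at h2 h3 h4 ⊢
    rw [← h3, ← h4]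
    linear_combination (starRingEnd ℂ (axisHat y.1)) * (axisHat y.1) * (𝐞 (2 * y.1) : ℂ) *
      ((δ : ℂ) ^ (d - 1)) ^ 2 * (starRingEnd ℂ (crossHat d (δ • y.2))) * crossHat d (δ • y.2) * h2
  have key' := congrArg (starRingEnd ℂ) key
  rw [map_mul, map_mul, Complex.conj_conj, Complex.conj_ofReal] at key'
  rw [pairTerm, tubeKernel, axisKernelOf, MeasurableEquiv.symm_apply_apply]
  split_ifs
  · exact key
  · rw [← key']; ring

/-- Disjointness of the shifted tubes makes the translated wave packets almost orthogonal. -/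
theorem sum_enorm_inner_shifted_le (hd : 1 ≤ d) {N : ℕ} (U : Fin N → TubeFrame d) {δ : ℝ}
    (hδ : 0 < δ) (hδ1 : δ ≤ 1)
    (hU : Pairwise fun i j => Disjoint (shiftedTube (U i) δ) (shiftedTube (U j) δ)) {r : ℝ} (T : ℕ)
    (u : Lp ℂ 2 (ballMeasure d r)) :
    ∑ c : Fin N × (Fin d → Fin T),
      ‖⟪u, wavePacket r (integrable_shiftAmp hd (U c.1) hδ 2 fun i => (c.2 i : ℕ))⟫_ℂ‖ₑ ^ 2 ≤
      ENNReal.ofReal (6 ^ d) * ‖u‖ₑ ^ 2 := by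
  -- For a fixed tube, the coefficients over the lattice are Fourier coefficients of W j on a cube
  -- of side 6.
  set W : Fin N → EuclideanSpace ℝ (Fin d) → ℂ := fun j ξ =>
    tubeAmp hd (U j) δ 2 ξ * ⟪u, planeWave r ξ⟫_ℂ
  have hfin : ∫⁻ ξ, ‖⟪u, planeWave r ξ⟫_ℂ‖ₑ ^ 2 = ‖u‖ₑ ^ 2 := lintegral_inner_planeWave_sq u
  have hG : MemLp (fun ξ => ⟪u, planeWave r ξ⟫_ℂ) 2 := by
    refine ⟨(continuous_inner_planeWave u).aestronglyMeasurable, ?_⟩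
    rw [eLpNorm_lt_top_iff_lintegral_rpow_enorm_lt_top (by simp) (by simp)]
    simp only [ENNReal.toReal_ofNat, ENNReal.rpow_ofNat, hfin]
    finiteness
  have hWm : ∀ j, MemLp (W j) 2 := fun j =>
    hG.of_le ((measurable_tubeAmp hd (U j) δ 2).aestronglyMeasurable.mul hG.1)
      (Filter.Eventually.of_forall fun ξ => by
        rw [norm_mul]
        exact mul_le_of_le_one_left (norm_nonneg _) (norm_tubeAmp_le hd (U j) δ 2 ξ))
  have hsum : ∀ j, ∑ n : Fin d → Fin T,
      ‖⟪u, wavePacket r (integrable_shiftAmp hd (U j) hδ 2 fun i => (n i : ℕ))⟫_ℂ‖ₑ ^ 2 ≤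
      ENNReal.ofReal (6 ^ d) * ∫⁻ ξ, ‖W j ξ‖ₑ ^ 2 := fun j => by
    obtain ⟨a, ha⟩ := shiftedTube_subset_cube (U j) hδ1
    have := sum_enorm_integral_wave_le (ι := Fin d → Fin T) (n := fun n i => (n i : ℕ))
      (fun n n' h => funext fun i => Fin.ext (congrFun h i)) a (hWm j) (fun ξ hξ => by
        simp only [W]
        rw [tubeAmp_two_support hd (U j) hδ fun h => hξ (ha h), zero_mul])
    refine le_trans (le_of_eq (Finset.sum_congr rfl fun n _ => ?_)) this
    rw [inner_wavePacket]
    congr 2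
    refine integral_congr_ae (Filter.Eventually.of_forall fun ξ => ?_)
    simp only [W, shiftAmp]; ring
  rw [Fintype.sum_prod_type]
  calc _ ≤ ∑ j, ENNReal.ofReal (6 ^ d) * ∫⁻ ξ, ‖W j ξ‖ₑ ^ 2 := Finset.sum_le_sum fun j _ => hsum j
    _ = ENNReal.ofReal (6 ^ d) * ∫⁻ ξ, ∑ j, ‖W j ξ‖ₑ ^ 2 := by
        rw [← Finset.mul_sum, lintegral_finsetSum']
        exact fun j _ => (hWm j).1.enorm.pow_const _
    -- At most one shifted tube contains ξ, so at most one summand is nonzero there.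
    _ ≤ ENNReal.ofReal (6 ^ d) * ∫⁻ ξ, ‖⟪u, planeWave r ξ⟫_ℂ‖ₑ ^ 2 := by
        gcongr with ξ
        by_cases h : ∃ j, ξ ∈ shiftedTube (U j) δ
        · obtain ⟨j, hj⟩ := h
          rw [Finset.sum_eq_single j]
          · gcongr
            rw [enorm_le_iff_norm_le, norm_mul]
            exact mul_le_of_le_one_left (norm_nonneg _) (norm_tubeAmp_le hd (U j) δ 2 ξ)
          · intro i _ hij
            have : ξ ∉ shiftedTube (U i) δ := fun hi => Set.disjoint_left.1 (hU hij) hi hj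
            simp only [W]
            rw [tubeAmp_two_support hd (U i) hδ this]; simp
          · simp
        · push Not at h
          refine le_trans (le_of_eq (Finset.sum_eq_zero fun j _ => ?_)) zero_le
          simp only [W]
          rw [tubeAmp_two_support hd (U j) hδ (h j)]; simp
    _ = _ := by rw [hfin]

/-- Each packet has squared norm at most v, the measure of B(0, δ), so F = S = P = T^d N v. The mass
of the plane waves over ⋃ R_j is at most D = |ball| ε N v, and β = 6^d. The general bound becomes P
(βD/P)^a with a = |1/p - 1/2|, where N and v cancel in the quotient. -/
theorem norm_sum_column_le (hd : 1 ≤ d) {p : ℝ≥0∞} (hp : 1 ≤ p) {m : ℝ → ℂ}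
    (hm : Measurable m) {Mb : ℝ} (hMb : ∀ z, ‖m z‖ ≤ Mb) (hK : sphSchurNorm d p m ≠ ⊤)
    {N : ℕ} (hN : 0 < N) (U : Fin N → TubeFrame d) {δ : ℝ} (hδ : 0 < δ) (hδ1 : δ ≤ 1)
    (hU : Pairwise fun i j => Disjoint (shiftedTube (U i) δ) (shiftedTube (U j) δ))
    {ε : ℝ} (hε : 0 < ε)
    (hUε : volume.real (⋃ j, tube (U j) δ) / ∑ j, volume.real (tube (U j) δ) ≤ ε)
    {l r : ℝ} (hl : 0 < l) (hr : 0 < r) (hrl : r ≤ l) {T : ℕ} (hT : 0 < T)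
    (x : Fin N → (Fin d → Fin T) → Sph d) :
    ‖∑ c : Fin N × (Fin d → Fin T), ∫ h in Metric.ball (0 : EuclideanSpace ℝ (Fin d)) r,
      m (sphInner (x c.1 c.2) (chart l h)) *
        tubeKernel p (linFrame hd (U c.1)) δ (h - latticePt fun i => (c.2 i : ℕ))‖ ≤
      (sphSchurNorm d p m).toReal * ((T : ℝ) ^ d * N * volume.real (Metric.ball (0 : Cross d) δ) *
        (6 ^ d * volume.real (Metric.ball (0 : EuclideanSpace ℝ (Fin d)) r) * ε / T ^ d) ^ pExp p) := by
  set v := volume.real (Metric.ball (0 : Cross d) δ) with hv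
  have hv0 : 0 < v := ENNReal.toReal_pos (Metric.measure_ball_pos _ _ hδ).ne' measure_ball_lt_top.ne
  have hve : volume (Metric.ball (0 : Cross d) δ) = ENNReal.ofReal v :=
    (ENNReal.ofReal_toReal measure_ball_lt_top.ne).symm
  set B := volume.real (Metric.ball (0 : EuclideanSpace ℝ (Fin d)) r) with hB
  have hB0 : 0 < B := ENNReal.toReal_pos (Metric.measure_ball_pos _ _ hr).ne' measure_ball_lt_top.ne
  have hBe : volume (Metric.ball (0 : EuclideanSpace ℝ (Fin d)) r) = ENNReal.ofReal B :=
    (ENNReal.ofReal_toReal measure_ball_lt_top.ne).symm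
  set Ξ := ⋃ j, tube (U j) δ with hΞ
  have htube : ∀ j, volume.real (tube (U j) δ) = v := fun j => by
    rw [hv, measureReal_def, measureReal_def, tube, volume_image_modelTube hd]
    simp
  have htubetop : ∀ j, volume (tube (U j) δ) < ⊤ := fun j => volume_image_modelTube_lt_top hd _ _
  have hΞtop : volume Ξ ≠ ⊤ := by
    refine ((measure_iUnion_fintype_le _ _).trans_lt ?_).ne
    exact ENNReal.sum_lt_top.2 fun j _ => htubetop j
  have hΞr : volume.real Ξ ≤ ε * (N * v) := by
    have h1 : ∑ j, volume.real (tube (U j) δ) = N * v := by simp [htube]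
    rw [h1, div_le_iff₀ (by positivity)] at hUε
    exact hUε
  have hΞe : volume Ξ ≤ ENNReal.ofReal (ε * (N * v)) := by
    rw [← ENNReal.ofReal_toReal hΞtop]
    exact ENNReal.ofReal_le_ofReal hΞr
  set P : ℝ := (T : ℝ) ^ d * N * v with hP
  have hP0 : 0 < P := by positivity
  have hcard : (Fintype.card (Fin N × (Fin d → Fin T)) : ℝ) * v = P := by
    rw [hP, Fintype.card_prod, Fintype.card_pi]
    simp only [Fintype.card_fin, Finset.prod_const, Finset.card_univ]
    push_cast; ring
  have hsumv : ∑ _c : Fin N × (Fin d → Fin T), ENNReal.ofReal v = ENNReal.ofReal P := by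
    rw [← hcard, Finset.sum_const, Finset.card_univ, nsmul_eq_mul,
      ENNReal.ofReal_mul (by positivity), ENNReal.ofReal_natCast]
  have hpe0 : 0 ≤ pExp p := abs_nonneg _
  have main := norm_sum_integral_chart_le (Y := EuclideanSpace ℝ (Fin d)) (ν := ballMeasure d r)
    hd hp hm hMb hK (continuous_chart l).measurable
    (continuous_chartInv l).measurable
    ((ae_restrict_iff' measurableSet_ball).2 (Filter.Eventually.of_forall fun h hh =>
      chartInv_chart hl ((mem_ball_zero_iff.1 hh).trans_le hrl)))
    (map_chart_absolutelyContinuous hl hrl) (C := Fin N × (Fin d → Fin T))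
    (fun c => x c.1 c.2) (τ := volume.restrict Ξ) (v := planeWave r)
    (f := fun c => shiftAmp hd (U c.1) δ 0 fun i => (c.2 i : ℕ))
    (α := fun c => wavePacket r (integrable_shiftAmp hd (U c.1) hδ 0 fun i => (c.2 i : ℕ)))
    (γ := fun c => wavePacket r (integrable_shiftAmp hd (U c.1) hδ 2 fun i => (c.2 i : ℕ)))
    (F := P) (D := B * (ε * (N * v))) (β := 6 ^ d) (S := P) (isBessel_planeWave Ξ)
    (fun c => (measurable_shiftAmp hd _ _ _ _).aemeasurable)
    (fun u c => by
      rw [inner_wavePacket, setIntegral_eq_integral_of_forall_compl_eq_zero]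
      intro ξ hξ
      rw [shiftAmp, tubeAmp_zero_support hd _ hδ fun h => hξ (Set.mem_iUnion.2 ⟨_, h⟩), zero_mul,
        zero_mul]) hP0.le (by positivity) (by positivity) hP0.le
    (by
      rw [← hsumv]
      refine Finset.sum_le_sum fun c _ => ?_
      rw [← hve]
      exact (setLIntegral_le_lintegral _ _).trans (lintegral_shiftAmp_sq_le hd _ hδ _ _))
    (by
      simp only [enorm_planeWave_sq, lintegral_const, Measure.restrict_apply_univ]
      rw [ENNReal.ofReal_mul hB0.le, hBe]
      gcongr)
    (sum_enorm_inner_shifted_le hd U hδ hδ1 hU T)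
    (by
      rw [← hsumv]
      refine Finset.sum_le_sum fun c _ => ?_
      have hf2 := memLp_shiftAmp hd (U c.1) hδ 2 (fun i => (c.2 i : ℕ)) 2
      have hf1 := integrable_shiftAmp hd (U c.1) hδ 2 (fun i => (c.2 i : ℕ))
      rw [← lintegral_sq_Lp, ← hve]
      refine le_trans ?_ (lintegral_shiftAmp_sq_le hd (U c.1) hδ 2 fun i => (c.2 i : ℕ))
      rw [← lintegral_fourier_sq hf1 hf2,
        ← (Measure.measurePreserving_neg volume).lintegral_comp_emb
          (MeasurableEquiv.neg _).measurableEmbedding]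
      refine le_trans (le_of_eq (lintegral_congr_ae ?_)) (setLIntegral_le_lintegral
        (Metric.ball (0 : EuclideanSpace ℝ (Fin d)) r) _)
      filter_upwards [wavePacket_coe hf1] with h hh
      rw [hh, Real.fourierInv_eq_fourier_neg])
  refine le_trans (le_of_eq ?_) (main.trans (le_of_eq ?_))
  · congr 1
    refine Finset.sum_congr rfl fun c _ => ?_
    refine integral_congr_ae ?_
    filter_upwards [wavePacket_coe (r := r) (integrable_shiftAmp hd (U c.1) hδ 0
      fun i => (c.2 i : ℕ)), wavePacket_coe (r := r) (integrable_shiftAmp hd (U c.1) hδ 2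
      fun i => (c.2 i : ℕ))] with h h1 h2
    rw [h1, h2, fourierInv_shiftAmp, fourierInv_shiftAmp, pairTerm_fourierInv hd _ hδ]
  · congr 1
    set a := pExp p
    have e1 : P * (6 ^ d * B * ε / T ^ d) ^ a = P * ((6 ^ d * (B * (ε * (N * v)))) / P) ^ a := by
      congr 2
      rw [hP]; field_simp
    have e2 : √P * P ^ (1 / 2 - a) = P / P ^ a := by
      rw [Real.sqrt_eq_rpow, ← Real.rpow_add hP0, show (1 / 2 : ℝ) + (1 / 2 - a) = 1 - a by ring,
        Real.rpow_sub hP0, Real.rpow_one]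
    have e3 : 0 ≤ B * (ε * (N * v)) := by positivity
    rw [e1, Real.div_rpow (mul_nonneg (by positivity) e3) hP0.le,
      Real.mul_rpow (by positivity) e3]
    generalize (B * (ε * (N * v))) ^ a = Y
    linear_combination (Y * (6 ^ d : ℝ) ^ a) * e2

end TubeFamily

/-! ### A perturbed change of variables on the line -/

section ChangeOfVariables

/-- Decay of a function and of its Lipschitz constant. -/
structure KernelDecay (H : ℝ → ℂ) (A : ℝ) : Prop where
  continuous : Continuous H
  bound : ∀ s, ‖H s‖ ≤ A * ((1 + s ^ 2)⁻¹) ^ 2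
  lip : ∀ s s', |s' - s| ≤ 1 → ‖H s - H s'‖ ≤ A * |s' - s| * (1 + s ^ 2)⁻¹

variable {H : ℝ → ℂ} {A : ℝ}

theorem KernelDecay.nonneg (hH : KernelDecay H A) : 0 ≤ A := by
  have := (norm_nonneg _).trans (hH.bound 0)
  simpa using this

theorem KernelDecay.bound' (hH : KernelDecay H A) (s : ℝ) : ‖H s‖ ≤ A * (1 + s ^ 2)⁻¹ := by
  refine (hH.bound s).trans (mul_le_mul_of_nonneg_left ?_ hH.nonneg)
  have h1 : (1 + s ^ 2)⁻¹ ≤ 1 := inv_le_one_of_one_le₀ (by nlinarith)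
  have h0 : 0 ≤ (1 + s ^ 2)⁻¹ := by positivity
  nlinarith

theorem KernelDecay.tail (hH : KernelDecay H A) {R s : ℝ} (hR : 0 < R) (hs : R ≤ |s|) :
    ‖H s‖ ≤ A / R * (1 + s ^ 2)⁻¹ := by
  refine (hH.bound s).trans ?_
  rw [div_mul_eq_mul_div, le_div_iff₀ hR, sq, mul_assoc, mul_assoc]
  refine mul_le_mul_of_nonneg_left ?_ hH.nonneg
  have h0 : 0 ≤ (1 + s ^ 2)⁻¹ := by positivity
  have h1 : (1 + s ^ 2)⁻¹ * R ≤ 1 := by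
    rw [inv_mul_le_iff₀ (by positivity), mul_one]
    nlinarith [sq_abs s, abs_nonneg s]
  nlinarith

theorem KernelDecay.integrable (hH : KernelDecay H A) : Integrable H :=
  (integrable_inv_one_add_sq.const_mul A).mono' hH.continuous.aestronglyMeasurable
    (Filter.Eventually.of_forall hH.bound')

theorem KernelDecay.integral_norm_le (hH : KernelDecay H A) : ∫ s, ‖H s‖ ≤ A * Real.pi := by
  rw [← integral_univ_inv_one_add_sq, ← integral_const_mul]
  exact integral_mono hH.integrable.norm (integrable_inv_one_add_sq.const_mul A) hH.bound'

theorem norm_setIntegral_le_const_mul_pi {S : Set ℝ} (hS : MeasurableSet S) {F : ℝ → ℂ} {c : ℝ}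
    (hc : 0 ≤ c) (hF : ∀ s ∈ S, ‖F s‖ ≤ c * (1 + s ^ 2)⁻¹) : ‖∫ s in S, F s‖ ≤ c * Real.pi := by
  have hi := integrable_inv_one_add_sq.const_mul c
  rw [← integral_univ_inv_one_add_sq, ← integral_const_mul]
  refine (norm_integral_le_of_norm_le hi.integrableOn
    ((ae_restrict_iff' hS).2 (Filter.Eventually.of_forall hF))).trans ?_
  exact setIntegral_le_integral hi (Filter.Eventually.of_forall fun s => by positivity)

/-- Since f is only measurable, f(τ s) cannot be compared with f(s) pointwise. A change of variables
moves the perturbation onto the kernel H, which is Lipschitz. The parts beyond (-R, R), or outside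
its image, are small by decay. -/
theorem norm_setIntegral_comp_sub_le (hH : KernelDecay H A) {f f₁ : ℝ → ℂ} (hf : Measurable f)
    (hf₁ : Measurable f₁) {K : ℝ} (hfK : ∀ s, ‖f s‖ ≤ K) (hf₁K : ∀ s, ‖f₁ s‖ ≤ K) {S : Set ℝ}
    (hS : MeasurableSet S) {R η : ℝ} (hR : 1 ≤ R) (hSR : Set.Ioo (-R) R ⊆ S) (hη : 0 ≤ η)
    (hη2 : η ≤ 1 / 2) {τ τ' : ℝ → ℝ} (hτ : ∀ s ∈ Set.Ioo (-R) R, HasDerivAt τ (τ' s) s)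
    (hτ1 : ∀ s ∈ Set.Ioo (-R) R, |τ' s - 1| ≤ η) (hτ2 : ∀ s ∈ Set.Ioo (-R) R, |τ s - s| ≤ η)
    (hτf : ∀ s ∈ Set.Ioo (-R) R, f₁ s = f (τ s)) :
    ‖(∫ s in S, f₁ s * H s) - ∫ s, f s * H s‖ ≤ 3 * Real.pi * K * A * (η + 1 / R) := by
  set J := Set.Ioo (-R) R with hJ
  have hA := hH.nonneg
  have hK : 0 ≤ K := (norm_nonneg _).trans (hfK 0)
  have hR0 : 0 < R := by linarith
  have hJm : MeasurableSet J := measurableSet_Ioo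
  have hτc : ContinuousOn τ J := fun s hs => (hτ s hs).continuousAt.continuousWithinAt
  have hmono : StrictMonoOn τ J := by
    refine strictMonoOn_of_hasDerivWithinAt_pos (f' := τ') (convex_Ioo _ _) hτc (fun s hs => ?_)
      fun s hs => ?_
    · rw [interior_Ioo] at hs
      exact (hτ s hs).hasDerivWithinAt
    · rw [interior_Ioo] at hs
      have := abs_le.1 (hτ1 s hs)
      linarith [this.1]
  have hcv := integral_image_eq_integral_abs_deriv_smul hJm
    (fun s hs => (hτ s hs).hasDerivWithinAt) hmono.injOn fun y => f y * H y
  have hint : ∀ g : ℝ → ℂ, Measurable g → (∀ s, ‖g s‖ ≤ K) → Integrable fun s => g s * H s :=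
    fun g hg hgK => hH.integrable.bdd_mul hg.aestronglyMeasurable
      (Filter.Eventually.of_forall hgK)
  have hi := hint f hf hfK
  have hi₁ := hint f₁ hf₁ hf₁K
  have himeas : MeasurableSet (τ '' J) :=
    hJm.image_of_continuousOn_injOn hτc hmono.injOn
  -- Points move by at most 1/2 and R ≥ 1, so the intermediate value theorem puts (-R/2, R/2) inside
  -- the image.
  have hcover : ∀ y, y ∉ τ '' J → R / 2 ≤ |y| := by
    intro y hy
    by_contra hlt
    rw [not_le, abs_lt] at hlt
    have h1 : Set.Icc (y - 1 / 2) (y + 1 / 2) ⊆ J := fun s hs => by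
      constructor <;> linarith [hs.1, hs.2]
    have e1 := abs_le.1 (hτ2 (y - 1 / 2) (h1 ⟨le_rfl, by linarith⟩))
    have e2 := abs_le.1 (hτ2 (y + 1 / 2) (h1 ⟨by linarith, le_rfl⟩))
    obtain ⟨s, hs, hsy⟩ := intermediate_value_Icc (by linarith : y - 1 / 2 ≤ y + 1 / 2)
      (hτc.mono h1) (⟨by linarith [e1.2], by linarith [e2.1]⟩ : y ∈ Set.Icc _ _)
    exact hy ⟨s, h1 hs, hsy⟩
  have d1 : (∫ s in S, f₁ s * H s) =
      (∫ s in S \ J, f₁ s * H s) + ∫ s in J, f₁ s * H s := by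
    rw [add_comm, ← setIntegral_union Set.disjoint_sdiff_right (hS.diff hJm) hi₁.integrableOn
      hi₁.integrableOn, Set.union_sdiff_cancel hSR]
  have d2 : (∫ s, f s * H s) =
      (∫ s in τ '' J, f s * H s) + ∫ s in (τ '' J)ᶜ, f s * H s :=
    (integral_add_compl himeas hi).symm
  have b1 : ‖∫ s in S \ J, f₁ s * H s‖ ≤ K * (A / R) * Real.pi := by
    refine norm_setIntegral_le_const_mul_pi (hS.diff hJm) (by positivity) fun s hs => ?_
    rw [norm_mul, mul_assoc]
    refine mul_le_mul (hf₁K s) (hH.tail hR0 ?_) (norm_nonneg _) hK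
    have : s ∉ J := hs.2
    rw [hJ, Set.mem_Ioo, ← abs_lt, not_lt] at this
    exact this
  have b3 : ‖∫ s in (τ '' J)ᶜ, f s * H s‖ ≤ K * (A / (R / 2)) * Real.pi := by
    refine norm_setIntegral_le_const_mul_pi himeas.compl (by positivity) fun s hs => ?_
    rw [norm_mul, mul_assoc]
    exact mul_le_mul (hfK s) (hH.tail (by positivity) (hcover s hs)) (norm_nonneg _) hK
  have b2 : ‖(∫ s in J, f₁ s * H s) - ∫ s in τ '' J, f s * H s‖ ≤ K * (3 * A * η) * Real.pi := by
    have hτ'm : IntegrableOn (fun s => |τ' s| • (f (τ s) * H (τ s))) J :=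
      (integrableOn_image_iff_integrableOn_abs_deriv_smul hJm
        (fun s hs => (hτ s hs).hasDerivWithinAt) hmono.injOn _).1 hi.integrableOn
    rw [hcv, ← integral_sub hi₁.integrableOn hτ'm]
    refine norm_setIntegral_le_const_mul_pi hJm (by positivity) fun s hs => ?_
    have h1 := abs_le.1 (hτ1 s hs)
    rw [hτf s hs, abs_of_nonneg (by linarith [h1.1]), Complex.real_smul]
    have h2 : f (τ s) * H s - (τ' s : ℂ) * (f (τ s) * H (τ s)) =
      f (τ s) * ((H s - H (τ s)) + (((1 - τ' s : ℝ)) : ℂ) * H (τ s)) := by push_cast; ring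
    rw [h2, norm_mul, mul_assoc]
    refine mul_le_mul (hfK _) ?_ (norm_nonneg _) hK
    have h3 := hH.lip s (τ s) ((hτ2 s hs).trans (by linarith))
    have h4 : ‖(((1 - τ' s : ℝ)) : ℂ) * H (τ s)‖ ≤ η * (A * (1 + τ s ^ 2)⁻¹) := by
      rw [norm_mul, Complex.norm_real, Real.norm_eq_abs, abs_sub_comm]
      exact mul_le_mul (hτ1 s hs) (hH.bound' _) (norm_nonneg _) hη
    have h5 : (1 + τ s ^ 2)⁻¹ ≤ 2 * (1 + s ^ 2)⁻¹ := by
      rw [inv_eq_one_div, inv_eq_one_div, mul_one_div, div_le_div_iff₀ (by positivity)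
        (by positivity)]
      have := abs_le.1 ((hτ2 s hs).trans hη2)
      nlinarith [sq_nonneg (s - 2 * τ s), sq_nonneg (τ s - s), this.1, this.2]
    calc _ ≤ A * |τ s - s| * (1 + s ^ 2)⁻¹ + η * (A * (1 + τ s ^ 2)⁻¹) :=
          (norm_add_le _ _).trans (add_le_add h3 h4)
      _ ≤ A * η * (1 + s ^ 2)⁻¹ + η * (A * (2 * (1 + s ^ 2)⁻¹)) := by
          gcongr
          exact hτ2 s hs
      _ = _ := by ring
  have e : (∫ s in S, f₁ s * H s) - ∫ s, f s * H s =
      (∫ s in S \ J, f₁ s * H s) + ((∫ s in J, f₁ s * H s) - ∫ s in τ '' J, f s * H s) -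
      ∫ s in (τ '' J)ᶜ, f s * H s := by rw [d1, d2]; ring
  rw [e]
  calc _ ≤ K * (A / R) * Real.pi + K * (3 * A * η) * Real.pi + K * (A / (R / 2)) * Real.pi :=
        (norm_sub_le _ _).trans (add_le_add ((norm_add_le _ _).trans (add_le_add b1 b2)) b3)
    _ = _ := by field_simp; ring

end ChangeOfVariables

/-! ### The angle in the orthographic chart -/

section Angle

open Real

/-- The product formula for a difference of cosines, with |sin| bounded below by a chord and sin t'
≤ 2 sin((t + t')/2). It converts errors on cosines into errors on angles at the price of 1 / sin t'.
-/
theorem abs_sub_mul_sin_le {t t' : ℝ} (ht : t ∈ Set.Icc 0 π) (ht' : t' ∈ Set.Icc 0 π) :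
    |t - t'| * sin t' ≤ π * |cos t - cos t'| := by
  rw [cos_sub_cos, abs_mul, abs_mul, abs_neg, abs_two]
  have h1 : 0 ≤ sin ((t + t') / 2) :=
    sin_nonneg_of_nonneg_of_le_pi (by linarith [ht.1, ht'.1]) (by linarith [ht.2, ht'.2])
  have h2 : sin t' ≤ 2 * sin ((t + t') / 2) := by
    have h3 : sin t + sin t' = 2 * sin ((t + t') / 2) * cos ((t - t') / 2) := by
      rw [show t = (t + t') / 2 + (t - t') / 2 by ring,
        show t' = (t + t') / 2 - (t - t') / 2 by ring, sin_add, sin_sub]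
      ring_nf
    nlinarith [sin_nonneg_of_nonneg_of_le_pi ht.1 ht.2, cos_le_one ((t - t') / 2)]
  have h4 : |t - t'| ≤ π * |sin ((t - t') / 2)| := by
    have := mul_abs_le_abs_sin (x := (t - t') / 2) (by
      rw [abs_le]; constructor <;> linarith [ht.1, ht.2, ht'.1, ht'.2])
    rw [abs_div, abs_two] at this
    have hπ := pi_pos
    calc |t - t'| = π * (2 / π * (|t - t'| / 2)) := by field_simp
      _ ≤ _ := by gcongr
  rw [abs_of_nonneg h1]
  calc |t - t'| * sin t' ≤ (π * |sin ((t - t') / 2)|) * (2 * sin ((t + t') / 2)) := by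
        refine mul_le_mul h4 h2 (sin_nonneg_of_nonneg_of_le_pi ht'.1 ht'.2) (by positivity)
    _ = _ := by ring

/-- The cosine of the angle between two points, in the orthographic chart. -/
def chartCos (φ ς q σ : ℝ) : ℝ := cos φ * √(1 - σ ^ 2 - q ^ 2) + ς * sin φ * σ

variable {φ ς q σ b : ℝ}

/-- Both sides have the same expansion to first order in σ; the curvature, and with it the
transverse coordinate q, enters only at second order. -/
theorem abs_chartCos_sub_le (hς : |ς| = 1) (hb1 : b ≤ 1 / 2) (hσ : |σ| ≤ b)
    (hq : |q| ≤ b) : |chartCos φ ς q σ - cos (φ - ς * σ)| ≤ 3 * b ^ 2 := by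
  have hσ2 : σ ^ 2 ≤ b ^ 2 := sq_le_sq' (by linarith [abs_le.1 hσ]) (abs_le.1 hσ).2
  have hq2 : q ^ 2 ≤ b ^ 2 := sq_le_sq' (by linarith [abs_le.1 hq]) (abs_le.1 hq).2
  have hb0 : 0 ≤ b := (abs_nonneg _).trans hσ
  have hb2 : b ^ 2 ≤ 1 / 4 := by nlinarith
  have h1 : cos (ς * σ) = cos σ := by
    rcases (abs_eq one_pos.le).1 hς with rfl | rfl <;> simp
  have h2 : sin (ς * σ) = ς * sin σ := by
    rcases (abs_eq one_pos.le).1 hς with rfl | rfl <;> simp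
  rw [chartCos, cos_sub, h1, h2]
  have h3 : |√(1 - σ ^ 2 - q ^ 2) - cos σ| ≤ 2 * b ^ 2 := by
    have i1 : √(1 - σ ^ 2 - q ^ 2) ≤ 1 := sqrt_le_one.2 (by nlinarith)
    have i2 : 1 - σ ^ 2 - q ^ 2 ≤ √(1 - σ ^ 2 - q ^ 2) := le_sqrt_of_sq_le (by nlinarith)
    have i3 := one_sub_sq_div_two_le_cos (x := σ)
    rw [abs_le]
    constructor <;> linarith [cos_le_one σ]
  have h4 : |σ - sin σ| ≤ b ^ 2 := by
    have key : ∀ x : ℝ, 0 < x → x ≤ b → |x - sin x| ≤ b ^ 2 := fun x hx hxb => by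
      have j1 := sin_gt_sub_cube hx
      have j2 := sin_lt hx
      rw [abs_le]
      constructor
      · nlinarith
      · have : x ^ 3 ≤ b ^ 2 := by
          calc x ^ 3 ≤ b ^ 3 := by gcongr
            _ = b ^ 2 * b := by ring
            _ ≤ b ^ 2 * 1 := by gcongr; linarith
            _ = b ^ 2 := mul_one _
        linarith [pow_pos hx 3]
    rcases lt_trichotomy σ 0 with h | h | h
    · have := key (-σ) (by linarith) (by linarith [abs_le.1 hσ])
      rw [sin_neg, ← abs_neg] at this
      convert this using 2; ring
    · subst h; simp; positivity
    · exact key σ h ((le_abs_self σ).trans hσ)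
  have e : cos φ * √(1 - σ ^ 2 - q ^ 2) + ς * sin φ * σ - (cos φ * cos σ + sin φ * (ς * sin σ)) =
      cos φ * (√(1 - σ ^ 2 - q ^ 2) - cos σ) + ς * sin φ * (σ - sin σ) := by ring
  rw [e]
  calc _ ≤ |cos φ| * |√(1 - σ ^ 2 - q ^ 2) - cos σ| + |ς| * |sin φ| * |σ - sin σ| := by
        refine (abs_add_le _ _).trans (le_of_eq ?_)
        rw [abs_mul, abs_mul, abs_mul]
    _ ≤ 1 * (2 * b ^ 2) + 1 * 1 * b ^ 2 := by
        gcongr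
        · exact abs_cos_le_one φ
        · exact hς.le
        · exact abs_sin_le_one φ
    _ = _ := by ring

/-- The margin 1 - |cos φ| ≥ sin² φ / 2 absorbs the linear term, at most sin² φ / 40, so the
arccosine is smooth there. -/
theorem abs_chartCos_lt_one (hς : |ς| = 1) (hφ : 0 < sin φ) (hb : b ≤ sin φ / 40) (hσ : |σ| ≤ b) :
    |chartCos φ ς q σ| < 1 := by
  have h1 : √(1 - σ ^ 2 - q ^ 2) ≤ 1 := sqrt_le_one.2 (by nlinarith)
  have h2 : |cos φ| ≤ 1 - sin φ ^ 2 / 2 := by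
    have := sin_sq_add_cos_sq φ
    rw [← sq_abs (cos φ)] at this
    nlinarith [sq_nonneg (|cos φ| - 1)]
  calc |chartCos φ ς q σ| ≤ |cos φ| * |√(1 - σ ^ 2 - q ^ 2)| + |ς| * |sin φ| * |σ| := by
        rw [chartCos]
        refine (abs_add_le _ _).trans (le_of_eq ?_)
        rw [abs_mul, abs_mul, abs_mul]
    _ ≤ (1 - sin φ ^ 2 / 2) * 1 + 1 * sin φ * (sin φ / 40) := by
        rw [abs_of_nonneg (sqrt_nonneg _), abs_of_pos hφ, hς]
        have : 0 ≤ 1 - sin φ ^ 2 / 2 := (abs_nonneg _).trans h2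
        gcongr
        exact hσ.trans hb
    _ < 1 := by nlinarith

theorem abs_arccos_chartCos_sub_le (hς : |ς| = 1) (hφ : φ ∈ Set.Icc 0 π) (hφs : 0 < sin φ)
    (hb : b ≤ sin φ / 40) (hσ : |σ| ≤ b) (hq : |q| ≤ b) :
    |arccos (chartCos φ ς q σ) - (φ - ς * σ)| ≤ 20 * b ^ 2 / sin φ := by
  have hb0 : 0 ≤ b := (abs_nonneg _).trans hσ
  have hs1 := sin_le_one φ
  have hςσ : |ς * σ| ≤ b := by rw [abs_mul, hς, one_mul]; exact hσ
  have h1 := sin_le hφ.1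
  have h2 : sin φ ≤ π - φ := by
    rw [← sin_pi_sub]; exact sin_le (by linarith [hφ.2])
  have hmem : φ - ς * σ ∈ Set.Icc 0 π := by
    have := abs_le.1 hςσ
    constructor <;> linarith [this.1, this.2]
  have hc := abs_lt.1 (abs_chartCos_lt_one (q := q) hς hφs hb hσ)
  have hsin : 39 / 40 * sin φ ≤ sin (φ - ς * σ) := by
    have := abs_sin_sub_sin_le (φ - ς * σ) φ
    rw [show φ - ς * σ - φ = -(ς * σ) by ring, abs_neg] at this
    have := abs_le.1 (this.trans hςσ)
    linarith [this.1]
  have h3 := abs_sub_mul_sin_le (t := arccos (chartCos φ ς q σ)) (t' := φ - ς * σ)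
    ⟨arccos_nonneg _, arccos_le_pi _⟩ hmem
  rw [cos_arccos hc.1.le hc.2.le] at h3
  have h4 := abs_chartCos_sub_le (φ := φ) hς (by linarith) hσ hq
  rw [le_div_iff₀ hφs]
  -- Here 3.15 replaces π, and 3.15 · 3 · 40/39 < 20.
  have h5 : |arccos (chartCos φ ς q σ) - (φ - ς * σ)| * (39 / 40 * sin φ) ≤ 3.15 * (3 * b ^ 2) := by
    calc _ ≤ |arccos (chartCos φ ς q σ) - (φ - ς * σ)| * sin (φ - ς * σ) := by gcongr
      _ ≤ _ := h3
      _ ≤ _ := by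
        gcongr
        exact pi_lt_d2.le
  nlinarith [sq_nonneg b]

/-- The derivative of the angle. -/
def angleDeriv (φ ς q σ : ℝ) : ℝ :=
  -(ς * sin φ - cos φ * (σ / √(1 - σ ^ 2 - q ^ 2))) / √(1 - chartCos φ ς q σ ^ 2)

theorem hasDerivAt_arccos_chartCos (hς : |ς| = 1) (hφs : 0 < sin φ)
    (hb : b ≤ sin φ / 40) (hσ : |σ| ≤ b) (hq : |q| ≤ b) :
    HasDerivAt (fun σ => arccos (chartCos φ ς q σ)) (angleDeriv φ ς q σ) σ := by
  have hc := abs_lt.1 (abs_chartCos_lt_one (q := q) hς hφs hb hσ)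
  have hs1 := sin_le_one φ
  have hσ2 : σ ^ 2 ≤ b ^ 2 := sq_le_sq' (by linarith [abs_le.1 hσ]) (abs_le.1 hσ).2
  have hq2 : q ^ 2 ≤ b ^ 2 := sq_le_sq' (by linarith [abs_le.1 hq]) (abs_le.1 hq).2
  have hb0 : 0 ≤ b := (abs_nonneg _).trans hσ
  have hpos : 0 < 1 - σ ^ 2 - q ^ 2 := by nlinarith
  have h1 : HasDerivAt (fun σ => 1 - σ ^ 2 - q ^ 2) (-(2 * σ)) σ := by
    have := ((hasDerivAt_pow 2 σ).const_sub 1).sub_const (q ^ 2)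
    simpa using this
  have h2 := (h1.sqrt hpos.ne').const_mul (cos φ)
  have h3 : HasDerivAt (fun σ => ς * sin φ * σ) (ς * sin φ) σ := by
    simpa using (hasDerivAt_id σ).const_mul (ς * sin φ)
  have h4 := (hasDerivAt_arccos hc.1.ne' hc.2.ne).comp σ (h2.add h3)
  refine h4.congr_deriv ?_
  rw [angleDeriv]
  have : √(1 - σ ^ 2 - q ^ 2) ≠ 0 := (sqrt_pos.2 hpos).ne'
  field_simp
  ring

/-- The denominator of the derivative is the sine of the true angle, within 3b/2 of sin φ by the
previous estimate, and the numerator is -ς sin φ up to 2b. -/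
theorem abs_angleDeriv_add_le (hς : |ς| = 1) (hφ : φ ∈ Set.Icc 0 π) (hφs : 0 < sin φ)
    (hb : b ≤ sin φ / 40) (hσ : |σ| ≤ b) (hq : |q| ≤ b) :
    |angleDeriv φ ς q σ + ς| ≤ 8 * b / sin φ := by
  have hc := abs_lt.1 (abs_chartCos_lt_one (q := q) hς hφs hb hσ)
  have hs1 := sin_le_one φ
  have hσ2 : σ ^ 2 ≤ b ^ 2 := sq_le_sq' (by linarith [abs_le.1 hσ]) (abs_le.1 hσ).2
  have hq2 : q ^ 2 ≤ b ^ 2 := sq_le_sq' (by linarith [abs_le.1 hq]) (abs_le.1 hq).2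
  have hb0 : 0 ≤ b := (abs_nonneg _).trans hσ
  have h1 : 1 / 2 ≤ √(1 - σ ^ 2 - q ^ 2) := le_sqrt_of_sq_le (by nlinarith)
  set t := arccos (chartCos φ ς q σ) with ht
  have hsin : √(1 - chartCos φ ς q σ ^ 2) = sin t := (sin_arccos _).symm
  have h2 := abs_arccos_chartCos_sub_le hς hφ hφs hb hσ hq
  have h3 : 20 * b ^ 2 / sin φ ≤ b / 2 := by
    rw [div_le_iff₀ hφs]; nlinarith
  have hςσ : |ς * σ| ≤ b := by rw [abs_mul, hς, one_mul]; exact hσ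
  have h4 : |sin t - sin φ| ≤ 3 / 2 * b := by
    refine (abs_sin_sub_sin_le t φ).trans ?_
    have : t - φ = (t - (φ - ς * σ)) - ς * σ := by ring
    rw [this]
    refine (abs_sub _ _).trans ?_
    linarith
  have h5 : sin φ / 2 ≤ sin t := by linarith [(abs_le.1 h4).1]
  have h6 : |cos φ * (σ / √(1 - σ ^ 2 - q ^ 2))| ≤ 2 * b := by
    rw [abs_mul, abs_div, abs_of_nonneg (sqrt_nonneg _)]
    calc _ ≤ 1 * (b / (1 / 2)) := by
          gcongr
          exact abs_cos_le_one φ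
      _ = _ := by ring
  have hst : 0 < sin t := by linarith
  rw [angleDeriv, hsin]
  have e : -(ς * sin φ - cos φ * (σ / √(1 - σ ^ 2 - q ^ 2))) / sin t + ς =
      (ς * (sin t - sin φ) + cos φ * (σ / √(1 - σ ^ 2 - q ^ 2))) / sin t := by
    field_simp; ring
  rw [e, abs_div, abs_of_pos hst, div_le_div_iff₀ hst hφs]
  have h7 : |ς * (sin t - sin φ) + cos φ * (σ / √(1 - σ ^ 2 - q ^ 2))| ≤ 4 * b := by
    refine (abs_add_le _ _).trans ?_
    rw [abs_mul ς, hς]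
    linarith
  nlinarith [abs_nonneg (ς * (sin t - sin φ) + cos φ * (σ / √(1 - σ ^ 2 - q ^ 2)))]

end Angle

/-! ### The contribution of one wave packet -/

section Column

variable {d : ℕ}

/-- The direction of the axis of a frame. -/
def axisVec (L : LinFrame d) : EuclideanSpace ℝ (Fin d) := L (WithLp.toLp 2 ((1 : ℝ), (0 : Cross d)))

theorem norm_axisVec (L : LinFrame d) : ‖axisVec L‖ = 1 := by
  rw [← sq_eq_sq₀ (norm_nonneg _) zero_le_one, axisVec, norm_frame_sq]
  simp

/-- The point of the sphere at angle `φ` from the pole, in the direction `± axisVec L`. -/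
def columnPoint (L : LinFrame d) {ς : ℝ} (hς : |ς| = 1) (φ : ℝ) : Sph d :=
  ⟨consVec (Real.cos φ) ((ς * Real.sin φ) • axisVec L), by
    rw [mem_sphere_zero_iff_norm, ← sq_eq_sq₀ (norm_nonneg _) zero_le_one, norm_consVec_sq,
      norm_smul, norm_axisVec, mul_one, Real.norm_eq_abs, abs_mul, hς, one_mul, sq_abs, one_pow]
    exact Real.cos_sq_add_sin_sq φ⟩

theorem sphInner_columnPoint (L : LinFrame d) {ς : ℝ} (hς : |ς| = 1) (φ : ℝ) {l : ℝ} (hl : 0 < l)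
    {y : ℝ × Cross d} (hy : ‖L (WithLp.toLp 2 y)‖ < l) :
    sphInner (columnPoint L hς φ) (chart l (L (WithLp.toLp 2 y))) =
      chartCos φ ς (‖y.2‖ / l) (y.1 / l) := by
  rw [sphInner, chart_coe hl hy, columnPoint]
  simp only
  rw [inner_consVec, real_inner_smul_left, real_inner_smul_right, axisVec, inner_frame, norm_smul,
    mul_pow, norm_frame_sq, chartCos, norm_inv, Real.norm_of_nonneg hl.le]
  have : 1 - l⁻¹ ^ 2 * (y.1 ^ 2 + ‖y.2‖ ^ 2) = 1 - (y.1 / l) ^ 2 - (‖y.2‖ / l) ^ 2 := by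
    field_simp; ring
  rw [this, inner_zero_left]
  field_simp
  ring

/-- On a line parallel to the axis, the angle seen from the column point is θ - ςs/l up to second
order, because the angle θ + ςk₁/l of the column point compensates the axial coordinate k₁ of the
centre. The rescaled true angle τ(s) is thus a small perturbation of s. -/
theorem norm_setIntegral_line_sub_le (L : LinFrame d) {ς : ℝ} (hς : |ς| = 1) {θ l ρ : ℝ}
    (hθ : θ ∈ Set.Ioo 0 Real.pi) (hρ : 2 ≤ ρ) (hl : 320 * ρ ^ 2 ≤ l * Real.sin θ)
    {m : ℝ → ℂ} (hm : Measurable m) {K : ℝ} (hmK : ∀ t, ‖m t‖ ≤ K) {H : ℝ → ℂ} {A : ℝ}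
    (hH : KernelDecay H A) {k : ℝ × Cross d} (hk : ‖L (WithLp.toLp 2 k)‖ ≤ ρ) {w : Cross d}
    (hw : ‖w‖ < ρ / 2) :
    ‖(∫ s in {s | L (WithLp.toLp 2 (k + (s, w))) ∈ Metric.ball 0 (2 * ρ)},
        m (sphInner (columnPoint L hς (θ + ς * k.1 / l)) (chart l (L (WithLp.toLp 2 (k + (s, w)))))) *
          H s) - ∫ s, m (Real.cos (θ - ς * s / l)) * H s‖ ≤
      3 * Real.pi * K * A * (160 * ρ ^ 2 / (l * Real.sin θ) + 2 / ρ) := by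
  have hsθ : 0 < Real.sin θ := Real.sin_pos_of_pos_of_lt_pi hθ.1 hθ.2
  have hls : 0 < l * Real.sin θ := lt_of_lt_of_le (by positivity) hl
  have hl0 : 0 < l := pos_of_mul_pos_left hls hsθ.le
  have hς2 : ς * ς = 1 := by rw [← sq, ← sq_abs, hς, one_pow]
  have hρl : ρ / l ≤ Real.sin θ / 640 := by
    rw [div_le_iff₀ hl0]; nlinarith
  have hk1 : |k.1| ≤ ρ := by
    have := norm_frame_sq L k
    refine abs_le_of_sq_le_sq ?_ (by linarith)
    nlinarith [sq_nonneg ‖k.2‖, norm_nonneg (L (WithLp.toLp 2 k))]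
  have hk2 : ‖k.2‖ ≤ ρ := by
    have := norm_frame_sq L k
    refine le_of_sq_le_sq ?_ (by linarith)
    nlinarith [sq_nonneg k.1, norm_nonneg (L (WithLp.toLp 2 k))]
  set φ := θ + ς * k.1 / l with hφ
  have hφθ : |φ - θ| ≤ Real.sin θ / 640 := by
    rw [hφ, add_sub_cancel_left, abs_div, abs_mul, hς, one_mul, abs_of_pos hl0]
    exact (div_le_div_of_nonneg_right hk1 hl0.le).trans hρl
  have hsinφ : Real.sin θ / 2 ≤ Real.sin φ := by
    have := (abs_le.1 ((Real.abs_sin_sub_sin_le φ θ).trans hφθ)).1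
    linarith
  have hsφ : 0 < Real.sin φ := by linarith
  have hφmem : φ ∈ Set.Icc 0 Real.pi := by
    have h1 := Real.sin_le hθ.1.le
    have h2 : Real.sin θ ≤ Real.pi - θ := by
      rw [← Real.sin_pi_sub]; exact Real.sin_le (by linarith [hθ.2])
    have := abs_le.1 hφθ
    constructor <;> linarith [this.1, this.2]
  set b := 2 * ρ / l with hb
  have hb0 : 0 < b := by positivity
  have hbφ : b ≤ Real.sin φ / 40 := by
    rw [hb, mul_div_assoc]; linarith
  have hq : |‖k.2 + w‖ / l| ≤ b := by
    rw [abs_of_nonneg (by positivity), hb]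
    gcongr
    refine (norm_add_le _ _).trans ?_
    linarith
  have hσ : ∀ s ∈ Set.Ioo (-(ρ / 2)) (ρ / 2), |(k.1 + s) / l| ≤ b := fun s hs => by
    rw [abs_div, abs_of_pos hl0, hb]
    gcongr
    have := abs_lt.2 hs
    exact (abs_add_le _ _).trans (by linarith)
  have hnorm : ∀ s ∈ Set.Ioo (-(ρ / 2)) (ρ / 2), ‖L (WithLp.toLp 2 (k + (s, w)))‖ < 2 * ρ :=
    fun s hs => by
    have e1 : L (WithLp.toLp 2 (k + (s, w))) = L (WithLp.toLp 2 k) + L (WithLp.toLp 2 (s, w)) := by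
      rw [WithLp.toLp_add, map_add]
    have e2 : ‖L (WithLp.toLp 2 (s, w))‖ < ρ := by
      have h1 := norm_frame_sq L (s, w)
      have h2 : s ^ 2 ≤ (ρ / 2) ^ 2 := sq_le_sq' (by linarith [hs.1]) hs.2.le
      have h3 : ‖w‖ ^ 2 ≤ (ρ / 2) ^ 2 := by gcongr
      refine lt_of_pow_lt_pow_left₀ 2 (by linarith) ?_
      rw [h1]
      simp only
      nlinarith
    rw [e1]
    refine (norm_add_le _ _).trans_lt ?_
    linarith
  have h2ρl : 2 * ρ < l := by
    have h1 := Real.sin_le_one θ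
    have : ρ / l < 1 / 2 := by linarith
    rw [div_lt_iff₀ hl0] at this
    linarith
  have hcont : Continuous fun s : ℝ => L (WithLp.toLp 2 (k + (s, w))) :=
    L.continuous.comp ((WithLp.prod_continuous_toLp 2 _ _).comp (by fun_prop))
  -- By construction θ - ς τ(s)/l is exactly the angle at s.
  set τ : ℝ → ℝ := fun s => ς * l * (θ - Real.arccos (chartCos φ ς (‖k.2 + w‖ / l) ((k.1 + s) / l)))
    with hτdef
  have := norm_setIntegral_comp_sub_le hH (f := fun s => m (Real.cos (θ - ς * s / l)))
    (f₁ := fun s => m (sphInner (columnPoint L hς φ) (chart l (L (WithLp.toLp 2 (k + (s, w)))))))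
    (hm.comp (Continuous.measurable (by fun_prop)))
    (hm.comp ((continuous_sphInner_left _).comp ((continuous_chart l).comp hcont)).measurable)
    (fun s => hmK _) (fun s => hmK _)
    (S := {s | L (WithLp.toLp 2 (k + (s, w))) ∈ Metric.ball 0 (2 * ρ)})
    -- With b = 2ρ/l and sin φ ≥ sin θ / 2, the angular error 20 b² / sin φ times l is at most η;
    -- the hypothesis on l says η ≤ 1/2.
    (hcont.measurable measurableSet_ball) (R := ρ / 2) (η := 160 * ρ ^ 2 / (l * Real.sin θ))
    (by linarith) (fun s hs => mem_ball_zero_iff.2 (hnorm s hs)) (by positivity)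
    (by rw [div_le_iff₀ hls]; linarith) (τ := τ)
    (τ' := fun s => -ς * angleDeriv φ ς (‖k.2 + w‖ / l) ((k.1 + s) / l)) ?_ ?_ ?_ ?_
  · rw [show (1 : ℝ) / (ρ / 2) = 2 / ρ by field_simp] at this
    exact this
  · intro s hs
    have h1 := hasDerivAt_arccos_chartCos (φ := φ) hς hsφ hbφ (hσ s hs) hq
    have h2 : HasDerivAt (fun s => (k.1 + s) / l) (1 / l) s := by
      simpa using ((hasDerivAt_id s).const_add k.1).div_const l
    have h3 := ((h1.comp s h2).const_sub θ).const_mul (ς * l)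
    refine h3.congr_deriv ?_
    field_simp
  · intro s hs
    have h1 := abs_angleDeriv_add_le hς hφmem hsφ hbφ (hσ s hs) hq
    have e : -ς * angleDeriv φ ς (‖k.2 + w‖ / l) ((k.1 + s) / l) - 1 =
        -(ς * (angleDeriv φ ς (‖k.2 + w‖ / l) ((k.1 + s) / l) + ς)) := by linear_combination hς2
    rw [e, abs_neg, abs_mul, hς, one_mul]
    refine h1.trans ?_
    calc 8 * b / Real.sin φ ≤ 8 * b / (Real.sin θ / 2) := by gcongr
      _ = 32 * ρ / (l * Real.sin θ) := by rw [hb]; field_simp; ring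
      _ ≤ _ := by gcongr <;> nlinarith
  · intro s hs
    have h1 := abs_arccos_chartCos_sub_le hς hφmem hsφ hbφ (hσ s hs) hq
    have e : τ s - s = -(ς * l) * (Real.arccos (chartCos φ ς (‖k.2 + w‖ / l) ((k.1 + s) / l)) -
        (φ - ς * ((k.1 + s) / l))) := by
      simp only [hτdef, hφ]
      field_simp
      linear_combination s * hς2
    rw [e, abs_mul, abs_neg, abs_mul, hς, one_mul, abs_of_pos hl0]
    calc _ ≤ l * (20 * b ^ 2 / Real.sin φ) := by gcongr
      _ ≤ l * (20 * b ^ 2 / (Real.sin θ / 2)) := by gcongr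
      _ = _ := by rw [hb]; field_simp; ring
  · intro s hs
    have hlt := abs_lt.1 (abs_chartCos_lt_one (q := ‖k.2 + w‖ / l) hς hsφ hbφ (hσ s hs))
    have e1 : θ - ς * τ s / l = Real.arccos (chartCos φ ς (‖k.2 + w‖ / l) ((k.1 + s) / l)) := by
      simp only [hτdef]
      field_simp
      linear_combination (Real.arccos (chartCos φ ς (‖k.2 + w‖ / l) ((k.1 + s) / l)) - θ) * hς2
    rw [e1, Real.cos_arccos hlt.1.le hlt.2.le,
      sphInner_columnPoint L hς φ hl0 ((hnorm s hs).trans h2ρl)]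
    rfl

/-- The contribution of a wave packet is close to a convolution with `m ∘ cos`. -/
theorem norm_column_sub_le (L : LinFrame d) {ς : ℝ} (hς : |ς| = 1) {θ l ρ : ℝ}
    (hθ : θ ∈ Set.Ioo 0 Real.pi) (hρ : 2 ≤ ρ) (hl : 320 * ρ ^ 2 ≤ l * Real.sin θ)
    {m : ℝ → ℂ} (hm : Measurable m) {K : ℝ} (hmK : ∀ t, ‖m t‖ ≤ K) {H : ℝ → ℂ} {A : ℝ}
    (hH : KernelDecay H A) {Ψ : Cross d → ℝ} (hΨ0 : ∀ w, 0 ≤ Ψ w)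
    (hΨi : Integrable Ψ) (hΨ1 : Integrable fun w => ‖w‖ * Ψ w) {k : EuclideanSpace ℝ (Fin d)}
    (hk : ‖k‖ ≤ ρ) :
    ‖(∫ h in Metric.ball (0 : EuclideanSpace ℝ (Fin d)) (2 * ρ),
        m (sphInner (columnPoint L hς (θ + ς * ((frameEquiv L 0).symm k).1 / l)) (chart l h)) *
          (H ((frameEquiv L 0).symm (h - k)).1 * (Ψ ((frameEquiv L 0).symm (h - k)).2 : ℂ))) -
      ((∫ w, Ψ w : ℝ) : ℂ) * ∫ s, m (Real.cos (θ - ς * s / l)) * H s‖ ≤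
      Real.pi * K * A * (3 * (160 * ρ ^ 2 / (l * Real.sin θ) + 2 / ρ) * ∫ w, Ψ w) +
        Real.pi * K * A * (4 / ρ * ∫ w, ‖w‖ * Ψ w) := by
  have hA := hH.nonneg
  have hK : 0 ≤ K := (norm_nonneg _).trans (hmK 0)
  obtain ⟨k, rfl⟩ := (frameEquiv L 0).surjective k
  rw [MeasurableEquiv.symm_apply_apply]
  have hk' : frameEquiv L 0 k = L (WithLp.toLp 2 k) := by rw [frameEquiv_apply, zero_add]
  rw [hk'] at hk ⊢
  set x := columnPoint L hς (θ + ς * k.1 / l)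
  set P := ∫ s, m (Real.cos (θ - ς * s / l)) * H s
  have hcont : Continuous fun y : ℝ × Cross d => L (WithLp.toLp 2 (k + y)) :=
    L.continuous.comp ((WithLp.prod_continuous_toLp 2 _ _).comp (by fun_prop))
  set D : Set (ℝ × Cross d) := {y | L (WithLp.toLp 2 (k + y)) ∈ Metric.ball 0 (2 * ρ)}
  have hD : MeasurableSet D := hcont.measurable measurableSet_ball
  set f : ℝ × Cross d → ℂ := fun y => m (sphInner x (chart l (L (WithLp.toLp 2 (k + y)))))
  have hf : Measurable f :=
    hm.comp ((continuous_sphInner_left _).comp ((continuous_chart l).comp hcont)).measurable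
  have hfD : Measurable (D.indicator f) := hf.indicator hD
  have hfDb : ∀ y, ‖D.indicator f y‖ ≤ K := fun y =>
    (norm_indicator_le_norm_self f y).trans (hmK _)
  have hsub : ∀ y : ℝ × Cross d, frameEquiv L (L (WithLp.toLp 2 k)) y - L (WithLp.toLp 2 k) =
      frameEquiv L 0 y := fun y => by
    rw [frameEquiv_apply, frameEquiv_apply, add_sub_cancel_left, zero_add]
  have e1 : (∫ h in Metric.ball (0 : EuclideanSpace ℝ (Fin d)) (2 * ρ),
      m (sphInner x (chart l h)) * (H ((frameEquiv L 0).symm (h - L (WithLp.toLp 2 k))).1 *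
        (Ψ ((frameEquiv L 0).symm (h - L (WithLp.toLp 2 k))).2 : ℂ))) =
      ∫ y : ℝ × Cross d, D.indicator f y * (H y.1 * (Ψ y.2 : ℂ)) := by
    rw [← integral_indicator measurableSet_ball,
      ← (measurePreserving_frameEquiv L (L (WithLp.toLp 2 k))).integral_comp']
    refine integral_congr_ae (Filter.Eventually.of_forall fun y => ?_)
    have hy : frameEquiv L (L (WithLp.toLp 2 k)) y = L (WithLp.toLp 2 (k + y)) := by
      rw [frameEquiv_apply, WithLp.toLp_add, map_add]
    by_cases hyD : y ∈ D
    · have hyB : frameEquiv L (L (WithLp.toLp 2 k)) y ∈ Metric.ball 0 (2 * ρ) := by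
        rw [hy]; exact hyD
      simp only [Set.indicator_of_mem hyB, Set.indicator_of_mem hyD, hsub,
        MeasurableEquiv.symm_apply_apply]
      rw [hy]
    · have hyB : frameEquiv L (L (WithLp.toLp 2 k)) y ∉ Metric.ball 0 (2 * ρ) := by
        rw [hy]; exact hyD
      simp only [Set.indicator_of_notMem hyB, Set.indicator_of_notMem hyD, zero_mul]
  have hHΨ : Integrable (fun y : ℝ × Cross d => H y.1 * (Ψ y.2 : ℂ))
      ((volume : Measure ℝ).prod volume) := hH.integrable.mul_prod hΨi.ofReal
  have hint : Integrable (fun y : ℝ × Cross d => D.indicator f y * (H y.1 * (Ψ y.2 : ℂ)))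
      ((volume : Measure ℝ).prod volume) :=
    hHΨ.bdd_mul hfD.aestronglyMeasurable (Filter.Eventually.of_forall hfDb)
  set I : Cross d → ℂ := fun w => ∫ s, D.indicator f (s, w) * H s
  have e2 : ∫ y : ℝ × Cross d, D.indicator f y * (H y.1 * (Ψ y.2 : ℂ)) =
      ∫ w, (Ψ w : ℂ) * I w := by
    rw [Measure.volume_eq_prod, integral_prod_symm _ hint]
    refine integral_congr_ae (Filter.Eventually.of_forall fun w => ?_)
    simp only [I]
    rw [← integral_const_mul]
    refine integral_congr_ae (Filter.Eventually.of_forall fun s => ?_)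
    simp only; ring
  have hIi : Integrable fun w => (Ψ w : ℂ) * I w := by
    refine hint.integral_prod_right.congr (Filter.Eventually.of_forall fun w => ?_)
    simp only [I]
    rw [← integral_const_mul]
    refine integral_congr_ae (Filter.Eventually.of_forall fun s => ?_)
    simp only; ring
  have e3 : ((∫ w, Ψ w : ℝ) : ℂ) * P = ∫ w, (Ψ w : ℂ) * P := by
    rw [integral_mul_const, integral_complex_ofReal]
  have hIb : ∀ (g : ℝ → ℂ), (∀ s, ‖g s‖ ≤ K) → ‖∫ s, g s * H s‖ ≤ K * (A * Real.pi) := fun g hg => by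
    calc _ ≤ ∫ s, K * ‖H s‖ := norm_integral_le_of_norm_le (hH.integrable.norm.const_mul K)
          (Filter.Eventually.of_forall fun s => by
            rw [norm_mul]; gcongr; exact hg s)
      _ ≤ _ := by
          rw [integral_const_mul]
          gcongr
          exact hH.integral_norm_le
  have hΨc : Integrable fun w => (Ψ w : ℂ) := hΨi.ofReal
  rw [e1, e2, e3, ← integral_sub hIi (hΨc.mul_const P)]
  set E₁ := 3 * Real.pi * K * A * (160 * ρ ^ 2 / (l * Real.sin θ) + 2 / ρ)
  have hE₁ : 0 ≤ E₁ := by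
    have hsθ : 0 < Real.sin θ := Real.sin_pos_of_pos_of_lt_pi hθ.1 hθ.2
    have hls : 0 < l * Real.sin θ := lt_of_lt_of_le (by positivity) hl
    positivity
  calc _ ≤ ∫ w, (E₁ * Ψ w + (Real.pi * K * A * (4 / ρ)) * (‖w‖ * Ψ w)) := by
        refine norm_integral_le_of_norm_le ((hΨi.const_mul _).add (hΨ1.const_mul _))
          (Filter.Eventually.of_forall fun w => ?_)
        rw [← mul_sub, norm_mul, Complex.norm_real, Real.norm_of_nonneg (hΨ0 w)]
        -- Lines near the axis are handled by the change of variables. On the others a trivial bound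
        -- is multiplied by 2‖w‖/ρ ≥ 1, which brings in the first moment of Ψ.
        by_cases hw : ‖w‖ < ρ / 2
        · have h1 := norm_setIntegral_line_sub_le L hς hθ hρ hl hm hmK hH hk hw
          have h2 : I w = ∫ s in {s | L (WithLp.toLp 2 (k + (s, w))) ∈ Metric.ball 0 (2 * ρ)},
              m (sphInner x (chart l (L (WithLp.toLp 2 (k + (s, w)))))) * H s := by
            have hSm : MeasurableSet
                {s : ℝ | L (WithLp.toLp 2 (k + (s, w))) ∈ Metric.ball 0 (2 * ρ)} :=
              measurable_prodMk_right hD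
            refine Eq.trans ?_ (integral_indicator hSm)
            refine integral_congr_ae (Filter.Eventually.of_forall fun s => ?_)
            by_cases hs : (s, w) ∈ D
            · have hs' : s ∈ {s | L (WithLp.toLp 2 (k + (s, w))) ∈ Metric.ball 0 (2 * ρ)} := hs
              simp only [Set.indicator_of_mem hs]
              rw [Set.indicator_of_mem hs']
            · have hs' : s ∉ {s | L (WithLp.toLp 2 (k + (s, w))) ∈ Metric.ball 0 (2 * ρ)} := hs
              simp only [Set.indicator_of_notMem hs, zero_mul]
              rw [Set.indicator_of_notMem hs']
          rw [← h2] at h1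
          have h3 : 0 ≤ Real.pi * K * A * (4 / ρ) * (‖w‖ * Ψ w) := by
            have := hΨ0 w; positivity
          calc Ψ w * ‖I w - P‖ ≤ Ψ w * E₁ := mul_le_mul_of_nonneg_left h1 (hΨ0 w)
            _ ≤ _ := by linarith
        · rw [not_lt] at hw
          have h1 : ‖I w - P‖ ≤ 2 * (K * (A * Real.pi)) := by
            refine (norm_sub_le _ _).trans ?_
            linarith [hIb (fun s => D.indicator f (s, w)) fun s => hfDb _,
              hIb (fun s => m (Real.cos (θ - ς * s / l))) fun s => hmK _]
          have h2 : 1 ≤ 2 / ρ * ‖w‖ := by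
            rw [div_mul_eq_mul_div, le_div_iff₀ (by linarith)]; linarith
          have h3 : 0 ≤ E₁ * Ψ w := mul_nonneg hE₁ (hΨ0 w)
          have h4 : 0 ≤ Ψ w * (2 * (K * (A * Real.pi))) := by
            have := hΨ0 w; positivity
          calc Ψ w * ‖I w - P‖ ≤ Ψ w * (2 * (K * (A * Real.pi))) :=
                mul_le_mul_of_nonneg_left h1 (hΨ0 w)
            _ ≤ Ψ w * (2 * (K * (A * Real.pi))) * (2 / ρ * ‖w‖) := le_mul_of_one_le_right h4 h2
            _ = Real.pi * K * A * (4 / ρ) * (‖w‖ * Ψ w) := by ring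
            _ ≤ _ := by linarith
    _ = _ := by
        rw [integral_add (hΨi.const_mul _) (hΨ1.const_mul _), integral_const_mul,
          integral_const_mul]
        simp only [E₁]; ring

end Column

/-! ### Properties of the axial and transverse test kernels. -/

section Kernels

open SchwartzMap

theorem _root_.SchwartzMap.exists_kernelDecay (H : 𝓢(ℝ, ℂ)) : ∃ A, KernelDecay H A := by
  obtain ⟨C₀, hC₀, h0⟩ := H.decay 0 0
  obtain ⟨C₄, hC₄, h4⟩ := H.decay 4 0
  obtain ⟨D₀, hD₀, d0⟩ := H.decay 0 1
  obtain ⟨D₂, hD₂, d2⟩ := H.decay 2 1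
  simp only [norm_iteratedFDeriv_zero, Real.norm_eq_abs, pow_zero, one_mul] at h0 h4
  simp only [norm_iteratedFDeriv_eq_norm_iteratedDeriv, iteratedDeriv_one, Real.norm_eq_abs,
    pow_zero, one_mul, sq_abs] at d0 d2
  refine ⟨2 * (C₀ + C₄) + 3 * (D₀ + D₂), H.continuous, fun s => ?_, fun s s' hs => ?_⟩
  · rw [inv_pow, ← div_eq_mul_inv, le_div_iff₀ (by positivity)]
    have h1 := h0 s
    have h2 := h4 s
    have h3 : |s| ^ 4 = s ^ 4 := by rw [show 4 = 2 * 2 by norm_num, pow_mul, pow_mul, sq_abs]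
    rw [h3] at h2
    have h5 : (1 + s ^ 2) ^ 2 ≤ 2 * (1 + s ^ 4) := by nlinarith [sq_nonneg (s ^ 2 - 1)]
    calc ‖H s‖ * (1 + s ^ 2) ^ 2 ≤ ‖H s‖ * (2 * (1 + s ^ 4)) := by gcongr
      _ ≤ _ := by nlinarith
  · have hd : ∀ x ∈ segment ℝ s s', ‖deriv H x‖ ≤ 3 * (D₀ + D₂) * (1 + s ^ 2)⁻¹ := by
      intro x hx
      rw [← div_eq_mul_inv, le_div_iff₀ (by positivity)]
      have hxs : |x - s| ≤ 1 := by
        obtain ⟨a, b, ha, hb, hab, rfl⟩ := hx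
        have : a • s + b • s' - s = b * (s' - s) := by
          rw [smul_eq_mul, smul_eq_mul]; linear_combination s * hab
        rw [this, abs_mul, abs_of_nonneg hb]
        exact mul_le_one₀ (by linarith) (abs_nonneg _) hs
      have h1 : 1 + s ^ 2 ≤ 3 * (1 + x ^ 2) := by
        have := abs_le.1 hxs
        nlinarith [sq_nonneg (2 * x - s)]
      have h2 := d0 x
      have h3 := d2 x
      calc ‖deriv H x‖ * (1 + s ^ 2) ≤ ‖deriv H x‖ * (3 * (1 + x ^ 2)) := by gcongr
        _ ≤ _ := by nlinarith
    have := (convex_segment s s').norm_image_sub_le_of_norm_deriv_le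
      (fun x _ => H.differentiableAt) hd (left_mem_segment ℝ s s') (right_mem_segment ℝ s s')
    rw [norm_sub_rev]
    refine this.trans ?_
    rw [Real.norm_eq_abs, mul_right_comm]
    have : (0 : ℝ) ≤ (1 + s ^ 2)⁻¹ := by positivity
    gcongr
    linarith

theorem KernelDecay.conj {H : ℝ → ℂ} {A : ℝ} (hH : KernelDecay H A) :
    KernelDecay (fun s => starRingEnd ℂ (H s)) A where
  continuous := RCLike.continuous_conj.comp hH.continuous
  bound s := by rw [RCLike.norm_conj]; exact hH.bound s
  lip s s' h := by rw [← map_sub, RCLike.norm_conj]; exact hH.lip s s' h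

/-- `axisBump` as a Schwartz function. -/
def axisSchwartz : 𝓢(ℝ, ℂ) :=
  (axisBump.hasCompactSupport.comp_left (g := Complex.ofReal) Complex.ofReal_zero).toSchwartzMap
    (Complex.ofRealCLM.contDiff.comp axisBump.contDiff)

theorem axisSchwartz_apply (t : ℝ) : axisSchwartz t = (axisBump t : ℂ) := rfl

theorem axisBump_reflect (t : ℝ) : axisBump (1 - t) = axisBump t := by
  have := axisBump.sub (t - 1 / 2)
  rwa [show (1 / 2 : ℝ) - (t - 1 / 2) = 1 - t by ring,
    show (1 / 2 : ℝ) + (t - 1 / 2) = t by ring] at this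

theorem hasCompactSupport_axisBump_shift : HasCompactSupport fun t => axisBump (t - 1) := 
  axisBump.hasCompactSupport.comp_homeomorph (Homeomorph.subRight (1:ℝ))

/-- `axisBump (· - 1)` as a Schwartz function. -/
def axisShiftSchwartz : 𝓢(ℝ, ℂ) :=
  (hasCompactSupport_axisBump_shift.comp_left (g := Complex.ofReal) 
    Complex.ofReal_zero).toSchwartzMap
    (Complex.ofRealCLM.contDiff.comp (axisBump.contDiff.comp (contDiff_id.sub contDiff_const)))

theorem axisShiftSchwartz_apply (t : ℝ) : axisShiftSchwartz t = (axisBump (t - 1) : ℂ) := rfl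

theorem axisHat_eq : axisHat = 𝓕⁻ axisSchwartz := rfl

/-- The bump is real and symmetric about 1/2. This rewrites |φ̌|² without conjugation, as a product
of two inverse transforms. -/
theorem conj_axisHat (s : ℝ) : starRingEnd ℂ (axisHat s) = (𝐞 (-s) : ℂ) * axisHat s := by
  rw [axisHat_apply, ← integral_conj, ← integral_const_mul,
    ← integral_sub_left_eq_self _ volume (1 : ℝ)]
  refine integral_congr_ae (Filter.Eventually.of_forall fun t => ?_)
  simp only [map_mul, Complex.conj_ofReal, axisBump_reflect, ← Circle.coe_inv_eq_conj,
    ← AddChar.map_neg_eq_inv]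
  rw [mul_left_comm, ← Circle.coe_mul, ← AddChar.map_add_eq_mul]
  congr 3
  ring

theorem fourierInv_axisShift (s : ℝ) : 𝓕⁻ axisShiftSchwartz s = (𝐞 s : ℂ) * axisHat s := by
  rw [axisHat_apply, ← integral_const_mul, SchwartzMap.fourierInv_coe, Real.fourierInv_eq,
    ← integral_add_right_eq_self _ (1 : ℝ)]
  refine integral_congr_ae (Filter.Eventually.of_forall fun t => ?_)
  simp only [axisShiftSchwartz_apply, add_sub_cancel_right, Circle.smul_def, smul_eq_mul,
    RCLike.inner_apply, conj_trivial]
  rw [mul_add, mul_one, add_comm, AddChar.map_add_eq_mul, Circle.coe_mul, mul_comm t s]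
  ring

/-- The Fourier transform of `axisKernel`. -/
def axisKernelHat : 𝓢(ℝ, ℂ) :=
  SchwartzMap.convolution (ContinuousLinearMap.mul ℂ ℂ) axisSchwartz axisShiftSchwartz

/-- By the symmetry of the bump, e^{4πis} |φ̌(s)|² = φ̌(s) · e^{2πis} φ̌(s): the inverse transforms
of the bump and of its translate by 1. Their product is the inverse transform of the convolution. -/
theorem fourierInv_axisKernelHat (s : ℝ) : 𝓕⁻ axisKernelHat s = axisKernel s := by
  have h1 : 𝓕⁻ axisKernelHat s = 𝓕 axisKernelHat (-s) := by
    rw [SchwartzMap.fourierInv_coe, SchwartzMap.fourier_coe, Real.fourierInv_eq_fourier_neg]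
  have h2 : ∀ f : 𝓢(ℝ, ℂ), 𝓕 f (-s) = 𝓕⁻ f s := fun f => by
    rw [SchwartzMap.fourierInv_coe, SchwartzMap.fourier_coe, Real.fourierInv_eq_fourier_neg]
  have h3 : (𝐞 (2 * s) : ℂ) * (𝐞 (-s) : ℂ) = (𝐞 s : ℂ) := by
    rw [← Circle.coe_mul, ← AddChar.map_add_eq_mul]; congr 2; ring
  have h4 : ((‖axisHat s‖ ^ 2 : ℝ) : ℂ) = axisHat s * ((𝐞 (-s) : ℂ) * axisHat s) := by
    rw [← conj_axisHat, Complex.mul_conj']; push_cast; rfl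
  rw [h1, axisKernelHat, SchwartzMap.fourier_convolution, SchwartzMap.pairing_apply_apply, h2, h2,
    fourierInv_axisShift, ← axisHat_eq, axisKernel, h4, ← h3, ContinuousLinearMap.mul_apply']
  ring

theorem axisKernel_eq : axisKernel = 𝓕⁻ axisKernelHat := by
  ext s; rw [fourierInv_axisKernelHat]

theorem exists_kernelDecay_axisKernelOf : ∃ A, ∀ p, KernelDecay (axisKernelOf p) A := by
  obtain ⟨A, hA⟩ := (𝓕⁻ axisKernelHat).exists_kernelDecay
  rw [← axisKernel_eq] at hA
  refine ⟨A, fun p => ?_⟩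
  unfold axisKernelOf
  split_ifs
  · exact hA
  · exact hA.conj

theorem axisHat_neg (s : ℝ) : axisHat (-s) = starRingEnd ℂ (axisHat s) := by
  rw [axisHat_apply, axisHat_apply, ← integral_conj]
  refine integral_congr_ae (Filter.Eventually.of_forall fun t => ?_)
  simp only [map_mul, Complex.conj_ofReal, ← Circle.coe_inv_eq_conj, ← AddChar.map_neg_eq_inv,
    mul_neg]

theorem conj_axisKernel (s : ℝ) : starRingEnd ℂ (axisKernel s) = axisKernel (-s) := by
  simp only [axisKernel, map_mul, Complex.conj_ofReal, axisHat_neg, RCLike.norm_conj,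
    ← Circle.coe_inv_eq_conj, ← AddChar.map_neg_eq_inv, mul_neg]

theorem axisKernelHat_apply (x : ℝ) :
    axisKernelHat x = ((∫ t, axisBump t * axisBump (x - t - 1) : ℝ) : ℂ) := by
  rw [axisKernelHat, SchwartzMap.convolution_apply, MeasureTheory.convolution,
    ← integral_complex_ofReal]
  refine integral_congr_ae (Filter.Eventually.of_forall fun t => ?_)
  simp [axisSchwartz_apply, axisShiftSchwartz_apply]

theorem axisBump_pos {t : ℝ} (ht : t ∈ Set.Ioo (0 : ℝ) 1) : 0 < axisBump t := by
  refine axisBump.pos_of_mem_ball ?_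
  rw [Real.ball_eq_Ioo]
  simpa [axisBump] using by norm_num; exact ht

theorem axisKernelHat_re_nonneg (x : ℝ) : 0 ≤ (axisKernelHat x).re := by
  rw [axisKernelHat_apply, Complex.ofReal_re]
  exact integral_nonneg fun t => mul_nonneg axisBump.nonneg axisBump.nonneg

/-- At t = (x - 1)/2 both bumps in the convolution are evaluated at the same point of (0, 1). This
positivity later permits division. -/
theorem axisKernelHat_re_pos {x : ℝ} (hx : x ∈ Set.Ioo (1 : ℝ) 3) : 0 < (axisKernelHat x).re := by
  rw [axisKernelHat_apply, Complex.ofReal_re]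
  have hc : Continuous fun t => axisBump t * axisBump (x - t - 1) :=
    axisBump.continuous.mul (axisBump.continuous.comp (by fun_prop))
  refine hc.integral_pos_of_hasCompactSupport_nonneg_nonzero
    axisBump.hasCompactSupport.mul_right (fun t => mul_nonneg axisBump.nonneg axisBump.nonneg)
    (x := (x - 1) / 2) ?_
  have h1 := axisBump_pos (t := (x - 1) / 2) ⟨by linarith [hx.1], by linarith [hx.2]⟩
  have h2 : x - (x - 1) / 2 - 1 = (x - 1) / 2 := by ring
  rw [h2]; positivity

theorem axisKernelHat_eq_ofReal (x : ℝ) : axisKernelHat x = ((axisKernelHat x).re : ℂ) := by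
  rw [axisKernelHat_apply, Complex.ofReal_re]

theorem crossKernel_nonneg (d : ℕ) (δ : ℝ) (w : Cross d) : 0 ≤ crossKernel d δ w := by
  unfold crossKernel; positivity

theorem integrable_norm_crossHat_sq (d : ℕ) : Integrable fun w => ‖crossHat d w‖ ^ 2 :=
  ((crossHat d).memLp 2).integrable_norm_pow (by norm_num)

theorem integrable_norm_mul_norm_crossHat_sq (d : ℕ) :
    Integrable fun w => ‖w‖ * ‖crossHat d w‖ ^ 2 := by
  obtain ⟨C, -, hC⟩ := (crossHat d).decay 0 0
  simp only [pow_zero, one_mul, norm_iteratedFDeriv_zero] at hC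
  refine (((crossHat d).integrable_pow_mul volume 1).const_mul C).mono'
    (by fun_prop) (Filter.Eventually.of_forall fun w => ?_)
  rw [Real.norm_of_nonneg (by positivity), pow_one, sq]
  have := hC w
  have h1 := mul_le_mul_of_nonneg_left this (mul_nonneg (norm_nonneg w) (norm_nonneg (crossHat d w)))
  linarith

theorem integral_norm_crossHat_sq_pos (d : ℕ) : 0 < ∫ w, ‖crossHat d w‖ ^ 2 := by
  refine integral_pos_of_integrable_nonneg_nonzero (x := 0) (by fun_prop)
    (integrable_norm_crossHat_sq d) (fun w => by positivity) ?_
  have h1 : crossHat d 0 = ((∫ v, crossBump d v : ℝ) : ℂ) := by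
    rw [crossHat_apply, ← integral_complex_ofReal]
    simp
  have h2 := (crossBump d).integral_pos (μ := volume)
  rw [h1]
  simpa using h2.ne'

theorem integral_crossKernel (d : ℕ) {δ : ℝ} (hδ : 0 < δ) :
    ∫ w, crossKernel d δ w = δ ^ (d - 1) * ∫ w, ‖crossHat d w‖ ^ 2 := by
  have h := Measure.integral_comp_smul_of_nonneg (volume : Measure (Cross d))
    (fun w => ‖crossHat d w‖ ^ 2) δ (hR := hδ.le)
  unfold crossKernel
  rw [integral_const_mul, h, finrank_euclideanSpace_fin, smul_eq_mul]
  field_simp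

/-- The transverse width is 1/δ, so the first moment exceeds the mass by that order; it is the
source of the error 1/(ρδ). -/
theorem integral_norm_mul_crossKernel (d : ℕ) {δ : ℝ} (hδ : 0 < δ) :
    ∫ w, ‖w‖ * crossKernel d δ w = δ ^ (d - 1) * (δ⁻¹ * ∫ w, ‖w‖ * ‖crossHat d w‖ ^ 2) := by
  have h := Measure.integral_comp_smul_of_nonneg (volume : Measure (Cross d))
    (fun w => ‖w‖ * ‖crossHat d w‖ ^ 2) δ (hR := hδ.le)
  have h1 : ∀ w : Cross d, ‖w‖ * crossKernel d δ w =
      (δ ^ (d - 1)) ^ 2 * δ⁻¹ * (‖δ • w‖ * ‖crossHat d (δ • w)‖ ^ 2) := fun w => by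
    rw [crossKernel, norm_smul, Real.norm_of_nonneg hδ.le]
    field_simp
  simp_rw [h1]
  rw [integral_const_mul, h, finrank_euclideanSpace_fin, smul_eq_mul]
  field_simp

theorem integrable_crossKernel (d : ℕ) {δ : ℝ} (hδ : 0 < δ) : Integrable (crossKernel d δ) :=
  ((integrable_norm_crossHat_sq d).comp_smul hδ.ne').const_mul _

theorem integrable_norm_mul_crossKernel (d : ℕ) {δ : ℝ} (hδ : 0 < δ) :
    Integrable fun w => ‖w‖ * crossKernel d δ w := by
  have := ((integrable_norm_mul_norm_crossHat_sq d).comp_smul hδ.ne').const_mul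
    ((δ ^ (d - 1)) ^ 2 * δ⁻¹)
  refine this.congr (Filter.Eventually.of_forall fun w => ?_)
  simp only
  rw [crossKernel, norm_smul, Real.norm_of_nonneg hδ.le]
  field_simp

end Kernels

/-! ### The main estimate for averages at one scale. -/

section Core

variable {d : ℕ}

/-- The set of `ε` that are admissible in the definition of `besicovitchFun`. -/
def besicovitchSet (d : ℕ) (δ : ℝ) : Set ℝ :=
  {ε : ℝ | 0 < ε ∧ ∃ (N : ℕ) (U : Fin N → TubeFrame d), 0 < N ∧
    Pairwise (fun i j => Disjoint (shiftedTube (U i) δ) (shiftedTube (U j) δ)) ∧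
    volume.real (⋃ j, tube (U j) δ) / ∑ j, volume.real (tube (U j) δ) ≤ ε}

theorem norm_latticePt_le {n : Fin d → ℕ} {T : ℕ} (hn : ∀ i, n i ≤ T) :
    ‖latticePt n‖ ≤ d * (T / 6) := by
  have h1 : ‖latticePt n‖ ≤ ∑ i, ‖latticePt n i‖ := by
    rw [EuclideanSpace.norm_eq, Real.sqrt_le_left (Finset.sum_nonneg fun i _ => norm_nonneg _)]
    exact Finset.sum_sq_le_sq_sum_of_nonneg fun i _ => norm_nonneg _
  refine h1.trans ((Finset.sum_le_card_nsmul _ _ (T / 6 : ℝ) fun i _ => ?_).trans ?_)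
  · simp only [latticePt]
    rw [Real.norm_of_nonneg (by positivity)]
    have : (n i : ℝ) ≤ T := mod_cast hn i
    linarith
  · simp

theorem pExp_nonneg (p : ℝ≥0∞) : 0 ≤ pExp p := abs_nonneg _

theorem pExp_le_half {p : ℝ≥0∞} (hp : 1 ≤ p) : pExp p ≤ 1 / 2 := by
  have h : (p⁻¹).toReal ≤ 1 := by
    have : p⁻¹ ≤ 1 := ENNReal.inv_le_one.2 hp
    simpa using ENNReal.toReal_mono ENNReal.one_ne_top this
  have h0 : 0 ≤ (p⁻¹).toReal := ENNReal.toReal_nonneg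
  rw [pExp, abs_le]
  constructor <;> linarith

/-- The exponent stays in [0, 1/2]; this makes the constants uniform in p. -/
theorem rpow_pExp_le_max {p : ℝ≥0∞} (hp : 1 ≤ p) {x : ℝ} (hx : 0 ≤ x) : x ^ pExp p ≤ max 1 x := by
  rcases le_total x 1 with h | h
  · exact (Real.rpow_le_one hx h (pExp_nonneg p)).trans (le_max_left _ _)
  · refine (Real.rpow_le_rpow_of_exponent_le h ((pExp_le_half hp).trans
      (by norm_num : (1 / 2 : ℝ) ≤ 1))).trans ?_
    rw [Real.rpow_one]; exact le_max_right _ _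

/-- The main estimate, for points of the sphere far enough from `±1` relatively to the scale. -/
theorem norm_integral_cos_mul_axisKernelOf_le (hd : 1 ≤ d) {p : ℝ≥0∞} (hp : 1 ≤ p) {m : ℝ → ℂ}
    (hm : Measurable m) (hmK : ∀ t, ‖m t‖ ≤ (sphSchurNorm d p m).toReal)
    (hK : sphSchurNorm d p m ≠ ⊤) {A : ℝ} (hA : KernelDecay (axisKernelOf p) A)
    {δ : ℝ} (hδ : 0 < δ) (hδ1 : δ ≤ 1) {ε : ℝ} (hε : ε ∈ besicovitchSet d δ)
    {ς : ℝ} (hς : |ς| = 1) {θ l ρ : ℝ} (hθ : θ ∈ Set.Ioo 0 Real.pi) (hρ : 2 * d ≤ ρ)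
    (hl : 320 * ρ ^ 2 ≤ l * Real.sin θ) :
    (∫ w, ‖crossHat d w‖ ^ 2) * ‖∫ s, m (Real.cos (θ - ς * s / l)) * axisKernelOf p s‖ ≤
      (sphSchurNorm d p m).toReal *
        (Real.pi * A * (3 * (160 * ρ ^ 2 / (l * Real.sin θ) + 2 / ρ) *
            (∫ w, ‖crossHat d w‖ ^ 2) + 4 / (ρ * δ) * ∫ w, ‖w‖ * ‖crossHat d w‖ ^ 2) +
          volume.real (Metric.ball (0 : Cross d) 1) * (max 1 ((4 * d) ^ d *
            volume.real (Metric.ball (0 : EuclideanSpace ℝ (Fin d)) 1)) * ε ^ pExp p)) := by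
  obtain ⟨hε0, N, U, hN, hU, hUε⟩ := hε
  set K := (sphSchurNorm d p m).toReal
  have hd' : (1 : ℝ) ≤ d := mod_cast hd
  have hd0 : (0 : ℝ) < d := by linarith
  have hρ2 : 2 ≤ ρ := by linarith
  have hρ0 : 0 < ρ := by linarith
  have hsθ : 0 < Real.sin θ := Real.sin_pos_of_pos_of_lt_pi hθ.1 hθ.2
  have hl0 : 0 < l := by
    by_contra h
    have : l * Real.sin θ ≤ 0 := mul_nonpos_of_nonpos_of_nonneg (not_lt.1 h) hsθ.le
    nlinarith
  have hrl : 2 * ρ ≤ l := by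
    have : l * Real.sin θ ≤ l := mul_le_of_le_one_right hl0.le (Real.sin_le_one θ)
    nlinarith
  -- The upper bound keeps the lattice points in the ball of radius ρ; the lower bound makes T^d
  -- comparable to the volume of the ball of radius 2ρ.
  obtain ⟨T, hT0, hT1, hT2⟩ : ∃ T : ℕ, 0 < T ∧ (T : ℝ) ≤ 6 * ρ / d ∧ 3 * ρ / d ≤ T := by
    have h1 : 6 ≤ 3 * ρ / d := by rw [le_div_iff₀ hd0]; linarith
    have h2 := Nat.sub_one_lt_floor (6 * ρ / d)
    have h3 : 6 * ρ / d = 2 * (3 * ρ / d) := by ring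
    refine ⟨⌊6 * ρ / d⌋₊, ?_, Nat.floor_le (by positivity), by linarith⟩
    exact_mod_cast (by linarith : (0 : ℝ) < ⌊6 * ρ / d⌋₊)
  have hTpos : (0 : ℝ) < T := mod_cast hT0
  have hNpos : (0 : ℝ) < N := mod_cast hN
  set Q := ∫ s, m (Real.cos (θ - ς * s / l)) * axisKernelOf p s
  set x : Fin N → (Fin d → Fin T) → Sph d := fun j n => columnPoint (linFrame hd (U j)) hς
    (θ + ς * ((frameEquiv (linFrame hd (U j)) 0).symm (latticePt fun i => (n i : ℕ))).1 / l)
  have h1 := norm_sum_column_le hd hp hm hmK hK hN U hδ hδ1 hU hε0 hUε hl0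
    (by positivity : 0 < 2 * ρ) hrl hT0 x
  set col : Fin N × (Fin d → Fin T) → ℂ := fun c =>
    ∫ h in Metric.ball (0 : EuclideanSpace ℝ (Fin d)) (2 * ρ), m (sphInner (x c.1 c.2) (chart l h)) *
        tubeKernel p (linFrame hd (U c.1)) δ (h - latticePt fun i => (c.2 i : ℕ))
  set B := ∫ w, crossKernel d δ w
  set B₁ := ∫ w, ‖w‖ * crossKernel d δ w
  set E := Real.pi * K * A * (3 * (160 * ρ ^ 2 / (l * Real.sin θ) + 2 / ρ) * B) +
    Real.pi * K * A * (4 / ρ * B₁)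
  have h2 : ∀ c, ‖col c - (B : ℂ) * Q‖ ≤ E := fun c => by
    refine norm_column_sub_le (linFrame hd (U c.1)) hς hθ hρ2 hl hm hmK hA
      (crossKernel_nonneg d δ) (integrable_crossKernel d hδ) (integrable_norm_mul_crossKernel d hδ) ?_
    refine (norm_latticePt_le (T := T) fun i => (c.2 i).2.le).trans ?_
    rw [le_div_iff₀ hd0] at hT1
    linarith
  have hcard : (Fintype.card (Fin N × (Fin d → Fin T)) : ℝ) = N * T ^ d := by simp
  -- All N T^d columns approximate the same number B Q, so there is no cancellation in the sum.
  have h3 : (N * T ^ d : ℝ) * (B * ‖Q‖) ≤ ‖∑ c, col c‖ + (N * T ^ d : ℝ) * E := by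
    have hB : 0 ≤ B := integral_nonneg (crossKernel_nonneg d δ)
    have h4 : ∑ _c : Fin N × (Fin d → Fin T), (B : ℂ) * Q =
        ∑ c, col c - ∑ c, (col c - (B : ℂ) * Q) := by
      rw [Finset.sum_sub_distrib]; ring
    have h5 : ‖∑ _c : Fin N × (Fin d → Fin T), (B : ℂ) * Q‖ = (N * T ^ d : ℝ) * (B * ‖Q‖) := by
      rw [Finset.sum_const, Finset.card_univ, ← Nat.cast_smul_eq_nsmul ℝ, hcard, norm_smul,
        norm_mul (B : ℂ), Complex.norm_real, Real.norm_of_nonneg hB,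
        Real.norm_of_nonneg (by positivity : (0 : ℝ) ≤ N * T ^ d)]
    rw [← h5, h4]
    refine (norm_sub_le _ _).trans (add_le_add le_rfl ?_)
    refine (norm_sum_le _ _).trans ((Finset.sum_le_card_nsmul _ _ E fun c _ => h2 c).trans ?_)
    rw [Finset.card_univ, ← Nat.cast_smul_eq_nsmul ℝ, hcard, smul_eq_mul]
  have hvol1 : volume.real (Metric.ball (0 : Cross d) δ) =
      δ ^ (d - 1) * volume.real (Metric.ball (0 : Cross d) 1) := by
    rw [Measure.real, Measure.addHaar_ball_of_pos _ _ hδ, finrank_euclideanSpace_fin,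
      ENNReal.toReal_mul, ENNReal.toReal_ofReal (by positivity)]
    rfl
  have hvol2 : volume.real (Metric.ball (0 : EuclideanSpace ℝ (Fin d)) (2 * ρ)) =
      (2 * ρ) ^ d * volume.real (Metric.ball (0 : EuclideanSpace ℝ (Fin d)) 1) := by
    rw [Measure.real, Measure.addHaar_ball_of_pos _ _ (by positivity), finrank_euclideanSpace_fin,
      ENNReal.toReal_mul, ENNReal.toReal_ofReal (by positivity)]
    rfl
  set V := volume.real (Metric.ball (0 : EuclideanSpace ℝ (Fin d)) 1)
  set V' := volume.real (Metric.ball (0 : Cross d) 1)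
  have hV : 0 ≤ V := measureReal_nonneg
  have hV' : 0 ≤ V' := measureReal_nonneg
  have hK0 : 0 ≤ K := ENNReal.toReal_nonneg
  have h6 : (6 ^ d * volume.real (Metric.ball (0 : EuclideanSpace ℝ (Fin d)) (2 * ρ)) * ε /
      T ^ d) ^ pExp p ≤ max 1 ((4 * d) ^ d * V) * ε ^ pExp p := by
    have h7 : 6 ^ d * volume.real (Metric.ball (0 : EuclideanSpace ℝ (Fin d)) (2 * ρ)) * ε / T ^ d ≤
        (4 * d) ^ d * V * ε := by
      rw [div_le_iff₀ (by positivity), hvol2, ← mul_assoc, ← mul_pow]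
      have h8 : 6 * (2 * ρ) ≤ 4 * d * T := by
        rw [div_le_iff₀ hd0] at hT2; linarith
      calc (6 * (2 * ρ)) ^ d * V * ε ≤ (4 * d * T) ^ d * V * ε := by gcongr
        _ = _ := by rw [mul_pow]; ring
    refine (Real.rpow_le_rpow (by positivity) h7 (pExp_nonneg p)).trans ?_
    rw [Real.mul_rpow (by positivity) hε0.le]
    gcongr
    exact rpow_pExp_le_max hp (by positivity)
  have h9 : B * ‖Q‖ ≤ K * (δ ^ (d - 1) * V' * (max 1 ((4 * d) ^ d * V) * ε ^ pExp p)) + E := by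
    have hNT : (0 : ℝ) < N * T ^ d := by positivity
    refine le_of_mul_le_mul_left ?_ hNT
    refine (h3.trans (add_le_add h1 le_rfl)).trans ?_
    rw [mul_add _ _ E, hvol1]
    refine add_le_add ?_ le_rfl
    calc K * (T ^ d * N * (δ ^ (d - 1) * V') * _) ≤
        K * (T ^ d * N * (δ ^ (d - 1) * V') * (max 1 ((4 * d) ^ d * V) * ε ^ pExp p)) := by gcongr
      _ = _ := by ring
  -- The mass of the transverse kernel, its first moment and the section of a tube all carry the
  -- factor δ^{d-1}, which cancels.
  have hδd : 0 < δ ^ (d - 1) := by positivity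
  refine le_of_mul_le_mul_left ?_ hδd
  rw [← mul_assoc, ← integral_crossKernel d hδ]
  refine h9.trans (le_of_eq ?_)
  simp only [E, B, B₁]
  rw [integral_crossKernel d hδ, integral_norm_mul_crossKernel d hδ]
  field_simp
  ring

/-- With u³ = δ² l sin θ and ρ = u/δ, the errors ρ²/(l sin θ) and 1/(ρδ) both equal 1/u, and 1/ρ ≤
1/u as δ ≤ 1. If u ≤ 320 d the trivial bound is already of order 1/u. -/
theorem exists_norm_integral_cos_mul_axisKernelOf_le (hd : 1 ≤ d) :
    ∃ C : ℝ, 0 ≤ C ∧ ∀ p : ℝ≥0∞, 1 ≤ p → ∀ m : ℝ → ℂ, Measurable m →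
      (∀ t, ‖m t‖ ≤ (sphSchurNorm d p m).toReal) → sphSchurNorm d p m ≠ ⊤ →
      ∀ δ : ℝ, 0 < δ → δ ≤ 1 → ∀ ε ∈ besicovitchSet d δ, ∀ ς : ℝ, |ς| = 1 →
      ∀ θ ∈ Set.Ioo 0 Real.pi, ∀ l : ℝ, 0 < l →
        ‖∫ s, m (Real.cos (θ - ς * s / l)) * axisKernelOf p s‖ ≤
          C * (sphSchurNorm d p m).toReal *
            (ε ^ pExp p + 1 / (δ ^ 2 * l * Real.sin θ) ^ (1 / 3 : ℝ)) := by
  obtain ⟨A, hA⟩ := exists_kernelDecay_axisKernelOf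
  have hA0 : 0 ≤ A := (hA 1).nonneg
  set c := ∫ w, ‖crossHat d w‖ ^ 2
  set c' := ∫ w, ‖w‖ * ‖crossHat d w‖ ^ 2
  have hc : 0 < c := integral_norm_crossHat_sq_pos d
  have hc' : 0 ≤ c' := integral_nonneg fun w => by positivity
  have hd' : (1 : ℝ) ≤ d := mod_cast hd
  set V := volume.real (Metric.ball (0 : Cross d) 1) * max 1 ((4 * d) ^ d *
            volume.real (Metric.ball (0 : EuclideanSpace ℝ (Fin d)) 1))
  have hV : 0 ≤ V := by positivity
  have hπ := Real.pi_pos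
  set C₁ := (Real.pi * A * (3 * 162 * c + 4 * c') + V) / c
  refine ⟨C₁ + A * Real.pi * (320 * d), by positivity, ?_⟩
  intro p hp m hm hmK hK δ hδ hδ1 ε hε ς hς θ hθ l hl
  have hε0 : 0 < ε := hε.1
  have hsθ : 0 < Real.sin θ := Real.sin_pos_of_pos_of_lt_pi hθ.1 hθ.2
  set K := (sphSchurNorm d p m).toReal
  have hK0 : 0 ≤ K := ENNReal.toReal_nonneg
  set y := δ ^ 2 * l * Real.sin θ
  have hy : 0 < y := by positivity
  set u := y ^ (1 / 3 : ℝ)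
  have hu : 0 < u := by positivity
  have hu3 : u ^ 3 = y := by
    rw [← Real.rpow_natCast, ← Real.rpow_mul hy.le]; norm_num
  have hεa : 0 ≤ ε ^ pExp p := by positivity
  rcases le_total (320 * d : ℝ) u with h | h
  · have hρ : 2 * (d : ℝ) ≤ u / δ := by
      rw [le_div_iff₀ hδ]
      nlinarith
    have hl' : 320 * (u / δ) ^ 2 ≤ l * Real.sin θ := by
      have : l * Real.sin θ = u ^ 3 / δ ^ 2 := by rw [hu3]; simp only [y]; field_simp
      rw [this, div_pow, ← mul_div_assoc]
      gcongr
      nlinarith [sq_nonneg u]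
    have h1 := norm_integral_cos_mul_axisKernelOf_le hd hp hm hmK hK (hA p) hδ hδ1 hε hς hθ hρ hl'
    have h2 : 160 * (u / δ) ^ 2 / (l * Real.sin θ) = 160 * (1 / u) := by
      have : l * Real.sin θ = u ^ 3 / δ ^ 2 := by rw [hu3]; simp only [y]; field_simp
      rw [this]; field_simp
    have h3 : 2 / (u / δ) ≤ 2 * (1 / u) := by
      rw [div_div_eq_mul_div, mul_one_div]
      gcongr
      linarith
    have h4 : 4 / (u / δ * δ) = 4 * (1 / u) := by field_simp
    rw [h2, h4] at h1
    have h5 : c * ‖∫ s, m (Real.cos (θ - ς * s / l)) * axisKernelOf p s‖ ≤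
        c * (C₁ * K * (ε ^ pExp p + 1 / u)) := by
      refine h1.trans ?_
      have h6 : Real.pi * A * (3 * (160 * (1 / u) + 2 / (u / δ)) * c + 4 * (1 / u) * c') ≤
          Real.pi * A * (3 * (160 * (1 / u) + 2 * (1 / u)) * c + 4 * (1 / u) * c') := by gcongr
      have h7 : volume.real (Metric.ball (0 : Cross d) 1) * (max 1 ((4 * d) ^ d *
            volume.real (Metric.ball (0 : EuclideanSpace ℝ (Fin d)) 1)) * ε ^ pExp p) =
          V * ε ^ pExp p := by simp only [V]; ring
      rw [h7]
      have h8 : c * (C₁ * K * (ε ^ pExp p + 1 / u)) =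
          K * ((Real.pi * A * (3 * 162 * c + 4 * c') + V) * (ε ^ pExp p + 1 / u)) := by
        simp only [C₁]; field_simp
      rw [h8]
      refine mul_le_mul_of_nonneg_left ?_ hK0
      have h9 : 0 ≤ Real.pi * A * (3 * 162 * c + 4 * c') * ε ^ pExp p := by positivity
      have h10 : 0 ≤ V * (1 / u) := by positivity
      nlinarith
    refine (le_of_mul_le_mul_left h5 hc).trans ?_
    gcongr
    have : 0 ≤ A * Real.pi * (320 * d) := by positivity
    linarith
  · have h1 : ‖∫ s, m (Real.cos (θ - ς * s / l)) * axisKernelOf p s‖ ≤ K * (A * Real.pi) := by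
      calc _ ≤ ∫ s, K * ‖axisKernelOf p s‖ :=
            norm_integral_le_of_norm_le ((hA p).integrable.norm.const_mul K)
              (Filter.Eventually.of_forall fun s => by
                rw [norm_mul]; gcongr; exact hmK _)
        _ ≤ _ := by
            rw [integral_const_mul]
            gcongr
            exact (hA p).integral_norm_le
    have h2 : 1 ≤ 320 * d * (1 / u) := by rwa [mul_one_div, one_le_div hu]
    have h3 : 0 ≤ C₁ := by positivity
    calc _ ≤ K * (A * Real.pi) * 1 := by rw [mul_one]; exact h1
      _ ≤ K * (A * Real.pi) * (320 * d * (1 / u)) := by gcongr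
      _ = A * Real.pi * (320 * d) * K * (0 + 1 / u) := by ring
      _ ≤ _ := by
          gcongr
          linarith

/-- The average of `m ∘ cos` against `axisKernel` at scale `1 / l`. -/
def cosAverage (m : ℝ → ℂ) (l θ : ℝ) : ℂ := ∫ s, m (Real.cos (θ - s / l)) * axisKernel s

theorem cosAverage_periodic (m : ℝ → ℂ) (l : ℝ) :
    Function.Periodic (cosAverage m l) (2 * Real.pi) := fun θ => by
  unfold cosAverage
  congr 1 with s
  rw [add_sub_right_comm, Real.cos_add_two_pi]

/-- For p ≥ 2 the test kernel is conjugated, that is reflected, and the opposite sign ς undoes this.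
General angles reduce to (0, π) by periodicity and parity of the cosine, parity again changing the
sign ς. -/
theorem exists_norm_cosAverage_le (hd : 1 ≤ d) :
    ∃ C : ℝ, 0 ≤ C ∧ ∀ p : ℝ≥0∞, 1 ≤ p → ∀ m : ℝ → ℂ, Measurable m →
      (∀ t, ‖m t‖ ≤ (sphSchurNorm d p m).toReal) → sphSchurNorm d p m ≠ ⊤ →
      ∀ δ : ℝ, 0 < δ → δ ≤ 1 → ∀ ε ∈ besicovitchSet d δ, ∀ l : ℝ, 0 < l →
      ∀ θ : ℝ, Real.sin θ ≠ 0 →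
        ‖cosAverage m l θ‖ ≤ C * (sphSchurNorm d p m).toReal *
            (ε ^ pExp p + 1 / (δ ^ 2 * l * |Real.sin θ|) ^ (1 / 3 : ℝ)) := by
  obtain ⟨C, hC, h⟩ := exists_norm_integral_cos_mul_axisKernelOf_le hd
  refine ⟨C, hC, ?_⟩
  intro p hp m hm hmK hK δ hδ hδ1 ε hε l hl θ hθ
  have key : ∀ ς : ℝ, |ς| = 1 → ∀ θ ∈ Set.Ioo 0 Real.pi,
      ‖∫ s, m (Real.cos (θ - ς * s / l)) * axisKernel s‖ ≤ C * (sphSchurNorm d p m).toReal *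
            (ε ^ pExp p + 1 / (δ ^ 2 * l * Real.sin θ) ^ (1 / 3 : ℝ)) := by
    intro ς hς θ hθ
    by_cases hp2 : p < 2
    · have := h p hp m hm hmK hK δ hδ hδ1 ε hε ς hς θ hθ l hl
      simpa only [axisKernelOf, if_pos hp2] using this
    · have := h p hp m hm hmK hK δ hδ hδ1 ε hε (-ς) (by rwa [abs_neg]) θ hθ l hl
      simp only [axisKernelOf, if_neg hp2, conj_axisKernel] at this
      rw [← integral_neg_eq_self]
      convert this using 6
      ring_nf
  obtain ⟨θ', hθ', hcos, hG⟩ : ∃ θ' ∈ Set.Ioc (-Real.pi) Real.pi, Real.sin θ' = Real.sin θ ∧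
      cosAverage m l θ' = cosAverage m l θ := by
    refine ⟨toIocMod Real.two_pi_pos (-Real.pi) θ, ?_, ?_, ?_⟩
    · have := toIocMod_mem_Ioc Real.two_pi_pos (-Real.pi) θ
      rwa [show -Real.pi + 2 * Real.pi = Real.pi by ring] at this
    · rw [← self_sub_toIocDiv_zsmul]
      exact Real.sin_periodic.sub_zsmul_eq _
    · rw [← self_sub_toIocDiv_zsmul]
      exact (cosAverage_periodic m l).sub_zsmul_eq _
  rw [← hG, ← hcos]
  rw [← hcos] at hθ
  have hπ' : θ' ≠ Real.pi := fun h => hθ (by rw [h, Real.sin_pi])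
  have h0' : θ' ≠ 0 := fun h => hθ (by rw [h, Real.sin_zero])
  rcases lt_or_gt_of_ne h0' with h0 | h0
  · have hmem : -θ' ∈ Set.Ioo 0 Real.pi := ⟨by linarith, by linarith [hθ'.1]⟩
    have h1 := key (-1) (by simp) (-θ') hmem
    have h2 := Real.sin_pos_of_pos_of_lt_pi hmem.1 hmem.2
    rw [Real.sin_neg] at h1 h2
    rw [abs_of_neg (by linarith)]
    refine le_trans (le_of_eq ?_) h1
    unfold cosAverage
    congr 2 with s
    rw [← Real.cos_neg]
    congr 3
    ring
  · have hmem : θ' ∈ Set.Ioo 0 Real.pi := ⟨h0, lt_of_le_of_ne hθ'.2 hπ'⟩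
    have h1 := key 1 (by simp) θ' hmem
    rw [abs_of_pos (Real.sin_pos_of_pos_of_lt_pi hmem.1 hmem.2)]
    simpa only [one_mul, cosAverage] using h1

theorem exists_norm_cosAverage_le_of_bound : ∃ C : ℝ, 0 ≤ C ∧ ∀ (m : ℝ → ℂ) (K : ℝ),
    (∀ t, ‖m t‖ ≤ K) → ∀ l θ, ‖cosAverage m l θ‖ ≤ C * K := by
  obtain ⟨A, hA⟩ := (𝓕⁻ axisKernelHat).exists_kernelDecay
  rw [← axisKernel_eq] at hA
  have hA0 := hA.nonneg
  refine ⟨A * Real.pi, by positivity, fun m K hmK l θ => ?_⟩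
  have hK : 0 ≤ K := (norm_nonneg _).trans (hmK 0)
  calc _ ≤ ∫ s, K * ‖axisKernel s‖ := norm_integral_le_of_norm_le (hA.integrable.norm.const_mul K)
        (Filter.Eventually.of_forall fun s => by rw [norm_mul]; gcongr; exact hmK _)
    _ ≤ K * (A * Real.pi) := by
        rw [integral_const_mul]
        gcongr
        exact hA.integral_norm_le
    _ = _ := mul_comm _ _

end Core

/-! ### Modification of the symbol on null sets. -/

section BoundedSymbols

variable {d : ℕ}

theorem schurNorm_congr_ae {X : Type*} [MeasurableSpace X] {μ : Measure X} [SFinite μ]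
    (p : ℝ≥0∞) {m m' : X × X → ℂ} (h : ∀ᵐ z ∂(μ.prod μ), m z = m' z) :
    schurNorm p μ m = schurNorm p μ m' := by
  unfold schurNorm
  congr 1
  ext K
  refine forall_congr' fun a => forall_congr' fun b => ?_
  have : (∀ᵐ z ∂(μ.prod μ), b z = m z * a z) ↔ ∀ᵐ z ∂(μ.prod μ), b z = m' z * a z :=
    Filter.eventually_congr (h.mono fun z hz => by rw [hz])
  rw [this]

/-- The preimage is covered by countably many branches of the arccosine, which are differentiable on
(-1, 1); the endpoints add only countably many points. -/
theorem volume_cos_preimage_eq_zero {S : Set ℝ} (hS : volume S = 0) :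
    volume (Real.cos ⁻¹' S) = 0 := by
  have hsub : Real.cos ⁻¹' S ⊆ ⋃ k : ℤ,
      ((fun s => 2 * k * Real.pi + Real.arccos s) '' (S ∩ Set.Ioo (-1) 1 ∪ {-1, 1}) ∪
        (fun s => 2 * k * Real.pi - Real.arccos s) '' (S ∩ Set.Ioo (-1) 1 ∪ {-1, 1})) := by
    intro t ht
    have h1 := Real.neg_one_le_cos t
    have h2 := Real.cos_le_one t
    have hmem : Real.cos t ∈ S ∩ Set.Ioo (-1) 1 ∪ {-1, 1} := by
      rcases h1.eq_or_lt with h | h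
      · exact Or.inr (Or.inl h.symm)
      rcases h2.eq_or_lt with h' | h'
      · exact Or.inr (Or.inr h')
      exact Or.inl ⟨ht, h, h'⟩
    obtain ⟨k, hk⟩ := Real.cos_eq_cos_iff.1 (Real.cos_arccos h1 h2)
    refine Set.mem_iUnion.2 ⟨k, ?_⟩
    rcases hk with hk | hk
    · exact Or.inl ⟨_, hmem, hk.symm⟩
    · exact Or.inr ⟨_, hmem, hk.symm⟩
  have key : ∀ f : ℝ → ℝ, (∀ s ∈ Set.Ioo (-1 : ℝ) 1, DifferentiableAt ℝ f s) →
      volume (f '' (S ∩ Set.Ioo (-1) 1 ∪ {-1, 1})) = 0 := fun f hf => by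
    rw [Set.image_union]
    refine measure_union_null ?_ ((((Set.finite_singleton _).insert _).image f).measure_zero _)
    exact addHaar_image_eq_zero_of_differentiableOn_of_addHaar_eq_zero _
      (fun s hs => (hf s hs.2).differentiableWithinAt) (measure_mono_null Set.inter_subset_left hS)
  have harc : ∀ s ∈ Set.Ioo (-1 : ℝ) 1, DifferentiableAt ℝ Real.arccos s := fun s hs =>
    (Real.hasDerivAt_arccos hs.1.ne' hs.2.ne).differentiableAt
  refine measure_mono_null hsub (measure_iUnion_null fun k => measure_union_null ?_ ?_)
  · exact key _ fun s hs => (harc s hs).const_add _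
  · exact key _ fun s hs => (harc s hs).const_sub _

/-- A symbol can be modified on a null set so that it becomes bounded by its multiplier norm. -/
theorem exists_bounded_symbol (hd : 1 ≤ d) {p : ℝ≥0∞} (hp : 1 ≤ p) {m : ℝ → ℂ}
    (hm : Measurable fun t : Set.Ioo (-1 : ℝ) 1 => m t)
    (hM : ∃ M : ℝ, ∀ t ∈ Set.Ioo (-1 : ℝ) 1, ‖m t‖ ≤ M) (hK : sphSchurNorm d p m ≠ ⊤) :
    ∃ m' : ℝ → ℂ, Measurable m' ∧ sphSchurNorm d p m' = sphSchurNorm d p m ∧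
      (∀ t, ‖m' t‖ ≤ (sphSchurNorm d p m).toReal) ∧
      ∀ᵐ t : ℝ, m (Real.cos t) = m' (Real.cos t) := by
  obtain ⟨M, hM⟩ := hM
  -- Nothing is known about m outside (-1, 1), so it is first replaced by 0 there, then also where
  -- it exceeds its multiplier norm, a null set inside (-1, 1).
  set m₁ : ℝ → ℂ := (Set.Ioo (-1 : ℝ) 1).indicator m with hm₁_def
  have hm₁ : Measurable m₁ := by
    have h1 := (MeasurableEmbedding.subtype_coe
      (measurableSet_Ioo (a := (-1 : ℝ)) (b := 1))).measurable_extend hm (measurable_const (a := (0 : ℂ)))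
    convert h1 using 1
    ext t
    by_cases ht : t ∈ Set.Ioo (-1 : ℝ) 1
    · rw [hm₁_def, Set.indicator_of_mem ht]
      exact (Subtype.val_injective.extend_apply (fun t : Set.Ioo (-1 : ℝ) 1 => m t) _ ⟨t, ht⟩).symm
    · rw [hm₁_def, Set.indicator_of_notMem ht, Function.extend_apply']
      rintro ⟨a, rfl⟩; exact ht a.2
  have hM₁ : ∀ t, ‖m₁ t‖ ≤ max M 0 := fun t => by
    by_cases ht : t ∈ Set.Ioo (-1 : ℝ) 1
    · rw [hm₁_def, Set.indicator_of_mem ht]; exact (hM t ht).trans (le_max_left _ _)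
    · rw [hm₁_def, Set.indicator_of_notMem ht, norm_zero]; exact le_max_right _ _
  have hcs : Measurable fun z : Sph d × Sph d => sphInner z.1 z.2 := continuous_sphInner.measurable
  have hIoo : ∀ᵐ z ∂((sphMeasure d).prod (sphMeasure d)), sphInner z.1 z.2 ∈ Set.Ioo (-1 : ℝ) 1 :=
    (Measure.ae_prod_iff_ae_ae (hcs measurableSet_Ioo)).2
      (Filter.Eventually.of_forall fun x => measure_sphInner_notMem hd x)
  have hK₁ : sphSchurNorm d p m₁ = sphSchurNorm d p m :=
    schurNorm_congr_ae p (hIoo.mono fun z hz => Set.indicator_of_mem hz m)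
  set K := (sphSchurNorm d p m).toReal
  have hK0 : 0 ≤ K := ENNReal.toReal_nonneg
  have hbS : MeasurableSet {t | ‖m₁ t‖ ≤ K} := measurableSet_le hm₁.norm measurable_const
  set m₂ : ℝ → ℂ := {t | ‖m₁ t‖ ≤ K}.indicator m₁
  refine ⟨m₂, hm₁.indicator hbS, ?_, fun t => ?_, ?_⟩
  · rw [← hK₁]
    refine schurNorm_congr_ae p ?_
    have : ∀ᵐ z ∂((sphMeasure d).prod (sphMeasure d)), ‖m₁ (sphInner z.1 z.2)‖ ≤ K := by
      refine (Measure.ae_prod_iff_ae_ae (hcs hbS)).2 (Filter.Eventually.of_forall fun x => ?_)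
      have := norm_comp_sphInner_le hd hp hm₁ hM₁ (by rwa [hK₁]) x
      rwa [hK₁] at this
    exact this.mono fun z hz => Set.indicator_of_mem (s := {t | ‖m₁ t‖ ≤ K}) hz m₁
  · by_cases ht : t ∈ {t | ‖m₁ t‖ ≤ K}
    · simp only [m₂]
      rw [Set.indicator_of_mem ht]; exact ht
    · simp only [m₂]
      rw [Set.indicator_of_notMem ht, norm_zero]; exact hK0
  · have h1 := norm_le_sphSchurNorm hd hp hm₁ hM₁ (by rwa [hK₁])
    rw [hK₁] at h1
    have h2 : ∀ᵐ t : ℝ, t ∈ Set.Ioo (-1 : ℝ) 1 → m t = m₂ t := by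
      filter_upwards [h1] with t ht hmem
      simp only [m₂]
      rw [Set.indicator_of_mem (s := {t | ‖m₁ t‖ ≤ K}) (ht hmem)]
      exact (Set.indicator_of_mem hmem m).symm
    have h3 : volume (Real.cos ⁻¹' {t | ¬(t ∈ Set.Ioo (-1 : ℝ) 1 → m t = m₂ t)}) = 0 :=
      volume_cos_preimage_eq_zero h2
    have h4 : volume (Real.cos ⁻¹' {-1, 1}) = 0 := volume_cos_preimage_eq_zero
      (((Set.finite_singleton _).insert _).measure_zero _)
    have h5 : ∀ᵐ t : ℝ, Real.cos t ∉ ({-1, 1} : Set ℝ) := measure_eq_zero_iff_ae_notMem.1 h4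
    have h6 : ∀ᵐ t : ℝ, (Real.cos t ∈ Set.Ioo (-1 : ℝ) 1 → m (Real.cos t) = m₂ (Real.cos t)) := by
      rw [ae_iff]; exact h3
    filter_upwards [h5, h6] with t ht1 ht2
    refine ht2 ⟨lt_of_le_of_ne (Real.neg_one_le_cos t) fun h => ht1 (Or.inl h.symm),
      lt_of_le_of_ne (Real.cos_le_one t) fun h => ht1 (Or.inr h)⟩

theorem lpPiece_congr (w₀ w : ℝ → ℝ) (n : ℕ) {m m' : ℝ → ℂ}
    (h : ∀ᵐ t : ℝ, m (Real.cos t) = m' (Real.cos t)) (θ : ℝ) :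
    lpPiece w₀ w n m θ = lpPiece w₀ w n m' θ := by
  unfold lpPiece convolution
  refine integral_congr_ae ?_
  have := (Measure.measurePreserving_sub_left (volume : Measure ℝ) θ).quasiMeasurePreserving.ae h
  filter_upwards [this] with t ht
  simp only [ht]

end BoundedSymbols

/-! ### General properties of the Besicovitch function. -/

section Besicovitch

variable {d : ℕ}

theorem tubeFrame_nonempty (hd : 1 ≤ d) : Nonempty (TubeFrame d) := by
  have h := (stdOrthonormalBasis ℝ (WithLp 2 (ℝ × Cross d)))
  let e : WithLp 2 (ℝ × Cross d) ≃ₗᵢ[ℝ] EuclideanSpace ℝ (Fin d) :=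
    (h.reindex (finCongr ((finrank_model hd).trans finrank_euclideanSpace_fin))).repr
  exact ⟨e.toLinearIsometry.toAffineIsometry⟩

theorem preimage_image_modelTube (hd : 1 ≤ d) (U : TubeFrame d) (a b δ : ℝ) :
    frameEquiv (linFrame hd U) (U 0) ⁻¹' (U '' modelTube d a b δ) =
      Set.Icc a b ×ˢ Metric.ball (0 : Cross d) δ := by
  ext z
  constructor
  · rintro ⟨y, hy, hyz⟩
    rw [frameEquiv_apply, ← frame_apply hd] at hyz
    have := U.injective hyz
    subst this
    exact ⟨hy.1, mem_ball_zero_iff.2 hy.2⟩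
  · rintro ⟨h1, h2⟩
    exact frame_mem_image hd U ⟨h1, mem_ball_zero_iff.1 h2⟩

theorem measurableSet_image_modelTube (hd : 1 ≤ d) (U : TubeFrame d) (a b δ : ℝ) :
    MeasurableSet (U '' modelTube d a b δ) := by
  rw [← (frameEquiv (linFrame hd U) (U 0)).measurableSet_preimage, preimage_image_modelTube]
  exact measurableSet_Icc.prod measurableSet_ball

theorem volume_real_tube (hd : 1 ≤ d) (U : TubeFrame d) (δ : ℝ) :
    volume.real (tube U δ) = volume.real (Metric.ball (0 : Cross d) δ) := by
  rw [Measure.real, tube, volume_image_modelTube hd]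
  simp [Measure.real]

theorem bddBelow_besicovitchSet (d : ℕ) (δ : ℝ) : BddBelow (besicovitchSet d δ) :=
  ⟨0, fun _ hε => hε.1.le⟩

theorem besicovitchFun_nonneg (d : ℕ) (δ : ℝ) : 0 ≤ besicovitchFun d δ :=
  Real.sInf_nonneg fun _ hε => hε.1.le

/-- One tube suffices. Without this the real infimum would take its default value 0. -/
theorem besicovitchSet_nonempty (hd : 1 ≤ d) (δ : ℝ) : (besicovitchSet d δ).Nonempty := by
  obtain ⟨U⟩ := tubeFrame_nonempty hd
  refine ⟨max 1 (volume.real (⋃ _j : Fin 1, tube U δ) / ∑ _j : Fin 1, volume.real (tube U δ)),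
    lt_of_lt_of_le one_pos (le_max_left _ _), 1, fun _ => U, one_pos, ?_, le_max_right _ _⟩
  exact fun i j hij => absurd (Subsingleton.elim i j) hij

/-- To bound a quantity by `besicovitchFun d δ ^ a`, it is enough to consider `besicovitchSet`. -/
theorem le_besicovitchFun_rpow (hd : 1 ≤ d) {δ a B x y : ℝ} (ha : 0 ≤ a)
    (h : ∀ ε ∈ besicovitchSet d δ, x ≤ B * (ε ^ a + y)) :
    x ≤ B * (besicovitchFun d δ ^ a + y) := by
  obtain ⟨u, -, hu, hmem⟩ :=
    exists_seq_tendsto_sInf (besicovitchSet_nonempty hd δ) (bddBelow_besicovitchSet d δ)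
  refine ge_of_tendsto' (((hu.rpow_const (Or.inr ha)).add_const y).const_mul B) fun n => h _ (hmem n)

/-- Contracting v by the factor 1 - 1/(2δ) moves it by at most 1/2 and brings it to distance at
least 1/2 from the boundary of the large ball. -/
theorem exists_half_ball_subset {E : Type*} [NormedAddCommGroup E] [NormedSpace ℝ E] {δ : ℝ}
    (hδ : 1 ≤ δ) {v : E} (hv : ‖v‖ < δ) :
    ∃ v' : E, Metric.ball v' (1 / 2) ⊆ Metric.ball v 1 ∩ Metric.ball 0 δ := by
  have hδ0 : 0 < δ := by linarith
  have h1 : 0 ≤ 1 - (2 * δ)⁻¹ := by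
    rw [sub_nonneg]; exact inv_le_one_of_one_le₀ (by linarith)
  refine ⟨(1 - (2 * δ)⁻¹) • v, fun z hz => ?_⟩
  rw [mem_ball_iff_norm] at hz
  have h2 : ‖z - v‖ ≤ ‖z - (1 - (2 * δ)⁻¹) • v‖ + (2 * δ)⁻¹ * ‖v‖ := by
    rw [← Real.norm_of_nonneg (by positivity : 0 ≤ (2 * δ)⁻¹), ← norm_smul,
      Real.norm_of_nonneg (by positivity : 0 ≤ (2 * δ)⁻¹)]
    refine le_trans (le_of_eq ?_) (norm_sub_le _ _)
    congr 1
    module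
  have h3 : ‖z‖ ≤ ‖z - (1 - (2 * δ)⁻¹) • v‖ + (1 - (2 * δ)⁻¹) * ‖v‖ := by
    rw [← Real.norm_of_nonneg h1, ← norm_smul, Real.norm_of_nonneg h1]
    exact norm_le_norm_sub_add _ _ |>.trans (le_of_eq (by ring))
  have h4 : (2 * δ)⁻¹ * ‖v‖ ≤ 1 / 2 := by
    calc (2 * δ)⁻¹ * ‖v‖ ≤ (2 * δ)⁻¹ * δ := by gcongr
      _ = 1 / 2 := by field_simp
  have h5 : (1 - (2 * δ)⁻¹) * ‖v‖ ≤ δ - 1 / 2 := by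
    calc (1 - (2 * δ)⁻¹) * ‖v‖ ≤ (1 - (2 * δ)⁻¹) * δ := by gcongr
      _ = δ - 1 / 2 := by field_simp
  refine ⟨mem_ball_iff_norm.2 ?_, mem_ball_zero_iff.2 ?_⟩ <;> linarith

/-- The tube contains a piece [0, 1] × B(v', 1/2) whose points differ from y by at most 3 along the
axis and less than 1 across it. -/
theorem volume_half_ball_le (hd : 1 ≤ d) (U : TubeFrame d) {δ : ℝ} (hδ : 1 ≤ δ)
    {y : EuclideanSpace ℝ (Fin d)} (hy : y ∈ shiftedTube U δ) :
    volume (Metric.ball (0 : Cross d) (1 / 2)) ≤ volume (tube U δ ∩ Metric.ball y 4) := by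
  obtain ⟨z, ⟨hz1, hz2⟩, rfl⟩ := hy
  obtain ⟨v', hv'⟩ := exists_half_ball_subset hδ hz2
  set e := frameEquiv (linFrame hd U) (U 0)
  rw [← (measurePreserving_frameEquiv (linFrame hd U) (U 0)).measure_preimage_equiv
    (tube U δ ∩ Metric.ball (U z) 4)]
  calc volume (Metric.ball (0 : Cross d) (1 / 2))
      = volume (Set.Icc (0 : ℝ) 1 ×ˢ Metric.ball v' (1 / 2)) := by
        rw [Measure.volume_eq_prod, Measure.prod_prod, Real.volume_Icc,
          Measure.addHaar_ball_center volume v']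
        simp
    _ ≤ _ := by
        refine measure_mono fun t ht => ⟨?_, ?_⟩
        · have : t ∈ e ⁻¹' (U '' modelTube d 0 1 δ) := by
            rw [preimage_image_modelTube]
            exact ⟨ht.1, (hv' ht.2).2⟩
          exact this
        · rw [frameEquiv_apply, ← frame_apply hd, mem_ball_iff_norm, ← dist_eq_norm, U.dist_map,
            dist_eq_norm, ← sq_lt_sq₀ (norm_nonneg _) (by norm_num), WithLp.prod_norm_sq_eq_of_L2]
          have h3 : ‖(WithLp.toLp 2 t - z).fst‖ ≤ 3 := by
            have h5 : (WithLp.toLp 2 t - z).fst = t.1 - z.fst := rfl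
            rw [h5, Real.norm_eq_abs, abs_le]
            constructor <;> linarith [hz1.1, hz1.2, ht.1.1, ht.1.2]
          have h4 : ‖(WithLp.toLp 2 t - z).snd‖ < 1 := by
            have h5 : (WithLp.toLp 2 t - z).snd = t.2 - z.snd := rfl
            rw [h5]
            exact mem_ball_iff_norm.1 (hv' ht.2).1
          nlinarith [norm_nonneg (WithLp.toLp 2 t - z).fst, norm_nonneg (WithLp.toLp 2 t - z).snd]

/-- Thick tubes cannot be compressed. Pairs (y, z) at distance less than 4, with y in a shifted tube
and z in a tube, are counted in two ways: every y sees a fixed amount of the union of tubes, and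
every z sees at most a ball of radius 4. As the shifted tubes are disjoint, the sum of the volumes
is controlled by the volume of the union. -/
theorem exists_le_besicovitchFun (hd : 1 ≤ d) :
    ∃ c : ℝ, 0 < c ∧ ∀ δ : ℝ, 1 ≤ δ → c ≤ besicovitchFun d δ := by
  set v := volume (Metric.ball (0 : Cross d) (1 / 2))
  set b := volume (Metric.ball (0 : EuclideanSpace ℝ (Fin d)) 4)
  have hv : 0 < v := Metric.measure_ball_pos _ _ (by norm_num)
  have hv' : v ≠ ⊤ := measure_ball_lt_top.ne
  have hb : 0 < b := Metric.measure_ball_pos _ _ (by norm_num)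
  have hb' : b ≠ ⊤ := measure_ball_lt_top.ne
  have hvr : 0 < v.toReal := ENNReal.toReal_pos hv.ne' hv'
  have hbr : 0 < b.toReal := ENNReal.toReal_pos hb.ne' hb'
  refine ⟨v.toReal / b.toReal, by positivity, fun δ hδ => ?_⟩
  refine le_csInf (besicovitchSet_nonempty hd δ) ?_
  rintro ε ⟨hε, N, U, hN, hU, hUε⟩
  refine le_trans ?_ hUε
  set F := ⋃ j, shiftedTube (U j) δ
  set G := ⋃ j, tube (U j) δ
  have hF : MeasurableSet F :=
    MeasurableSet.iUnion fun j => measurableSet_image_modelTube hd (U j) 2 3 δ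
  have hG : MeasurableSet G :=
    MeasurableSet.iUnion fun j => measurableSet_image_modelTube hd (U j) 0 1 δ
  have hGtop : volume G ≠ ⊤ := by
    refine ((measure_iUnion_le _).trans_lt ?_).ne
    rw [tsum_fintype]
    exact ENNReal.sum_lt_top.2 fun j _ => volume_image_modelTube_lt_top hd (U j) δ
  set S : Set (EuclideanSpace ℝ (Fin d) × EuclideanSpace ℝ (Fin d)) :=
    {z | z.1 ∈ F ∧ z.2 ∈ G ∧ dist z.1 z.2 < 4}
  have hS : MeasurableSet S :=
    (measurable_fst hF).inter ((measurable_snd hG).inter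
      (measurableSet_lt (measurable_fst.dist measurable_snd) measurable_const))
  have h1 : v * volume F ≤ b * volume G := by
    calc v * volume F = ∫⁻ _ in F, v := by rw [setLIntegral_const]
      _ = ∫⁻ y, F.indicator (fun _ => v) y := (lintegral_indicator hF _).symm
      _ ≤ ∫⁻ y, volume (Prod.mk y ⁻¹' S) := by
          refine lintegral_mono fun y => ?_
          by_cases hy : y ∈ F
          · rw [Set.indicator_of_mem hy]
            obtain ⟨j, hj⟩ := Set.mem_iUnion.1 hy
            refine (volume_half_ball_le hd (U j) hδ hj).trans (measure_mono fun z hz => ?_)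
            exact ⟨hy, Set.mem_iUnion.2 ⟨j, hz.1⟩, by rw [dist_comm]; exact hz.2⟩
          · rw [Set.indicator_of_notMem hy]; exact zero_le
      _ = (volume.prod volume) S := (Measure.prod_apply hS).symm
      _ = ∫⁻ z, volume ((fun y => (y, z)) ⁻¹' S) := Measure.prod_apply_symm hS
      _ ≤ ∫⁻ z, G.indicator (fun _ => b) z := by
          refine lintegral_mono fun z => ?_
          by_cases hz : z ∈ G
          · rw [Set.indicator_of_mem hz]
            simp only [b]
            rw [← Measure.addHaar_ball_center volume z]
            exact measure_mono fun y hy => hy.2.2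
          · rw [Set.indicator_of_notMem hz, nonpos_iff_eq_zero]
            convert measure_empty (μ := (volume : Measure (EuclideanSpace ℝ (Fin d))))
            ext y
            simp only [Set.mem_preimage, Set.mem_empty_iff_false, iff_false]
            exact fun h => hz h.2.1
      _ = b * volume G := by rw [lintegral_indicator hG, setLIntegral_const]
  have h2 : volume F = ∑ j, volume (tube (U j) δ) := by
    rw [measure_iUnion hU fun j => measurableSet_image_modelTube hd (U j) 2 3 δ, tsum_fintype]
    refine Finset.sum_congr rfl fun j _ => ?_
    rw [shiftedTube, tube, volume_image_modelTube hd, volume_image_modelTube hd]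
    norm_num
  have h3 : (volume F).toReal = ∑ j, volume.real (tube (U j) δ) := by
    have h5 : ∀ j, volume (tube (U j) δ) ≠ ⊤ := fun j =>
      (volume_image_modelTube_lt_top hd (U j) δ).ne
    rw [h2, ENNReal.toReal_sum fun j _ => h5 j]
    rfl
  rw [← h3, div_le_div_iff₀ hbr ?_]
  · have h4 := ENNReal.toReal_mono (ENNReal.mul_ne_top hb' hGtop) h1
    rw [ENNReal.toReal_mul, ENNReal.toReal_mul] at h4
    rw [Measure.real]
    linarith
  · rw [h3]
    have : Nonempty (Fin N) := ⟨⟨0, hN⟩⟩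
    refine Finset.sum_pos (fun j _ => ?_) Finset.univ_nonempty
    rw [volume_real_tube hd]
    exact ENNReal.toReal_pos (Metric.measure_ball_pos _ _ (by linarith)).ne' measure_ball_lt_top.ne

end Besicovitch

/-! ### Littlewood-Paley pieces as superpositions of averages. -/

section Decomposition

open scoped SchwartzMap

/-- The dilation `ξ ↦ axisKernelHat (ξ / b)`. -/
def dilatedHat {b : ℝ} (hb : 0 < b) : 𝓢(ℝ, ℂ) :=
  SchwartzMap.compCLMOfContinuousLinearEquiv ℂ
    (ContinuousLinearEquiv.unitsEquivAut ℝ (Units.mk0 b⁻¹ (inv_ne_zero hb.ne'))) axisKernelHat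

theorem dilatedHat_apply {b : ℝ} (hb : 0 < b) (ξ : ℝ) :
    dilatedHat hb ξ = axisKernelHat (ξ * b⁻¹) := rfl

theorem fourierInv_real_eq (f : ℝ → ℂ) (s : ℝ) : 𝓕⁻ f s = ∫ ξ, (𝐞 (ξ * s) : ℂ) * f ξ := by
  rw [Real.fourierInv_eq]
  refine integral_congr_ae (Filter.Eventually.of_forall fun t => ?_)
  simp only [Circle.smul_def, smul_eq_mul, RCLike.inner_apply, conj_trivial]
  rw [mul_comm s t]

theorem fourierInv_comp_mul_inv (f : ℝ → ℂ) {b : ℝ} (hb : 0 < b) (s : ℝ) :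
    𝓕⁻ (fun ξ => f (ξ * b⁻¹)) s = b * 𝓕⁻ f (b * s) := by
  rw [fourierInv_real_eq, fourierInv_real_eq]
  have := Measure.integral_comp_mul_right (fun η => (𝐞 (η * (b * s)) : ℂ) * f η) b⁻¹
  rw [inv_inv, abs_of_pos hb, Complex.real_smul] at this
  rw [← this]
  refine integral_congr_ae (Filter.Eventually.of_forall fun t => ?_)
  simp only
  congr 3
  field_simp

theorem fourierInv_dilatedHat {b : ℝ} (hb : 0 < b) (s : ℝ) :
    𝓕⁻ (dilatedHat hb) s = b * axisKernel (b * s) := by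
  rw [SchwartzMap.fourierInv_coe, ← fourierInv_axisKernelHat, SchwartzMap.fourierInv_coe,
    ← fourierInv_comp_mul_inv _ hb]
  rfl

theorem fourierInv_mul_eq (f g : 𝓢(ℝ, ℂ)) (s : ℝ) :
    𝓕⁻ (fun ξ => f ξ * g ξ) s = ∫ u, (𝓕⁻ f) u * (𝓕⁻ g) (s - u) := by
  have h : (𝓕⁻ (SchwartzMap.pairing (ContinuousLinearMap.mul ℂ ℂ) f g) : 𝓢(ℝ, ℂ)) =
      SchwartzMap.convolution (ContinuousLinearMap.mul ℂ ℂ) (𝓕⁻ f) (𝓕⁻ g) := by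
    simp [SchwartzMap.convolution]
  have h1 := congrArg (fun F : 𝓢(ℝ, ℂ) => F s) h
  simp only [SchwartzMap.fourierInv_coe, SchwartzMap.convolution_apply] at h1
  simp only [SchwartzMap.fourierInv_coe]
  exact h1

/-- Averages of bounded functions against a convolution. -/
theorem integral_convolution_mul (f g : 𝓢(ℝ, ℂ)) {F : ℝ → ℂ} (hF : Measurable F) {K : ℝ}
    (hK : ∀ t, ‖F t‖ ≤ K) :
    ∫ s, (∫ u, f u * g (s - u)) * F s = ∫ u, f u * ∫ v, g v * F (u + v) := by
  have hi : Integrable (fun z : ℝ × ℝ => f z.2 * g (z.1 - z.2) * F z.1) (volume.prod volume) := by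
    have h := f.integrable.convolution_integrand (ContinuousLinearMap.mul ℂ ℂ) g.integrable
      (μ := volume) (ν := volume)
    exact h.mul_bdd (c := K) (hF.comp measurable_fst).aestronglyMeasurable
      (Filter.Eventually.of_forall fun z => hK _)
  simp_rw [← integral_mul_const]
  rw [integral_integral_swap hi]
  refine integral_congr_ae (Filter.Eventually.of_forall fun u => ?_)
  simp only
  rw [← integral_const_mul, ← integral_add_left_eq_self _ u]
  refine integral_congr_ae (Filter.Eventually.of_forall fun v => ?_)
  simp only [add_sub_cancel_left]
  ring

variable {w₀ w : ℝ → ℝ}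

theorem IsLittlewoodPaley.eq_zero_of_lt (hw : IsLittlewoodPaley w₀ w) {ξ : ℝ} (h : ξ < 1 / 2) :
    w ξ = 0 := by
  by_contra hne
  exact absurd (hw.support (subset_tsupport _ hne)).1 (not_le.2 h)

theorem IsLittlewoodPaley.hasCompactSupport (hw : IsLittlewoodPaley w₀ w) : HasCompactSupport w :=
  isCompact_Icc.of_isClosed_subset (isClosed_tsupport _) hw.support

theorem IsLittlewoodPaley.hasCompactSupport_zero (hw : IsLittlewoodPaley w₀ w) :
    HasCompactSupport w₀ :=
  isCompact_Icc.of_isClosed_subset (isClosed_tsupport _) hw.support_zero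

/-- The ratios of two dilations of `axisKernelHat` whose supports cover `[1/2, 2]`. -/
theorem dilations_pos : (0 : ℝ) < 9 / 20 ∧ (0 : ℝ) < 9 / 10 := by norm_num

/-- The transform of the test kernel is positive on (1, 3), too short an interval for one dilate to
cover [1/2, 2]. The dilates by 9/20 and 9/10 are positive on (9/20, 27/20) and (9/10, 27/10), so
their sum is positive on the support of w, and Q is the quotient. -/
theorem IsLittlewoodPaley.exists_factor (hw : IsLittlewoodPaley w₀ w) : ∃ Q : 𝓢(ℝ, ℂ), ∀ ξ,
    (w ξ : ℂ) = Q ξ * dilatedHat dilations_pos.1 ξ + Q ξ * dilatedHat dilations_pos.2 ξ := by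
  set S : ℝ → ℝ := fun ξ => (dilatedHat dilations_pos.1 ξ).re + (dilatedHat dilations_pos.2 ξ).re
    with hSdef
  have hS : ContDiff ℝ ∞ S :=
    (Complex.reCLM.contDiff.comp ((dilatedHat dilations_pos.1).smooth ⊤)).add
      (Complex.reCLM.contDiff.comp ((dilatedHat dilations_pos.2).smooth ⊤))
  have hpos : ∀ ξ ∈ Set.Icc (1 / 2 : ℝ) 2, 0 < S ξ := fun ξ hξ => by
    simp only [hSdef, dilatedHat_apply]
    rcases lt_or_ge ξ 1 with h | h
    · refine add_pos_of_pos_of_nonneg (axisKernelHat_re_pos ⟨?_, ?_⟩) (axisKernelHat_re_nonneg _)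
      · linarith [hξ.1]
      · linarith [hξ.1]
    · refine add_pos_of_nonneg_of_pos (axisKernelHat_re_nonneg _) (axisKernelHat_re_pos ⟨?_, ?_⟩)
      · linarith [hξ.1]
      · linarith [hξ.2]
  have hq : ContDiff ℝ ∞ fun ξ => w ξ / S ξ := by
    refine contDiff_iff_contDiffAt.2 fun ξ => ?_
    by_cases hξ : ξ ∈ tsupport w
    · exact hw.smooth.contDiffAt.div hS.contDiffAt (hpos ξ (hw.support hξ)).ne'
    · refine (contDiffAt_const (c := (0 : ℝ))).congr_of_eventuallyEq ?_
      filter_upwards [notMem_tsupport_iff_eventuallyEq.1 hξ] with t ht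
      rw [ht]; simp
  have hqc : HasCompactSupport fun ξ => w ξ / S ξ := by
    simp only [div_eq_mul_inv]
    exact hw.hasCompactSupport.mul_right
  refine ⟨(hqc.comp_left (g := Complex.ofReal) Complex.ofReal_zero).toSchwartzMap
    (Complex.ofRealCLM.contDiff.comp hq), fun ξ => ?_⟩
  change (w ξ : ℂ) = ((w ξ / S ξ : ℝ) : ℂ) * dilatedHat dilations_pos.1 ξ +
    ((w ξ / S ξ : ℝ) : ℂ) * dilatedHat dilations_pos.2 ξ
  rw [← mul_add]
  have h1 : dilatedHat dilations_pos.1 ξ + dilatedHat dilations_pos.2 ξ = (S ξ : ℂ) := by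
    simp only [hSdef, dilatedHat_apply]
    push_cast
    rw [← axisKernelHat_eq_ofReal, ← axisKernelHat_eq_ofReal]
  rw [h1, ← Complex.ofReal_mul]
  congr 1
  by_cases hξ : ξ ∈ tsupport w
  · rw [div_mul_cancel₀ _ (hpos ξ (hw.support hξ)).ne']
  · rw [image_eq_zero_of_notMem_tsupport hξ]; simp

/-- The average of `m ∘ cos` against the inverse Fourier transform of `w`, at scale `1 / r`. -/
def pieceAverage (w : ℝ → ℝ) (m : ℝ → ℂ) (r θ : ℝ) : ℂ :=
  ∫ s, 𝓕⁻ (fun ξ => (w ξ : ℂ)) s * m (Real.cos (θ - s / r))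

theorem IsLittlewoodPaley.integrable_fourierInv (hw : IsLittlewoodPaley w₀ w) :
    Integrable (𝓕⁻ (fun ξ => (w ξ : ℂ))) := by
  have := (𝓕⁻ ((hw.hasCompactSupport.comp_left (g := Complex.ofReal)
    Complex.ofReal_zero).toSchwartzMap (Complex.ofRealCLM.contDiff.comp hw.smooth))).integrable
    (μ := volume)
  rwa [SchwartzMap.fourierInv_coe] at this

theorem IsLittlewoodPaley.integrable_kernelW_zero (hw : IsLittlewoodPaley w₀ w) :
    Integrable (kernelW w₀ w 0) := by
  have := (𝓕⁻ ((hw.hasCompactSupport_zero.comp_left (g := Complex.ofReal)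
    Complex.ofReal_zero).toSchwartzMap (Complex.ofRealCLM.contDiff.comp hw.smooth_zero))).integrable
    (μ := volume)
  rwa [SchwartzMap.fourierInv_coe] at this

/-- Since w vanishes below 1/2, w(|ξ|/2^n) is the sum of a part on positive frequencies and its
reflection. -/
theorem IsLittlewoodPaley.kernelW_eq (hw : IsLittlewoodPaley w₀ w) {n : ℕ} (hn : 1 ≤ n) (s : ℝ) :
    kernelW w₀ w n s = 2 ^ n * 𝓕⁻ (fun ξ => (w ξ : ℂ)) (2 ^ n * s) +
      2 ^ n * 𝓕⁻ (fun ξ => (w ξ : ℂ)) (2 ^ n * -s) := by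
  have hr : (0 : ℝ) < 2 ^ n := by positivity
  have hwi : Integrable fun ξ => (w ξ : ℂ) :=
    (hw.smooth.continuous.integrable_of_hasCompactSupport hw.hasCompactSupport).ofReal
  have hi : ∀ s : ℝ, Integrable fun ξ : ℝ => (𝐞 (ξ * s) : ℂ) * (w (ξ * (2 ^ n)⁻¹) : ℂ) := fun s => by
    have h1 : Integrable fun ξ : ℝ => (w (ξ * (2 ^ n)⁻¹) : ℂ) :=
      hwi.comp_mul_right' (inv_ne_zero hr.ne')
    refine h1.bdd_mul (c := 1) (Continuous.aestronglyMeasurable ?_)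
      (Filter.Eventually.of_forall fun ξ => (Circle.norm_coe _).le)
    exact continuous_subtype_val.comp (Real.continuous_fourierChar.comp (by fun_prop))
  have h2 := fourierInv_comp_mul_inv (fun ξ => (w ξ : ℂ)) hr
  push_cast at h2
  rw [← h2 s, ← h2 (-s), kernelW, fourierInv_real_eq, fourierInv_real_eq, fourierInv_real_eq,
    ← integral_neg_eq_self (fun ξ => (𝐞 (ξ * -s) : ℂ) * (w (ξ * (2 ^ n)⁻¹) : ℂ)), ← integral_add (hi s)]
  · refine integral_congr_ae (Filter.Eventually.of_forall fun ξ => ?_)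
    simp only [dyadic, neg_mul_neg]
    rw [if_neg (by omega), ← mul_add, ← Complex.ofReal_add]
    congr 2
    rcases le_total 0 ξ with h | h
    · rw [abs_of_nonneg h, div_eq_mul_inv, hw.eq_zero_of_lt (ξ := -ξ * (2 ^ n)⁻¹), add_zero]
      refine lt_of_le_of_lt ?_ (by norm_num : (0 : ℝ) < 1 / 2)
      exact mul_nonpos_of_nonpos_of_nonneg (by linarith) (by positivity)
    · rw [abs_of_nonpos h, div_eq_mul_inv, hw.eq_zero_of_lt (ξ := ξ * (2 ^ n)⁻¹), zero_add]
      refine lt_of_le_of_lt ?_ (by norm_num : (0 : ℝ) < 1 / 2)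
      exact mul_nonpos_of_nonpos_of_nonneg h (by positivity)
  · exact (hi (-s)).comp_neg

/-- As the cosine is even, the negative frequencies at θ act as the positive ones at -θ. -/
theorem IsLittlewoodPaley.lpPiece_eq (hw : IsLittlewoodPaley w₀ w) {n : ℕ} (hn : 1 ≤ n)
    {m : ℝ → ℂ} (hm : Measurable m) {K : ℝ} (hK : ∀ t, ‖m t‖ ≤ K) (θ : ℝ) :
    lpPiece w₀ w n m θ = pieceAverage w m (2 ^ n) θ + pieceAverage w m (2 ^ n) (-θ) := by
  have hr : (0 : ℝ) < 2 ^ n := by positivity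
  set W := 𝓕⁻ (fun ξ => (w ξ : ℂ))
  have hW : Integrable W := hw.integrable_fourierInv
  have hi : ∀ a : ℝ, a ≠ 0 → Integrable fun s => (2 ^ n * W (a * s)) * m (Real.cos (θ - s)) := by
    intro a ha
    refine ((hW.comp_mul_left' ha).const_mul _).mul_bdd (c := K)
      (hm.comp (by fun_prop)).aestronglyMeasurable (Filter.Eventually.of_forall fun s => hK _)
  have h1 : ∀ a : ℝ, |a| = 2 ^ n → ∫ s, (2 ^ n * W (a * s)) * m (Real.cos (θ - s)) =
      ∫ s, W s * m (Real.cos (θ - s / a)) := by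
    intro a ha
    have ha0 : a ≠ 0 := fun h => by rw [h, abs_zero] at ha; exact hr.ne ha
    have := Measure.integral_comp_mul_left (fun s => W s * m (Real.cos (θ - s / a))) a
    rw [abs_inv, ha, Complex.real_smul] at this
    push_cast at this
    rw [← one_mul (∫ s, W s * m (Real.cos (θ - s / a))),
      ← mul_inv_cancel₀ (pow_ne_zero n two_ne_zero : (2 : ℂ) ^ n ≠ 0), mul_assoc, ← this, ← integral_const_mul]
    refine integral_congr_ae (Filter.Eventually.of_forall fun s => ?_)
    simp only
    rw [mul_div_cancel_left₀ _ ha0, mul_assoc]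
  have h2 := hi (2 ^ n) hr.ne'
  have h3 := hi (-2 ^ n) (neg_ne_zero.2 hr.ne')
  have h4 : lpPiece w₀ w n m θ = ∫ s, ((2 ^ n * W (2 ^ n * s)) * m (Real.cos (θ - s)) +
      (2 ^ n * W (-2 ^ n * s)) * m (Real.cos (θ - s))) := by
    unfold lpPiece convolution
    refine integral_congr_ae (Filter.Eventually.of_forall fun s => ?_)
    simp only [ContinuousLinearMap.mul_apply']
    rw [hw.kernelW_eq hn, add_mul, mul_neg, neg_mul]
  rw [h4, integral_add h2 h3, h1 _ (abs_of_pos hr), h1 _ (by rw [abs_neg, abs_of_pos hr])]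
  unfold pieceAverage
  congr 1
  refine integral_congr_ae (Filter.Eventually.of_forall fun s => ?_)
  simp only
  rw [← Real.cos_neg]
  congr 3
  rw [div_neg]; ring

/-- A product of transforms is a convolution of kernels, so the piece is a superposition of averages
at the angles θ - u/r, weighted by the integrable function 𝓕⁻ Q. -/
theorem pieceAverage_eq {Q : 𝓢(ℝ, ℂ)} (hQ : ∀ ξ,
      (w ξ : ℂ) = Q ξ * dilatedHat dilations_pos.1 ξ + Q ξ * dilatedHat dilations_pos.2 ξ)
    {m : ℝ → ℂ} (hm : Measurable m) {K : ℝ} (hK : ∀ t, ‖m t‖ ≤ K) {r : ℝ} (hr : 0 < r) (θ : ℝ) :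
    pieceAverage w m r θ = (∫ u, 𝓕⁻ Q u * cosAverage m (9 / 20 * r) (θ - u / r)) +
      ∫ u, 𝓕⁻ Q u * cosAverage m (9 / 10 * r) (θ - u / r) := by
  have hF : Measurable fun s => m (Real.cos (θ - s / r)) := hm.comp (by fun_prop)
  have key : ∀ {b : ℝ} (hb : 0 < b), ∫ s, (∫ u, 𝓕⁻ Q u * 𝓕⁻ (dilatedHat hb) (s - u)) *
      m (Real.cos (θ - s / r)) = ∫ u, 𝓕⁻ Q u * cosAverage m (b * r) (θ - u / r) := fun {b} hb => by
    rw [integral_convolution_mul _ _ hF (fun s => hK _)]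
    refine integral_congr_ae (Filter.Eventually.of_forall fun u => ?_)
    simp only [fourierInv_dilatedHat, cosAverage]
    congr 1
    have hb' : (b : ℂ) ≠ 0 := mod_cast hb.ne'
    have := Measure.integral_comp_mul_left
      (fun s => m (Real.cos (θ - u / r - s / (b * r))) * axisKernel s) b
    rw [abs_inv, abs_of_pos hb, Complex.real_smul, Complex.ofReal_inv] at this
    rw [← one_mul (∫ s, m (Real.cos (θ - u / r - s / (b * r))) * axisKernel s),
      ← mul_inv_cancel₀ hb', mul_assoc, ← this, ← integral_const_mul]
    refine integral_congr_ae (Filter.Eventually.of_forall fun v => ?_)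
    simp only
    have h1 : θ - u / r - b * v / (b * r) = θ - (u + v) / r := by field_simp; ring
    rw [h1]; ring
  have hsplit : ∀ s, 𝓕⁻ (fun ξ => (w ξ : ℂ)) s =
      (∫ u, 𝓕⁻ Q u * 𝓕⁻ (dilatedHat dilations_pos.1) (s - u)) +
        ∫ u, 𝓕⁻ Q u * 𝓕⁻ (dilatedHat dilations_pos.2) (s - u) := fun s => by
    rw [← fourierInv_mul_eq, ← fourierInv_mul_eq]
    simp_rw [hQ]
    have hi : ∀ g : 𝓢(ℝ, ℂ), Integrable fun ξ => (𝐞 (ξ * s) : ℂ) * (Q ξ * g ξ) := fun g => by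
      have h1 : Integrable fun ξ => Q ξ * g ξ :=
        (SchwartzMap.pairing (ContinuousLinearMap.mul ℂ ℂ) Q g).integrable
      refine h1.bdd_mul (c := 1) (Continuous.aestronglyMeasurable ?_)
        (Filter.Eventually.of_forall fun ξ => (Circle.norm_coe _).le)
      exact continuous_subtype_val.comp (Real.continuous_fourierChar.comp (by fun_prop))
    rw [fourierInv_real_eq, fourierInv_real_eq, fourierInv_real_eq, ← integral_add (hi _) (hi _)]
    simp only [mul_add]
  have hint : ∀ {b : ℝ} (hb : 0 < b), Integrable fun s =>
      (∫ u, 𝓕⁻ Q u * 𝓕⁻ (dilatedHat hb) (s - u)) * m (Real.cos (θ - s / r)) := fun {b} hb => by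
    refine Integrable.mul_bdd (c := K) ?_ hF.aestronglyMeasurable
      (Filter.Eventually.of_forall fun s => hK _)
    simp_rw [← fourierInv_mul_eq]
    have := (𝓕⁻ (SchwartzMap.pairing (ContinuousLinearMap.mul ℂ ℂ) Q
      (dilatedHat hb))).integrable (μ := volume)
    rw [SchwartzMap.fourierInv_coe] at this
    exact this
  unfold pieceAverage
  simp_rw [hsplit, add_mul]
  rw [integral_add (hint _) (hint _), key, key]

end Decomposition

/-! ### The estimate for Littlewood-Paley pieces in all dimensions. -/

section MainEstimate

open scoped SchwartzMap

variable {w₀ w : ℝ → ℝ} {d : ℕ}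

theorem IsLittlewoodPaley.exists_norm_lpPiece_le_of_bound (hw : IsLittlewoodPaley w₀ w) :
    ∃ C : ℝ, 0 ≤ C ∧ ∀ (m : ℝ → ℂ) (K : ℝ), Measurable m → (∀ t, ‖m t‖ ≤ K) → ∀ n θ,
      ‖lpPiece w₀ w n m θ‖ ≤ C * K := by
  set W := 𝓕⁻ (fun ξ => (w ξ : ℂ))
  have hW : Integrable W := hw.integrable_fourierInv
  have h0 := hw.integrable_kernelW_zero
  have hb : ∀ {f : ℝ → ℂ}, Integrable f → ∀ {F : ℝ → ℂ} {K : ℝ}, (∀ t, ‖F t‖ ≤ K) →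
      ‖∫ s, f s * F s‖ ≤ (∫ s, ‖f s‖) * K := fun {f} hf {F} {K} hF => by
    rw [← integral_mul_const]
    refine norm_integral_le_of_norm_le (hf.norm.mul_const K)
      (Filter.Eventually.of_forall fun s => ?_)
    rw [norm_mul]; gcongr; exact hF s
  have hW0 : 0 ≤ ∫ s, ‖W s‖ := by positivity
  have h00 : 0 ≤ ∫ s, ‖kernelW w₀ w 0 s‖ := by positivity
  refine ⟨(∫ s, ‖kernelW w₀ w 0 s‖) + 2 * ∫ s, ‖W s‖, by positivity, ?_⟩
  intro m K hm hK n θ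
  have hK0 : 0 ≤ K := (norm_nonneg _).trans (hK 0)
  rcases Nat.eq_zero_or_pos n with rfl | hn
  · have : ‖lpPiece w₀ w 0 m θ‖ ≤ (∫ s, ‖kernelW w₀ w 0 s‖) * K :=
      hb h0 (F := fun s => m (Real.cos (θ - s))) fun s => hK _
    nlinarith
  · rw [hw.lpPiece_eq hn hm hK]
    have h1 : ∀ θ, ‖pieceAverage w m (2 ^ n) θ‖ ≤ (∫ s, ‖W s‖) * K := fun θ =>
      hb hW (F := fun s => m (Real.cos (θ - s / 2 ^ n))) fun s => hK _
    have := (norm_add_le _ _).trans (add_le_add (h1 θ) (h1 (-θ)))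
    nlinarith

theorem abs_sin_sub_le (x y : ℝ) : |Real.sin x| - |y| ≤ |Real.sin (x - y)| := by
  have h1 : |Real.sin x - Real.sin (x - y)| ≤ |y| := by
    have := Real.abs_sin_sub_sin_le x (x - y)
    rwa [sub_sub_cancel] at this
  have h2 := abs_sub_abs_le_abs_sub (Real.sin x) (Real.sin (x - y))
  linarith

/-- The average at θ - u/r is estimated directly when |u| ≤ r|sin θ|/2, where the sine has lost at
most a factor 2. For larger u it is bounded trivially, at the price of a weight 1 + 2|u| that is
integrable against 𝓕⁻ Q. -/
theorem IsLittlewoodPaley.exists_norm_lpPiece_le (hw : IsLittlewoodPaley w₀ w) (hd : 1 ≤ d) :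
    ∃ C : ℝ, 0 ≤ C ∧ ∀ p : ℝ≥0∞, 1 ≤ p → ∀ m : ℝ → ℂ, Measurable m →
      (∀ t, ‖m t‖ ≤ (sphSchurNorm d p m).toReal) → sphSchurNorm d p m ≠ ⊤ →
      ∀ δ : ℝ, 0 < δ → δ ≤ 1 → ∀ ε ∈ besicovitchSet d δ, ∀ n : ℕ, 1 ≤ n →
      ∀ θ : ℝ, Real.sin θ ≠ 0 →
        ‖lpPiece w₀ w n m θ‖ ≤ C * (sphSchurNorm d p m).toReal *
            (ε ^ pExp p + 1 / (δ ^ 2 * 2 ^ n * |Real.sin θ|) ^ (1 / 3 : ℝ)) := by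
  obtain ⟨Q, hQ⟩ := hw.exists_factor
  obtain ⟨C₁, hC₁, h₁⟩ := exists_norm_cosAverage_le hd
  obtain ⟨C₂, hC₂, h₂⟩ := exists_norm_cosAverage_le_of_bound
  set B := ∫ u, ‖𝓕⁻ Q u‖ * (1 + 2 * |u|)
  have hBi : Integrable fun u => ‖𝓕⁻ Q u‖ * (1 + 2 * |u|) := by
    have h3 := (𝓕⁻ Q).integrable_pow_mul volume 1
    have h4 := (𝓕⁻ Q).integrable (μ := volume)
    refine (h4.norm.add (h3.const_mul 2)).congr (Filter.Eventually.of_forall fun u => ?_)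
    simp only [Pi.add_apply, pow_one, Real.norm_eq_abs]
    ring
  have hB : 0 ≤ B := integral_nonneg fun u => by positivity
  refine ⟨4 * (B * (2 * C₁ + C₂)), by positivity, ?_⟩
  intro p hp m hm hmK hK δ hδ hδ1 ε hε n hn θ hθ
  set K := (sphSchurNorm d p m).toReal
  have hK0 : 0 ≤ K := ENNReal.toReal_nonneg
  have hr : (0 : ℝ) < 2 ^ n := by positivity
  have hε0 : 0 ≤ ε ^ pExp p := Real.rpow_nonneg hε.1.le _
  set r : ℝ := 2 ^ n
  have key : ∀ b : ℝ, 9 / 20 ≤ b → ∀ θ : ℝ, Real.sin θ ≠ 0 →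
      ‖∫ u, 𝓕⁻ Q u * cosAverage m (b * r) (θ - u / r)‖ ≤
        B * (2 * C₁ + C₂) * K * (ε ^ pExp p + 1 / (δ ^ 2 * r * |Real.sin θ|) ^ (1 / 3 : ℝ)) := by
    intro b hb θ hθ
    have hb0 : 0 < b := by linarith
    have hs : 0 < |Real.sin θ| := abs_pos.2 hθ
    set y := δ ^ 2 * r * |Real.sin θ|
    have hy : 0 < y := by positivity
    set v := y ^ (1 / 3 : ℝ)
    have hv : 0 < v := by positivity
    have hG : ∀ u, ‖cosAverage m (b * r) (θ - u / r)‖ ≤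
        (1 + 2 * |u|) * ((2 * C₁ + C₂) * K * (ε ^ pExp p + 1 / v)) := by
      intro u
      rcases le_or_gt |u| (r * |Real.sin θ| / 2) with hu | hu
      · have h3 : |Real.sin θ| / 2 ≤ |Real.sin (θ - u / r)| := by
          have := abs_sin_sub_le θ (u / r)
          rw [abs_div, abs_of_pos hr] at this
          have h4 : |u| / r ≤ |Real.sin θ| / 2 := by rw [div_le_iff₀ hr]; linarith
          linarith
        have hs' := (half_pos hs).trans_le h3
        have h4 := h₁ p hp m hm hmK hK δ hδ hδ1 ε hε (b * r) (by positivity) (θ - u / r)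
          (abs_pos.1 hs')
        have h5 : v ≤ 2 * (δ ^ 2 * (b * r) * |Real.sin (θ - u / r)|) ^ (1 / 3 : ℝ) := by
          have h8 : (8 : ℝ) ^ (1 / 3 : ℝ) = 2 := by
            rw [show (8 : ℝ) = 2 ^ (3 : ℝ) by norm_num, ← Real.rpow_mul (by norm_num)]
            norm_num
          rw [← h8, ← Real.mul_rpow (by norm_num) (by positivity)]
          refine Real.rpow_le_rpow hy.le ?_ (by norm_num)
          calc y = 8 * (δ ^ 2 * ((1 / 4) * r) * (|Real.sin θ| / 2)) := by simp only [y]; ring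
            _ ≤ _ := by
              gcongr
              linarith
        have h6 : 1 / (δ ^ 2 * (b * r) * |Real.sin (θ - u / r)|) ^ (1 / 3 : ℝ) ≤ 2 * (1 / v) := by
          rw [mul_one_div, div_le_div_iff₀ (by positivity) hv]
          linarith
        have h7 : 0 ≤ 1 / v := by positivity
        calc _ ≤ C₁ * K * (ε ^ pExp p + 2 * (1 / v)) := h4.trans (by gcongr)
          _ ≤ C₁ * K * (2 * (ε ^ pExp p + 1 / v)) := by gcongr; linarith
          _ = 1 * ((2 * C₁ + 0) * K * (ε ^ pExp p + 1 / v)) := by ring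
          _ ≤ _ := by
              gcongr
              linarith [abs_nonneg u]
      · have h3 := h₂ m K hmK (b * r) (θ - u / r)
        -- As δ ≤ 1, y is at most r|sin θ| < 2|u|, and a cube root does not exceed its argument when
        -- that is at least 1.
        have h4 : v ≤ 1 + 2 * |u| := by
          have h5 : y ≤ 1 + 2 * |u| := by
            have : y ≤ 1 ^ 2 * r * |Real.sin θ| := by simp only [y]; gcongr
            linarith
          have h6 : (1 : ℝ) ≤ 1 + 2 * |u| := by linarith [abs_nonneg u]
          calc v ≤ (1 + 2 * |u|) ^ (1 / 3 : ℝ) := Real.rpow_le_rpow hy.le h5 (by norm_num)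
            _ ≤ (1 + 2 * |u|) ^ (1 : ℝ) := Real.rpow_le_rpow_of_exponent_le h6 (by norm_num)
            _ = _ := Real.rpow_one _
        have h5 : 1 ≤ (1 + 2 * |u|) * (1 / v) := by rwa [mul_one_div, one_le_div hv]
        calc _ ≤ C₂ * K * 1 := by rw [mul_one]; exact h3
          _ ≤ C₂ * K * ((1 + 2 * |u|) * (1 / v)) := by gcongr
          _ = (1 + 2 * |u|) * ((2 * 0 + C₂) * K * (0 + 1 / v)) := by ring
          _ ≤ _ := by gcongr
    calc _ ≤ ∫ u, ‖𝓕⁻ Q u‖ * (1 + 2 * |u|) * ((2 * C₁ + C₂) * K * (ε ^ pExp p + 1 / v)) := by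
          refine norm_integral_le_of_norm_le (hBi.mul_const _)
            (Filter.Eventually.of_forall fun u => ?_)
          rw [norm_mul, mul_assoc]
          gcongr
          exact hG u
      _ = _ := by rw [integral_mul_const]; ring
  rw [hw.lpPiece_eq hn hm hmK, pieceAverage_eq hQ hm hmK hr, pieceAverage_eq hQ hm hmK hr]
  have hθ' : Real.sin (-θ) ≠ 0 := by rwa [Real.sin_neg, neg_ne_zero]
  have k1 := key (9 / 20) le_rfl θ hθ
  have k2 := key (9 / 10) (by norm_num) θ hθ
  have k3 := key (9 / 20) le_rfl (-θ) hθ'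
  have k4 := key (9 / 10) (by norm_num) (-θ) hθ'
  rw [Real.sin_neg, abs_neg] at k3 k4
  refine (norm_add_le _ _).trans ((add_le_add (norm_add_le _ _) (norm_add_le _ _)).trans ?_)
  linarith

/-- The estimate of Littlewood-Paley pieces in terms of `besicovitchFun`, for every `δ`. -/
theorem IsLittlewoodPaley.exists_norm_lpPiece_le_besicovitchFun (hw : IsLittlewoodPaley w₀ w)
    (hd : 1 ≤ d) :
    ∃ C : ℝ, 0 ≤ C ∧ ∀ p : ℝ≥0∞, 1 ≤ p → ∀ m : ℝ → ℂ,
      Measurable (fun t : Set.Ioo (-1 : ℝ) 1 => m t) →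
      (∃ M : ℝ, ∀ t ∈ Set.Ioo (-1 : ℝ) 1, ‖m t‖ ≤ M) → sphSchurNorm d p m ≠ ⊤ →
      ∀ (n : ℕ) (θ : ℝ), Real.sin θ ≠ 0 → ∀ δ : ℝ, 0 < δ →
        ‖lpPiece w₀ w n m θ‖ ≤ C * (sphSchurNorm d p m).toReal *
          (besicovitchFun d δ ^ pExp p + 1 / |δ ^ 2 * 2 ^ n * Real.sin θ| ^ (1 / 3 : ℝ)) := by
  obtain ⟨C₁, hC₁, h₁⟩ := hw.exists_norm_lpPiece_le hd
  obtain ⟨C₂, hC₂, h₂⟩ := hw.exists_norm_lpPiece_le_of_bound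
  obtain ⟨c, hc, hcδ⟩ := exists_le_besicovitchFun hd
  refine ⟨C₁ + C₂ * max 1 c⁻¹ + C₂, by positivity, ?_⟩
  intro p hp m hm hM hK n θ hθ δ hδ
  obtain ⟨m', hm', hmK, hmb, hae⟩ := exists_bounded_symbol hd hp hm hM hK
  rw [lpPiece_congr w₀ w n hae θ, ← hmK]
  rw [← hmK] at hmb hK
  set K := (sphSchurNorm d p m').toReal
  have hK0 : 0 ≤ K := ENNReal.toReal_nonneg
  have htriv := h₂ m' K hm' hmb n θ
  have hs : 0 < |Real.sin θ| := abs_pos.2 hθ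
  have habs : |δ ^ 2 * 2 ^ n * Real.sin θ| = δ ^ 2 * 2 ^ n * |Real.sin θ| := by
    rw [abs_mul, abs_of_pos (by positivity : 0 < δ ^ 2 * 2 ^ n)]
  rw [habs]
  have hf0 : 0 ≤ besicovitchFun d δ ^ pExp p := Real.rpow_nonneg (besicovitchFun_nonneg d δ) _
  have he0 : 0 ≤ 1 / (δ ^ 2 * 2 ^ n * |Real.sin θ|) ^ (1 / 3 : ℝ) := by positivity
  rcases le_or_gt δ 1 with hδ1 | hδ1
  · rcases Nat.eq_zero_or_pos n with rfl | hn
    · have h3 : 1 ≤ 1 / (δ ^ 2 * 2 ^ 0 * |Real.sin θ|) ^ (1 / 3 : ℝ) := by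
        rw [le_div_iff₀ (by positivity), one_mul]
        refine Real.rpow_le_one (by positivity) ?_ (by norm_num)
        have h4 := Real.abs_sin_le_one θ
        have h5 : δ ^ 2 ≤ 1 := pow_le_one₀ hδ.le hδ1
        rw [pow_zero, mul_one]
        exact mul_le_one₀ h5 hs.le h4
      calc _ ≤ C₂ * K * 1 := by rw [mul_one]; exact htriv
        _ ≤ C₂ * K * (besicovitchFun d δ ^ pExp p +
            1 / (δ ^ 2 * 2 ^ 0 * |Real.sin θ|) ^ (1 / 3 : ℝ)) := by gcongr; linarith
        _ ≤ _ := by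
            gcongr
            have : 0 ≤ C₂ * max 1 c⁻¹ := by positivity
            linarith
    · refine (le_besicovitchFun_rpow hd (pExp_nonneg p) fun ε hε =>
        h₁ p hp m' hm' hmb hK δ hδ hδ1 ε hε n hn θ hθ).trans ?_
      gcongr
      have : 0 ≤ C₂ * max 1 c⁻¹ := by positivity
      linarith
  · have h3 := hcδ δ hδ1.le
    have h4 : 1 ≤ max 1 c⁻¹ * besicovitchFun d δ ^ pExp p := by
      have h5 : 1 ≤ c⁻¹ ^ pExp p * besicovitchFun d δ ^ pExp p := by
        rw [← Real.mul_rpow (by positivity) (besicovitchFun_nonneg d δ)]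
        refine Real.one_le_rpow ?_ (pExp_nonneg p)
        rwa [inv_mul_eq_div, one_le_div hc]
      refine h5.trans ?_
      gcongr
      exact rpow_pExp_le_max hp (by positivity)
    calc _ ≤ C₂ * K * 1 := by rw [mul_one]; exact htriv
      _ ≤ C₂ * K * (max 1 c⁻¹ * besicovitchFun d δ ^ pExp p) := by gcongr
      _ = (0 + C₂ * max 1 c⁻¹ + 0) * K * (besicovitchFun d δ ^ pExp p + 0) := by ring
      _ ≤ _ := by gcongr

end MainEstimate

/-! ### Tubes around lines in the plane. -/

section PlaneTubes

/-- The linear isometry `(t, w) ↦ (c t - s w, s t + c w)`, where `c ^ 2 + s ^ 2 = 1`. -/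
def planeIsometry {c s : ℝ} (h : c ^ 2 + s ^ 2 = 1) :
    WithLp 2 (ℝ × EuclideanSpace ℝ (Fin (2 - 1))) →ₗᵢ[ℝ] EuclideanSpace ℝ (Fin 2) where
  toFun z := !₂[c * z.fst - s * z.snd 0, s * z.fst + c * z.snd 0]
  map_add' y z := by
    ext i
    fin_cases i <;> simp <;> ring
  map_smul' r z := by
    ext i
    fin_cases i <;> simp <;> ring
  norm_map' z := by
    have h1 : ‖z.snd‖ ^ 2 = z.snd 0 ^ 2 := by
      rw [EuclideanSpace.norm_sq_eq]
      simp
    rw [← sq_eq_sq₀ (norm_nonneg _) (norm_nonneg _), WithLp.prod_norm_sq_eq_of_L2, h1,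
      EuclideanSpace.norm_sq_eq, Fin.sum_univ_two]
    simp only [LinearMap.coe_mk, AddHom.coe_mk, Real.norm_eq_abs, sq_abs]
    simp
    linear_combination (z.fst ^ 2 + z.snd 0 ^ 2) * h

theorem sq_add_sq_slope (a : ℝ) : (1 / √(1 + a ^ 2)) ^ 2 + (a / √(1 + a ^ 2)) ^ 2 = 1 := by
  have h : 0 < 1 + a ^ 2 := by positivity
  rw [div_pow, div_pow, Real.sq_sqrt h.le]
  field_simp

/-- The frame whose axis is the line `y = a x + b`, starting at `(0, b)`. -/
def lineFrame (a b : ℝ) : TubeFrame 2 :=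
  (AffineIsometryEquiv.constVAdd ℝ (EuclideanSpace ℝ (Fin 2)) !₂[0, b]).toAffineIsometry.comp
    (planeIsometry (sq_add_sq_slope a)).toAffineIsometry

theorem lineFrame_apply_zero (a b : ℝ) (z : WithLp 2 (ℝ × EuclideanSpace ℝ (Fin (2 - 1)))) :
    lineFrame a b z 0 = (z.fst - a * z.snd 0) / √(1 + a ^ 2) := by
  change (!₂[0, b] + planeIsometry (sq_add_sq_slope a) z : EuclideanSpace ℝ (Fin 2)) 0 = _
  simp [planeIsometry]
  ring

theorem lineFrame_apply_one (a b : ℝ) (z : WithLp 2 (ℝ × EuclideanSpace ℝ (Fin (2 - 1)))) :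
    lineFrame a b z 1 = b + (a * z.fst + z.snd 0) / √(1 + a ^ 2) := by
  change (!₂[0, b] + planeIsometry (sq_add_sq_slope a) z : EuclideanSpace ℝ (Fin 2)) 1 = _
  simp [planeIsometry]
  ring

theorem abs_lineFrame_sub_le {a b δ : ℝ} (ha : a ∈ Set.Icc (0 : ℝ) 1)
    {z : WithLp 2 (ℝ × EuclideanSpace ℝ (Fin (2 - 1)))} (hz : ‖z.snd‖ < δ) :
    |lineFrame a b z 1 - (a * lineFrame a b z 0 + b)| ≤ 3 / 2 * δ := by
  have hs : 0 < √(1 + a ^ 2) := by positivity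
  have hs2 : √(1 + a ^ 2) ≤ 3 / 2 := by
    rw [Real.sqrt_le_left (by norm_num)]; nlinarith [ha.1, ha.2]
  have h1 : lineFrame a b z 1 - (a * lineFrame a b z 0 + b) = z.snd 0 * √(1 + a ^ 2) := by
    rw [lineFrame_apply_zero, lineFrame_apply_one]
    have := Real.sq_sqrt (by positivity : 0 ≤ 1 + a ^ 2)
    field_simp
    linear_combination -(z.snd 0) * this
  have h2 : |z.snd 0| ≤ δ := (PiLp.norm_apply_le z.snd 0).trans hz.le
  rw [h1, abs_mul, abs_of_pos hs, mul_comm]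
  exact mul_le_mul hs2 h2 (abs_nonneg _) (by norm_num)

theorem lineFrame_apply_zero_mem {a b δ : ℝ} (ha : a ∈ Set.Icc (0 : ℝ) 1)
    {z : WithLp 2 (ℝ × EuclideanSpace ℝ (Fin (2 - 1)))} (hz1 : z.fst ∈ Set.Icc (0 : ℝ) 1)
    (hz : ‖z.snd‖ < δ) : lineFrame a b z 0 ∈ Set.Icc (-δ) (1 + δ) := by
  have hs : 1 ≤ √(1 + a ^ 2) := Real.one_le_sqrt.2 (by nlinarith [sq_nonneg a])
  have h2 : |z.snd 0| ≤ δ := (PiLp.norm_apply_le z.snd 0).trans hz.le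
  have hδ : 0 ≤ δ := (abs_nonneg _).trans h2
  have h3 : |a * z.snd 0| ≤ δ := by
    rw [abs_mul, abs_of_nonneg ha.1]
    exact (mul_le_of_le_one_left (abs_nonneg _) ha.2).trans h2
  rw [abs_le] at h3
  rw [lineFrame_apply_zero]
  constructor
  · rw [le_div_iff₀ (by linarith)]; nlinarith [hz1.1]
  · rw [div_le_iff₀ (by linarith)]; nlinarith [hz1.2]

/-- Slopes in [0, 1] tilt the axis little: (2 - 1/20)/(3/2) = 13/10. Shifted tubes thus lie to the
right of 1, where the lines constructed below have separated. -/
theorem le_lineFrame_apply_zero {a b δ : ℝ} (ha : a ∈ Set.Icc (0 : ℝ) 1) (hδ : δ ≤ 1 / 20)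
    {z : WithLp 2 (ℝ × EuclideanSpace ℝ (Fin (2 - 1)))} (hz1 : 2 ≤ z.fst)
    (hz : ‖z.snd‖ < δ) : 13 / 10 ≤ lineFrame a b z 0 := by
  have hs : 0 < √(1 + a ^ 2) := by positivity
  have hs2 : √(1 + a ^ 2) ≤ 3 / 2 := by
    rw [Real.sqrt_le_left (by norm_num)]; nlinarith [ha.1, ha.2]
  have h2 : |z.snd 0| ≤ δ := (PiLp.norm_apply_le z.snd 0).trans hz.le
  have h3 : |a * z.snd 0| ≤ δ := by
    rw [abs_mul, abs_of_nonneg ha.1]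
    exact (mul_le_of_le_one_left (abs_nonneg _) ha.2).trans h2
  rw [abs_le] at h3
  rw [lineFrame_apply_zero, le_div_iff₀ hs]
  nlinarith

/-- The area of a neighbourhood of a graph. -/
theorem volume_graph_nhds {f : ℝ → ℝ} (hf : Continuous f) (I : Set ℝ) (hI : MeasurableSet I)
    (r : ℝ) :
    volume {z : EuclideanSpace ℝ (Fin 2) | z 0 ∈ I ∧ |z 1 - f (z 0)| ≤ r} =
      ENNReal.ofReal (2 * r) * volume I := by
  have hT : MeasurableSet {y : ℝ × ℝ | y.1 ∈ I ∧ |y.2 - f y.1| ≤ r} :=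
    (measurable_fst hI).inter (measurableSet_le
      (continuous_snd.sub (hf.comp continuous_fst)).abs.measurable measurable_const)
  have h1 := ((volume_preserving_finTwoArrow ℝ).comp
    (PiLp.volume_preserving_ofLp (Fin 2))).measure_preimage
      hT.nullMeasurableSet
  have h2 : {z : EuclideanSpace ℝ (Fin 2) | z 0 ∈ I ∧ |z 1 - f (z 0)| ≤ r} =
      ((MeasurableEquiv.finTwoArrow : (Fin 2 → ℝ) ≃ᵐ ℝ × ℝ) ∘
        (WithLp.ofLp : EuclideanSpace ℝ (Fin 2) → Fin 2 → ℝ)) ⁻¹'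
        {y : ℝ × ℝ | y.1 ∈ I ∧ |y.2 - f y.1| ≤ r} := rfl
  rw [h2, h1, Measure.volume_eq_prod, Measure.prod_apply hT, ← setLIntegral_const,
    ← lintegral_indicator hI]
  refine lintegral_congr fun x => ?_
  by_cases hx : x ∈ I
  · rw [Set.indicator_of_mem hx]
    have : Prod.mk x ⁻¹' {y : ℝ × ℝ | y.1 ∈ I ∧ |y.2 - f y.1| ≤ r} =
        Set.Icc (f x - r) (f x + r) := by
      ext y
      simp only [Set.mem_preimage, Set.mem_ofPred_eq, hx, true_and, Set.mem_Icc, abs_le]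
      constructor <;> rintro ⟨h1, h2⟩ <;> constructor <;> linarith
    rw [this, Real.volume_Icc]
    congr 1; ring
  · rw [Set.indicator_of_notMem hx]
    have : Prod.mk x ⁻¹' {y : ℝ × ℝ | y.1 ∈ I ∧ |y.2 - f y.1| ≤ r} = ∅ := by
      ext y; simp [hx]
    rw [this, measure_empty]

end PlaneTubes

/-! ### Besicovitch's construction with binary digits. -/

section BinaryDigits

theorem sum_two_pow_inv (n : ℕ) :
    ∑ j ∈ Finset.range n, ((2 : ℝ) ^ (j + 1))⁻¹ = 1 - (2 ^ n)⁻¹ := by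
  induction n with
  | zero => simp
  | succ n ih => rw [Finset.sum_range_succ, ih, pow_succ]; field_simp; ring

theorem sum_mul_two_pow_inv (n : ℕ) :
    ∑ j ∈ Finset.range n, ((2 : ℝ) ^ (j + 1))⁻¹ * (j + 1) = 2 - (n + 2) * (2 ^ n)⁻¹ := by
  induction n with
  | zero => simp
  | succ n ih => rw [Finset.sum_range_succ, ih, pow_succ]; push_cast; field_simp; ring

/-- The ordinate at `x` of the line with binary digits `e`. -/
def digitLine (N : ℕ) (e : ℕ → ℝ) (n : ℕ) (x : ℝ) : ℝ :=
  ∑ i ∈ Finset.range n, e i * (2 ^ (i + 1))⁻¹ * (x - i / N)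

variable {N : ℕ} {e e' : ℕ → ℝ}

theorem continuous_digitLine (N : ℕ) (e : ℕ → ℝ) (n : ℕ) : Continuous (digitLine N e n) := by
  unfold digitLine; fun_prop

/-- Above [n/N, (n+1)/N] the digit of index n + 1 + j multiplies x - (n+1+j)/N, of size at most (j +
1)/N + δ, with weight 2^{-(n+j+2)}. The later digits thus contribute little, so that 2^{n+1} thin
neighbourhoods of graphs cover all the lines over this strip. -/
theorem abs_digitLine_sub_le (hN : 0 < N) (he : ∀ i, |e i| ≤ 1) {n : ℕ} (hn : n + 1 ≤ N)
    {δ x : ℝ} (hδ : 0 ≤ δ) (hx : x ∈ Set.Icc ((n : ℝ) / N - δ) ((n + 1) / N + δ)) :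
    |digitLine N e N x - digitLine N e (n + 1) x| ≤ (2 ^ (n + 1))⁻¹ * (2 / N) + δ := by
  have hN' : (0 : ℝ) < N := mod_cast hN
  have h1 : digitLine N e N x - digitLine N e (n + 1) x =
      ∑ j ∈ Finset.range (N - (n + 1)), e (n + 1 + j) * (2 ^ (n + 1 + j + 1))⁻¹ *
        (x - (n + 1 + j : ℕ) / N) := by
    unfold digitLine
    rw [← Finset.sum_range_add_sum_Ico _ hn, add_sub_cancel_left, Finset.sum_Ico_eq_sum_range]
  have h2 : ∀ j : ℕ, |e (n + 1 + j) * (2 ^ (n + 1 + j + 1))⁻¹ * (x - (n + 1 + j : ℕ) / N)| ≤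
      (2 ^ (n + 1))⁻¹ * ((2 ^ (j + 1))⁻¹ * (j + 1) * (1 / N) + (2 ^ (j + 1))⁻¹ * δ) := by
    intro j
    have h3 : |x - ((n + 1 + j : ℕ) : ℝ) / N| ≤ (j + 1) * (1 / N) + δ := by
      have h4 : ((n + 1 + j : ℕ) : ℝ) / N = n / N + (j + 1) * (1 / N) := by push_cast; ring
      have h5 : ((n : ℝ) + 1) / N = n / N + 1 / N := by ring
      have h6 : 0 ≤ (j : ℝ) * (1 / N) := by positivity
      have h7 : 0 < 1 / (N : ℝ) := by positivity
      obtain ⟨h8, h9⟩ := hx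
      rw [h5] at h9
      rw [h4, abs_le]
      constructor <;> nlinarith
    rw [abs_mul, abs_mul, abs_of_pos (by positivity : (0 : ℝ) < (2 ^ (n + 1 + j + 1))⁻¹)]
    calc _ ≤ 1 * (2 ^ (n + 1 + j + 1))⁻¹ * ((j + 1) * (1 / N) + δ) := by gcongr; exact he _
      _ = _ := by rw [add_assoc (n + 1), pow_add, mul_inv]; ring
  rw [h1]
  refine (Finset.abs_sum_le_sum_abs _ _).trans ((Finset.sum_le_sum fun j _ => h2 j).trans ?_)
  rw [← Finset.mul_sum, Finset.sum_add_distrib, ← Finset.sum_mul, ← Finset.sum_mul,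
    sum_two_pow_inv, sum_mul_two_pow_inv, mul_add]
  refine add_le_add ?_ ?_
  · rw [← mul_one_div 2]
    gcongr
    have : (0 : ℝ) ≤ (↑(N - (n + 1)) + 2) * (2 ^ (N - (n + 1)))⁻¹ := by positivity
    linarith
  · have h3 : ((2 : ℝ) ^ (n + 1))⁻¹ ≤ 1 := inv_le_one_of_one_le₀ (one_le_pow₀ (by norm_num))
    have h4 : (1 - ((2 : ℝ) ^ (N - (n + 1)))⁻¹) * δ ≤ δ := by
      have : 0 ≤ ((2 : ℝ) ^ (N - (n + 1)))⁻¹ * δ := by positivity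
      linarith
    have h5 : 0 ≤ (1 - ((2 : ℝ) ^ (N - (n + 1)))⁻¹) * δ :=
      mul_nonneg (sub_nonneg.2 (inv_le_one_of_one_le₀ (one_le_pow₀ (by norm_num)))) hδ
    calc _ ≤ 1 * ((1 - ((2 : ℝ) ^ (N - (n + 1)))⁻¹) * δ) := by gcongr
      _ ≤ _ := by rwa [one_mul]

/-- The first differing digit contributes 2^{-(n+1)} (x - n/N), and the later ones together at most
this times 1 - 2^{-(N-n-1)}. The remainder is 2^{-N} (x - n/N). -/
theorem le_abs_digitLine_sub (hN : 0 < N) {n : ℕ} (hn : n < N) (heq : ∀ i < n, e i = e' i)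
    (hne : |e n - e' n| = 1) (hle : ∀ i, |e i - e' i| ≤ 1) {x : ℝ} (hx : 1 ≤ x) :
    (2 ^ N)⁻¹ * (x - 1) ≤ |digitLine N e N x - digitLine N e' N x| := by
  have hN' : (0 : ℝ) < N := mod_cast hN
  have h1 : digitLine N e N x - digitLine N e' N x =
      (e n - e' n) * (2 ^ (n + 1))⁻¹ * (x - n / N) +
      ∑ j ∈ Finset.range (N - (n + 1)), (e (n + 1 + j) - e' (n + 1 + j)) *
        (2 ^ (n + 1 + j + 1))⁻¹ * (x - (n + 1 + j : ℕ) / N) := by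
    unfold digitLine
    rw [← Finset.sum_sub_distrib, ← Finset.sum_range_add_sum_Ico _ (show n + 1 ≤ N from hn),
      Finset.sum_range_succ, Finset.sum_eq_zero, zero_add, Finset.sum_Ico_eq_sum_range]
    · congr 1
      · ring
      · exact Finset.sum_congr rfl fun j _ => by ring
    · intro i hi
      rw [heq i (Finset.mem_range.1 hi), sub_self]
  have hn1 : (n : ℝ) / N ≤ 1 := by
    rw [div_le_one hN']; exact_mod_cast hn.le
  have hy : 0 ≤ x - n / N := by linarith
  have h2 : ∀ j ∈ Finset.range (N - (n + 1)), |(e (n + 1 + j) - e' (n + 1 + j)) *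
      (2 ^ (n + 1 + j + 1))⁻¹ * (x - (n + 1 + j : ℕ) / N)| ≤
      (2 ^ (n + 1))⁻¹ * (x - n / N) * (2 ^ (j + 1))⁻¹ := by
    intro j hj
    have hj' : n + 1 + j ≤ N := by have := Finset.mem_range.1 hj; omega
    have h3 : |x - ((n + 1 + j : ℕ) : ℝ) / N| ≤ x - n / N := by
      have h4 : ((n + 1 + j : ℕ) : ℝ) / N ≤ 1 := by
        rw [div_le_one hN']; exact_mod_cast hj'
      have h5 : (n : ℝ) / N ≤ ((n + 1 + j : ℕ) : ℝ) / N := by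
        gcongr; omega
      rw [abs_le]
      constructor <;> linarith
    rw [abs_mul, abs_mul, abs_of_pos (by positivity : (0 : ℝ) < (2 ^ (n + 1 + j + 1))⁻¹)]
    calc _ ≤ 1 * (2 ^ (n + 1 + j + 1))⁻¹ * (x - n / N) := by gcongr; exact hle _
      _ = _ := by rw [add_assoc (n + 1), pow_add, mul_inv]; ring
  have h3 := (Finset.abs_sum_le_sum_abs _ _).trans (Finset.sum_le_sum h2)
  rw [← Finset.mul_sum, sum_two_pow_inv] at h3
  have h4 : |(e n - e' n) * (2 ^ (n + 1))⁻¹ * (x - n / N)| = (2 ^ (n + 1))⁻¹ * (x - n / N) := by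
    rw [abs_mul, abs_mul, hne, one_mul, abs_of_nonneg hy, abs_of_pos (by positivity)]
  have h5 : ((2 : ℝ) ^ (n + 1))⁻¹ * (2 ^ (N - (n + 1)))⁻¹ = (2 ^ N)⁻¹ := by
    rw [← mul_inv, ← pow_add, Nat.add_sub_cancel' (Nat.succ_le_of_lt hn)]
  rw [h1]
  refine le_trans ?_ (abs_sub_abs_le_abs_add _ _)
  rw [h4]
  have h6 : (2 ^ N : ℝ)⁻¹ * (x - 1) ≤ (2 ^ N)⁻¹ * (x - n / N) := by gcongr
  rw [← h5] at h6 ⊢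
  linarith

/-- The binary digits of a vertex of the discrete cube, as real numbers. -/
def digit (ε : Fin N → Bool) (i : ℕ) : ℝ := if h : i < N then (if ε ⟨i, h⟩ then 1 else 0) else 0

theorem digit_mem (ε : Fin N → Bool) (i : ℕ) : digit ε i = 0 ∨ digit ε i = 1 := by
  unfold digit; split_ifs <;> simp

theorem exists_first_digit_ne {ε ε' : Fin N → Bool} (h : ε ≠ ε') :
    ∃ n < N, (∀ i < n, digit ε i = digit ε' i) ∧ digit ε n ≠ digit ε' n := by
  classical
  have hex : ∃ n, n < N ∧ digit ε n ≠ digit ε' n := by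
    by_contra! hcon
    refine h (funext fun i => ?_)
    have := hcon i i.2
    simp only [digit, i.2, dif_pos] at this
    by_cases h1 : ε i <;> by_cases h2 : ε' i <;> simp_all
  refine ⟨Nat.find hex, (Nat.find_spec hex).1, fun i hi => ?_, (Nat.find_spec hex).2⟩
  by_contra hcon
  exact Nat.find_min hex hi ⟨hi.trans (Nat.find_spec hex).1, hcon⟩

theorem abs_digit_le (ε : Fin N → Bool) (i : ℕ) : |digit ε i| ≤ 1 := by
  rcases digit_mem ε i with h | h <;> simp [h]

/-- The slope of the line with binary digits `ε`. -/
def digitSlope (ε : Fin N → Bool) : ℝ := ∑ i ∈ Finset.range N, digit ε i * (2 ^ (i + 1))⁻¹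

/-- The ordinate at the origin of the line with binary digits `ε`. -/
def digitIntercept (ε : Fin N → Bool) : ℝ :=
  -∑ i ∈ Finset.range N, digit ε i * (2 ^ (i + 1))⁻¹ * (i / N)

theorem digitLine_eq (ε : Fin N → Bool) (x : ℝ) :
    digitLine N (digit ε) N x = digitSlope ε * x + digitIntercept ε := by
  rw [digitLine, digitSlope, digitIntercept, Finset.sum_mul, ← sub_eq_add_neg,
    ← Finset.sum_sub_distrib]
  exact Finset.sum_congr rfl fun i _ => by ring

theorem digitSlope_mem (ε : Fin N → Bool) : digitSlope ε ∈ Set.Icc (0 : ℝ) 1 := by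
  have h0 : ∀ i, 0 ≤ digit ε i := fun i => by rcases digit_mem ε i with h | h <;> simp [h]
  refine ⟨Finset.sum_nonneg fun i _ => mul_nonneg (h0 i) (by positivity), ?_⟩
  have h1 : digitSlope ε ≤ ∑ i ∈ Finset.range N, ((2 : ℝ) ^ (i + 1))⁻¹ := by
    refine Finset.sum_le_sum fun i _ => ?_
    exact mul_le_of_le_one_left (by positivity) ((le_abs_self _).trans (abs_digit_le ε i))
  rw [sum_two_pow_inv] at h1
  have : (0 : ℝ) ≤ (2 ^ N)⁻¹ := by positivity
  linarith

/-- The tube around the line with binary digits `ε`. -/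
def digitFrame (ε : Fin N → Bool) : TubeFrame 2 := lineFrame (digitSlope ε) (digitIntercept ε)

/-- At abscissa at least 13/10 two lines are at vertical distance at least 2^{-N} · 3/10, whereas a
common point of the tubes would bring them within 2^{-N} · 3/20. -/
theorem disjoint_shiftedTube_digitFrame (hN : 0 < N) {ε ε' : Fin N → Bool} (h : ε ≠ ε') :
    Disjoint (shiftedTube (digitFrame ε) ((2 ^ N)⁻¹ / 20))
      (shiftedTube (digitFrame ε') ((2 ^ N)⁻¹ / 20)) := by
  rw [Set.disjoint_left]
  rintro _ ⟨z, ⟨hz1, hz2⟩, rfl⟩ ⟨z', ⟨-, hz2'⟩, hz'⟩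
  obtain ⟨n, hn, heq, hne⟩ := exists_first_digit_ne h
  have hδ : ((2 : ℝ) ^ N)⁻¹ / 20 ≤ 1 / 20 := by
    have : ((2 : ℝ) ^ N)⁻¹ ≤ 1 := inv_le_one_of_one_le₀ (one_le_pow₀ (by norm_num))
    linarith
  have h1 := le_lineFrame_apply_zero (b := digitIntercept ε) (digitSlope_mem ε) hδ hz1.1 hz2
  have h2 := abs_lineFrame_sub_le (b := digitIntercept ε) (digitSlope_mem ε) hz2
  have h3 := abs_lineFrame_sub_le (b := digitIntercept ε') (digitSlope_mem ε') hz2'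
  rw [digitFrame, digitFrame] at hz'
  rw [hz'] at h3
  rw [← digitLine_eq] at h2 h3
  set x := lineFrame (digitSlope ε) (digitIntercept ε) z 0
  have hle : ∀ i, |digit ε i - digit ε' i| ≤ 1 := fun i => by
    rcases digit_mem ε i with h | h <;> rcases digit_mem ε' i with h' | h' <;> simp [h, h']
  have hne1 : |digit ε n - digit ε' n| = 1 := by
    rcases digit_mem ε n with h | h <;> rcases digit_mem ε' n with h' | h' <;> simp [h, h'] at hne ⊢
  have h4 := le_abs_digitLine_sub hN hn heq hne1 hle (x := x) (by linarith)
  have hpos : (0 : ℝ) < (2 ^ N)⁻¹ := by positivity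
  have h5 : (2 ^ N : ℝ)⁻¹ * (3 / 10) ≤ (2 ^ N)⁻¹ * (x - 1) := by gcongr; linarith
  rw [abs_le] at h2 h3
  have h6 : |digitLine N (digit ε) N x - digitLine N (digit ε') N x| ≤
      3 * ((2 ^ N)⁻¹ / 20) := by
    rw [abs_le]; constructor <;> linarith
  linarith

theorem tube_digitFrame_subset (hN : 0 < N) (ε : Fin N → Bool) {δ : ℝ} (hδ : 0 < δ) :
    tube (digitFrame ε) δ ⊆ ⋃ k : Fin N, ⋃ σ : Fin (k + 1) → Bool,
      {z : EuclideanSpace ℝ (Fin 2) | z 0 ∈ Set.Icc ((k : ℝ) / N - δ) ((k + 1) / N + δ) ∧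
        |z 1 - digitLine N (digit σ) (k + 1) (z 0)| ≤ (2 ^ (k + 1 : ℕ))⁻¹ * (2 / N) + 3 * δ} := by
  have hN' : (0 : ℝ) < N := mod_cast hN
  rintro _ ⟨z, ⟨hz1, hz2⟩, rfl⟩
  have h1 := lineFrame_apply_zero_mem (b := digitIntercept ε) (digitSlope_mem ε) hz1 hz2
  have h2 := abs_lineFrame_sub_le (b := digitIntercept ε) (digitSlope_mem ε) hz2
  rw [← digitLine_eq] at h2
  rw [← digitFrame] at h1 h2
  set x := digitFrame ε z 0
  -- A tube may protrude by δ beyond [0, 1] horizontally; the enlarged first and last strips absorb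
  -- this.
  obtain ⟨k, hk, hx⟩ : ∃ k < N, x ∈ Set.Icc ((k : ℝ) / N - δ) ((k + 1) / N + δ) := by
    rcases lt_or_ge x 1 with hx1 | hx1
    · rcases lt_or_ge x 0 with hx0 | hx0
      · refine ⟨0, hN, ?_, ?_⟩
        · simpa using h1.1
        · have : (0 : ℝ) ≤ ((0 : ℕ) + 1) / N + δ := by positivity
          linarith
      · refine ⟨⌊x * N⌋₊, ?_, ?_, ?_⟩
        · rw [Nat.floor_lt (by positivity)]
          nlinarith
        · have := Nat.floor_le (by positivity : 0 ≤ x * N)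
          rw [← div_le_iff₀ hN'] at this
          linarith
        · have := (Nat.lt_floor_add_one (x * N)).le
          rw [← le_div_iff₀ hN'] at this
          linarith
    · refine ⟨N - 1, by omega, ?_, ?_⟩
      · have : ((N - 1 : ℕ) : ℝ) / N ≤ 1 := by
          rw [div_le_one hN']; exact_mod_cast Nat.sub_le N 1
        linarith
      · have : (((N - 1 : ℕ) : ℝ) + 1) / N = 1 := by
          rw [← Nat.cast_add_one, Nat.sub_add_cancel hN, div_self hN'.ne']
        rw [this]; exact h1.2
  refine Set.mem_iUnion.2 ⟨⟨k, hk⟩, Set.mem_iUnion.2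
    ⟨fun i => ε ⟨i, lt_of_lt_of_le i.2 hk⟩, hx, ?_⟩⟩
  have h3 : digitLine N (digit fun i : Fin (k + 1) => ε ⟨i, lt_of_lt_of_le i.2 hk⟩) (k + 1) x =
      digitLine N (digit ε) (k + 1) x := by
    refine Finset.sum_congr rfl fun i hi => ?_
    have hi' := Finset.mem_range.1 hi
    rw [digit, dif_pos hi', digit, dif_pos (lt_of_lt_of_le hi' hk)]
  have h4 := abs_digitLine_sub_le hN (abs_digit_le ε) hk hδ.le hx
  simp only
  rw [h3]
  rw [abs_le] at h2 h4 ⊢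
  constructor <;> linarith

/-- Over the k-th strip, of width at most 2/N after enlargement, 2^{k+1} neighbourhoods of graphs
have total area at most (8/N + 12δ 2^{k+1})/N. Summing over N strips with δ = 2^{-N}/20 gives at
most (8 + 6/5)/N. -/
theorem volume_iUnion_tube_digitFrame_le (hN : 0 < N) :
    volume.real (⋃ ε : Fin N → Bool, tube (digitFrame ε) ((2 ^ N)⁻¹ / 20)) ≤ 12 / N := by
  set δ : ℝ := (2 ^ N)⁻¹ / 20
  have hδ : 0 < δ := by positivity
  have hN' : (0 : ℝ) < N := mod_cast hN
  have hδN : 2 * δ ≤ 1 / N := by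
    have h1 : (N : ℝ) ≤ 2 ^ N := by exact_mod_cast Nat.lt_two_pow_self.le
    have h2 : ((2 : ℝ) ^ N)⁻¹ ≤ (N : ℝ)⁻¹ := inv_anti₀ hN' h1
    have h3 : (0 : ℝ) < (2 ^ N)⁻¹ := by positivity
    simp only [δ]
    rw [one_div]
    linarith
  have hsub : (⋃ ε : Fin N → Bool, tube (digitFrame ε) δ) ⊆ _ :=
    Set.iUnion_subset fun ε => tube_digitFrame_subset hN ε hδ
  have h1 : volume (⋃ ε : Fin N → Bool, tube (digitFrame ε) δ) ≤
      ∑ k : Fin N, ∑ _σ : Fin (k + 1) → Bool,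
        ENNReal.ofReal (2 * ((2 ^ (k + 1 : ℕ))⁻¹ * (2 / N) + 3 * δ) * (1 / N + 2 * δ)) := by
    refine (measure_mono hsub).trans ((measure_iUnion_fintype_le _ _).trans
      (Finset.sum_le_sum fun k _ => (measure_iUnion_fintype_le _ _).trans
        (Finset.sum_le_sum fun σ _ => ?_)))
    rw [volume_graph_nhds (continuous_digitLine N (digit σ) (k + 1)) _ measurableSet_Icc,
      Real.volume_Icc, ← ENNReal.ofReal_mul (by positivity)]
    refine le_of_eq ?_
    congr 2
    ring
  have h2 : volume.real (⋃ ε : Fin N → Bool, tube (digitFrame ε) δ) ≤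
      ∑ k : Fin N, ∑ _σ : Fin (k + 1) → Bool,
        2 * ((2 ^ (k + 1 : ℕ))⁻¹ * (2 / N) + 3 * δ) * (1 / N + 2 * δ) := by
    refine ENNReal.toReal_le_of_le_ofReal (by positivity) (h1.trans (le_of_eq ?_))
    rw [ENNReal.ofReal_sum_of_nonneg fun k _ => by positivity]
    refine Finset.sum_congr rfl fun k _ => ?_
    rw [ENNReal.ofReal_sum_of_nonneg fun k _ => by positivity]
  refine h2.trans ?_
  have h3 : ∀ k : Fin N, ∑ _σ : Fin (k + 1) → Bool,
      2 * ((2 ^ (k + 1 : ℕ))⁻¹ * (2 / N) + 3 * δ) * (1 / N + 2 * δ) ≤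
      (8 / N + 12 * δ * 2 ^ (k + 1 : ℕ)) * (1 / N) := by
    intro k
    rw [Finset.sum_const, Finset.card_univ, Fintype.card_fun, Fintype.card_bool, Fintype.card_fin,
      nsmul_eq_mul]
    push_cast
    calc _ ≤ (2 : ℝ) ^ (k + 1 : ℕ) * (2 * ((2 ^ (k + 1 : ℕ))⁻¹ * (2 / N) + 3 * δ) *
          (1 / N + 1 / N)) := by gcongr
      _ = _ := by field_simp; ring
  refine (Finset.sum_le_sum fun k _ => h3 k).trans ?_
  rw [← Finset.sum_mul, Finset.sum_add_distrib, ← Finset.mul_sum,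
    Fin.sum_univ_eq_sum_range fun k => (2 : ℝ) ^ (k + 1)]
  have h4 : ∑ k ∈ Finset.range N, (2 : ℝ) ^ (k + 1) ≤ 2 * 2 ^ N := by
    simp_rw [pow_succ']
    rw [← Finset.mul_sum, geom_sum_eq (by norm_num)]
    have : (0 : ℝ) < 2 ^ N := by positivity
    linarith
  have h5 : ∑ _k : Fin N, (8 : ℝ) / N = 8 := by
    rw [Finset.sum_const, Finset.card_univ, Fintype.card_fin, nsmul_eq_mul]
    field_simp
  rw [h5, mul_one_div]
  gcongr
  have h6 : 12 * δ * (2 * 2 ^ N) = 6 / 5 := by simp only [δ]; field_simp; norm_num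
  have h7 : 12 * δ * ∑ k ∈ Finset.range N, (2 : ℝ) ^ (k + 1) ≤ 12 * δ * (2 * 2 ^ N) := by gcongr
  linarith

/-- A quantitative form of Besicovitch's construction in the plane. -/
theorem exists_besicovitchFun_two_le :
    ∃ C : ℝ, 0 < C ∧ ∀ N : ℕ, 0 < N → besicovitchFun 2 ((2 ^ N)⁻¹ / 20) ≤ C / N := by
  set V := volume.real (Metric.ball (0 : Cross 2) 1)
  have hV : 0 < V :=
    ENNReal.toReal_pos (Metric.measure_ball_pos _ _ one_pos).ne' measure_ball_lt_top.ne
  refine ⟨240 / V, by positivity, fun N hN => ?_⟩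
  have hN' : (0 : ℝ) < N := mod_cast hN
  set δ : ℝ := (2 ^ N)⁻¹ / 20 with hδdef
  have hδ : 0 < δ := by positivity
  have hvol : volume.real (Metric.ball (0 : Cross 2) δ) = δ * V := by
    rw [Measure.real, Measure.addHaar_ball_of_pos _ _ hδ, finrank_euclideanSpace_fin,
      ENNReal.toReal_mul, ENNReal.toReal_ofReal (by positivity)]
    simp [V, Measure.real]
  let f := (Fintype.equivFin (Fin N → Bool)).symm
  refine csInf_le (bddBelow_besicovitchSet 2 δ) ⟨by positivity, _, fun j => digitFrame (f j),
    Fintype.card_pos, fun i j hij => disjoint_shiftedTube_digitFrame hN (f.injective.ne hij), ?_⟩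
  have h1 : (⋃ j, tube (digitFrame (f j)) δ) = ⋃ ε : Fin N → Bool, tube (digitFrame ε) δ :=
    f.surjective.iUnion_comp fun ε => tube (digitFrame ε) δ
  rw [h1]
  simp_rw [volume_real_tube one_le_two, hvol]
  rw [Finset.sum_const, Finset.card_univ, Fintype.card_fin, Fintype.card_fun, Fintype.card_bool,
    Fintype.card_fin, nsmul_eq_mul]
  push_cast
  -- The total area of the 2^N tubes does not depend on N, while that of their union is O(1/N).
  have h2 : (2 : ℝ) ^ N * (δ * V) = V / 20 := by rw [hδdef]; field_simp
  rw [h2]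
  calc _ ≤ 12 / (N : ℝ) / (V / 20) := by gcongr; exact volume_iUnion_tube_digitFrame_le hN
    _ = _ := by field_simp; norm_num

end BinaryDigits

end SphericalSchur

end

/-! ### The logarithmic estimate on the two-dimensional sphere and the conclusion. -/

namespace SphericalSchur

/-- Exponential growth beats X^a ≤ X. The number 400 = 20² comes from the width 2^{-N}/20 of the
tubes, and 512 = 8³ is a perfect cube above it. -/
theorem two_pow_rpow_le {X a : ℝ} (ha' : a ≤ 1 / 2) {y : ℝ} (hX : 8 ≤ X)
    (hy : 2 ^ (X / 2) / 400 ≤ y) : 1 / y ^ (1 / 3 : ℝ) ≤ 96 * X ^ (-a) := by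
  have hX0 : 0 < X := by linarith
  have h1 : (2 : ℝ) ^ (X / 6) / 8 ≤ y ^ (1 / 3 : ℝ) := by
    have h2 : (2 : ℝ) ^ (X / 6) / 8 = (2 ^ (X / 2) / 512) ^ (1 / 3 : ℝ) := by
      rw [Real.div_rpow (by positivity) (by norm_num), ← Real.rpow_mul (by norm_num),
        show (512 : ℝ) = 8 ^ (3 : ℝ) by norm_num, ← Real.rpow_mul (by norm_num)]
      norm_num
      congr 1; ring
    rw [h2]
    refine Real.rpow_le_rpow (by positivity) (le_trans ?_ hy) (by norm_num)
    gcongr; norm_num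
  have h3 : X / 12 ≤ (2 : ℝ) ^ (X / 6) := by
    have h4 : X / 6 * Real.log 2 + 1 ≤ (2 : ℝ) ^ (X / 6) := by
      rw [Real.rpow_def_of_pos (by norm_num), mul_comm (Real.log 2)]
      exact Real.add_one_le_exp _
    have := Real.log_two_gt_d9
    nlinarith
  have h5 : X ^ (-a) = 1 / X ^ a := by rw [Real.rpow_neg hX0.le, one_div]
  have h6 : X ^ a ≤ X := by
    calc X ^ a ≤ X ^ (1 : ℝ) := Real.rpow_le_rpow_of_exponent_le (by linarith) (by linarith)
      _ = X := Real.rpow_one X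
  have hy0 : 0 < y ^ (1 / 3 : ℝ) := lt_of_lt_of_le (by positivity) h1
  rw [h5, mul_one_div, div_le_div_iff₀ hy0 (by positivity)]
  linarith

theorem IsLittlewoodPaley.exists_norm_lpPiece_two_le {w₀ w : ℝ → ℝ}
    (hw : IsLittlewoodPaley w₀ w) :
    ∃ C : ℝ, ∀ p : ℝ≥0∞, 1 ≤ p → ∀ m : ℝ → ℂ,
      Measurable (fun t : Set.Ioo (-1 : ℝ) 1 => m t) →
      (∃ M : ℝ, ∀ t ∈ Set.Ioo (-1 : ℝ) 1, ‖m t‖ ≤ M) → sphSchurNorm 2 p m ≠ ⊤ →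
      ∀ (n : ℕ) (θ : ℝ), 1 ≤ n → Real.sin θ ≠ 0 →
        ‖lpPiece w₀ w n m θ‖ ≤ C * (sphSchurNorm 2 p m).toReal *
          max 1 ((n : ℝ) + Real.logb 2 |Real.sin θ|) ^ (-pExp p) := by
  obtain ⟨C₁, hC₁, h₁⟩ := hw.exists_norm_lpPiece_le_besicovitchFun one_le_two
  obtain ⟨C₂, hC₂, h₂⟩ := hw.exists_norm_lpPiece_le_of_bound
  obtain ⟨C₃, hC₃, h₃⟩ := exists_besicovitchFun_two_le
  refine ⟨8 * C₂ + C₁ * (max 1 (8 * C₃) + 96), ?_⟩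
  intro p hp m hm hM hK n θ _ hθ
  set K := (sphSchurNorm 2 p m).toReal with hKdef
  have hK0 : 0 ≤ K := ENNReal.toReal_nonneg
  set X := (n : ℝ) + Real.logb 2 |Real.sin θ| with hX
  have ha := pExp_nonneg p
  have ha' := pExp_le_half hp
  -- For X < 8 the power of max 1 X is bounded below, so boundedness of the piece suffices; for X ≥
  -- 8 the integer N below is positive.
  rcases lt_or_ge X 8 with hX8 | hX8
  · have h4 : ‖lpPiece w₀ w n m θ‖ ≤ C₂ * K := by
      obtain ⟨m', hm', -, hmb, hae⟩ := exists_bounded_symbol one_le_two hp hm hM hK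
      rw [lpPiece_congr w₀ w n hae θ]
      exact h₂ m' K hm' hmb n θ
    have h5 : 1 ≤ 8 * max 1 X ^ (-pExp p) := by
      have h6 : max 1 X ^ pExp p ≤ 8 :=
        (rpow_pExp_le_max hp (by positivity)).trans
          (max_le (by norm_num) (max_le (by norm_num) hX8.le))
      rw [Real.rpow_neg (by positivity), ← div_eq_mul_inv, le_div_iff₀ (by positivity), one_mul]
      exact h6
    have h7 : 0 ≤ C₁ * (max 1 (8 * C₃) + 96) := by positivity
    calc _ ≤ C₂ * K * 1 := by rw [mul_one]; exact h4
      _ ≤ C₂ * K * (8 * max 1 X ^ (-pExp p)) := by gcongr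
      _ = (8 * C₂ + 0) * K * max 1 X ^ (-pExp p) := by ring
      _ ≤ _ := by gcongr
  · have hX0 : 0 < X := by linarith
    rw [max_eq_right (by linarith : 1 ≤ X)]
    -- With δ = 2^{-N}/20 one has δ² 2^n |sin θ| = 2^{X-2N}/400 ≥ 2^{X/2}/400, so the error term is
    -- exponentially small in X, while N ≥ X/8 makes the Besicovitch function O(1/X).
    set N := ⌊X / 4⌋₊
    have hN1 : (N : ℝ) ≤ X / 4 := Nat.floor_le (by positivity)
    have hN2 : X / 8 ≤ N := by
      have := Nat.sub_one_lt_floor (X / 4)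
      simp only [N]
      linarith
    have hN : 0 < N := by
      have : (0 : ℝ) < N := by linarith
      exact_mod_cast this
    have hN' : (0 : ℝ) < N := mod_cast hN
    refine (h₁ p hp m hm hM hK n θ hθ ((2 ^ N)⁻¹ / 20) (by positivity)).trans ?_
    have h4 : besicovitchFun 2 ((2 ^ N)⁻¹ / 20) ^ pExp p ≤ max 1 (8 * C₃) * X ^ (-pExp p) := by
      have h5 : besicovitchFun 2 ((2 ^ N)⁻¹ / 20) ≤ 8 * C₃ * X⁻¹ := by
        refine (h₃ N hN).trans ?_
        rw [← div_eq_mul_inv, div_le_div_iff₀ hN' hX0]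
        nlinarith
      refine (Real.rpow_le_rpow (besicovitchFun_nonneg _ _) h5 ha).trans ?_
      rw [Real.mul_rpow (by positivity) (by positivity), Real.inv_rpow hX0.le,
        ← Real.rpow_neg hX0.le]
      gcongr
      exact rpow_pExp_le_max hp (by positivity)
    have h6 : 2 ^ (X / 2) / 400 ≤ |((2 ^ N)⁻¹ / 20) ^ 2 * 2 ^ n * Real.sin θ| := by
      have hs : 0 < |Real.sin θ| := abs_pos.2 hθ
      have h7 : (2 : ℝ) ^ X = 2 ^ n * |Real.sin θ| := by
        rw [hX, Real.rpow_add (by norm_num), Real.rpow_natCast,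
          Real.rpow_logb (by norm_num) (by norm_num) hs]
      have h8 : |((2 ^ N : ℝ)⁻¹ / 20) ^ 2 * 2 ^ n * Real.sin θ| = 2 ^ (X - 2 * N) / 400 := by
        rw [abs_mul, abs_of_pos (by positivity : (0 : ℝ) < ((2 ^ N)⁻¹ / 20) ^ 2 * 2 ^ n),
          Real.rpow_sub (by norm_num), h7, mul_comm 2 (N : ℝ), Real.rpow_mul (by norm_num),
          Real.rpow_natCast]
        norm_num
        field_simp
        norm_num
      rw [h8]
      gcongr
      · norm_num
      · linarith
    have h9 := two_pow_rpow_le ha' hX8 h6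
    have h10 : 0 ≤ X ^ (-pExp p) := by positivity
    calc _ ≤ C₁ * K * (max 1 (8 * C₃) * X ^ (-pExp p) + 96 * X ^ (-pExp p)) := by gcongr
      _ = (8 * 0 + C₁ * (max 1 (8 * C₃) + 96)) * K * X ^ (-pExp p) := by ring
      _ ≤ _ := by gcongr

end SphericalSchur

theorem theorem1p6 (w₀ w : ℝ → ℝ) (hw : SphericalSchur.IsLittlewoodPaley w₀ w) :
    (∀ d : ℕ, 1 ≤ d → ∃ C : ℝ, ∀ p : ℝ≥0∞, 1 ≤ p → ∀ m : ℝ → ℂ,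
      Measurable (fun t : Set.Ioo (-1 : ℝ) 1 => m t) →
      (∃ M : ℝ, ∀ t ∈ Set.Ioo (-1 : ℝ) 1, ‖m t‖ ≤ M) →
      SphericalSchur.sphSchurNorm d p m ≠ ⊤ →
      ∀ (n : ℕ) (θ : ℝ), Real.sin θ ≠ 0 →
        ‖SphericalSchur.lpPiece w₀ w n m θ‖ ≤
          C * (SphericalSchur.sphSchurNorm d p m).toReal *
            ⨅ δ : Set.Ioi (0 : ℝ),
              (SphericalSchur.besicovitchFun d δ ^ SphericalSchur.pExp p +
                1 / |(δ : ℝ) ^ 2 * 2 ^ n * Real.sin θ| ^ (1 / 3 : ℝ))) ∧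
    (∃ C : ℝ, ∀ p : ℝ≥0∞, 1 ≤ p → ∀ m : ℝ → ℂ,
      Measurable (fun t : Set.Ioo (-1 : ℝ) 1 => m t) →
      (∃ M : ℝ, ∀ t ∈ Set.Ioo (-1 : ℝ) 1, ‖m t‖ ≤ M) →
      SphericalSchur.sphSchurNorm 2 p m ≠ ⊤ →
      ∀ (n : ℕ) (θ : ℝ), 1 ≤ n → Real.sin θ ≠ 0 →
        ‖SphericalSchur.lpPiece w₀ w n m θ‖ ≤
          C * (SphericalSchur.sphSchurNorm 2 p m).toReal *
            max 1 ((n : ℝ) + Real.logb 2 |Real.sin θ|) ^ (-SphericalSchur.pExp p)) := by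
  refine ⟨fun d hd => ?_, hw.exists_norm_lpPiece_two_le⟩
  obtain ⟨C, hC, h⟩ := hw.exists_norm_lpPiece_le_besicovitchFun hd
  refine ⟨C, fun p hp m hm hM hK n θ hθ => ?_⟩
  rw [Real.mul_iInf_of_nonneg (mul_nonneg hC ENNReal.toReal_nonneg)]
  exact le_ciInf fun δ => h p hp m hm hM hK n θ hθ δ δ.2
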